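/- **Setting.** Let $F$ be a non-archimedean local field of residual characteristic $\neq 2$, with ring of integers $R$, $\varpi$ a generator of its maximal ideal, $q$ the number of elements of its residue field, and absolute value normalized by $|\varpi|=q^{-1}$. Let $\psi$ be an additive character of $F$ that is trivial on $R$ but not on $\varpi^{-1}R$, and let $\chi_0$ be a character of $F^\times$, trivial on $R^\times$, with $\varepsilon:=\chi_0(\varpi)\in\{1,-1\}$ (the trivial or the unramified quadratic character). Let $J$ be the antidiagonal $5\times5$ matrix of $1$'s, $G=SO(3,2;F)=\{g\in SL(5,F):{}^tgJg=J\}$ and $K=G\cap SL(5,R)$. There are two cases. In the *split case* put $c=1$, $v_0={}^t(0,0,1,0,0)$, $v_1={}^t(\frac12,0,0,0,1)$. In the *non-split case* fix a unit $\theta\in R^\times$ that is not a square and put $c=4\theta$, $v_0={}^t(0,2\theta,0,1,0)$, $v_1={}^t(2\theta,0,0,1,1)$. Let $S=\{x\in F^5: 2x_1x_5+2x_2x_4+x_3^2=c\}$, on which $G$ acts, and $C=\mathrm{Stab}_G(v_0)$. For $r\ge 0$ put $d_r=\mathrm{diag}(\varpi^r,1,1,1,\varpi^{-r})$; let $\phi_r$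 be the characteristic function of the orbit $Kd_rv_1\subset S$ and $\Phi_r=\phi_0+\dots+\phi_r$. Let $C_c(K\backslash S)$ be the space of $K$-invariant, locally constant, compactly supported functions $S\to\mathbb C$. Let $H=PGL(2,F)$, $K'=PGL(2,R)$ (the image of $GL(2,R)$ in $H$), $n(x)=\begin{pmatrix}1&x\\0&1\end{pmatrix}$, $a(\alpha)=\begin{pmatrix}\alpha&0\\0&1\end{pmatrix}$, $N'=\{n(x)\}$, $A'=\{a(\alpha)\}$ and $\psi_{N'}(n(x))=\psi(x)$. Let $C_c(N'\backslash H/K',\psi_{N'})$ be the space of right $K'$-invariant functions $\phi'$ on $H$, compactly supported modulo $N'$, with $\phi'(ng)=\overline{\psi_{N'}(n)}\,\phi'(g)$ for $n\in N'$. Haar measures are normalized to give $R$, $R^\times$, $K$, $K\cap C$ and $K'$ volume $1$, and $ds$ is the $G$-invariant measure on $S$ for which $Kv_1$ has volume $1$. Functions in $C_c(K\backslash G/K)$ and $C_c(K'\backslash H/K')$ are called spherical; their Satake transforms are $f^\vee(\pi_\zeta)=\mathrm{tr}\,\pi_\zeta(f)$ and $f'^\vee(\pi'_\zeta)=\mathrm{tr}\,\pi'_\zeta(f')$,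 $\zeta\in\mathbb C$. Here $\pi_\zeta=I_G(\zeta,\frac12+\zeta)$ is normalizedly induced from the character of the upper triangular Borel subgroup of $G$ that takes an element with diagonal $(\alpha,\beta,1,\beta^{-1},\alpha^{-1})$ to $|\alpha/\beta|^{\zeta}|\beta|^{1/2+\zeta}$, and $\pi'_\zeta$ is normalizedly induced from the character $n(x)a(\alpha)\mapsto|\alpha|^\zeta\chi_0(\alpha)$ of $N'A'$. Spherical functions $f$ and $f'$ are *corresponding* if $f^\vee(\pi_\zeta)=f'^\vee(\pi'_\zeta)$ for all $\zeta\in\mathbb C$. Put $\phi_f(gv_0)=\int_Cf(gh)\,dh$ and $\phi'_{f'}(g)=\int_{N'}\psi_{N'}(n)f'(ng)\,dn$. **Proposition.** (0) For every $\zeta\in\mathbb C$ there is exactly one $K$-invariant function $T_\zeta$ on $S$ with $T_\zeta(v_1)=1$ and $\int_Gf(g)T_\zeta(gs)\,dg=f^\vee(\pi_\zeta)T_\zeta(s)$ for all spherical $f$ on $G$ and all $s\in S$; and there is exactly one function $W_\zeta$ on $H$ (the normalized unramified Whittaker function) with $W_\zeta(1)=1$, $W_\zeta(ngk)=\psi_{N'}(n)W_\zeta(g)$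 for $n\in N'$, $g\in H$, $k\in K'$, and $\int_Hf'(x)W_\zeta(hx)\,dx=f'^\vee(\pi'_\zeta)W_\zeta(h)$ for all spherical $f'$ on $H$ and all $h\in H$. (1) For every $\phi\in C_c(K\backslash S)$ there is exactly one $\phi'=\mathcal F(\phi)\in C_c(N'\backslash H/K',\psi_{N'})$ such that $$\int_S\phi(s)T_\zeta(s)\,ds=\int_{F^\times}\phi'(a(\alpha))\,W_\zeta(a(\alpha))\,|\alpha|^{-1}\,d^\times\alpha\qquad\text{for all }\zeta\in\mathbb C,$$ and $\mathcal F$ is a linear bijection from $C_c(K\backslash S)$ onto $C_c(N'\backslash H/K',\psi_{N'})$. (2) For $r\in\mathbb Z$ there is a function $\phi'_r\in C_c(N'\backslash H/K',\psi_{N'})$ with $\phi'_r(a(\alpha))=1$ if $r\ge0$ and $|\alpha|=q^{-r}$, and $\phi'_r(a(\alpha))=0$ otherwise (since $H=N'A'K'$, it is determined by these values); and for all $r\ge0$ $$\mathcal F(\Phi_r)=\varepsilon^rq^r\left(\phi'_r\mp\varepsilon\,\phi'_{r-1}\right),$$ with the upper sign in the split case and the lower sign in the non-split case. In particular, for $\varepsilon=-1$,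 $\mathcal F(\Phi_r)=(-1)^rq^r(\phi'_r\pm\phi'_{r-1})$. (3) If $f$ and $f'$ are corresponding spherical functions, then $\mathcal F(\phi_f)=\phi'_{f'}$. -/

import Mathlib

open MeasureTheory Matrix

open scoped MatrixGroups

noncomputable section

namespace SO5PGL2

/-! ### Hecke algebras, induced representations and traces of Hecke operators -/

section General

/-- The trace of a finite rank endomorphism of a (possibly infinite dimensional) vector space:
the trace of its restriction to its own range. -/
def finiteRankTrace {V : Type*} [AddCommGroup V] [Module ℂ V] (L : V →ₗ[ℂ] V) : ℂ :=
  LinearMap.trace ℂ (LinearMap.range L)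
    (L.restrict (p := LinearMap.range L) (q := LinearMap.range L)
      (fun x _ => LinearMap.mem_range_self L x))

variable {G : Type*} [Group G] [TopologicalSpace G]

/-- `C_c(K\G/K)`: compactly supported `K`-biinvariant functions (the spherical functions). -/
def spherical (K : Subgroup G) : Submodule ℂ (G → ℂ) where
  carrier := {f | (∀ k ∈ K, ∀ g, f (k * g) = f g) ∧ (∀ k ∈ K, ∀ g, f (g * k) = f g) ∧
    HasCompactSupport f}
  add_mem' := by
    rintro f g ⟨h1, h2, h3⟩ ⟨h1', h2', h3'⟩
    exact ⟨fun k hk x => by simp [h1 k hk, h1' k hk], fun k hk x => by simp [h2 k hk, h2' k hk],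
      h3.add h3'⟩
  zero_mem' := ⟨fun _ _ _ => rfl, fun _ _ _ => rfl, HasCompactSupport.zero⟩
  smul_mem' := by
    rintro c f ⟨h1, h2, h3⟩
    exact ⟨fun k hk x => by simp [h1 k hk], fun k hk x => by simp [h2 k hk],
      h3.smul_left (f := fun _ => c)⟩

/-- The space of locally constant functions `φ` on `G` with `φ (b i * g) = χ i * φ g`; here
`b : ι → G` parametrizes (the elements of) a subgroup of `G` and `χ` is the inducing character. -/
def induced {ι : Type*} (b : ι → G) (χ : ι → ℂ) : Submodule ℂ (G → ℂ) where
  carrier := {φ | IsLocallyConstant φ ∧ ∀ i g, φ (b i * g) = χ i * φ g}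
  add_mem' := by
    rintro f g ⟨h1, h2⟩ ⟨h1', h2'⟩
    exact ⟨h1.add h1', fun i x => by simp [h2, h2', mul_add]⟩
  zero_mem' := ⟨IsLocallyConstant.const 0, fun _ _ => by simp⟩
  smul_mem' := by
    rintro c f ⟨h1, h2⟩
    refine ⟨h1.comp (fun z => c • z), fun i x => ?_⟩
    simp only [Pi.smul_apply, h2, smul_eq_mul]
    ring

variable [IsTopologicalGroup G]

theorem isLocallyConstant_of_right_invariant {K : Subgroup G} (hK : IsOpen (K : Set G))
    {f : G → ℂ} (hf : ∀ k ∈ K, ∀ g, f (g * k) = f g) : IsLocallyConstant f := by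
  rw [IsLocallyConstant.iff_exists_open]
  intro x
  refine ⟨(fun y => x⁻¹ * y) ⁻¹' (K : Set G), hK.preimage (by fun_prop), by simp [K.one_mem], ?_⟩
  intro y hy
  have := hf (x⁻¹ * y) hy x
  simpa using this

variable [MeasurableSpace G] [BorelSpace G] (μ : Measure G) [μ.IsHaarMeasure]

/-- The operator `(π(f)φ)(h) = ∫ f(g) φ(hg) dg` of a spherical function `f` on an induced
representation, on which `G` acts by right translation. -/
def heckeOperator {K : Subgroup G} (hK : IsOpen (K : Set G)) {ι : Type*} (b : ι → G) (χ : ι → ℂ)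
    (f : spherical K) : induced b χ →ₗ[ℂ] induced b χ :=
  have hint : ∀ (φ : induced b χ) (h : G),
      Integrable (fun g => (f : G → ℂ) g * (φ : G → ℂ) (h * g)) μ := by
    intro φ h
    apply Continuous.integrable_of_hasCompactSupport
    · have h1 := (isLocallyConstant_of_right_invariant hK f.2.2.1).continuous
      have h2 := φ.2.1.continuous
      fun_prop
    · exact f.2.2.2.mul_right
  { toFun := fun φ => ⟨fun h => ∫ g, (f : G → ℂ) g * (φ : G → ℂ) (h * g) ∂μ, by
      refine ⟨isLocallyConstant_of_right_invariant hK ?_, ?_⟩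
      · intro k hk h
        rw [← integral_mul_left_eq_self (fun g => (f : G → ℂ) g * (φ : G → ℂ) (h * g)) k]
        simp only [f.2.1 k hk, mul_assoc]
      · intro i h
        change ∫ g, (f : G → ℂ) g * (φ : G → ℂ) (b i * h * g) ∂μ =
          χ i * ∫ g, (f : G → ℂ) g * (φ : G → ℂ) (h * g) ∂μ
        rw [← integral_const_mul]
        congr 1
        funext g
        rw [mul_assoc, φ.2.2]
        ring⟩
    map_add' := by
      intro φ φ'
      apply Subtype.ext
      funext h
      simp only [Submodule.coe_add, Pi.add_apply, mul_add]
      exact integral_add (hint φ h) (hint φ' h)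
    map_smul' := by
      intro c φ
      apply Subtype.ext
      funext h
      simp only [Submodule.coe_smul, Pi.smul_apply, smul_eq_mul, RingHom.id_apply]
      rw [← integral_const_mul]
      congr 1
      funext g
      ring }

end General

/-! ### The local field -/

section Field

variable (F : Type*) [NontriviallyNormedField F] [IsUltrametricDist F]

/-- The ring of integers `R = {x | ‖x‖ ≤ 1}`. -/
abbrev integers : ValuationSubring F := (NormedField.valuation (K := F)).valuationSubring

/-- The residue field of `F`. -/
abbrev Residue : Type _ := IsLocalRing.ResidueField (integers F)

/-- The number `q` of elements of the residue field. -/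
def resCard : ℕ := Nat.card (Residue F)

variable {F}

theorem mem_integers {x : F} : x ∈ integers F ↔ ‖x‖ ≤ 1 := by
  rw [Valuation.mem_valuationSubring_iff, NormedField.valuation_apply]
  exact_mod_cast Iff.rfl

theorem isOpen_norm_le_one : IsOpen {x : F | ‖x‖ ≤ 1} := by
  have := IsUltrametricDist.isOpen_closedBall (0 : F) (r := 1) one_ne_zero
  simpa [Metric.closedBall, dist_zero_right] using this

end Field

/-! ### The group `G = SO(3,2)` -/

section GroupG

variable (F : Type*) [NontriviallyNormedField F]

/-- The antidiagonal matrix `J₅`. -/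
def J : Matrix (Fin 5) (Fin 5) F := Matrix.of fun i j => if j = Fin.rev i then 1 else 0

/-- `SO(3,2;F)`: the `g ∈ SL(5,F)` with `ᵗg J g = J`. -/
def SO5 : Subgroup (Matrix.SpecialLinearGroup (Fin 5) F) where
  carrier := {g | g.1ᵀ * J F * g.1 = J F}
  one_mem' := by
    change (1 : Matrix (Fin 5) (Fin 5) F)ᵀ * J F * 1 = J F
    simp
  mul_mem' := by
    intro a b ha hb
    change a.1ᵀ * J F * a.1 = J F at ha
    change b.1ᵀ * J F * b.1 = J F at hb
    change (a.1 * b.1)ᵀ * J F * (a.1 * b.1) = J F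
    calc _ = b.1ᵀ * (a.1ᵀ * J F * a.1) * b.1 := by
            simp only [transpose_mul, Matrix.mul_assoc]
      _ = _ := by rw [ha, hb]
  inv_mem' := by
    intro a ha
    change a.1ᵀ * J F * a.1 = J F at ha
    change (a⁻¹).1ᵀ * J F * (a⁻¹).1 = J F
    have h1 : a.1 * (a⁻¹).1 = 1 := congrArg Subtype.val (mul_inv_cancel a)
    have h2 : (a⁻¹).1ᵀ * a.1ᵀ = 1 := by rw [← transpose_mul, h1, transpose_one]
    calc (a⁻¹).1ᵀ * J F * (a⁻¹).1 = (a⁻¹).1ᵀ * (a.1ᵀ * J F * a.1) * (a⁻¹).1 := by rw [ha]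
      _ = ((a⁻¹).1ᵀ * a.1ᵀ) * J F * (a.1 * (a⁻¹).1) := by simp only [Matrix.mul_assoc]
      _ = J F := by rw [h1, h2]; simp

instance : MeasurableSpace (SO5 F) := borel _

instance : BorelSpace (SO5 F) := ⟨rfl⟩

variable {F}

/-- The matrix of an element of `G`. -/
def toMat (g : SO5 F) : Matrix (Fin 5) (Fin 5) F := g.1.1

variable (F)

/-- Upper triangular Borel subgroup `B` of `G`. -/
def BorelG : Type _ := {b : SO5 F // ∀ i j : Fin 5, j < i → toMat b i j = 0}

variable {F}

/-- For `b ∈ B` with diagonal `(α, β, 1, β⁻¹, α⁻¹)`, the value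
`δ_B^{1/2}(b) |α/β|^ζ |β|^ζ'`, where `δ_B(b) = |α|^3 |β|`. -/
def borelCharG (ζ ζ' : ℂ) (b : BorelG F) : ℂ :=
  ((‖toMat b.1 0 0‖ ^ (3 / 2 : ℝ) * ‖toMat b.1 1 1‖ ^ (1 / 2 : ℝ) : ℝ) : ℂ) *
    ((‖toMat b.1 0 0‖ / ‖toMat b.1 1 1‖ : ℝ) : ℂ) ^ ζ * ((‖toMat b.1 1 1‖ : ℝ) : ℂ) ^ ζ'

variable [IsUltrametricDist F]

variable (F) in
/-- `K = SO(3,2;R)`. -/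
def KG : Subgroup (SO5 F) :=
  (Matrix.SpecialLinearGroup.map (n := Fin 5) (algebraMap (integers F) F)).range.comap (SO5 F).subtype

theorem mem_KG {g : SO5 F} : g ∈ KG F ↔ ∀ i j, ‖toMat g i j‖ ≤ 1 := by
  constructor
  · rintro ⟨a, ha⟩ i j
    have : toMat g i j = ((a : Matrix (Fin 5) (Fin 5) (integers F)) i j : F) := by
      rw [toMat, show g.1 = _ from ha.symm]
      rfl
    rw [this]
    exact mem_integers.1 (a i j).2
  · intro h
    let m : Matrix (Fin 5) (Fin 5) (integers F) :=
      Matrix.of fun i j => ⟨toMat g i j, mem_integers.2 (h i j)⟩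
    have hm : (algebraMap (integers F) F).mapMatrix m = toMat g := by
      ext i j; rfl
    have hd : m.det = 1 := by
      apply Subtype.val_injective
      have := RingHom.map_det (algebraMap (integers F) F) m
      rw [hm] at this
      exact this.trans g.1.2
    refine ⟨⟨m, hd⟩, ?_⟩
    exact Subtype.ext hm

theorem isOpen_KG : IsOpen (KG F : Set (SO5 F)) := by
  have : (KG F : Set (SO5 F)) = ⋂ i, ⋂ j, {g | ‖toMat g i j‖ ≤ 1} := by
    ext g; simp [mem_KG]
  rw [this]
  refine isOpen_iInter_of_finite fun i => isOpen_iInter_of_finite fun j => ?_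
  refine isOpen_norm_le_one.preimage (f := fun g : SO5 F => toMat g i j) ?_
  have h : Continuous (fun g : SO5 F => g.1 i) := by fun_prop
  exact (continuous_apply j).comp h

/-- The Satake transform `f^∨(π_ζ) = tr π_ζ(f)`, where `π_ζ = I_G(ζ, 1/2 + ζ)`. -/
def satakeG (μG : Measure (SO5 F)) [μG.IsHaarMeasure] (f : spherical (KG F)) (ζ : ℂ) : ℂ :=
  finiteRankTrace
    (heckeOperator μG isOpen_KG (fun b : BorelG F => b.1) (borelCharG ζ (1 / 2 + ζ)) f)

end GroupG

/-! ### The symmetric space `S` -/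

/-- The two cases: the split one, and the non-split one with its parameter `θ`. -/
inductive Kind (F : Type*) where
  | split : Kind F
  | nonsplit (θ : F) : Kind F

namespace Kind

variable {F : Type*} [NontriviallyNormedField F]

/-- In the non-split case, `θ` is a unit of `R` that is not a square. -/
def Admissible : Kind F → Prop
  | split => True
  | nonsplit θ => ‖θ‖ = 1 ∧ ¬ IsSquare θ

/-- The value of the quadratic form on `S`. -/
def level : Kind F → F
  | split => 1
  | nonsplit θ => 4 * θ

/-- The base point `v₀`. -/
def v0 : Kind F → Fin 5 → F
  | split => ![0, 0, 1, 0, 0]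
  | nonsplit θ => ![0, 2 * θ, 0, 1, 0]

/-- The vector `v₁`. -/
def v1 : Kind F → Fin 5 → F
  | split => ![1 / 2, 0, 0, 0, 1]
  | nonsplit θ => ![2 * θ, 0, 0, 1, 1]

/-- The sign `±`: `1` in the split case and `-1` in the non-split case. -/
def sign : Kind F → ℂ
  | split => 1
  | nonsplit _ => -1

end Kind

section Sphere

variable {F : Type*} [NontriviallyNormedField F]

/-- `S`: the `x ∈ F⁵` with `ᵗx J x = 2 x₁ x₅ + 2 x₂ x₄ + x₃²` equal to `1`, resp. `4θ`. -/
abbrev Sphere (t : Kind F) : Type _ := {x : Fin 5 → F // x ⬝ᵥ (J F *ᵥ x) = t.level}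

theorem form_eq (x : Fin 5 → F) :
    x ⬝ᵥ (J F *ᵥ x) = 2 * x 0 * x 4 + 2 * x 1 * x 3 + x 2 ^ 2 := by
  simp [dotProduct, mulVec, J, Fin.sum_univ_five, Fin.rev, Fin.ext_iff]
  ring

instance (t : Kind F) : MulAction (SO5 F) (Sphere t) where
  smul g x := ⟨toMat g *ᵥ x.1, by
    have hg : (toMat g)ᵀ * J F * toMat g = J F := g.2
    calc _ = x.1 ⬝ᵥ (((toMat g)ᵀ * J F * toMat g) *ᵥ x.1) := by
            rw [← mulVec_mulVec, ← mulVec_mulVec, dotProduct_mulVec x.1 (toMat g)ᵀ,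
              vecMul_transpose]
      _ = t.level := by rw [hg, x.2]⟩
  one_smul x := Subtype.ext (one_mulVec x.1)
  mul_smul g h x := Subtype.ext (mulVec_mulVec x.1 (toMat g) (toMat h)).symm

theorem v0_mem (t : Kind F) : t.v0 ⬝ᵥ (J F *ᵥ t.v0) = t.level := by
  rw [form_eq]
  cases t
  · simp [Kind.v0, Kind.level]
  · simp [Kind.v0, Kind.level]; ring

/-- The base point `v₀` as a point of `S`. -/
def base (t : Kind F) : Sphere t := ⟨t.v0, v0_mem t⟩

/-- `C_θ`, the stabilizer of `v₀` in `G`. -/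
abbrev C (t : Kind F) : Subgroup (SO5 F) := MulAction.stabilizer (SO5 F) (base t)

/-- The vector `d_r v₁`, where `d_r = diag(ϖ^r, 1, 1, 1, ϖ^{-r})`. -/
def dv (t : Kind F) (ϖ : Fˣ) (r : ℕ) : Fin 5 → F :=
  Matrix.diagonal ![(ϖ : F) ^ r, 1, 1, 1, ((ϖ : F) ^ r)⁻¹] *ᵥ t.v1

variable [IsUltrametricDist F]

/-- The `K`-orbit of `d_r v₁` in `S`. -/
def orbit (t : Kind F) (ϖ : Fˣ) (r : ℕ) : Set (Sphere t) :=
  {x | ∃ k ∈ KG F, x.1 = toMat k *ᵥ dv t ϖ r}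

/-- `C_c^∞(K\S)`: locally constant, compactly supported, `K`-invariant functions on `S`. -/
def CcS (t : Kind F) : Submodule ℂ (Sphere t → ℂ) where
  carrier := {φ | IsLocallyConstant φ ∧ HasCompactSupport φ ∧
    ∀ k ∈ KG F, ∀ s, φ (k • s) = φ s}
  add_mem' := by
    rintro f g ⟨h1, h2, h3⟩ ⟨h1', h2', h3'⟩
    exact ⟨h1.add h1', h2.add h2', fun k hk s => by simp [h3 k hk, h3' k hk]⟩
  zero_mem' := ⟨IsLocallyConstant.const 0, HasCompactSupport.zero, fun _ _ _ => rfl⟩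
  smul_mem' := by
    rintro c f ⟨h1, h2, h3⟩
    exact ⟨h1.comp (fun z => c • z), h2.smul_left (f := fun _ => c),
      fun k hk s => by simp [h3 k hk]⟩

open Classical in
/-- The characteristic function `φ_r` of the `K`-orbit of `d_r v₁`. -/
def phi (t : Kind F) (ϖ : Fˣ) (r : ℕ) : Sphere t → ℂ :=
  fun x => if x ∈ orbit t ϖ r then 1 else 0

/-- `Φ_r = φ_0 + ⋯ + φ_r`. -/
def Phi (t : Kind F) (ϖ : Fˣ) (r : ℕ) : Sphere t → ℂ :=
  ∑ i ∈ Finset.range (r + 1), phi t ϖ i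

/-- `φ_f (g v₀) = ∫_C f(gh) dh`. (`G` is transitive on `S` and the integral depends only
on `g v₀`.) -/
def phiOf (t : Kind F) (μC : Measure (C t)) (f : SO5 F → ℂ) : Sphere t → ℂ :=
  Function.extend (fun g : SO5 F => g • base t) (fun g => ∫ h : C t, f (g * h) ∂μC) 0

/-- `T` is the `K`-invariant function `T_ζ` on `S` with `∫_G f(g) T(gs) dg = f^∨(π_ζ) T(s)` for all
spherical `f`, normalized by `T(v₁) = 1`. -/
def IsT (t : Kind F) (ϖ : Fˣ) (μG : Measure (SO5 F)) [μG.IsHaarMeasure] (ζ : ℂ)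
    (T : Sphere t → ℂ) : Prop :=
  (∀ k ∈ KG F, ∀ s, T (k • s) = T s) ∧
  (∃ s : Sphere t, s.1 = dv t ϖ 0 ∧ T s = 1) ∧
  ∀ (f : spherical (KG F)) (s : Sphere t),
    ∫ g, (f : SO5 F → ℂ) g * T (g • s) ∂μG = satakeG μG f ζ * T s

/-- `μS` is the `G`-invariant Radon measure on `S` that gives the `K`-orbit of `d₀ v₁ = v₁`
volume `1`. -/
structure IsInvariantMeasure (t : Kind F) (ϖ : Fˣ) [MeasurableSpace F]
    (μS : Measure (Sphere t)) : Prop where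
  finite_on_compacts : ∀ s : Set (Sphere t), IsCompact s → μS s < ⊤
  invariant : ∀ g : SO5 F, μS.map (fun s => g • s) = μS
  normalized : μS (orbit t ϖ 0) = 1

end Sphere

/-! ### The group `H = PGL(2)` -/

section GroupH

variable (F : Type*) [NontriviallyNormedField F]

/-- `H = PGL(2,F)`. -/
abbrev H : Type _ := PGL(2, F)

instance : TopologicalSpace (H F) :=
  inferInstanceAs (TopologicalSpace (GL (Fin 2) F ⧸ Subgroup.center (GL (Fin 2) F)))

instance : IsTopologicalGroup (H F) :=
  inferInstanceAs (IsTopologicalGroup (GL (Fin 2) F ⧸ Subgroup.center (GL (Fin 2) F)))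

instance : MeasurableSpace (H F) := borel _

instance : BorelSpace (H F) := ⟨rfl⟩

variable {F}

/-- The class of `!![1, x; 0, 1]` in `H`. -/
def nH (x : F) : H F :=
  ProjGenLinGroup.mk (GeneralLinearGroup.mkOfDetNeZero !![1, x; 0, 1] (by simp))

/-- The class of `!![a, 0; 0, 1]` in `H`. -/
def aH (a : Fˣ) : H F :=
  ProjGenLinGroup.mk (GeneralLinearGroup.mkOfDetNeZero !![(a : F), 0; 0, 1] (by simp))

/-- The value at `n(x) diag(a, 1) ∈ B' = N'A'` of the character from which `π'_ζ` is induced, times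
the square root `|a|^{1/2}` of the modulus. -/
def borelCharH (χ₀ : Fˣ →* ℂˣ) (ζ : ℂ) (p : F × Fˣ) : ℂ :=
  ((‖(p.2 : F)‖ ^ (1 / 2 : ℝ) : ℝ) : ℂ) * ((‖(p.2 : F)‖ : ℝ) : ℂ) ^ ζ * (χ₀ p.2 : ℂ)

variable [IsUltrametricDist F]

variable (F) in
/-- `K' = PGL(2,R)`, the image of `GL(2,R)` in `H`. -/
def KH : Subgroup (H F) :=
  (GeneralLinearGroup.map (n := Fin 2) (algebraMap (integers F) F)).range.map ProjGenLinGroup.mk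

theorem mem_range_GL {g : GL (Fin 2) F} :
    g ∈ (GeneralLinearGroup.map (n := Fin 2) (algebraMap (integers F) F)).range ↔
      (∀ i j, ‖g i j‖ ≤ 1) ∧ ∀ i j, ‖(g⁻¹ : GL (Fin 2) F) i j‖ ≤ 1 := by
  constructor
  · rintro ⟨a, rfl⟩
    rw [← map_inv]
    exact ⟨fun i j => mem_integers.1 (a i j).2,
      fun i j => mem_integers.1 ((a⁻¹ : GL (Fin 2) (integers F)) i j).2⟩
  · rintro ⟨h, h'⟩
    let m : Matrix (Fin 2) (Fin 2) (integers F) :=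
      Matrix.of fun i j => ⟨g i j, mem_integers.2 (h i j)⟩
    let m' : Matrix (Fin 2) (Fin 2) (integers F) :=
      Matrix.of fun i j => ⟨(g⁻¹ : GL (Fin 2) F) i j, mem_integers.2 (h' i j)⟩
    have hinj : Function.Injective ((algebraMap (integers F) F).mapMatrix (m := Fin 2)) :=
      Matrix.map_injective Subtype.val_injective
    have hm : (algebraMap (integers F) F).mapMatrix m = (g : Matrix (Fin 2) (Fin 2) F) := by
      ext i j; rfl
    have hm' : (algebraMap (integers F) F).mapMatrix m' =
        ((g⁻¹ : GL (Fin 2) F) : Matrix (Fin 2) (Fin 2) F) := by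
      ext i j; rfl
    refine ⟨⟨m, m', hinj ?_, hinj ?_⟩, ?_⟩
    · rw [map_mul, hm, hm', map_one]; exact g.mul_inv
    · rw [map_mul, hm, hm', map_one]; exact g.inv_mul
    · ext i j; rfl

theorem isOpen_KH : IsOpen (KH F : Set (H F)) := by
  have h1 : IsOpen ((GeneralLinearGroup.map (n := Fin 2) (algebraMap (integers F) F)).range :
      Set (GL (Fin 2) F)) := by
    have : ((GeneralLinearGroup.map (n := Fin 2) (algebraMap (integers F) F)).range :
        Set (GL (Fin 2) F)) = (⋂ i, ⋂ j, {g : GL (Fin 2) F | ‖g i j‖ ≤ 1}) ∩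
          ⋂ i, ⋂ j, {g : GL (Fin 2) F | ‖(g⁻¹ : GL (Fin 2) F) i j‖ ≤ 1} := by
      ext g
      simp only [SetLike.mem_coe, mem_range_GL, Set.mem_inter_iff, Set.mem_iInter,
        Set.mem_ofPred_eq]
    rw [this]
    refine IsOpen.inter ?_ ?_
    · refine isOpen_iInter_of_finite fun i => isOpen_iInter_of_finite fun j => ?_
      refine isOpen_norm_le_one.preimage (f := fun g : GL (Fin 2) F => g i j) ?_
      have h : Continuous (fun g : GL (Fin 2) F => g i) := by fun_prop
      exact (continuous_apply j).comp h
    · refine isOpen_iInter_of_finite fun i => isOpen_iInter_of_finite fun j => ?_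
      refine isOpen_norm_le_one.preimage
        (f := fun g : GL (Fin 2) F => (g⁻¹ : GL (Fin 2) F) i j) ?_
      have h : Continuous (fun g : GL (Fin 2) F => (g⁻¹ : GL (Fin 2) F) i) := by fun_prop
      exact (continuous_apply j).comp h
  exact QuotientGroup.isOpenMap_coe (N := Subgroup.center (GL (Fin 2) F)) _ h1

/-- The Satake transform `f'^∨(π'_ζ) = tr π'_ζ(f')`, where `π'_ζ = I_{H,χ₀}(ζ, -ζ)`. -/
def satakeH (χ₀ : Fˣ →* ℂˣ) (μH : Measure (H F)) [μH.IsHaarMeasure] (f : spherical (KH F))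
    (ζ : ℂ) : ℂ :=
  finiteRankTrace
    (heckeOperator μH isOpen_KH (fun p : F × Fˣ => nH p.1 * aH p.2) (borelCharH χ₀ ζ) f)

/-- `W` is the normalized unramified Whittaker function `W_ζ` of `π'_ζ`. -/
def IsW (ψ : AddChar F Circle) (χ₀ : Fˣ →* ℂˣ) (μH : Measure (H F)) [μH.IsHaarMeasure] (ζ : ℂ)
    (W : H F → ℂ) : Prop :=
  W 1 = 1 ∧
  (∀ (x : F) (g : H F), ∀ k ∈ KH F, W (nH x * g * k) = (ψ x : ℂ) * W g) ∧
  ∀ (f : spherical (KH F)) (h : H F),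
    satakeH χ₀ μH f ζ * W h = ∫ x, (f : H F → ℂ) x * W (h * x) ∂μH

/-- `C_c(N'\H/K', ψ_{N'})`: the right `K'`-invariant functions `φ'` on `H` with
`φ'(ng) = conj (ψ_{N'}(n)) φ'(g)` that are compactly supported modulo `N'`. -/
def CcH (ψ : AddChar F Circle) : Submodule ℂ (H F → ℂ) where
  carrier := {φ | (∀ (x : F) g, φ (nH x * g) = starRingEnd ℂ (ψ x : ℂ) * φ g) ∧
    (∀ k ∈ KH F, ∀ g, φ (g * k) = φ g) ∧
    ∃ Ω : Set (H F), IsCompact Ω ∧ ∀ g, φ g ≠ 0 → ∃ x : F, ∃ ω ∈ Ω, g = nH x * ω}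
  add_mem' := by
    rintro f g ⟨h1, h2, Ω, hΩ, h3⟩ ⟨h1', h2', Ω', hΩ', h3'⟩
    refine ⟨fun x s => by simp [h1, h1', mul_add], fun k hk s => by simp [h2 k hk, h2' k hk],
      Ω ∪ Ω', hΩ.union hΩ', fun s hs => ?_⟩
    by_cases hf : f s = 0
    · have hg : g s ≠ 0 := by
        intro hg
        exact hs (by simp [hf, hg])
      obtain ⟨x, ω, hω, e⟩ := h3' s hg
      exact ⟨x, ω, Or.inr hω, e⟩
    · obtain ⟨x, ω, hω, e⟩ := h3 s hf
      exact ⟨x, ω, Or.inl hω, e⟩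
  zero_mem' := ⟨fun _ _ => by simp, fun _ _ _ => rfl, ∅, isCompact_empty,
    fun _ h => absurd rfl h⟩
  smul_mem' := by
    rintro c f ⟨h1, h2, Ω, hΩ, h3⟩
    refine ⟨fun x s => ?_, fun k hk s => by simp [h2 k hk], Ω, hΩ, fun s hs => h3 s ?_⟩
    · simp only [Pi.smul_apply, h1, smul_eq_mul]
      ring
    · intro h
      exact hs (by simp [h])

/-- `φ'_{f'}(g) = ∫_{N'} ψ_{N'}(n) f'(ng) dn`. -/
def phiOf' [MeasurableSpace F] (ψ : AddChar F Circle) (μF : Measure F) (f : H F → ℂ) : H F → ℂ :=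
  fun g => ∫ x, (ψ x : ℂ) * f (nH x * g) ∂μF

end GroupH

section Correspondence

variable {F : Type*} [NontriviallyNormedField F] [IsUltrametricDist F]

/-- Spherical functions `f` on `G` and `f'` on `H` are corresponding if their Satake transforms
agree at `π_ζ` and `π'_ζ`, for all complex `ζ`. -/
def Corresponding (χ₀ : Fˣ →* ℂˣ) (μG : Measure (SO5 F)) [μG.IsHaarMeasure] (μH : Measure (H F))
    [μH.IsHaarMeasure] (f : spherical (KG F)) (f' : spherical (KH F)) : Prop :=
  ∀ ζ : ℂ, satakeG μG f ζ = satakeH χ₀ μH f' ζ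

end Correspondence

end SO5PGL2

end

open SO5PGL2

set_option linter.unusedSectionVars false

namespace SO5PGL2

/-! ### Cosets of open subgroups -/

section Cosets

variable {Γ : Type*} [Group Γ] [TopologicalSpace Γ] [IsTopologicalGroup Γ]

/-! Pairing with `T_ζ` on one side and with `W_ζ` on the other identifies both function spaces with
ℂ[X], where X = q^ζ + q^{-ζ}, and 𝓕 is the composite of the two identifications. For this the
natural basis functions must pair to polynomials of degrees 0, 1, 2, …; the explicit formula for 𝓕
then compares two explicit families of polynomials.

On the side of H, a function in `CcH ψ` is determined by its values at a(ϖ^m) with m ≥ 0, since the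
conductor of ψ forces it to vanish for m < 0. The Jacquet integral of the spherical function `w ^
hgt` is a Hecke eigenfunction. Evaluated shell by shell, it gives W_ζ(a(ϖ^m)) = (ε q^{-1/2})^m
S_m(X), where S_m(z + z⁻¹) = z^m + z^{m-2} + ⋯ + z^{-m} (`jacquet_natCast`, `hecke_whittaker`).
Hence φ'_m pairs to (ε q^{1/2})^m S_m, which is `torusPoly`.

On the side of S, the K-orbits are the spheres ‖s‖ = q^r. The trace of f on π_ζ is its eigenvalue on
the spherical vector. An intertwining integral along the short root shows that the same eigenvalue
is obtained from (q^{3/2+ζ})^{-`rht`}, a power of the norm of the last row (`satakeG_eq`). When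
q^{3/2+ζ} = q^{-n}, this power is ‖last row of g‖^n. Now |(gs)₅| = ‖last row of g‖ · |(ks)₅| for
some k in K depending on g alone, so the K-average of |s₅|^n is an eigenfunction on S with exactly
that eigenvalue (`integral_mul_avgPow`). For these ζ the integral of T_ζ over the ball ‖s‖ ≤ q^r is
therefore a ratio of integrals of |s₅|^n.

Those integrals are elementary. In the coordinates s₅ and u = (s₃, s₂, s₄)/s₅ the invariant measure
is a product on each shell |s₅| = q^m, and what remains is the volume of the integral solutions of
2ab + z² ≡ e modulo powers of ϖ (`cube_ternarySet`). The number of square roots of the level, 2 or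
0, produces the sign ±. The result is `ballPoly`, equal to q^{3r/2}(S_r ∓ q^{-1/2} S_{r-1}).

For general ζ, T_ζ is defined by dividing the polynomial of each orbit by the volume of the orbit.
The eigenfunction equation is an identity of Laurent polynomials in q^ζ that holds at infinitely
many points, hence everywhere (`IsLaurent.eq_of_infinite`). Uniqueness of T_ζ and W_ζ comes from
testing with characteristic functions of double cosets, which gives a triangular system.

Finally `ballPoly_eq_torusPoly` is the formula for 𝓕(Φ_r). For corresponding f and f', the pairing
of φ_f unfolds to ∫ f(g) T_ζ(g v₀) dg, the Satake transform of f, and that of φ'_{f'} unfolds to ∫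
f' W_ζ, the Satake transform of f'. -/

theorem exists_finset_cosets {U : Subgroup Γ} (hU : IsOpen (U : Set Γ)) {C : Set Γ}
    (hC : IsCompact C) : ∃ s : Finset Γ, (∀ g ∈ C, ∃ x ∈ s, x⁻¹ * g ∈ U) ∧
      ∀ x ∈ s, ∀ y ∈ s, x⁻¹ * y ∈ U → x = y := by
  classical
  obtain ⟨t, ht⟩ := hC.elim_finite_subcover (fun x : Γ => (fun g => x⁻¹ * g) ⁻¹' (U : Set Γ))
    (fun x => hU.preimage (by fun_prop))
    (fun g _ => Set.mem_iUnion.2 ⟨g, by simp [U.one_mem]⟩)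
  refine ⟨(t.image (QuotientGroup.mk : Γ → Γ ⧸ U)).image Quotient.out, fun g hg => ?_, ?_⟩
  · obtain ⟨x, hx, hg'⟩ := Set.mem_iUnion₂.1 (ht hg)
    refine ⟨(QuotientGroup.mk x : Γ ⧸ U).out,
      Finset.mem_image_of_mem _ (Finset.mem_image_of_mem _ hx), ?_⟩
    rw [← QuotientGroup.eq, QuotientGroup.out_eq']
    exact QuotientGroup.eq.2 hg'
  · intro x hx y hy hxy
    obtain ⟨a, -, rfl⟩ := Finset.mem_image.1 hx
    obtain ⟨b, -, rfl⟩ := Finset.mem_image.1 hy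
    have := QuotientGroup.eq.2 hxy
    rw [QuotientGroup.out_eq', QuotientGroup.out_eq'] at this
    rw [this]

open Classical in
theorem exists_coset_sum {U : Subgroup Γ} (hU : IsOpen (U : Set Γ)) {f : Γ → ℂ}
    (hf : ∀ k ∈ U, ∀ g, f (g * k) = f g) (hc : HasCompactSupport f) :
    ∃ s : Finset Γ, (∀ x ∈ s, ∀ y ∈ s, x⁻¹ * y ∈ U → x = y) ∧
      ∀ g, f g = ∑ x ∈ s, f x * if x⁻¹ * g ∈ U then 1 else 0 := by
  obtain ⟨s, hs, hs'⟩ := exists_finset_cosets hU hc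
  refine ⟨s, hs', fun g => ?_⟩
  have key : ∀ x, x⁻¹ * g ∈ U → f x = f g := fun x hx => by
    have := hf _ hx x
    rwa [mul_inv_cancel_left, eq_comm] at this
  by_cases hg : f g = 0
  · rw [hg, Finset.sum_eq_zero]
    intro x _
    split_ifs with h
    · rw [key x h, hg, zero_mul]
    · rw [mul_zero]
  · obtain ⟨x, hx, hxg⟩ := hs g (subset_tsupport _ hg)
    rw [Finset.sum_eq_single_of_mem x hx, if_pos hxg, key x hxg, mul_one]
    intro y hy hyx
    rw [if_neg, mul_zero]
    intro hyg
    refine hyx (hs' y hy x hx ?_)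
    have := U.mul_mem hyg (U.inv_mem hxg)
    simpa using this

variable [MeasurableSpace Γ] [BorelSpace Γ] (μ : Measure Γ) [μ.IsHaarMeasure]

theorem exists_integral_eq_sum {U : Subgroup Γ} (hU : IsOpen (U : Set Γ)) {f : Γ → ℂ}
    (hf : ∀ k ∈ U, ∀ g, f (g * k) = f g) (hc : HasCompactSupport f) :
    ∃ s : Finset Γ, ∀ φ : Γ → ℂ, (∀ x, IntegrableOn (fun g => φ (x * g)) U μ) →
      ∫ g, f g * φ g ∂μ = ∑ x ∈ s, f x * ∫ g in (U : Set Γ), φ (x * g) ∂μ := by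
  classical
  obtain ⟨s, -, hs⟩ := exists_coset_sum hU hf hc
  refine ⟨s, fun φ hφ => ?_⟩
  have h1 : ∀ x, (fun g => if x⁻¹ * g ∈ U then φ g else 0) =
      fun g => (U : Set Γ).indicator (fun g => φ (x * g)) (x⁻¹ * g) := by
    intro x
    funext g
    simp [Set.indicator_apply]
  have h2 : ∀ x, Integrable (fun g => if x⁻¹ * g ∈ U then φ g else 0) μ := by
    intro x
    rw [h1]
    exact ((integrable_indicator_iff hU.measurableSet).2 (hφ x)).comp_mul_left x⁻¹
  calc ∫ g, f g * φ g ∂μ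
      = ∫ g, ∑ x ∈ s, f x * (if x⁻¹ * g ∈ U then φ g else 0) ∂μ := by
        congr 1
        funext g
        rw [hs g, Finset.sum_mul]
        refine Finset.sum_congr rfl fun x _ => ?_
        split_ifs <;> simp
    _ = ∑ x ∈ s, f x * ∫ g, (if x⁻¹ * g ∈ U then φ g else 0) ∂μ := by
        rw [integral_finsetSum _ fun x _ => (h2 x).const_mul _]
        simp_rw [integral_const_mul]
    _ = _ := by
        refine Finset.sum_congr rfl fun x _ => ?_
        rw [h1, integral_mul_left_eq_self
          (fun g => (U : Set Γ).indicator (fun g => φ (x * g)) g) x⁻¹,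
          integral_indicator hU.measurableSet]

/-- The finite set depends on f only and serves all φ simultaneously. A Hecke integral thus becomes
a finite sum with fixed coefficients, which can be exchanged with other integrals and depends on a
parameter in φ as a Laurent polynomial whenever φ does. -/
theorem exists_integral_eq_sum_of_invariant {U : Subgroup Γ} (hU : IsOpen (U : Set Γ))
    (hμ : μ U = 1) {f : Γ → ℂ}
    (hf : ∀ k ∈ U, ∀ g, f (g * k) = f g) (hc : HasCompactSupport f) :
    ∃ s : Finset Γ, ∀ φ : Γ → ℂ, (∀ k ∈ U, ∀ g, φ (g * k) = φ g) →
      ∫ g, f g * φ g ∂μ = ∑ x ∈ s, f x * φ x := by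
  obtain ⟨s, hs⟩ := exists_integral_eq_sum μ hU hf hc
  refine ⟨s, fun φ hφ => ?_⟩
  have h1 : ∀ x, Set.EqOn (fun g => φ (x * g)) (fun _ => φ x) U := fun x k hk => hφ k hk x
  rw [hs φ fun x => ?_]
  · refine Finset.sum_congr rfl fun x _ => ?_
    rw [setIntegral_congr_fun hU.measurableSet (h1 x), setIntegral_const]
    simp [Measure.real, hμ]
  · refine (integrableOn_congr_fun (h1 x) hU.measurableSet).2 ?_
    simp [hμ]

end Cosets

/-! ### The trace of a Hecke operator -/

section Trace

/-- The range lies in the line through v, on which L acts by c. Either the range is that whole line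
and the trace is c · 1, or L = 0, in which case c = 0 as well. -/
theorem finiteRankTrace_eq {V : Type*} [AddCommGroup V] [Module ℂ V] (L : V →ₗ[ℂ] V) {v : V}
    (hv : v ≠ 0) {c : ℂ} (hc : L v = c • v) (h : ∀ w, ∃ a : ℂ, L w = a • v) :
    finiteRankTrace L = c := by
  unfold finiteRankTrace
  have hr : LinearMap.range L ≤ Submodule.span ℂ {v} := by
    rintro _ ⟨w, rfl⟩
    obtain ⟨a, ha⟩ := h w
    rw [ha]
    exact Submodule.smul_mem _ _ (Submodule.mem_span_singleton_self v)
  have hfin : FiniteDimensional ℂ (LinearMap.range L) := Submodule.finiteDimensional_of_le hr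
  have hL : L.restrict (p := LinearMap.range L) (q := LinearMap.range L)
      (fun x _ => LinearMap.mem_range_self L x) = c • LinearMap.id := by
    ext x
    obtain ⟨a, ha⟩ := Submodule.mem_span_singleton.1 (hr x.2)
    simp only [LinearMap.coe_restrict_apply, LinearMap.smul_apply, LinearMap.id_apply,
      Submodule.coe_smul]
    rw [← ha, map_smul, hc, smul_comm]
  rw [hL, map_smul, LinearMap.trace_id, smul_eq_mul]
  by_cases h0 : ∀ w, L w = 0
  · have h1 : c = 0 := by
      have := hc.symm.trans (h0 v)
      exact (smul_eq_zero.1 this).resolve_right hv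
    rw [h1, zero_mul]
  · push Not at h0
    obtain ⟨w, hw⟩ := h0
    have h1 : LinearMap.range L = Submodule.span ℂ {v} := by
      refine le_antisymm hr ?_
      obtain ⟨a, ha⟩ := h w
      have ha0 : a ≠ 0 := fun h => hw (by rw [ha, h, zero_smul])
      rw [Submodule.span_singleton_le_iff_mem]
      exact ⟨a⁻¹ • w, by rw [map_smul, ha, smul_smul, inv_mul_cancel₀ ha0, one_smul]⟩
    rw [h1, finrank_span_singleton hv, Nat.cast_one, mul_one]

variable {G : Type*} [Group G] [TopologicalSpace G] [IsTopologicalGroup G]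
  [MeasurableSpace G] [BorelSpace G] (μ : Measure G) [μ.IsHaarMeasure]

/-- Write h = b k: the substitution g ↦ k⁻¹ g is absorbed by the left invariance of f, and b leaves
the integral through its character. So the spherical vector is a Hecke eigenvector at every point.
-/
theorem integral_mul_eq_integral_mul_of_iwasawa {K : Subgroup G} (f : spherical K) {ι : Type*}
    (b : ι → G) (χ : ι → ℂ) (hG : ∀ g, ∃ i, ∃ k ∈ K, g = b i * k) {φ₀ : G → ℂ}
    (hφb : ∀ i g, φ₀ (b i * g) = χ i * φ₀ g) (hφK : ∀ k ∈ K, ∀ g, φ₀ (g * k) = φ₀ g)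
    (hφ1 : φ₀ 1 = 1) (h : G) :
    ∫ g, (f : G → ℂ) g * φ₀ (h * g) ∂μ = (∫ g, (f : G → ℂ) g * φ₀ g ∂μ) * φ₀ h := by
  obtain ⟨i, k, hk, rfl⟩ := hG h
  have h1 : φ₀ (b i * k) = χ i := by rw [hφK k hk, ← mul_one (b i), hφb, hφ1, mul_one]
  rw [h1, ← integral_mul_left_eq_self _ k⁻¹, ← integral_mul_const]
  congr 1
  funext g
  rw [f.2.1 _ (K.inv_mem hk), mul_assoc, mul_inv_cancel_left, hφb]
  ring

/-- A spherical f maps everything to K-fixed vectors, and by the Iwasawa decomposition these are the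
multiples of φ₀. The trace is therefore the eigenvalue on φ₀. -/
theorem finiteRankTrace_heckeOperator {K : Subgroup G} (hK : IsOpen (K : Set G)) (f : spherical K)
    {ι : Type*} (b : ι → G) (χ : ι → ℂ) (hG : ∀ g, ∃ i, ∃ k ∈ K, g = b i * k) {φ₀ : G → ℂ}
    (hφb : ∀ i g, φ₀ (b i * g) = χ i * φ₀ g) (hφK : ∀ k ∈ K, ∀ g, φ₀ (g * k) = φ₀ g)
    (hφ1 : φ₀ 1 = 1) :
    finiteRankTrace (heckeOperator μ hK b χ f) = ∫ g, (f : G → ℂ) g * φ₀ g ∂μ := by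
  let v : induced b χ := ⟨φ₀, isLocallyConstant_of_right_invariant hK hφK, hφb⟩
  refine finiteRankTrace_eq _ (v := v) ?_ ?_ ?_
  · intro hv
    have : φ₀ 1 = 0 := congrFun (congrArg Subtype.val hv) 1
    rw [hφ1] at this
    exact one_ne_zero this
  · apply Subtype.ext
    funext h
    exact integral_mul_eq_integral_mul_of_iwasawa μ f b χ hG hφb hφK hφ1 h
  · intro w
    refine ⟨((heckeOperator μ hK b χ f w : induced b χ) : G → ℂ) 1, Subtype.ext ?_⟩
    funext h
    obtain ⟨i, k, hk, rfl⟩ := hG h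
    have hinv : ∀ k ∈ K, ∀ g, ((heckeOperator μ hK b χ f w : induced b χ) : G → ℂ) (g * k) =
        ((heckeOperator μ hK b χ f w : induced b χ) : G → ℂ) g := by
      intro k hk g
      change ∫ x, (f : G → ℂ) x * (w : G → ℂ) (g * k * x) ∂μ =
        ∫ x, (f : G → ℂ) x * (w : G → ℂ) (g * x) ∂μ
      rw [← integral_mul_left_eq_self (fun x => (f : G → ℂ) x * (w : G → ℂ) (g * x)) k]
      simp only [f.2.1 k hk, mul_assoc]
    change _ = ((heckeOperator μ hK b χ f w : induced b χ) : G → ℂ) 1 * φ₀ (b i * k)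
    rw [hinv k hk, hφK k hk, ← mul_one (b i), (heckeOperator μ hK b χ f w).2.2, hφb, hφ1]
    ring

end Trace

/-! ### Laurent polynomial functions -/

section Laurent

/-- The function `f` agrees on `ℂ \ {0}` with a Laurent polynomial. -/
def IsLaurent (f : ℂ → ℂ) : Prop :=
  ∃ (N : ℕ) (P : Polynomial ℂ), ∀ z ≠ 0, z ^ N * f z = P.eval z

namespace IsLaurent

variable {f g : ℂ → ℂ}

theorem const (c : ℂ) : IsLaurent fun _ => c := ⟨0, Polynomial.C c, fun z _ => by simp⟩

theorem add (hf : IsLaurent f) (hg : IsLaurent g) : IsLaurent fun z => f z + g z := by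
  obtain ⟨N, P, h⟩ := hf
  obtain ⟨M, Q, h'⟩ := hg
  refine ⟨N + M, Polynomial.X ^ M * P + Polynomial.X ^ N * Q, fun z hz => ?_⟩
  simp only [Polynomial.eval_add, Polynomial.eval_mul, Polynomial.eval_pow, Polynomial.eval_X,
    ← h z hz, ← h' z hz]
  ring

theorem mul (hf : IsLaurent f) (hg : IsLaurent g) : IsLaurent fun z => f z * g z := by
  obtain ⟨N, P, h⟩ := hf
  obtain ⟨M, Q, h'⟩ := hg
  refine ⟨N + M, P * Q, fun z hz => ?_⟩
  simp only [Polynomial.eval_mul, ← h z hz, ← h' z hz]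
  ring

theorem sum {ι : Type*} (s : Finset ι) {f : ι → ℂ → ℂ} (h : ∀ i ∈ s, IsLaurent (f i)) :
    IsLaurent fun z => ∑ i ∈ s, f i z := by
  classical
  induction s using Finset.induction_on with
  | empty => simpa using const 0
  | insert a s ha ih =>
    simp_rw [Finset.sum_insert ha]
    exact (h a (Finset.mem_insert_self a s)).add
      (ih fun i hi => h i (Finset.mem_insert_of_mem hi))

theorem zpow (n : ℤ) : IsLaurent fun z => z ^ n := by
  obtain ⟨m, rfl | rfl⟩ := n.eq_nat_or_neg
  · exact ⟨0, Polynomial.X ^ m, fun z _ => by simp⟩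
  · exact ⟨m, 1, fun z hz => by simp [hz]⟩

theorem congr (hf : IsLaurent f) (h : ∀ z ≠ 0, f z = g z) : IsLaurent g := by
  obtain ⟨N, P, hP⟩ := hf
  exact ⟨N, P, fun z hz => by rw [← h z hz, hP z hz]⟩

theorem eval_add_inv (P : Polynomial ℂ) : IsLaurent fun z => P.eval (z + z⁻¹) := by
  induction P using Polynomial.induction_on' with
  | add p q hp hq =>
    simp_rw [Polynomial.eval_add]
    exact hp.add hq
  | monomial n a =>
    simp_rw [Polynomial.eval_monomial]
    refine (const a).mul ?_
    induction n with
    | zero => simpa using const 1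
    | succ n ih =>
      simp_rw [pow_succ]
      exact ih.mul (((zpow 1).add (zpow (-1))).congr fun z _ => by simp)

/-- After multiplication by a power of z both sides are polynomials, and these agree at infinitely
many points. This transports the eigenfunction equations from special parameters, where an integral
formula is available, to all parameters. -/
theorem eq_of_infinite (hf : IsLaurent f) (hg : IsLaurent g) {A : Set ℂ} (hA : A.Infinite)
    (h : ∀ z ∈ A, z ≠ 0 ∧ f z = g z) {z : ℂ} (hz : z ≠ 0) : f z = g z := by
  obtain ⟨N, P, hP⟩ := hf
  obtain ⟨M, Q, hQ⟩ := hg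
  have h1 : Polynomial.X ^ M * P = Polynomial.X ^ N * Q := by
    refine Polynomial.eq_of_infinite_eval_eq _ _ (hA.mono fun w hw => ?_)
    obtain ⟨hw0, hw'⟩ := h w hw
    simp only [Set.mem_ofPred_eq, Polynomial.eval_mul, Polynomial.eval_pow, Polynomial.eval_X,
      ← hP w hw0, ← hQ w hw0, hw']
    ring
  have h2 := congrArg (Polynomial.eval z) h1
  simp only [Polynomial.eval_mul, Polynomial.eval_pow, Polynomial.eval_X, ← hP z hz,
    ← hQ z hz] at h2
  refine mul_left_cancel₀ (pow_ne_zero (N + M) hz) ?_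
  linear_combination h2

end IsLaurent

end Laurent

end SO5PGL2

namespace SO5PGL2

/-! ### Arithmetic of the local field -/

section LocalField

variable {F : Type*} [NontriviallyNormedField F] [IsUltrametricDist F]

/-- `ϖ` generates the maximal ideal, and the absolute value is the normalized one. -/
structure IsUniformizer (ϖ : Fˣ) : Prop where
  lt_one_iff : ∀ x : F, ‖x‖ < 1 ↔ ‖x‖ ≤ ‖(ϖ : F)‖
  norm_eq : ‖(ϖ : F)‖ = (resCard F : ℝ)⁻¹

theorem norm_add_le_of_le {x y : F} {r : ℝ} (hx : ‖x‖ ≤ r) (hy : ‖y‖ ≤ r) : ‖x + y‖ ≤ r :=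
  (IsUltrametricDist.norm_add_le_max x y).trans (max_le hx hy)

theorem norm_sub_le_of_le {x y : F} {r : ℝ} (hx : ‖x‖ ≤ r) (hy : ‖y‖ ≤ r) : ‖x - y‖ ≤ r := by
  rw [sub_eq_add_neg]
  exact norm_add_le_of_le hx (by rwa [norm_neg])

theorem norm_add_eq_of_lt {x y : F} (h : ‖x‖ < ‖y‖) : ‖x + y‖ = ‖y‖ := by
  rw [IsUltrametricDist.norm_add_eq_max_of_norm_ne_norm h.ne, max_eq_right h.le]

theorem norm_mul_le_one {x y : F} (hx : ‖x‖ ≤ 1) (hy : ‖y‖ ≤ 1) : ‖x * y‖ ≤ 1 := by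
  rw [norm_mul]
  exact mul_le_one₀ hx (norm_nonneg _) hy

theorem norm_natCast_le_one (n : ℕ) : ‖(n : F)‖ ≤ 1 :=
  IsUltrametricDist.norm_natCast_le_one F n

theorem norm_two_le_one : ‖(2 : F)‖ ≤ 1 := by exact_mod_cast norm_natCast_le_one (F := F) 2

theorem norm_two_eq_one (hres : ringChar (Residue F) ≠ 2) : ‖(2 : F)‖ = 1 := by
  refine le_antisymm norm_two_le_one (not_lt.1 fun h => hres ?_)
  have h1 : (2 : integers F) ∈ IsLocalRing.maximalIdeal (integers F) := by
    rw [IsLocalRing.mem_maximalIdeal, mem_nonunits_iff]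
    intro hu
    obtain ⟨y, hy⟩ := hu.exists_right_inv
    have hy' : (2 : F) * (y : F) = 1 := congrArg Subtype.val hy
    have hy1 : ‖(y : F)‖ ≤ 1 := mem_integers.1 y.2
    have := congrArg norm hy'
    rw [norm_mul, norm_one] at this
    nlinarith [norm_nonneg (2 : F), norm_nonneg (y : F)]
  have h2 : ((2 : ℕ) : Residue F) = 0 := by
    have := (IsLocalRing.residue_eq_zero_iff (2 : integers F)).2 h1
    rw [map_ofNat] at this
    exact_mod_cast this
  have h3 := (ringChar.spec (Residue F) 2).1 h2
  rcases (Nat.dvd_prime Nat.prime_two).1 h3 with h | h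
  · exact absurd h CharP.ringChar_ne_one
  · exact h

variable {ϖ : Fˣ}

namespace IsUniformizer

variable (hu : IsUniformizer ϖ)
include hu

theorem norm_lt_one : ‖(ϖ : F)‖ < 1 := (hu.lt_one_iff _).2 le_rfl

theorem one_lt_card : 1 < (resCard F : ℝ) := by
  have h := hu.norm_lt_one
  rw [hu.norm_eq] at h
  have h0 : 0 < (resCard F : ℝ)⁻¹ := by
    rw [← hu.norm_eq]
    exact norm_pos_iff.2 ϖ.ne_zero
  exact (inv_lt_one₀ (inv_pos.1 h0)).1 h

theorem card_pos : 0 < (resCard F : ℝ) := zero_lt_one.trans hu.one_lt_card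

theorem one_lt_card_nat : 1 < resCard F := by exact_mod_cast hu.one_lt_card

theorem norm_zpow (m : ℤ) : ‖((ϖ ^ m : Fˣ) : F)‖ = (resCard F : ℝ) ^ (-m) := by
  rw [Units.val_zpow_eq_zpow_val, _root_.norm_zpow, hu.norm_eq, _root_.inv_zpow, _root_.zpow_neg]

/-- If |a| lies in (q^m, q^{m+1}] and were less than q^{m+1}, then aϖ^{m+1} would have norm below 1,
hence at most q⁻¹, giving |a| ≤ q^m. -/
theorem exists_norm_eq (a : Fˣ) : ∃ m : ℤ, ‖(a : F)‖ = (resCard F : ℝ) ^ m := by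
  have ha : 0 < ‖(a : F)‖ := norm_pos_iff.2 a.ne_zero
  obtain ⟨m, h1, h2⟩ := exists_mem_Ioc_zpow ha hu.one_lt_card
  refine ⟨m + 1, le_antisymm h2 (not_lt.1 fun h3 => ?_)⟩
  have h4 : ‖((a * ϖ ^ (m + 1) : Fˣ) : F)‖ < 1 := by
    rw [Units.val_mul, norm_mul, hu.norm_zpow]
    calc ‖(a : F)‖ * (resCard F : ℝ) ^ (-(m + 1))
        < (resCard F : ℝ) ^ (m + 1) * (resCard F : ℝ) ^ (-(m + 1)) :=
          mul_lt_mul_of_pos_right h3 (zpow_pos hu.card_pos _)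
      _ = 1 := by rw [← zpow_add₀ hu.card_pos.ne']; simp
  rw [hu.lt_one_iff, Units.val_mul, norm_mul, hu.norm_zpow, hu.norm_eq] at h4
  have h5 : ‖(a : F)‖ ≤ (resCard F : ℝ) ^ m := by
    have h6 := mul_le_mul_of_nonneg_right h4 (zpow_pos hu.card_pos (m + 1)).le
    rw [mul_assoc, ← zpow_add₀ hu.card_pos.ne', neg_add_cancel, zpow_zero, mul_one,
      zpow_add_one₀ hu.card_pos.ne'] at h6
    refine h6.trans (le_of_eq ?_)
    field_simp [hu.card_pos.ne']
  exact absurd h1 (not_lt.2 h5)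

theorem norm_lt_iff {k : ℤ} (x : F) :
    ‖x‖ < (resCard F : ℝ) ^ k ↔ ‖x‖ ≤ (resCard F : ℝ) ^ (k - 1) := by
  constructor
  · intro h
    by_cases hx : x = 0
    · rw [hx, norm_zero]
      exact (zpow_pos hu.card_pos _).le
    · obtain ⟨m, hm⟩ := hu.exists_norm_eq (Units.mk0 x hx)
      rw [Units.val_mk0] at hm
      rw [hm] at h ⊢
      have := (zpow_lt_zpow_iff_right₀ hu.one_lt_card).1 h
      exact zpow_le_zpow_right₀ hu.one_lt_card.le (by omega)
  · intro h
    exact h.trans_lt (zpow_lt_zpow_right₀ hu.one_lt_card (by omega))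

theorem norm_eq_iff_exists {k : ℤ} (x : F) :
    ‖x‖ = (resCard F : ℝ) ^ k ↔ ‖x‖ ≤ (resCard F : ℝ) ^ k ∧ ¬ ‖x‖ ≤ (resCard F : ℝ) ^ (k - 1) := by
  rw [← hu.norm_lt_iff, not_lt]
  exact ⟨fun h => ⟨h.le, h.ge⟩, fun h => le_antisymm h.1 h.2⟩

theorem zpow_inj {m n : ℤ} : (resCard F : ℝ) ^ m = (resCard F : ℝ) ^ n ↔ m = n :=
  zpow_right_inj₀ hu.card_pos hu.one_lt_card.ne'

end IsUniformizer

/-- The exponent `k` with `‖x‖ = q ^ k`. -/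
noncomputable def lv (x : F) : ℤ := Int.log (resCard F) ‖x‖

theorem IsUniformizer.lv_eq (hu : IsUniformizer ϖ) {x : F} {k : ℤ}
    (h : ‖x‖ = (resCard F : ℝ) ^ k) : lv x = k := by
  rw [lv, h]
  exact Int.log_zpow hu.one_lt_card_nat k

theorem IsUniformizer.norm_eq_zpow_lv (hu : IsUniformizer ϖ) {x : F} (hx : x ≠ 0) :
    ‖x‖ = (resCard F : ℝ) ^ lv x := by
  obtain ⟨m, hm⟩ := hu.exists_norm_eq (Units.mk0 x hx)
  rw [Units.val_mk0] at hm
  rw [hu.lv_eq hm, hm]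

theorem isClosed_norm_le (r : ℝ) : IsClosed {x : F | ‖x‖ ≤ r} := isClosed_le continuous_norm
  continuous_const

theorem isClosed_norm_eq (r : ℝ) : IsClosed {x : F | ‖x‖ = r} := isClosed_eq continuous_norm
  continuous_const

theorem isOpen_norm_le {r : ℝ} (hr : r ≠ 0) : IsOpen {x : F | ‖x‖ ≤ r} := by
  have := IsUltrametricDist.isOpen_closedBall (0 : F) hr
  simpa [Metric.closedBall, dist_zero_right] using this

section Compact

variable [LocallyCompactSpace F]

theorem isCompact_norm_le (r : ℝ) : IsCompact {x : F | ‖x‖ ≤ r} := by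
  have : ProperSpace F := ProperSpace.of_locallyCompactSpace F
  have := isCompact_closedBall (0 : F) r
  simpa [Metric.closedBall, dist_zero_right] using this

/-- Hensel's lemma for square roots. -/
theorem isSquare_of_norm_sub_lt (h2 : ‖(2 : F)‖ = 1) {θ z : F} (hθ : ‖θ‖ = 1)
    (hz : ‖z ^ 2 - θ‖ < 1) : IsSquare θ := by
  have hunit : ∀ y : F, ‖y ^ 2 - θ‖ < 1 → ‖y‖ = 1 := by
    intro y hy
    have h1 : ‖y ^ 2 - θ + θ‖ = ‖θ‖ := norm_add_eq_of_lt (by rwa [hθ])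
    rw [sub_add_cancel, norm_pow, hθ] at h1
    exact (pow_eq_one_iff_of_nonneg (norm_nonneg y) two_ne_zero).1 h1
  have hcpt : IsCompact {x : F | ‖x‖ = 1} :=
    (isCompact_norm_le (F := F) 1).of_isClosed_subset (isClosed_norm_eq 1)
      fun x hx => le_of_eq hx
  -- Compactness replaces the Newton iteration: y minimizes |y² - θ| on the unit sphere. One Newton
  -- step squares the error, so a minimum below 1 must be 0.
  obtain ⟨y, hy1, hy⟩ := hcpt.exists_isMinOn ⟨z, hunit z hz⟩
    (f := fun y => ‖y ^ 2 - θ‖) (by fun_prop)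
  have hy1 : ‖y‖ = 1 := hy1
  have hlt : ‖y ^ 2 - θ‖ < 1 := (hy (hunit z hz)).trans_lt hz
  have hy0 : y ≠ 0 := fun h => by simp [h] at hy1
  have h20 : (2 : F) ≠ 0 := fun h => by simp [h] at h2
  have key : (y - (y ^ 2 - θ) / (2 * y)) ^ 2 - θ = ((y ^ 2 - θ) / (2 * y)) ^ 2 := by
    field_simp
    ring
  have hnorm : ‖(y - (y ^ 2 - θ) / (2 * y)) ^ 2 - θ‖ = ‖y ^ 2 - θ‖ ^ 2 := by
    rw [key, norm_pow, norm_div, norm_mul, h2, hy1, mul_one, div_one]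
  have hlt2 : ‖(y - (y ^ 2 - θ) / (2 * y)) ^ 2 - θ‖ < 1 := by
    rw [hnorm]
    nlinarith [norm_nonneg (y ^ 2 - θ)]
  have hmin : ‖y ^ 2 - θ‖ ≤ ‖(y - (y ^ 2 - θ) / (2 * y)) ^ 2 - θ‖ := hy (hunit _ hlt2)
  rw [hnorm] at hmin
  have h0 : ‖y ^ 2 - θ‖ = 0 := by
    by_contra h
    have := lt_of_le_of_ne (norm_nonneg _) (Ne.symm h)
    nlinarith
  exact ⟨y, by rw [← sq]; exact (sub_eq_zero.1 (norm_eq_zero.1 h0)).symm⟩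

variable [MeasurableSpace F] [BorelSpace F] (μF : Measure F) [μF.IsAddHaarMeasure]

/-- The unit ball is the disjoint union of q translates of the maximal ideal, one for each residue
class, and all of them have the same measure. -/
theorem IsUniformizer.measure_unit_ball (hu : IsUniformizer ϖ) (hμF : μF {x | ‖x‖ ≤ 1} = 1) :
    μF {x | ‖x‖ ≤ ‖(ϖ : F)‖} = ENNReal.ofReal ‖(ϖ : F)‖ := by
  have hcard : Nat.card (Residue F) ≠ 0 := by
    have := hu.one_lt_card_nat
    unfold resCard at this
    omega
  have hfin : Finite (Residue F) := Nat.finite_of_card_ne_zero hcard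
  have hfint : Fintype (Residue F) := Fintype.ofFinite _
  let l : Residue F → integers F := Function.surjInv IsLocalRing.residue_surjective
  have hl : ∀ c, IsLocalRing.residue (integers F) (l c) = c :=
    Function.surjInv_eq IsLocalRing.residue_surjective
  have hm : ∀ x y : integers F, IsLocalRing.residue (integers F) x =
      IsLocalRing.residue (integers F) y ↔ ‖(x : F) - y‖ ≤ ‖(ϖ : F)‖ := by
    intro x y
    rw [← sub_eq_zero, ← map_sub, IsLocalRing.residue_eq_zero_iff, ← hu.lt_one_iff,
      IsLocalRing.mem_maximalIdeal, mem_nonunits_iff]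
    have h1 : ‖((x - y : integers F) : F)‖ ≤ 1 := mem_integers.1 (x - y).2
    change _ ↔ ‖((x - y : integers F) : F)‖ < 1
    generalize x - y = w at h1
    constructor
    · intro hw
      refine lt_of_le_of_ne h1 fun h => hw ?_
      have hw0 : (w : F) ≠ 0 := fun h0 => by simp [h0] at h
      refine IsUnit.of_mul_eq_one (⟨(w : F)⁻¹, mem_integers.2 (by simp [h])⟩ : integers F)
        (Subtype.ext ?_)
      exact mul_inv_cancel₀ hw0
    · rintro hw hwu
      obtain ⟨v, hv⟩ := hwu.exists_right_inv
      have hv0 : (w : F) * (v : F) = 1 := congrArg Subtype.val hv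
      have hv' := congrArg norm hv0
      have hv1 : ‖(v : F)‖ ≤ 1 := mem_integers.1 v.2
      rw [norm_mul, norm_one] at hv'
      nlinarith [norm_nonneg (w : F), norm_nonneg (v : F)]
  have hunion : {x : F | ‖x‖ ≤ 1} =
      ⋃ c : Residue F, (fun x => -(l c : F) + x) ⁻¹' {x | ‖x‖ ≤ ‖(ϖ : F)‖} := by
    ext x
    simp only [Set.mem_ofPred_eq, Set.mem_iUnion, Set.mem_preimage]
    constructor
    · intro hx
      refine ⟨IsLocalRing.residue (integers F) ⟨x, mem_integers.2 hx⟩, ?_⟩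
      have := (hm ⟨x, mem_integers.2 hx⟩
        (l (IsLocalRing.residue (integers F) ⟨x, mem_integers.2 hx⟩))).1 (hl _).symm
      rwa [neg_add_eq_sub]
    · rintro ⟨c, hc⟩
      have h1 := mem_integers.1 (l c).2
      have := norm_add_le_of_le h1 (hc.trans hu.norm_lt_one.le)
      rwa [add_neg_cancel_left] at this
  have hmeas := congrArg μF hunion
  rw [hμF, measure_iUnion] at hmeas
  · simp_rw [measure_preimage_add] at hmeas
    rw [tsum_fintype, Finset.sum_const, Finset.card_univ, nsmul_eq_mul,
      ← Nat.card_eq_fintype_card] at hmeas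
    rw [hu.norm_eq]
    have h3 : (resCard F : ENNReal) * μF {x | ‖x‖ ≤ ‖(ϖ : F)‖} = 1 := hmeas.symm
    rw [ENNReal.ofReal_inv_of_pos hu.card_pos, ENNReal.ofReal_natCast]
    rw [← hu.norm_eq]
    exact ENNReal.eq_inv_of_mul_eq_one_left (by rwa [mul_comm] at h3)
  · intro c d hcd
    refine Set.disjoint_left.2 fun x hx hx' => hcd ?_
    simp only [Set.mem_preimage, Set.mem_ofPred_eq, neg_add_eq_sub] at hx hx'
    have := norm_sub_le_of_le hx' hx
    rw [sub_sub_sub_cancel_left] at this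
    have := (hm _ _).2 this
    rwa [hl, hl] at this
  · intro c
    exact (isClosed_norm_le _).measurableSet.preimage (by fun_prop)

theorem map_mul_eq_smul (a : Fˣ) : ∃ c : ENNReal, μF.map (fun x => (a : F) * x) = c • μF := by
  have : ProperSpace F := ProperSpace.of_locallyCompactSpace F
  let e : F ≃+ F := ⟨⟨fun x => (a : F) * x, fun x => ((a⁻¹ : Fˣ) : F) * x, fun x => by simp,
    fun x => by simp⟩, fun x y => mul_add _ _ _⟩
  have : (μF.map (fun x => (a : F) * x)).IsAddHaarMeasure :=
    e.isAddHaarMeasure_map μF (continuous_const_mul _) (continuous_const_mul _)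
  exact ⟨_, Measure.isAddLeftInvariant_eq_smul _ μF⟩

/-- By uniqueness of Haar measure the image measure is a multiple of μF, and the factor can be read
off from one ball. This is done for units and for ϖ; the claim is multiplicative, and every a is a
unit times a power of ϖ. -/
theorem IsUniformizer.map_mul (hu : IsUniformizer ϖ) (hμF : μF {x | ‖x‖ ≤ 1} = 1) (a : Fˣ) :
    μF.map (fun x => (a : F) * x) = ENNReal.ofReal ‖(a : F)‖⁻¹ • μF := by
  have hmeas : ∀ b : Fˣ, Measurable (fun x : F => (b : F) * x) := fun b =>
    (continuous_const_mul _).measurable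
  have hball : ∀ r : ℝ, MeasurableSet {x : F | ‖x‖ ≤ r} := fun r =>
    (isClosed_norm_le r).measurableSet
  have hpre : ∀ (b : Fˣ) (r : ℝ), (fun x => (b : F) * x) ⁻¹' {x | ‖x‖ ≤ ‖(b : F)‖ * r} =
      {x : F | ‖x‖ ≤ r} := by
    intro b r
    ext x
    simp [norm_mul, mul_le_mul_iff_right₀ (norm_pos_iff.2 b.ne_zero)]
  -- the claim for units, for `ϖ`, and its multiplicativity
  let P : Fˣ → Prop := fun b => μF.map (fun x => (b : F) * x) = ENNReal.ofReal ‖(b : F)‖⁻¹ • μF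
  have hval : ∀ b : Fˣ, ∀ r : ℝ, μF {x | ‖x‖ ≤ ‖(b : F)‖ * r} ≠ 0 →
      μF {x | ‖x‖ ≤ ‖(b : F)‖ * r} ≠ ⊤ → μF {x | ‖x‖ ≤ r} =
        ENNReal.ofReal ‖(b : F)‖⁻¹ * μF {x | ‖x‖ ≤ ‖(b : F)‖ * r} → P b := by
    intro b r h0 h1 h2
    obtain ⟨c, hc⟩ := map_mul_eq_smul μF b
    have h3 := congrArg (fun m => m {x | ‖x‖ ≤ ‖(b : F)‖ * r}) hc
    simp only [Measure.smul_apply, smul_eq_mul] at h3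
    rw [Measure.map_apply (hmeas b) (hball _), hpre, h2] at h3
    have : ENNReal.ofReal ‖(b : F)‖⁻¹ = c := (ENNReal.mul_left_inj h0 h1).1 h3
    change _ = _
    rw [hc, this]
  have hmulP : ∀ b c : Fˣ, P b → P c → P (b * c) := by
    intro b c hb hc
    change _ = _
    have : (fun x : F => ((b * c : Fˣ) : F) * x) = (fun x => (b : F) * x) ∘ fun x => (c : F) * x := by
      funext x
      simp [mul_assoc]
    rw [this, ← Measure.map_map (hmeas b) (hmeas c), hc, Measure.map_smul, hb, smul_smul,
      Units.val_mul, norm_mul, mul_inv, mul_comm, ENNReal.ofReal_mul (by positivity)]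
  have hunit : ∀ b : Fˣ, ‖(b : F)‖ = 1 → P b := by
    intro b hb
    refine hval b 1 ?_ ?_ ?_ <;> simp [hb, hμF]
  have hϖ : P ϖ := by
    refine hval ϖ 1 ?_ ?_ ?_ <;> rw [mul_one, hu.measure_unit_ball μF hμF]
    · simp
    · exact ENNReal.ofReal_ne_top
    · rw [hμF, ← ENNReal.ofReal_mul (by positivity), inv_mul_cancel₀ (by simp), ENNReal.ofReal_one]
  have hinv : ∀ b : Fˣ, P b → P b⁻¹ := by
    intro b hb
    have hb' : μF.map (fun x => (b : F) * x) = ENNReal.ofReal ‖(b : F)‖⁻¹ • μF := hb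
    have h1 : (μF.map (fun x => (b : F) * x)).map (fun x => ((b⁻¹ : Fˣ) : F) * x) = μF := by
      rw [Measure.map_map (hmeas _) (hmeas _)]
      have : ((fun x => ((b⁻¹ : Fˣ) : F) * x) ∘ fun x => (b : F) * x) = id := by
        funext x; simp
      rw [this, Measure.map_id]
    rw [hb', Measure.map_smul] at h1
    change _ = _
    conv_rhs => rw [← h1]
    rw [smul_smul, ← ENNReal.ofReal_mul (by positivity)]
    simp
  have hpow : ∀ m : ℤ, P (ϖ ^ m) := by
    intro m
    induction m with
    | zero => exact hunit _ (by simp)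
    | succ i ih => rw [_root_.zpow_add_one]; exact hmulP _ _ ih hϖ
    | pred i ih => rw [_root_.zpow_sub_one]; exact hmulP _ _ ih (hinv _ hϖ)
  obtain ⟨m, hm⟩ := hu.exists_norm_eq a
  have : a = ϖ ^ (-m) * (ϖ ^ m * a) := by
    rw [← mul_assoc, ← _root_.zpow_add]
    simp
  change P a
  rw [this]
  refine hmulP _ _ (hpow _) (hunit _ ?_)
  rw [Units.val_mul, norm_mul, hu.norm_zpow, hm, ← zpow_add₀ hu.card_pos.ne']
  simp

theorem IsUniformizer.measure_norm_le (hu : IsUniformizer ϖ) (hμF : μF {x | ‖x‖ ≤ 1} = 1)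
    (m : ℤ) : μF {x | ‖x‖ ≤ (resCard F : ℝ) ^ m} = ENNReal.ofReal ((resCard F : ℝ) ^ m) := by
  have h := congrArg (fun ν => ν {x : F | ‖x‖ ≤ 1}) (hu.map_mul μF hμF (ϖ ^ m))
  simp only [Measure.smul_apply, smul_eq_mul] at h
  rw [Measure.map_apply (continuous_const_mul _).measurable (isClosed_norm_le 1).measurableSet,
    hμF, mul_one, hu.norm_zpow, _root_.zpow_neg, inv_inv] at h
  rw [← h]
  congr 1
  ext x
  rw [Set.mem_preimage, Set.mem_ofPred_eq, Set.mem_ofPred_eq, norm_mul, hu.norm_zpow, _root_.zpow_neg,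
    inv_mul_le_iff₀ (zpow_pos hu.card_pos _), mul_one]

theorem IsUniformizer.integral_mul (hu : IsUniformizer ϖ) (hμF : μF {x | ‖x‖ ≤ 1} = 1) (a : Fˣ)
    (f : F → ℂ) : ∫ x, f ((a : F) * x) ∂μF = (‖(a : F)‖⁻¹ : ℝ) * ∫ x, f x ∂μF := by
  let e : F ≃ₜ F := Homeomorph.mulLeft₀ (a : F) a.ne_zero
  have h := e.isClosedEmbedding.measurableEmbedding.integral_map (μ := μF) f
  have he : (e : F → F) = fun x => (a : F) * x := rfl
  rw [he, hu.map_mul μF hμF, integral_smul_measure, ENNReal.toReal_ofReal (by positivity)] at h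
  rw [← h]
  simp

variable (ψ : AddChar F Circle)

theorem continuous_of_trivial (hψ : ∀ x : F, ‖x‖ ≤ 1 → ψ x = 1) :
    IsLocallyConstant (fun x => (ψ x : ℂ)) := by
  rw [IsLocallyConstant.iff_exists_open]
  intro x
  refine ⟨(fun y => y - x) ⁻¹' {y : F | ‖y‖ ≤ 1}, isOpen_norm_le_one.preimage (by fun_prop),
    by simp, fun y hy => ?_⟩
  have : ψ y = ψ (y - x) * ψ x := by rw [← AddChar.map_add_eq_mul, sub_add_cancel]
  rw [this, hψ _ hy, one_mul]

open Classical in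
-- For m ≤ 0 the character is trivial on the ball. For m ≥ 1 the ball contains some y with ψ(y) ≠ 1,
-- and translation by y multiplies the integral by the conjugate of ψ(y), so it vanishes.
theorem IsUniformizer.integral_addChar (hu : IsUniformizer ϖ) (hμF : μF {x | ‖x‖ ≤ 1} = 1)
    (hψ : ∀ x : F, ‖x‖ ≤ 1 → ψ x = 1)
    (hψ' : ∃ x : F, ‖x‖ ≤ 1 ∧ ψ ((ϖ : F)⁻¹ * x) ≠ 1) (m : ℤ) :
    ∫ x in {x : F | ‖x‖ ≤ (resCard F : ℝ) ^ m}, (starRingEnd ℂ (ψ x : ℂ)) ∂μF =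
      if m ≤ 0 then (resCard F : ℂ) ^ m else 0 := by
  have hmeas : MeasurableSet {x : F | ‖x‖ ≤ (resCard F : ℝ) ^ m} :=
    (isClosed_norm_le _).measurableSet
  split_ifs with hm
  · rw [setIntegral_congr_fun (g := fun _ => 1) hmeas]
    · rw [setIntegral_const, Measure.real, hu.measure_norm_le μF hμF, ENNReal.toReal_ofReal
        (zpow_pos hu.card_pos _).le]
      simp
    · intro x hx
      have : ‖x‖ ≤ 1 := le_trans hx (by
        rw [← zpow_zero (resCard F : ℝ)]
        exact zpow_le_zpow_right₀ hu.one_lt_card.le hm)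
      simp [hψ x this]
  · obtain ⟨x, hx, hx'⟩ := hψ'
    set y := (ϖ : F)⁻¹ * x
    have hy : ‖y‖ ≤ (resCard F : ℝ) ^ m := by
      have h1 : ‖y‖ ≤ (resCard F : ℝ) := by
        rw [norm_mul, norm_inv, hu.norm_eq, inv_inv]
        exact mul_le_of_le_one_right hu.card_pos.le hx
      refine h1.trans ?_
      conv_lhs => rw [← zpow_one (resCard F : ℝ)]
      exact zpow_le_zpow_right₀ hu.one_lt_card.le (by omega)
    rw [← integral_indicator hmeas]
    set I := ∫ x, {x : F | ‖x‖ ≤ (resCard F : ℝ) ^ m}.indicator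
      (fun x => starRingEnd ℂ (ψ x : ℂ)) x ∂μF with hI
    have h1 : I = starRingEnd ℂ (ψ y : ℂ) * I := by
      conv_lhs => rw [hI, ← integral_add_left_eq_self _ y]
      rw [hI, ← integral_const_mul]
      congr 1
      funext z
      have h2 : y + z ∈ {x : F | ‖x‖ ≤ (resCard F : ℝ) ^ m} ↔
          z ∈ {x : F | ‖x‖ ≤ (resCard F : ℝ) ^ m} := by
        constructor
        · intro h
          have := norm_sub_le_of_le h hy
          rwa [add_sub_cancel_left] at this
        · exact norm_add_le_of_le hy
      by_cases hz : z ∈ {x : F | ‖x‖ ≤ (resCard F : ℝ) ^ m}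
      · rw [Set.indicator_of_mem hz, Set.indicator_of_mem (h2.2 hz), AddChar.map_add_eq_mul]
        simp
      · rw [Set.indicator_of_notMem hz, Set.indicator_of_notMem (mt h2.1 hz), mul_zero]
    by_contra h0
    have h3 : starRingEnd ℂ (ψ y : ℂ) = 1 := by
      have : (starRingEnd ℂ (ψ y : ℂ) - 1) * I = 0 := by linear_combination -h1
      exact sub_eq_zero.1 ((mul_eq_zero.1 this).resolve_right h0)
    have h4 : (ψ y : ℂ) = 1 := by
      have := congrArg (starRingEnd ℂ) h3
      simpa using this
    exact hx' (Circle.ext (by simpa using h4))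

end Compact

theorem IsUniformizer.measure_units (hu : IsUniformizer ϖ) [MeasurableSpace Fˣ] [BorelSpace Fˣ]
    (μU : Measure Fˣ) [μU.IsHaarMeasure] (hμU : μU {a | ‖(a : F)‖ = 1} = 1) (m : ℤ) :
    μU {a | ‖(a : F)‖ = (resCard F : ℝ) ^ m} = 1 := by
  rw [← hμU, ← measure_preimage_mul μU (ϖ ^ m) {a | ‖(a : F)‖ = 1}]
  congr 1
  ext a
  rw [Set.mem_preimage, Set.mem_ofPred_eq, Set.mem_ofPred_eq, Units.val_mul, norm_mul,
    hu.norm_zpow, _root_.zpow_neg, inv_mul_eq_one₀ (zpow_pos hu.card_pos _).ne', eq_comm]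

end LocalField

end SO5PGL2

namespace SO5PGL2

/-! ### The group `H = PGL(2)`: Iwasawa decomposition and height -/

section GroupH

variable {F : Type*} [NontriviallyNormedField F]

/-- A function on `H` obtained from a function on `GL(2)`. -/
noncomputable def liftH {X : Type*} (f : GL (Fin 2) F → X) (h : H F) : X :=
  f (Function.surjInv ProjGenLinGroup.mk_surjective h)

theorem liftH_mk {X : Type*} {f : GL (Fin 2) F → X}
    (hf : ∀ g (u : Fˣ), f (g * GeneralLinearGroup.scalar (Fin 2) u) = f g) (g : GL (Fin 2) F) :
    liftH f (ProjGenLinGroup.mk g) = f g := by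
  obtain ⟨u, hu⟩ := ProjGenLinGroup.mk_eq_mk_iff.1
    (Function.surjInv_eq ProjGenLinGroup.mk_surjective (ProjGenLinGroup.mk g))
  rw [liftH, ← hf _ u, hu]

theorem mul_scalar_apply (g : GL (Fin 2) F) (u : Fˣ) (i j : Fin 2) :
    (g * GeneralLinearGroup.scalar (Fin 2) u) i j = g i j * (u : F) := by
  rw [Units.val_mul, GeneralLinearGroup.coe_scalar]
  simp [Matrix.scalar_apply, Matrix.mul_diagonal]

/-- The element of `GL(2)` with given entries. -/
noncomputable def gl2 (a b c d : F) (h : a * d - b * c ≠ 0) : GL (Fin 2) F :=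
  GeneralLinearGroup.mkOfDetNeZero !![a, b; c, d] (by rwa [Matrix.det_fin_two_of])

theorem coe_gl2 (a b c d : F) (h : a * d - b * c ≠ 0) :
    (gl2 a b c d h : Matrix (Fin 2) (Fin 2) F) = !![a, b; c, d] := rfl

theorem det_coe_ne_zero (g : GL (Fin 2) F) : g 0 0 * g 1 1 - g 0 1 * g 1 0 ≠ 0 := by
  rw [← Matrix.det_fin_two]
  exact g.det_ne_zero

theorem gl2_eta (g : GL (Fin 2) F) :
    g = gl2 (g 0 0) (g 0 1) (g 1 0) (g 1 1) (det_coe_ne_zero g) := by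
  apply Units.ext
  rw [coe_gl2]
  exact Matrix.eta_fin_two _

theorem nH_eq (x : F) : nH x = ProjGenLinGroup.mk (gl2 1 x 0 1 (by simp)) := rfl

theorem aH_eq (a : Fˣ) : aH a = ProjGenLinGroup.mk (gl2 (a : F) 0 0 1 (by simp)) := rfl

theorem mk_gl2_eq {a b c d a' b' c' d' : F} (h : a * d - b * c ≠ 0) (h' : a' * d' - b' * c' ≠ 0)
    (u : F) (h1 : a * u = a') (h2 : b * u = b') (h3 : c * u = c') (h4 : d * u = d') :
    (ProjGenLinGroup.mk (gl2 a b c d h) : H F) = ProjGenLinGroup.mk (gl2 a' b' c' d' h') := by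
  have hu : u ≠ 0 := by
    rintro rfl
    apply h'
    rw [← h1, ← h2, ← h3, ← h4]
    ring
  rw [ProjGenLinGroup.mk_eq_mk_iff]
  refine ⟨Units.mk0 u hu, GeneralLinearGroup.ext fun i j => ?_⟩
  rw [mul_scalar_apply, coe_gl2, coe_gl2]
  fin_cases i <;> fin_cases j <;> simp [h1, h2, h3, h4]

theorem gl2_mul {a b c d a' b' c' d' : F} (h : a * d - b * c ≠ 0) (h' : a' * d' - b' * c' ≠ 0) :
    gl2 a b c d h * gl2 a' b' c' d' h' =
      gl2 (a * a' + b * c') (a * b' + b * d') (c * a' + d * c') (c * b' + d * d') (by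
        have : (a * a' + b * c') * (c * b' + d * d') - (a * b' + b * d') * (c * a' + d * c') =
          (a * d - b * c) * (a' * d' - b' * c') := by ring
        rw [this]
        exact mul_ne_zero h h') := by
  apply Units.ext
  rw [Units.val_mul, coe_gl2, coe_gl2, coe_gl2]
  simp

theorem nH_add (x y : F) : (nH (x + y) : H F) = nH x * nH y := by
  rw [nH_eq, nH_eq, nH_eq, ← map_mul, gl2_mul]
  exact mk_gl2_eq _ _ 1 (by ring) (by ring) (by ring) (by ring)

theorem nH_zero : (nH 0 : H F) = 1 := by
  rw [nH_eq, ← map_one ProjGenLinGroup.mk]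
  congr 1
  apply Units.ext
  rw [coe_gl2]
  exact Matrix.one_fin_two.symm

theorem aH_mul (a b : Fˣ) : (aH (a * b) : H F) = aH a * aH b := by
  rw [aH_eq, aH_eq, aH_eq, ← map_mul, gl2_mul]
  exact mk_gl2_eq _ _ 1 (by simp) (by ring) (by ring) (by ring)

theorem aH_one : (aH 1 : H F) = 1 := by
  rw [aH_eq, ← map_one ProjGenLinGroup.mk]
  congr 1
  apply Units.ext
  rw [coe_gl2]
  exact Matrix.one_fin_two.symm

theorem aH_mul_nH (a : Fˣ) (x : F) : (aH a * nH x : H F) = nH (a * x) * aH a := by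
  rw [nH_eq, aH_eq, nH_eq, ← map_mul, ← map_mul, gl2_mul, gl2_mul]
  exact mk_gl2_eq _ _ 1 (by ring) (by ring) (by ring) (by ring)

theorem continuous_nH : Continuous (nH : F → H F) := by
  have : (nH : F → H F) = fun x =>
      (QuotientGroup.mk' (Subgroup.center (GL (Fin 2) F)))
        (GeneralLinearGroup.upperRightHom (Multiplicative.ofAdd x)) := by
    funext x
    rw [nH_eq]
    change ProjGenLinGroup.mk _ = ProjGenLinGroup.mk _
    congr 1
    refine GeneralLinearGroup.ext fun i j => ?_
    rw [coe_gl2]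
    fin_cases i <;> fin_cases j <;> rfl
  rw [this]
  exact QuotientGroup.continuous_mk.comp
    (GeneralLinearGroup.continuous_upperRightHom.comp continuous_id)

variable [IsUltrametricDist F]

theorem mk_mem_KH {g : GL (Fin 2) F} (h : ∀ i j, ‖g i j‖ ≤ 1)
    (hd : ‖(g : Matrix (Fin 2) (Fin 2) F).det‖ = 1) : (ProjGenLinGroup.mk g : H F) ∈ KH F := by
  refine Subgroup.mem_map_of_mem _ (mem_range_GL.2 ⟨h, fun i j => ?_⟩)
  rw [Matrix.coe_units_inv, Matrix.inv_def, Ring.inverse_eq_inv', Matrix.adjugate_fin_two,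
    Matrix.smul_apply, smul_eq_mul, norm_mul, norm_inv, hd, inv_one, one_mul]
  fin_cases i <;> fin_cases j <;> simp [h]

theorem mk_gl2_mem_KH {a b c d : F} (h : a * d - b * c ≠ 0) (ha : ‖a‖ ≤ 1) (hb : ‖b‖ ≤ 1)
    (hc : ‖c‖ ≤ 1) (hd : ‖d‖ ≤ 1) (h1 : ‖a * d - b * c‖ = 1) :
    (ProjGenLinGroup.mk (gl2 a b c d h) : H F) ∈ KH F := by
  refine mk_mem_KH (fun i j => ?_) ?_
  · rw [coe_gl2]
    fin_cases i <;> fin_cases j <;> simp [ha, hb, hc, hd]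
  · rw [coe_gl2, Matrix.det_fin_two_of, h1]

theorem exists_of_mem_KH {k : H F} (hk : k ∈ KH F) : ∃ g : GL (Fin 2) F,
    k = ProjGenLinGroup.mk g ∧ (∀ i j, ‖g i j‖ ≤ 1) ∧ ‖g 0 0 * g 1 1 - g 0 1 * g 1 0‖ = 1 := by
  obtain ⟨g, hg, rfl⟩ := Subgroup.mem_map.1 hk
  obtain ⟨h1, h2⟩ := mem_range_GL.1 hg
  refine ⟨g, rfl, h1, ?_⟩
  have h3 : ∀ g' : GL (Fin 2) F, (∀ i j, ‖g' i j‖ ≤ 1) →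
      ‖(g' : Matrix (Fin 2) (Fin 2) F).det‖ ≤ 1 := by
    intro g' h
    rw [Matrix.det_fin_two]
    exact norm_sub_le_of_le (norm_mul_le_one (h _ _) (h _ _)) (norm_mul_le_one (h _ _) (h _ _))
  have h4 : (g : Matrix (Fin 2) (Fin 2) F).det *
      ((g⁻¹ : GL (Fin 2) F) : Matrix (Fin 2) (Fin 2) F).det = 1 := by
    rw [← Matrix.det_mul, ← Units.val_mul, mul_inv_cancel, Units.val_one, Matrix.det_one]
  have h5 := congrArg norm h4
  rw [norm_mul, norm_one] at h5
  rw [← Matrix.det_fin_two]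
  have h6 := h3 _ h1
  have h7 := h3 _ h2
  refine le_antisymm h6 ?_
  nlinarith [norm_nonneg (g : Matrix (Fin 2) (Fin 2) F).det]

theorem nH_mem_KH {x : F} (hx : ‖x‖ ≤ 1) : (nH x : H F) ∈ KH F := by
  rw [nH_eq]
  exact mk_gl2_mem_KH _ (by simp) hx (by simp) (by simp) (by simp)

theorem aH_mem_KH {a : Fˣ} (ha : ‖(a : F)‖ = 1) : (aH a : H F) ∈ KH F := by
  rw [aH_eq]
  exact mk_gl2_mem_KH _ ha.le (by simp) (by simp) (by simp) (by simp [ha])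

/-- The smaller entry of the bottom row is cleared by the larger one through a column operation with
integral quotient, with a swap of columns when c dominates. Dividing by the remaining bottom entry
is allowed in PGL(2). -/
theorem iwasawaH_aux {p q c d : F} (hdet : p * d - q * c ≠ 0) : ∃ (x : F) (a : Fˣ), ∃ k ∈ KH F,
    ProjGenLinGroup.mk (gl2 p q c d hdet) * k = nH x * aH a := by
  by_cases hcd : ‖c‖ ≤ ‖d‖
  · have hd : d ≠ 0 := by
      rintro rfl
      have : c = 0 := by simpa using hcd
      exact hdet (by rw [this]; ring)
    have hk : (1 : F) * 1 - 0 * (-c / d) ≠ 0 := by simp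
    refine ⟨q / d, Units.mk0 ((p * d - q * c) / d ^ 2) (div_ne_zero hdet (pow_ne_zero 2 hd)),
      _, mk_gl2_mem_KH hk (by simp) (by simp) ?_ (by simp) (by simp), ?_⟩
    · rw [norm_div, norm_neg]
      exact div_le_one_of_le₀ hcd (norm_nonneg _)
    · rw [nH_eq, aH_eq, ← map_mul, ← map_mul, gl2_mul, gl2_mul]
      refine mk_gl2_eq _ _ d⁻¹ ?_ ?_ ?_ ?_ <;> simp [hd] <;> field_simp <;> ring
  · have hc : c ≠ 0 := by
      rintro rfl
      exact hcd (by simp)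
    have hk : (-d / c) * 0 - 1 * 1 ≠ (0 : F) := by simp
    refine ⟨p / c, Units.mk0 (-(p * d - q * c) / c ^ 2)
      (div_ne_zero (neg_ne_zero.2 hdet) (pow_ne_zero 2 hc)),
      _, mk_gl2_mem_KH hk ?_ (by simp) (by simp) (by simp) (by simp), ?_⟩
    · rw [norm_div, norm_neg]
      exact div_le_one_of_le₀ (not_le.1 hcd).le (norm_nonneg _)
    · rw [nH_eq, aH_eq, ← map_mul, ← map_mul, gl2_mul, gl2_mul]
      refine mk_gl2_eq _ _ c⁻¹ ?_ ?_ ?_ ?_ <;> simp [hc] <;> field_simp <;> ring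

theorem iwasawaH (h : H F) : ∃ (x : F) (a : Fˣ), ∃ k ∈ KH F, h = nH x * aH a * k := by
  suffices ∃ (x : F) (a : Fˣ), ∃ k ∈ KH F, h * k = nH x * aH a by
    obtain ⟨x, a, k, hk, e⟩ := this
    exact ⟨x, a, k⁻¹, (KH F).inv_mem hk, by rw [← e, mul_inv_cancel_right]⟩
  induction h using ProjGenLinGroup.induction_on with | mk g =>
  rw [gl2_eta g]
  exact iwasawaH_aux _

/-- The height `‖det g‖ / ‖second row of g‖²` on `H`. -/
noncomputable def heightH : H F → ℝ :=
  liftH fun g => ‖g 0 0 * g 1 1 - g 0 1 * g 1 0‖ / max ‖g 1 0‖ ‖g 1 1‖ ^ 2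

/-- The function `‖g‖² / ‖det g‖` on `H`. -/
noncomputable def gaugeH : H F → ℝ :=
  liftH fun g => max (max ‖g 0 0‖ ‖g 0 1‖) (max ‖g 1 0‖ ‖g 1 1‖) ^ 2 /
    ‖g 0 0 * g 1 1 - g 0 1 * g 1 0‖

theorem heightH_mk (g : GL (Fin 2) F) : heightH (ProjGenLinGroup.mk g) =
    ‖g 0 0 * g 1 1 - g 0 1 * g 1 0‖ / max ‖g 1 0‖ ‖g 1 1‖ ^ 2 := by
  refine liftH_mk (fun g u => ?_) g
  simp only [mul_scalar_apply, norm_mul]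
  have hu : ‖(u : F)‖ ≠ 0 := by simp
  have : g 0 0 * (u : F) * (g 1 1 * u) - g 0 1 * u * (g 1 0 * u) =
      (g 0 0 * g 1 1 - g 0 1 * g 1 0) * (u : F) ^ 2 := by ring
  rw [this, norm_mul, norm_pow, ← max_mul_of_nonneg _ _ (norm_nonneg _), mul_pow,
    mul_div_mul_right _ _ (pow_ne_zero 2 hu)]

theorem gaugeH_mk (g : GL (Fin 2) F) : gaugeH (ProjGenLinGroup.mk g) =
    max (max ‖g 0 0‖ ‖g 0 1‖) (max ‖g 1 0‖ ‖g 1 1‖) ^ 2 /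
      ‖g 0 0 * g 1 1 - g 0 1 * g 1 0‖ := by
  refine liftH_mk (fun g u => ?_) g
  simp only [mul_scalar_apply, norm_mul]
  have hu : ‖(u : F)‖ ≠ 0 := by simp
  have : g 0 0 * (u : F) * (g 1 1 * u) - g 0 1 * u * (g 1 0 * u) =
      (g 0 0 * g 1 1 - g 0 1 * g 1 0) * (u : F) ^ 2 := by ring
  rw [this, norm_mul, norm_pow, ← max_mul_of_nonneg _ _ (norm_nonneg _),
    ← max_mul_of_nonneg _ _ (norm_nonneg _), ← max_mul_of_nonneg _ _ (norm_nonneg _), mul_pow,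
    mul_div_mul_right _ _ (pow_ne_zero 2 hu)]

theorem heightH_gl2 {a b c d : F} (h : a * d - b * c ≠ 0) :
    heightH (ProjGenLinGroup.mk (gl2 a b c d h)) = ‖a * d - b * c‖ / max ‖c‖ ‖d‖ ^ 2 := by
  rw [heightH_mk, coe_gl2]
  simp

theorem gaugeH_gl2 {a b c d : F} (h : a * d - b * c ≠ 0) :
    gaugeH (ProjGenLinGroup.mk (gl2 a b c d h)) =
      max (max ‖a‖ ‖b‖) (max ‖c‖ ‖d‖) ^ 2 / ‖a * d - b * c‖ := by
  rw [gaugeH_mk, coe_gl2]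
  simp

theorem row_mul_le {c d a b a' b' : F} (ha : ‖a‖ ≤ 1) (hb : ‖b‖ ≤ 1) (ha' : ‖a'‖ ≤ 1)
    (hb' : ‖b'‖ ≤ 1) :
    max ‖c * a + d * b‖ ‖c * a' + d * b'‖ ≤ max ‖c‖ ‖d‖ := by
  have key : ∀ {x y : F}, ‖x‖ ≤ 1 → ‖y‖ ≤ 1 → ‖c * x + d * y‖ ≤ max ‖c‖ ‖d‖ := by
    intro x y hx hy
    refine norm_add_le_of_le ?_ ?_ <;> rw [norm_mul]
    · exact (mul_le_of_le_one_right (norm_nonneg _) hx).trans (le_max_left _ _)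
    · exact (mul_le_of_le_one_right (norm_nonneg _) hy).trans (le_max_right _ _)
  exact max_le (key ha hb) (key ha' hb')

theorem heightH_mul_KH {k : H F} (hk : k ∈ KH F) (h : H F) : heightH (h * k) = heightH h := by
  have key : ∀ (h : H F), ∀ k ∈ KH F, heightH h ≤ heightH (h * k) := by
    intro h k hk
    obtain ⟨k, rfl, h1, h2⟩ := exists_of_mem_KH hk
    induction h using ProjGenLinGroup.induction_on with | mk g =>
    have hg := det_coe_ne_zero g
    have hk0 := det_coe_ne_zero k
    rw [gl2_eta g, gl2_eta k, ← map_mul, gl2_mul, heightH_gl2, heightH_gl2]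
    have e : ∀ a b c d a' b' c' d' : F,
        (a * a' + b * c') * (c * b' + d * d') - (a * b' + b * d') * (c * a' + d * c') =
          (a * d - b * c) * (a' * d' - b' * c') := by intros; ring
    rw [e, norm_mul, h2, mul_one]
    have hpos : 0 < max ‖g 1 0 * k 0 0 + g 1 1 * k 1 0‖ ‖g 1 0 * k 0 1 + g 1 1 * k 1 1‖ := by
      by_contra hn
      have h0 : max ‖g 1 0 * k 0 0 + g 1 1 * k 1 0‖ ‖g 1 0 * k 0 1 + g 1 1 * k 1 1‖ ≤ 0 :=
        not_lt.1 hn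
      have h3 : g 1 0 * k 0 0 + g 1 1 * k 1 0 = 0 :=
        norm_le_zero_iff.1 ((le_max_left _ _).trans h0)
      have h4 : g 1 0 * k 0 1 + g 1 1 * k 1 1 = 0 :=
        norm_le_zero_iff.1 ((le_max_right _ _).trans h0)
      have := e (g 0 0) (g 0 1) (g 1 0) (g 1 1) (k 0 0) (k 0 1) (k 1 0) (k 1 1)
      rw [h3, h4] at this
      exact mul_ne_zero hg hk0 (by rw [← this]; ring)
    gcongr _ / ?_ ^ 2
    exact row_mul_le (h1 _ _) (h1 _ _) (h1 _ _) (h1 _ _)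
  refine le_antisymm ?_ (key h k hk)
  have := key (h * k) k⁻¹ ((KH F).inv_mem hk)
  rwa [mul_inv_cancel_right] at this

theorem gaugeH_mul_KH {k : H F} (hk : k ∈ KH F) (h : H F) : gaugeH (h * k) = gaugeH h := by
  have key : ∀ (h : H F), ∀ k ∈ KH F, gaugeH (h * k) ≤ gaugeH h := by
    intro h k hk
    obtain ⟨k, rfl, h1, h2⟩ := exists_of_mem_KH hk
    induction h using ProjGenLinGroup.induction_on with | mk g =>
    rw [gl2_eta g, gl2_eta k, ← map_mul, gl2_mul, gaugeH_gl2, gaugeH_gl2]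
    have e : ∀ a b c d a' b' c' d' : F,
        (a * a' + b * c') * (c * b' + d * d') - (a * b' + b * d') * (c * a' + d * c') =
          (a * d - b * c) * (a' * d' - b' * c') := by intros; ring
    rw [e, norm_mul, h2, mul_one]
    gcongr ?_ ^ 2 / _
    exact max_le_max (row_mul_le (h1 _ _) (h1 _ _) (h1 _ _) (h1 _ _))
      (row_mul_le (h1 _ _) (h1 _ _) (h1 _ _) (h1 _ _))
  refine le_antisymm (key h k hk) ?_
  have := key (h * k) k⁻¹ ((KH F).inv_mem hk)
  rwa [mul_inv_cancel_right] at this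

/-- With right invariance this makes the gauge constant on double cosets of K'. In the uniqueness
proof for W it restricts the Iwasawa coordinates that occur in K' a(ϖ^m) K'. -/
theorem gaugeH_KH_mul {k : H F} (hk : k ∈ KH F) (h : H F) : gaugeH (k * h) = gaugeH h := by
  have key : ∀ (h : H F), ∀ k ∈ KH F, gaugeH (k * h) ≤ gaugeH h := by
    intro h k hk
    obtain ⟨k, rfl, h1, h2⟩ := exists_of_mem_KH hk
    induction h using ProjGenLinGroup.induction_on with | mk g =>
    rw [gl2_eta g, gl2_eta k, ← map_mul, gl2_mul, gaugeH_gl2, gaugeH_gl2]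
    have e : ∀ a b c d a' b' c' d' : F,
        (a * a' + b * c') * (c * b' + d * d') - (a * b' + b * d') * (c * a' + d * c') =
          (a * d - b * c) * (a' * d' - b' * c') := by intros; ring
    rw [e, norm_mul, h2, one_mul]
    have key : ∀ {x y c d : F}, ‖x‖ ≤ 1 → ‖y‖ ≤ 1 → ‖x * c + y * d‖ ≤ max ‖c‖ ‖d‖ := by
      intro x y c d hx hy
      refine norm_add_le_of_le ?_ ?_ <;> rw [norm_mul]
      · exact (mul_le_of_le_one_left (norm_nonneg _) hx).trans (le_max_left _ _)
      · exact (mul_le_of_le_one_left (norm_nonneg _) hy).trans (le_max_right _ _)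
    gcongr ?_ ^ 2 / _
    rw [max_max_max_comm ‖g 0 0‖]
    refine max_le (max_le ?_ ?_) (max_le ?_ ?_)
    · exact (key (h1 _ _) (h1 _ _)).trans (le_max_left _ _)
    · exact (key (h1 _ _) (h1 _ _)).trans (le_max_right _ _)
    · exact (key (h1 _ _) (h1 _ _)).trans (le_max_left _ _)
    · exact (key (h1 _ _) (h1 _ _)).trans (le_max_right _ _)
  refine le_antisymm (key h k hk) ?_
  have := key (k * h) k⁻¹ ((KH F).inv_mem hk)
  rwa [inv_mul_cancel_left] at this

theorem heightH_nH_mul (x : F) (h : H F) : heightH (nH x * h) = heightH h := by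
  induction h using ProjGenLinGroup.induction_on with | mk g =>
  rw [gl2_eta g, nH_eq, ← map_mul, gl2_mul, heightH_gl2, heightH_gl2]
  congr 2
  · ring
  · simp

theorem heightH_aH_mul (a : Fˣ) (h : H F) : heightH (aH a * h) = ‖(a : F)‖ * heightH h := by
  induction h using ProjGenLinGroup.induction_on with | mk g =>
  rw [gl2_eta g, aH_eq, ← map_mul, gl2_mul, heightH_gl2, heightH_gl2, ← mul_div_assoc, ← norm_mul]
  congr 2
  · ring
  · simp

theorem heightH_one : heightH (1 : H F) = 1 := by
  rw [← nH_zero, nH_eq, heightH_gl2]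
  simp

theorem heightH_nak (x : F) (a : Fˣ) {k : H F} (hk : k ∈ KH F) :
    heightH (nH x * aH a * k) = ‖(a : F)‖ := by
  rw [heightH_mul_KH hk, heightH_nH_mul, ← mul_one (aH a), heightH_aH_mul, heightH_one, mul_one]

theorem heightH_aH (a : Fˣ) : heightH (aH a : H F) = ‖(a : F)‖ := by
  rw [← mul_one (aH a), heightH_aH_mul, heightH_one, mul_one]

theorem gaugeH_na (x : F) (a : Fˣ) :
    gaugeH (nH x * aH a) = max (max ‖(a : F)‖ ‖x‖) 1 ^ 2 / ‖(a : F)‖ := by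
  rw [nH_eq, aH_eq, ← map_mul, gl2_mul, gaugeH_gl2]
  simp

/-- The nontrivial Weyl element of `H`. -/
noncomputable def wH : H F := ProjGenLinGroup.mk (gl2 0 1 1 0 (by simp))

theorem heightH_wna (x : F) (a : Fˣ) :
    heightH (wH * (nH x * aH a)) = ‖(a : F)‖ / max ‖(a : F)‖ ‖x‖ ^ 2 := by
  rw [wH, nH_eq, aH_eq, ← map_mul, ← map_mul, gl2_mul, gl2_mul, heightH_gl2]
  simp

theorem na_mem_KH {x : F} {a : Fˣ} (h : (nH x * aH a : H F) ∈ KH F) : ‖(a : F)‖ = 1 ∧ ‖x‖ ≤ 1 := by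
  have h1 : heightH (nH x * aH a : H F) = 1 := by
    rw [← one_mul (nH x * aH a), heightH_mul_KH h, heightH_one]
  rw [heightH_nH_mul, heightH_aH] at h1
  have h2 : gaugeH (nH x * aH a : H F) = 1 := by
    rw [← one_mul (nH x * aH a), gaugeH_mul_KH h, ← nH_zero, nH_eq, gaugeH_gl2]
    simp
  rw [gaugeH_na, h1, div_one] at h2
  refine ⟨h1, ?_⟩
  have h3 : max (max 1 ‖x‖) 1 = 1 :=
    (pow_eq_one_iff_of_nonneg (by positivity) two_ne_zero).1 h2
  exact ((le_max_right _ _).trans (le_max_left _ _)).trans h3.le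

/-- The Iwasawa coordinates are not unique: the norm of the diagonal part is determined, but x only
modulo the ball of radius |b|. A function with a prescribed character on N' must therefore vanish
wherever the character is nontrivial on that ball. -/
theorem nak_eq {x y : F} {a b : Fˣ} {k l : H F} (hk : k ∈ KH F) (hl : l ∈ KH F)
    (h : nH x * aH a * k = nH y * aH b * l) : ‖(a : F)‖ = ‖(b : F)‖ ∧ ‖x - y‖ ≤ ‖(b : F)‖ := by
  have h1 : nH (((b⁻¹ : Fˣ) : F) * (x - y)) * aH (b⁻¹ * a) ∈ KH F := by
    have : nH (((b⁻¹ : Fˣ) : F) * (x - y)) * aH (b⁻¹ * a) = l * k⁻¹ := by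
      have e : nH (x - y) * aH a = aH b * l * k⁻¹ := by
        rw [sub_eq_neg_add, nH_add, mul_assoc, eq_mul_inv_iff_mul_eq, mul_assoc, h, mul_assoc,
          ← mul_assoc (nH (-y)), ← nH_add, neg_add_cancel, nH_zero, one_mul]
      rw [aH_mul, ← mul_assoc, ← aH_mul_nH, mul_assoc, e, ← mul_assoc, ← mul_assoc, ← aH_mul,
        inv_mul_cancel, aH_one, one_mul]
    rw [this]
    exact (KH F).mul_mem hl ((KH F).inv_mem hk)
  obtain ⟨h2, h3⟩ := na_mem_KH h1
  have hb : 0 < ‖(b : F)‖ := norm_pos_iff.2 b.ne_zero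
  rw [Units.val_mul, norm_mul, Units.val_inv_eq_inv_val, norm_inv,
    inv_mul_eq_one₀ hb.ne'] at h2
  rw [norm_mul, Units.val_inv_eq_inv_val, norm_inv, inv_mul_le_iff₀ hb, mul_one] at h3
  exact ⟨h2.symm, h3⟩

theorem nak_mem {x y : F} {a b : Fˣ} (h1 : ‖(a : F)‖ = ‖(b : F)‖) (h2 : ‖x - y‖ ≤ ‖(b : F)‖) :
    ∃ k ∈ KH F, nH x * aH a = nH y * aH b * k := by
  have hb : 0 < ‖(b : F)‖ := norm_pos_iff.2 b.ne_zero
  refine ⟨nH (((b⁻¹ : Fˣ) : F) * (x - y)) * aH (b⁻¹ * a),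
    (KH F).mul_mem (nH_mem_KH ?_) (aH_mem_KH ?_), ?_⟩
  · rwa [norm_mul, Units.val_inv_eq_inv_val, norm_inv, inv_mul_le_iff₀ hb, mul_one]
  · rw [Units.val_mul, norm_mul, Units.val_inv_eq_inv_val, norm_inv, inv_mul_eq_one₀ hb.ne', h1]
  · rw [← mul_assoc, mul_assoc (nH y), aH_mul_nH, Units.mul_inv_cancel_left, ← mul_assoc,
      mul_assoc, ← nH_add, ← aH_mul, mul_inv_cancel_left, add_sub_cancel]

/-- GL(2,R) is embedded by g ↦ (g, g⁻¹); its image consists of the pairs of integral matrices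
inverse to each other, a closed subset of a compact product. -/
theorem isCompact_KH [LocallyCompactSpace F] : IsCompact (KH F : Set (H F)) := by
  have h1 : IsCompact ((GeneralLinearGroup.map (n := Fin 2) (algebraMap (integers F) F)).range :
      Set (GL (Fin 2) F)) := by
    rw [Units.isEmbedding_embedProduct.isInducing.isCompact_iff]
    let B : Set (Matrix (Fin 2) (Fin 2) F) := {m | ∀ i j, ‖m i j‖ ≤ 1}
    have hB : IsCompact B := by
      have : B = Set.pi Set.univ fun i : Fin 2 => Set.pi Set.univ fun j : Fin 2 =>
          {x : F | ‖x‖ ≤ 1} := by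
        ext m
        exact ⟨fun h i _ j _ => h i j, fun h i j => h i trivial j trivial⟩
      rw [this]
      exact isCompact_univ_pi fun i => isCompact_univ_pi fun j => isCompact_norm_le 1
    have hB' : IsCompact (MulOpposite.op '' B) := hB.image MulOpposite.continuous_op
    have hcl : IsClosed {p : Matrix (Fin 2) (Fin 2) F × (Matrix (Fin 2) (Fin 2) F)ᵐᵒᵖ |
        p.1 * p.2.unop = 1 ∧ p.2.unop * p.1 = 1} := by
      refine (isClosed_eq ?_ continuous_const).inter (isClosed_eq ?_ continuous_const)
      · exact continuous_fst.mul (MulOpposite.continuous_unop.comp continuous_snd)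
      · exact (MulOpposite.continuous_unop.comp continuous_snd).mul continuous_fst
    convert (hB.prod hB').inter_right hcl using 1
    ext ⟨m, m'⟩
    constructor
    · rintro ⟨g, hg, e⟩
      obtain ⟨h1, h2⟩ := mem_range_GL.1 hg
      rw [← e]
      exact ⟨⟨h1, Set.mem_image_of_mem _ h2⟩, g.mul_inv, g.inv_mul⟩
    · rintro ⟨⟨h1, m'', h2, rfl⟩, h3, h4⟩
      exact ⟨⟨m, m'', h3, h4⟩, mem_range_GL.2 ⟨h1, h2⟩, rfl⟩
  exact h1.image QuotientGroup.continuous_mk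

end GroupH

end SO5PGL2

namespace SO5PGL2

/-! ### Height exponents, Satake parameters and the spherical function of H -/

section WhittakerH

variable {F : Type*} [NontriviallyNormedField F] [IsUltrametricDist F] {ϖ : Fˣ}

/-- The exponent of the height. -/
noncomputable def hgt (h : H F) : ℤ := Int.log (resCard F) (heightH h)

theorem IsUniformizer.hgt_eq (hu : IsUniformizer ϖ) {h : H F} {m : ℤ}
    (hm : heightH h = (resCard F : ℝ) ^ m) : hgt h = m := by
  rw [hgt, hm]
  exact Int.log_zpow hu.one_lt_card_nat m

theorem IsUniformizer.heightH_eq (hu : IsUniformizer ϖ) (h : H F) :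
    heightH h = (resCard F : ℝ) ^ hgt h := by
  obtain ⟨x, a, k, hk, rfl⟩ := iwasawaH h
  obtain ⟨m, hm⟩ := hu.exists_norm_eq a
  rw [hu.hgt_eq ((heightH_nak x a hk).trans hm), heightH_nak x a hk, hm]

theorem hgt_nak (x : F) (a : Fˣ) {k : H F} (hk : k ∈ KH F) : hgt (nH x * aH a * k) = lv (a : F) := by
  rw [hgt, heightH_nak x a hk, lv]

theorem hgt_mul_KH {k : H F} (hk : k ∈ KH F) (h : H F) : hgt (h * k) = hgt h := by
  rw [hgt, heightH_mul_KH hk, hgt]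

theorem hgt_aH (a : Fˣ) : hgt (aH a : H F) = lv (a : F) := by rw [hgt, heightH_aH, lv]

theorem IsUniformizer.norm_mul_zpow_lv (hu : IsUniformizer ϖ) (a : Fˣ) :
    ‖(a : F)‖ * (resCard F : ℝ) ^ (-lv (a : F)) = 1 := by
  rw [_root_.zpow_neg, ← hu.norm_eq_zpow_lv a.ne_zero, mul_inv_cancel₀ (by simp)]

theorem IsUniformizer.lv_zpow (hu : IsUniformizer ϖ) (m : ℤ) : lv ((ϖ ^ m : Fˣ) : F) = -m :=
  hu.lv_eq (hu.norm_zpow m)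

theorem IsUniformizer.hgt_nan (hu : IsUniformizer ϖ) (x : F) (a : Fˣ) (h : H F) :
    hgt (nH x * aH a * h) = lv (a : F) + hgt h := by
  apply hu.hgt_eq
  rw [mul_assoc, heightH_nH_mul, heightH_aH_mul, hu.heightH_eq, zpow_add₀ hu.card_pos.ne',
    ← hu.norm_eq_zpow_lv a.ne_zero]

theorem hgt_one : hgt (1 : H F) = 0 := by
  rw [hgt, heightH_one, Int.log_one_right]

/-- The Satake parameter `q ^ ζ`. -/
noncomputable def satakeParam (F : Type*) [NontriviallyNormedField F] [IsUltrametricDist F]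
    (ζ : ℂ) : ℂ := (resCard F : ℂ) ^ ζ

theorem IsUniformizer.satakeParam_ne_zero (hu : IsUniformizer ϖ) (ζ : ℂ) :
    satakeParam F ζ ≠ 0 := by
  have : (resCard F : ℂ) ≠ 0 := by exact_mod_cast hu.card_pos.ne'
  simp [satakeParam, Complex.cpow_eq_zero_iff, this]

theorem IsUniformizer.zpow_cpow (hu : IsUniformizer ϖ) (m : ℤ) (ζ : ℂ) :
    (((resCard F : ℝ) ^ m : ℝ) : ℂ) ^ ζ = satakeParam F ζ ^ m := by
  have hq : (resCard F : ℂ) ≠ 0 := by exact_mod_cast hu.card_pos.ne'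
  rw [satakeParam, Complex.cpow_def_of_ne_zero (by
    rw [Complex.ofReal_ne_zero]; exact (zpow_pos hu.card_pos m).ne'), ← Complex.ofReal_log
    (zpow_pos hu.card_pos m).le, Real.log_zpow, Complex.cpow_def_of_ne_zero hq, ← Complex.exp_int_mul,
    Complex.ofReal_mul, Complex.ofReal_log hu.card_pos.le]
  congr 1
  push_cast
  ring

/-- The square root of `q`. -/
noncomputable def sqrtCard (F : Type*) [NontriviallyNormedField F] [IsUltrametricDist F] : ℂ :=
  ((Real.sqrt (resCard F) : ℝ) : ℂ)

theorem IsUniformizer.sqrtCard_sq (hu : IsUniformizer ϖ) : sqrtCard F ^ 2 = (resCard F : ℂ) := by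
  rw [sqrtCard, ← Complex.ofReal_pow, Real.sq_sqrt hu.card_pos.le, Complex.ofReal_natCast]

theorem IsUniformizer.sqrtCard_ne_zero (hu : IsUniformizer ϖ) : sqrtCard F ≠ 0 := by
  rw [sqrtCard, Complex.ofReal_ne_zero]
  exact (Real.sqrt_pos.2 hu.card_pos).ne'

theorem IsUniformizer.rpow_half (hu : IsUniformizer ϖ) (m : ℤ) :
    (((((resCard F : ℝ) ^ m) ^ (1 / 2 : ℝ) : ℝ)) : ℂ) = sqrtCard F ^ m := by
  rw [sqrtCard, ← Complex.ofReal_zpow, ← Real.sqrt_eq_rpow]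
  congr 1
  rw [Real.sqrt_eq_iff_eq_sq (zpow_pos hu.card_pos m).le
    (zpow_pos (Real.sqrt_pos.2 hu.card_pos) m).le, sq, ← _root_.mul_zpow,
    Real.mul_self_sqrt hu.card_pos.le]

variable {χ₀ : Fˣ →* ℂˣ}

theorem IsUniformizer.character_eq (hu : IsUniformizer ϖ)
    (hχ : ∀ a : Fˣ, ‖(a : F)‖ = 1 → χ₀ a = 1) (hχ' : χ₀ ϖ ^ 2 = 1) (a : Fˣ) :
    (χ₀ a : ℂ) = (χ₀ ϖ : ℂ) ^ lv (a : F) := by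
  have h1 : χ₀ (a * ϖ ^ lv (a : F)) = 1 := by
    apply hχ
    rw [Units.val_mul, norm_mul, hu.norm_zpow, hu.norm_mul_zpow_lv]
  have h2 : χ₀ ϖ = (χ₀ ϖ)⁻¹ := by
    rw [eq_inv_iff_mul_eq_one, ← sq, hχ']
  rw [_root_.map_mul, map_zpow, mul_eq_one_iff_eq_inv, ← _root_.inv_zpow, ← h2] at h1
  rw [h1, Units.val_zpow_eq_zpow_val]

theorem IsUniformizer.borelCharH_eq (hu : IsUniformizer ϖ)
    (hχ : ∀ a : Fˣ, ‖(a : F)‖ = 1 → χ₀ a = 1) (hχ' : χ₀ ϖ ^ 2 = 1) (ζ : ℂ) (x : F) (a : Fˣ) :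
    borelCharH χ₀ ζ (x, a) = ((χ₀ ϖ : ℂ) * sqrtCard F * satakeParam F ζ) ^ lv (a : F) := by
  have h := hu.norm_eq_zpow_lv a.ne_zero
  have h1 : (((‖(a : F)‖ ^ (1 / 2 : ℝ) : ℝ)) : ℂ) = sqrtCard F ^ lv (a : F) := by
    conv_lhs => rw [h]
    exact hu.rpow_half _
  have h2 : ((‖(a : F)‖ : ℝ) : ℂ) ^ ζ = satakeParam F ζ ^ lv (a : F) := by
    conv_lhs => rw [h]
    exact hu.zpow_cpow _ _
  rw [borelCharH]
  dsimp only
  rw [h1, h2, hu.character_eq hχ hχ', _root_.mul_zpow, _root_.mul_zpow]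
  ring

/-- The spherical vector of π'_ζ is `w ^ hgt` with w = ε q^{1/2} q^ζ: the three factors come from
χ₀, from the modulus character and from |α|^ζ. -/
theorem IsUniformizer.satakeH_eq (hu : IsUniformizer ϖ)
    (hχ : ∀ a : Fˣ, ‖(a : F)‖ = 1 → χ₀ a = 1) (hχ' : χ₀ ϖ ^ 2 = 1)
    (μH : Measure (H F)) [μH.IsHaarMeasure] (f : spherical (KH F)) (ζ : ℂ) :
    satakeH χ₀ μH f ζ =
      ∫ g, (f : H F → ℂ) g * ((χ₀ ϖ : ℂ) * sqrtCard F * satakeParam F ζ) ^ hgt g ∂μH := by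
  have hw : (χ₀ ϖ : ℂ) * sqrtCard F * satakeParam F ζ ≠ 0 :=
    mul_ne_zero (mul_ne_zero (Units.ne_zero _) hu.sqrtCard_ne_zero) (hu.satakeParam_ne_zero ζ)
  refine finiteRankTrace_heckeOperator μH isOpen_KH f _ _ ?_ ?_ ?_ ?_
  · intro g
    obtain ⟨x, a, k, hk, e⟩ := iwasawaH g
    exact ⟨(x, a), k, hk, e⟩
  · rintro ⟨x, a⟩ g
    rw [hu.borelCharH_eq hχ hχ', hu.hgt_nan, zpow_add₀ hw]
  · intro k hk g
    rw [hgt_mul_KH hk]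
  · rw [hgt_one, _root_.zpow_zero]

theorem IsUniformizer.hecke_height (hu : IsUniformizer ϖ) (μH : Measure (H F)) [μH.IsHaarMeasure]
    (f : spherical (KH F)) {w : ℂ} (hw : w ≠ 0) (h : H F) :
    ∫ g, (f : H F → ℂ) g * w ^ hgt (h * g) ∂μH = (∫ g, (f : H F → ℂ) g * w ^ hgt g ∂μH) * w ^ hgt h
    := by
  refine integral_mul_eq_integral_mul_of_iwasawa μH f
    (fun p : F × Fˣ => nH p.1 * aH p.2) (fun p => w ^ lv (p.2 : F)) ?_ (φ₀ := fun g => w ^ hgt g)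
    ?_ ?_ ?_ h
  · intro g
    obtain ⟨x, a, k, hk, e⟩ := iwasawaH g
    exact ⟨(x, a), k, hk, e⟩
  · rintro ⟨x, a⟩ g
    rw [hu.hgt_nan, zpow_add₀ hw]
  · intro k hk g
    rw [hgt_mul_KH hk]
  · rw [hgt_one, _root_.zpow_zero]

/-! ### Quasi-invariant functions on `N' \ H / K'` -/

/-- `Φ(n(x) g k) = c(x) Φ(g)`. -/
def IsQuasi (c : F → ℂ) (Φ : H F → ℂ) : Prop :=
  ∀ (x : F) (g : H F), ∀ k ∈ KH F, Φ (nH x * g * k) = c x * Φ g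

/-- The function `n(x) a(α) k ↦ c(x) w(m)` for `|α| = q ^ (-m)`. -/
noncomputable def whit (c : F → ℂ) (w : ℤ → ℂ) (h : H F) : ℂ :=
  c (iwasawaH h).choose * w (-hgt h)

variable {c : F → ℂ}

/-- `whit` uses a chosen Iwasawa coordinate, ambiguous modulo the ball of radius |a|. For |a| ≤ 1
the character c does not see the ambiguity, and for |a| > 1 the factor w is 0 by `hw`. -/
theorem IsUniformizer.whit_nak (hu : IsUniformizer ϖ) (hc : ∀ x y, c (x + y) = c x * c y)
    (hc1 : ∀ x, ‖x‖ ≤ 1 → c x = 1) {w : ℤ → ℂ} (hw : ∀ m < 0, w m = 0) (x : F) (a : Fˣ) {k : H F}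
    (hk : k ∈ KH F) : whit c w (nH x * aH a * k) = c x * w (-lv (a : F)) := by
  rw [whit, hgt_nak x a hk]
  obtain ⟨b, l, hl, e⟩ := (iwasawaH (nH x * aH a * k)).choose_spec
  set y := (iwasawaH (nH x * aH a * k)).choose
  obtain ⟨-, h1⟩ := nak_eq hl hk e.symm
  by_cases h : lv (a : F) ≤ 0
  · have h2 : ‖y - x‖ ≤ 1 := by
      refine h1.trans ?_
      rw [hu.norm_eq_zpow_lv a.ne_zero]
      exact zpow_le_one_of_nonpos₀ hu.one_lt_card.le h
    have h3 : c y = c (y - x) * c x := by rw [← hc, sub_add_cancel]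
    rw [h3, hc1 _ h2, one_mul]
  · rw [hw _ (by omega), mul_zero, mul_zero]

theorem IsUniformizer.isQuasi_whit (hu : IsUniformizer ϖ) (hc : ∀ x y, c (x + y) = c x * c y)
    (hc1 : ∀ x, ‖x‖ ≤ 1 → c x = 1) {w : ℤ → ℂ} (hw : ∀ m < 0, w m = 0) :
    IsQuasi c (whit c w) := by
  intro x g k hk
  obtain ⟨y, a, l, hl, rfl⟩ := iwasawaH g
  have : nH x * (nH y * aH a * l) * k = nH (x + y) * aH a * (l * k) := by
    rw [nH_add]
    group
  rw [this, hu.whit_nak hc hc1 hw _ _ ((KH F).mul_mem hl hk), hu.whit_nak hc hc1 hw _ _ hl, hc,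
    mul_assoc]

theorem IsUniformizer.whit_aH (hu : IsUniformizer ϖ) (hc : ∀ x y, c (x + y) = c x * c y)
    (hc1 : ∀ x, ‖x‖ ≤ 1 → c x = 1) {w : ℤ → ℂ} (hw : ∀ m < 0, w m = 0) (a : Fˣ) :
    whit c w (aH a) = w (-lv (a : F)) := by
  have := hu.whit_nak hc hc1 hw 0 a (KH F).one_mem
  rwa [nH_zero, one_mul, mul_one, hc1 0 (by simp), one_mul] at this

namespace IsQuasi

variable {Φ Φ' : H F → ℂ} (hΦ : IsQuasi c Φ)
include hΦ

theorem mul_KH (hc1 : ∀ x, ‖x‖ ≤ 1 → c x = 1) {k : H F} (hk : k ∈ KH F) (g : H F) :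
    Φ (g * k) = Φ g := by
  have := hΦ 0 g k hk
  rwa [nH_zero, one_mul, hc1 0 (by simp), one_mul] at this

theorem nH_mul (x : F) (g : H F) : Φ (nH x * g) = c x * Φ g := by
  have := hΦ x g 1 (KH F).one_mem
  rwa [mul_one] at this

theorem nak (hu : IsUniformizer ϖ) (hc1 : ∀ x, ‖x‖ ≤ 1 → c x = 1) (x : F) (a : Fˣ) {k : H F}
    (hk : k ∈ KH F) :
    Φ (nH x * aH a * k) = c x * Φ (aH (ϖ ^ (-lv (a : F)))) := by
  rw [hΦ _ _ _ hk]
  congr 1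
  have h1 : (aH a : H F) = aH (ϖ ^ (-lv (a : F))) * aH (ϖ ^ (lv (a : F)) * a) := by
    rw [← aH_mul, ← mul_assoc, ← _root_.zpow_add, neg_add_cancel, _root_.zpow_zero, one_mul]
  rw [h1, hΦ.mul_KH hc1]
  apply aH_mem_KH
  rw [Units.val_mul, norm_mul, hu.norm_zpow, mul_comm, hu.norm_mul_zpow_lv]

/-- An integral unipotent on the right of a(ϖ^m) changes nothing, yet moved to the left it becomes
n(ϖ^m y). For m < 0 the choice y = ϖ^{-m-1}x is integral and gives c(ϖ⁻¹x) ≠ 1, so the value must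
vanish. -/
theorem eq_zero (hu : IsUniformizer ϖ) (hc1 : ∀ x, ‖x‖ ≤ 1 → c x = 1)
    (hc2 : ∃ x : F, ‖x‖ ≤ 1 ∧ c ((ϖ : F)⁻¹ * x) ≠ 1) {m : ℤ} (hm : m < 0) :
    Φ (aH (ϖ ^ m)) = 0 := by
  obtain ⟨x, hx, hx'⟩ := hc2
  have h1 : Φ (aH (ϖ ^ m) * nH (((ϖ ^ (-m - 1) : Fˣ) : F) * x)) = Φ (aH (ϖ ^ m)) := by
    refine hΦ.mul_KH hc1 (nH_mem_KH ?_) _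
    refine norm_mul_le_one ?_ hx
    rw [hu.norm_zpow]
    exact zpow_le_one_of_nonpos₀ hu.one_lt_card.le (by omega)
  rw [aH_mul_nH, hΦ.nH_mul, ← mul_assoc, ← Units.val_mul, ← _root_.zpow_add,
    show m + (-m - 1) = -1 by ring, _root_.zpow_neg_one, Units.val_inv_eq_inv_val] at h1
  have h2 : (c ((ϖ : F)⁻¹ * x) - 1) * Φ (aH (ϖ ^ m)) = 0 := by linear_combination h1
  exact (mul_eq_zero.1 h2).resolve_left (sub_ne_zero.2 hx')

theorem ext (hu : IsUniformizer ϖ) (hc1 : ∀ x, ‖x‖ ≤ 1 → c x = 1)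
    (hc2 : ∃ x : F, ‖x‖ ≤ 1 ∧ c ((ϖ : F)⁻¹ * x) ≠ 1) (hΦ' : IsQuasi c Φ')
    (h : ∀ m : ℕ, Φ (aH (ϖ ^ (m : ℤ))) = Φ' (aH (ϖ ^ (m : ℤ)))) : Φ = Φ' := by
  funext g
  obtain ⟨x, a, k, hk, rfl⟩ := iwasawaH g
  rw [hΦ.nak hu hc1 x a hk, hΦ'.nak hu hc1 x a hk]
  congr 1
  rcases lt_or_ge (-lv (a : F)) 0 with h1 | h1
  · rw [hΦ.eq_zero hu hc1 hc2 h1, hΦ'.eq_zero hu hc1 hc2 h1]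
  · lift -lv (a : F) to ℕ using h1 with m
    exact h m

theorem sub (hΦ' : IsQuasi c Φ') : IsQuasi c (Φ - Φ') := by
  intro x g k hk
  simp only [Pi.sub_apply, hΦ x g k hk, hΦ' x g k hk]
  ring

end IsQuasi

end WhittakerH

end SO5PGL2

namespace SO5PGL2

/-! ### Chebyshev polynomials S_m evaluated at z + z⁻¹ -/

section Chebyshev

open Polynomial (Chebyshev.S)

theorem chebyshevS_succ {z : ℂ} (hz : z ≠ 0) (m : ℕ) :
    (Polynomial.Chebyshev.S ℂ (m + 1 : ℕ)).eval (z + z⁻¹) =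
      z * (Polynomial.Chebyshev.S ℂ m).eval (z + z⁻¹) + (z⁻¹) ^ (m + 1) := by
  induction m with
  | zero => simp
  | succ m ih =>
    have h : Polynomial.Chebyshev.S ℂ ((m + 1 + 1 : ℕ) : ℤ) =
        Polynomial.X * Polynomial.Chebyshev.S ℂ ((m + 1 : ℕ) : ℤ) -
          Polynomial.Chebyshev.S ℂ (m : ℤ) := by
      have := Polynomial.Chebyshev.S_add_two ℂ (m : ℤ)
      push_cast
      rw [← this]
      ring_nf
    rw [h, Polynomial.eval_sub, Polynomial.eval_mul, Polynomial.eval_X, pow_succ z⁻¹ (m + 1)]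
    have h1 : z * z⁻¹ = 1 := mul_inv_cancel₀ hz
    linear_combination z⁻¹ * ih + (Polynomial.Chebyshev.S ℂ (m : ℤ)).eval (z + z⁻¹) * h1

theorem chebyshevS_eq_sum {z : ℂ} (hz : z ≠ 0) (m : ℕ) :
    z ^ m * (Polynomial.Chebyshev.S ℂ m).eval (z + z⁻¹) =
      ∑ l ∈ Finset.range (m + 1), (z ^ 2) ^ (m - l) := by
  induction m with
  | zero => simp
  | succ m ih =>
    rw [Finset.sum_range_succ]
    have h : ∑ l ∈ Finset.range (m + 1), (z ^ 2) ^ (m + 1 - l) =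
        z ^ 2 * ∑ l ∈ Finset.range (m + 1), (z ^ 2) ^ (m - l) := by
      rw [Finset.mul_sum]
      refine Finset.sum_congr rfl fun l hl => ?_
      rw [← pow_succ', Nat.sub_add_comm (by simpa [Nat.lt_succ_iff] using hl)]
    rw [h, ← ih, chebyshevS_succ hz, Nat.sub_self, pow_zero]
    have h1 : z ^ (m + 1) * (z⁻¹) ^ (m + 1) = 1 := by
      rw [← mul_pow, mul_inv_cancel₀ hz, one_pow]
    linear_combination h1

end Chebyshev

/-! ### Torus values of the Whittaker function and truncated Jacquet integrals -/

section WhittakerFunction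

variable {F : Type*} [NontriviallyNormedField F] [IsUltrametricDist F] {ϖ : Fˣ}

/-- The values of the normalized Whittaker function on the torus. -/
noncomputable def whitVal (F : Type*) [NontriviallyNormedField F] [IsUltrametricDist F]
    (ε z : ℂ) (m : ℤ) : ℂ :=
  if m < 0 then 0 else (ε * (sqrtCard F)⁻¹) ^ m * (Polynomial.Chebyshev.S ℂ m).eval (z + z⁻¹)

theorem whitVal_neg (ε z : ℂ) : ∀ m < 0, whitVal F ε z m = 0 := fun _ hm => if_pos hm

theorem whitVal_natCast (ε z : ℂ) (m : ℕ) : whitVal F ε z m =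
    (ε * (sqrtCard F)⁻¹) ^ m * (Polynomial.Chebyshev.S ℂ m).eval (z + z⁻¹) := by
  rw [whitVal, if_neg (by omega), _root_.zpow_natCast]

/-- The character of conductor `R` as a complex valued function. -/
theorem addChar_add (ψ : AddChar F Circle) (x y : F) :
    (ψ (x + y) : ℂ) = (ψ x : ℂ) * (ψ y : ℂ) := by
  rw [AddChar.map_add_eq_mul, Circle.coe_mul]

theorem addChar_eq_one {ψ : AddChar F Circle} (hψ : ∀ x : F, ‖x‖ ≤ 1 → ψ x = 1) (x : F)
    (hx : ‖x‖ ≤ 1) : (ψ x : ℂ) = 1 := by rw [hψ x hx, Circle.coe_one]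

theorem addChar_ne_one {ψ : AddChar F Circle}
    (hψ' : ∃ x : F, ‖x‖ ≤ 1 ∧ ψ ((ϖ : F)⁻¹ * x) ≠ 1) :
    ∃ x : F, ‖x‖ ≤ 1 ∧ (ψ ((ϖ : F)⁻¹ * x) : ℂ) ≠ 1 := by
  obtain ⟨x, hx, h⟩ := hψ'
  exact ⟨x, hx, fun h1 => h (Circle.ext (by simpa using h1))⟩

theorem conj_addChar_add (ψ : AddChar F Circle) (x y : F) :
    starRingEnd ℂ (ψ (x + y) : ℂ) = starRingEnd ℂ (ψ x : ℂ) * starRingEnd ℂ (ψ y : ℂ) := by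
  rw [addChar_add, _root_.map_mul]

theorem conj_addChar_eq_one {ψ : AddChar F Circle} (hψ : ∀ x : F, ‖x‖ ≤ 1 → ψ x = 1) (x : F)
    (hx : ‖x‖ ≤ 1) : starRingEnd ℂ (ψ x : ℂ) = 1 := by rw [addChar_eq_one hψ x hx, map_one]

theorem conj_addChar_ne_one {ψ : AddChar F Circle}
    (hψ' : ∃ x : F, ‖x‖ ≤ 1 ∧ ψ ((ϖ : F)⁻¹ * x) ≠ 1) :
    ∃ x : F, ‖x‖ ≤ 1 ∧ starRingEnd ℂ (ψ ((ϖ : F)⁻¹ * x) : ℂ) ≠ 1 := by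
  obtain ⟨x, hx, h⟩ := addChar_ne_one hψ'
  exact ⟨x, hx, fun h1 => h (by simpa using congrArg (starRingEnd ℂ) h1)⟩

theorem conj_mul_self_addChar (ψ : AddChar F Circle) (x : F) :
    starRingEnd ℂ (ψ x : ℂ) * (ψ x : ℂ) = 1 := by
  rw [← Circle.coe_inv_eq_conj, ← Circle.coe_mul, inv_mul_cancel, Circle.coe_one]

section Jacquet

variable [LocallyCompactSpace F] [MeasurableSpace F] [BorelSpace F] {μF : Measure F}
  [μF.IsAddHaarMeasure] {ψ : AddChar F Circle}

/-- The truncated Jacquet integral of the spherical function `w ^ hgt`. -/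
noncomputable def jacquet (μF : Measure F) (ψ : AddChar F Circle) (w : ℂ) (k : ℤ) (h : H F) : ℂ :=
  ∫ x in {x : F | ‖x‖ ≤ (resCard F : ℝ) ^ k},
    starRingEnd ℂ (ψ x : ℂ) * w ^ hgt (wH * (nH x * h)) ∂μF

theorem continuous_jacquet_integrand (hψ : ∀ x : F, ‖x‖ ≤ 1 → ψ x = 1) (w : ℂ) (h : H F) :
    Continuous fun x : F => starRingEnd ℂ (ψ x : ℂ) * w ^ hgt (wH * (nH x * h)) := by
  refine (Complex.continuous_conj.comp (continuous_of_trivial ψ hψ).continuous).mul ?_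
  have h1 : IsLocallyConstant fun h : H F => w ^ hgt h :=
    isLocallyConstant_of_right_invariant isOpen_KH fun k hk g => by rw [hgt_mul_KH hk]
  exact h1.continuous.comp (continuous_const.mul (continuous_nH.mul continuous_const))

theorem integrableOn_jacquet (hψ : ∀ x : F, ‖x‖ ≤ 1 → ψ x = 1) (w : ℂ) (h : H F) (k : ℤ) :
    IntegrableOn (fun x : F => starRingEnd ℂ (ψ x : ℂ) * w ^ hgt (wH * (nH x * h)))
      {x : F | ‖x‖ ≤ (resCard F : ℝ) ^ k} μF :=
  (continuous_jacquet_integrand hψ w h).continuousOn.integrableOn_compact (isCompact_norm_le _)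

/-- The truncation ball is preserved by translation by y only if it contains y, so the equivariance
under N' is available only for k large in terms of y. -/
theorem jacquet_nH_mul (w : ℂ) {k : ℤ} {y : F}
    (hy : ‖y‖ ≤ (resCard F : ℝ) ^ k) (h : H F) :
    jacquet μF ψ w k (nH y * h) = (ψ y : ℂ) * jacquet μF ψ w k h := by
  have hmeas : MeasurableSet {x : F | ‖x‖ ≤ (resCard F : ℝ) ^ k} :=
    (isClosed_norm_le _).measurableSet
  rw [jacquet, jacquet, ← integral_indicator hmeas, ← integral_indicator hmeas,
    ← integral_add_left_eq_self _ (-y), ← integral_const_mul]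
  congr 1
  funext x
  have h2 : -y + x ∈ {x : F | ‖x‖ ≤ (resCard F : ℝ) ^ k} ↔
      x ∈ {x : F | ‖x‖ ≤ (resCard F : ℝ) ^ k} := by
    rw [Set.mem_ofPred_eq, Set.mem_ofPred_eq, neg_add_eq_sub]
    constructor
    · intro h
      have := norm_add_le_of_le h hy
      rwa [sub_add_cancel] at this
    · exact fun h => norm_sub_le_of_le h hy
  by_cases hx : x ∈ {x : F | ‖x‖ ≤ (resCard F : ℝ) ^ k}
  · rw [Set.indicator_of_mem hx, Set.indicator_of_mem (h2.2 hx), ← mul_assoc (nH (-y + x)),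
      ← nH_add, neg_add_cancel_comm, ← mul_assoc (ψ y : ℂ)]
    congr 1
    have h3 : starRingEnd ℂ (ψ x : ℂ) = starRingEnd ℂ (ψ y : ℂ) *
        starRingEnd ℂ (ψ (-y + x) : ℂ) := by
      rw [← conj_addChar_add, add_neg_cancel_left]
    rw [h3, ← mul_assoc, mul_comm (ψ y : ℂ), conj_mul_self_addChar, one_mul]
  · rw [Set.indicator_of_notMem hx, Set.indicator_of_notMem (mt h2.1 hx), mul_zero]

theorem jacquet_mul_KH (w : ℂ) (k : ℤ) (h : H F) {l : H F} (hl : l ∈ KH F) :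
    jacquet μF ψ w k (h * l) = jacquet μF ψ w k h := by
  simp_rw [jacquet, ← mul_assoc, hgt_mul_KH hl]

open Classical in
-- The new shell |x| = q^{k+1} lies outside the ball of radius |a| = q^{-m}. There the height of w
-- n(x) a is the constant |a|/|x|², and it remains to integrate the character over a difference of
-- two balls.
theorem IsUniformizer.jacquet_succ (hu : IsUniformizer ϖ) (hμF : μF {x | ‖x‖ ≤ 1} = 1)
    (hψ : ∀ x : F, ‖x‖ ≤ 1 → ψ x = 1)
    (hψ' : ∃ x : F, ‖x‖ ≤ 1 ∧ ψ ((ϖ : F)⁻¹ * x) ≠ 1) (w : ℂ) {m k : ℤ} (hk : -m ≤ k) :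
    jacquet μF ψ w (k + 1) (aH (ϖ ^ m)) = jacquet μF ψ w k (aH (ϖ ^ m)) +
      w ^ (-m - 2 * (k + 1)) * ((if k + 1 ≤ 0 then (resCard F : ℂ) ^ (k + 1) else 0) -
        if k ≤ 0 then (resCard F : ℂ) ^ k else 0) := by
  have hsub : {x : F | ‖x‖ ≤ (resCard F : ℝ) ^ k} ⊆ {x : F | ‖x‖ ≤ (resCard F : ℝ) ^ (k + 1)} :=
    fun x hx => le_trans hx (zpow_le_zpow_right₀ hu.one_lt_card.le (by omega))
  have hmeas : ∀ k : ℤ, MeasurableSet {x : F | ‖x‖ ≤ (resCard F : ℝ) ^ k} := fun k =>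
    (isClosed_norm_le _).measurableSet
  have h1 := setIntegral_sdiff (hmeas k)
    (integrableOn_jacquet (μF := μF) hψ w (aH (ϖ ^ m)) (k + 1)) hsub
  have hint : IntegrableOn (fun x : F => starRingEnd ℂ (ψ x : ℂ))
      {x : F | ‖x‖ ≤ (resCard F : ℝ) ^ (k + 1)} μF :=
    (Complex.continuous_conj.comp
      (continuous_of_trivial ψ hψ).continuous).continuousOn.integrableOn_compact
        (isCompact_norm_le _)
  have h2 := setIntegral_sdiff (hmeas k) hint hsub
  rw [hu.integral_addChar μF ψ hμF hψ hψ', hu.integral_addChar μF ψ hμF hψ hψ'] at h2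
  rw [jacquet, jacquet, ← h2, ← integral_const_mul, ← sub_eq_iff_eq_add', ← h1]
  refine setIntegral_congr_fun ((hmeas _).diff (hmeas _)) ?_
  rintro x ⟨hx1, hx2⟩
  have hx : ‖x‖ = (resCard F : ℝ) ^ (k + 1) := by
    rw [hu.norm_eq_iff_exists]
    exact ⟨hx1, by rwa [add_sub_cancel_right]⟩
  dsimp only
  rw [mul_comm]
  congr 2
  apply hu.hgt_eq
  rw [heightH_wna, hx, hu.norm_zpow, max_eq_right (zpow_le_zpow_right₀ hu.one_lt_card.le (by omega)),
    ← _root_.zpow_natCast, ← _root_.zpow_mul, ← zpow_sub₀ hu.card_pos.ne']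
  congr 1
  push_cast
  ring

open Classical in
-- For |x| ≤ |a| the height of w n(x) a is |a|⁻¹ = q^m independently of x.
theorem IsUniformizer.jacquet_start (hu : IsUniformizer ϖ) (hμF : μF {x | ‖x‖ ≤ 1} = 1)
    (hψ : ∀ x : F, ‖x‖ ≤ 1 → ψ x = 1)
    (hψ' : ∃ x : F, ‖x‖ ≤ 1 ∧ ψ ((ϖ : F)⁻¹ * x) ≠ 1) (w : ℂ) (m : ℤ) :
    jacquet μF ψ w (-m) (aH (ϖ ^ m)) =
      w ^ m * if -m ≤ 0 then (resCard F : ℂ) ^ (-m) else 0 := by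
  rw [jacquet, ← hu.integral_addChar μF ψ hμF hψ hψ', ← integral_const_mul]
  refine setIntegral_congr_fun (isClosed_norm_le _).measurableSet ?_
  intro x hx
  dsimp only
  rw [mul_comm]
  congr 2
  apply hu.hgt_eq
  rw [heightH_wna, hu.norm_zpow, max_eq_left hx,
    ← _root_.zpow_natCast, ← _root_.zpow_mul, ← zpow_sub₀ hu.card_pos.ne']
  congr 1
  push_cast
  ring

theorem IsUniformizer.jacquet_neg (hu : IsUniformizer ϖ) (hμF : μF {x | ‖x‖ ≤ 1} = 1)
    (hψ : ∀ x : F, ‖x‖ ≤ 1 → ψ x = 1)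
    (hψ' : ∃ x : F, ‖x‖ ≤ 1 ∧ ψ ((ϖ : F)⁻¹ * x) ≠ 1) (w : ℂ) {m k : ℤ} (hm : m < 0)
    (hk : -m ≤ k) : jacquet μF ψ w k (aH (ϖ ^ m)) = 0 := by
  induction k, hk using Int.leInduction with
  | base => rw [hu.jacquet_start hμF hψ hψ', if_neg (by omega), mul_zero]
  | succ k hk ih =>
    rw [hu.jacquet_succ hμF hψ hψ' w hk, ih, if_neg (by omega), if_neg (by omega)]
    ring

/-- The shells between radius q^{-m} and 1 build up two geometric sums in z², the shell of radius q
completes the second one, and later shells contribute 0. Together they give (1 - (q z²)⁻¹) times a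
sum which is z^m S_m(z + z⁻¹). -/
theorem IsUniformizer.jacquet_natCast (hu : IsUniformizer ϖ) (hμF : μF {x | ‖x‖ ≤ 1} = 1)
    (hψ : ∀ x : F, ‖x‖ ≤ 1 → ψ x = 1)
    (hψ' : ∃ x : F, ‖x‖ ≤ 1 ∧ ψ ((ϖ : F)⁻¹ * x) ≠ 1) {ε z : ℂ} (hε : ε ^ 2 = 1) (hz : z ≠ 0)
    (m : ℕ) {k : ℤ} (hk : 1 ≤ k) : jacquet μF ψ (ε * sqrtCard F * z) k (aH (ϖ ^ (m : ℤ))) =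
      (1 - ((resCard F : ℂ) * z ^ 2)⁻¹) * whitVal F ε z m := by
  have hs := hu.sqrtCard_ne_zero
  have hq : (resCard F : ℂ) ≠ 0 := by exact_mod_cast hu.card_pos.ne'
  have hε0 : ε ≠ 0 := by rintro rfl; simp at hε
  set w := ε * sqrtCard F * z with hw
  have hw0 : w ≠ 0 := mul_ne_zero (mul_ne_zero hε0 hs) hz
  have hw2 : w ^ 2 = (resCard F : ℂ) * z ^ 2 := by
    rw [hw, mul_pow, mul_pow, hε, hu.sqrtCard_sq, one_mul]
  have step : ∀ j : ℤ, w ^ (-(m : ℤ) - 2 * j) = (w ^ m)⁻¹ * ((resCard F : ℂ) * z ^ 2) ^ (-j) := by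
    intro j
    rw [← hw2, zpow_sub₀ hw0, _root_.zpow_neg, _root_.zpow_natCast, div_eq_mul_inv,
      _root_.zpow_neg, ← _root_.zpow_natCast w 2, ← _root_.zpow_mul]
    norm_num
  -- A shell of radius q^j with j ≤ 0 contributes q^j - q^{j-1}; the two sums keep track of these
  -- two terms separately, the second being one term shorter.
  have key : ∀ i : ℕ, i ≤ m → jacquet μF ψ w (-(m : ℤ) + i) (aH (ϖ ^ (m : ℤ))) =
      (w ^ m)⁻¹ * (∑ l ∈ Finset.range (i + 1), (z ^ 2) ^ (m - l) -
        ((resCard F : ℂ) * z ^ 2)⁻¹ * ∑ l ∈ Finset.range i, (z ^ 2) ^ (m - l)) := by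
    intro i
    induction i with
    | zero =>
      intro _
      rw [Nat.cast_zero, add_zero, hu.jacquet_start hμF hψ hψ', if_pos (by omega)]
      simp only [zero_add, Finset.range_one, Finset.sum_singleton, Nat.sub_zero, Finset.range_zero,
        Finset.sum_empty, mul_zero, sub_zero]
      rw [_root_.zpow_neg, _root_.zpow_natCast, _root_.zpow_natCast]
      have : w ^ m * w ^ m = (resCard F : ℂ) ^ m * (z ^ 2) ^ m := by
        rw [← mul_pow, ← sq, hw2, mul_pow]
      field_simp
      linear_combination this
    | succ i ih =>
      intro hi
      rw [Nat.cast_add, Nat.cast_one, ← add_assoc, hu.jacquet_succ hμF hψ hψ' w (by omega),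
        ih (by omega), if_pos (by omega), if_pos (by omega), step, Finset.sum_range_succ _ (i + 1),
        Finset.sum_range_succ (n := i)]
      obtain ⟨j, rfl⟩ := Nat.exists_eq_add_of_le hi
      have e1 : i + 1 + j - (i + 1) = j := by omega
      have e2 : i + 1 + j - i = j + 1 := by omega
      have e3 : -(-(((i + 1 + j : ℕ) : ℤ)) + (i : ℤ) + 1) = (j : ℤ) := by push_cast; ring
      have e4 : -(((i + 1 + j : ℕ) : ℤ)) + (i : ℤ) + 1 = -(j : ℤ) := by push_cast; ring
      have e5 : -(((i + 1 + j : ℕ) : ℤ)) + (i : ℤ) = -((j + 1 : ℕ) : ℤ) := by push_cast; ring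
      rw [e3, e4, e5, e1, e2, _root_.zpow_neg, _root_.zpow_neg, _root_.zpow_natCast,
        _root_.zpow_natCast, _root_.zpow_natCast]
      field_simp
      ring
  have h0 := key m le_rfl
  rw [neg_add_cancel] at h0
  -- In the shell of radius q only -1 survives from the character integrals 0 and 1. This supplies
  -- the term l = m missing from the second sum, so the two sums become proportional.
  have h1 : jacquet μF ψ w 1 (aH (ϖ ^ (m : ℤ))) = (w ^ m)⁻¹ * ((1 - ((resCard F : ℂ) * z ^ 2)⁻¹) *
      ∑ l ∈ Finset.range (m + 1), (z ^ 2) ^ (m - l)) := by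
    have := hu.jacquet_succ (μF := μF) hμF hψ hψ' w (m := m) (k := 0) (by omega)
    rw [zero_add] at this
    rw [this, h0, step, if_neg (by omega), if_pos le_rfl, _root_.zpow_zero,
      Finset.sum_range_succ _ m, Nat.sub_self, pow_zero, _root_.zpow_neg_one]
    ring
  have h2 : jacquet μF ψ w k (aH (ϖ ^ (m : ℤ))) = jacquet μF ψ w 1 (aH (ϖ ^ (m : ℤ))) := by
    induction k, hk using Int.leInduction with
    | base => rfl
    | succ k hk ih =>
      rw [hu.jacquet_succ hμF hψ hψ' w (by omega), ih, if_neg (by omega), if_neg (by omega)]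
      ring
  rw [h2, h1, ← chebyshevS_eq_sum hz, whitVal_natCast, hw, mul_pow, mul_pow, mul_pow]
  have hεε : ε ^ m * ε ^ m = 1 := by rw [← mul_pow, ← sq, hε, one_pow]
  have : (ε ^ m)⁻¹ = ε ^ m := inv_eq_of_mul_eq_one_left hεε
  rw [mul_inv, mul_inv, this]
  have hzm : z ^ m ≠ 0 := pow_ne_zero _ hz
  rw [inv_pow]
  generalize (Polynomial.Chebyshev.S ℂ (m : ℤ)).eval (z + z⁻¹) = S
  field_simp

end Jacquet

end WhittakerFunction

end SO5PGL2

namespace SO5PGL2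

/-! ### Characteristic functions of double cosets as test functions -/

section DoubleCoset

variable {G : Type*} [Group G] [TopologicalSpace G] [IsTopologicalGroup G]

/-- The double coset `K a K`. -/
def doubleCosetSet (K : Subgroup G) (a : G) : Set G := {g | ∃ k ∈ K, ∃ l ∈ K, g = k * a * l}

theorem mem_doubleCosetSet_self (K : Subgroup G) (a : G) : a ∈ doubleCosetSet K a :=
  ⟨1, K.one_mem, 1, K.one_mem, by simp⟩

theorem mul_mul_mem_doubleCosetSet {K : Subgroup G} {a k l g : G} (hk : k ∈ K) (hl : l ∈ K) :
    k * g * l ∈ doubleCosetSet K a ↔ g ∈ doubleCosetSet K a := by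
  constructor
  · rintro ⟨k', hk', l', hl', e⟩
    exact ⟨k⁻¹ * k', K.mul_mem (K.inv_mem hk) hk', l' * l⁻¹, K.mul_mem hl' (K.inv_mem hl), by
      rw [← mul_assoc, eq_mul_inv_iff_mul_eq, mul_assoc, mul_assoc, eq_inv_mul_iff_mul_eq,
        ← mul_assoc, e, mul_assoc]⟩
  · rintro ⟨k', hk', l', hl', rfl⟩
    exact ⟨k * k', K.mul_mem hk hk', l' * l, K.mul_mem hl' hl, by simp only [mul_assoc]⟩

theorem isOpen_doubleCosetSet {K : Subgroup G} (hK : IsOpen (K : Set G)) (a : G) :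
    IsOpen (doubleCosetSet K a) := by
  rw [isOpen_iff_forall_mem_open]
  intro x hx
  refine ⟨(fun y => x⁻¹ * y) ⁻¹' (K : Set G), fun y hy => ?_, hK.preimage (by fun_prop), by
    simp [K.one_mem]⟩
  have := (mul_mul_mem_doubleCosetSet (a := a) (g := x) K.one_mem hy).2 hx
  simpa using this

theorem isCompact_doubleCosetSet {K : Subgroup G} (hK : IsCompact (K : Set G)) (a : G) :
    IsCompact (doubleCosetSet K a) := by
  convert (hK.prod hK).image (f := fun p : G × G => p.1 * a * p.2) (by fun_prop) using 1
  ext g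
  constructor
  · rintro ⟨k, hk, l, hl, rfl⟩
    exact ⟨(k, l), ⟨hk, hl⟩, rfl⟩
  · rintro ⟨⟨k, l⟩, ⟨hk, hl⟩, rfl⟩
    exact ⟨k, hk, l, hl, rfl⟩

open Classical in
/-- The characteristic function of `K a K`. -/
noncomputable def doubleCosetFun {K : Subgroup G} (hK : IsCompact (K : Set G)) (a : G) :
    spherical K :=
  ⟨fun g => if g ∈ doubleCosetSet K a then 1 else 0, fun k hk g => by
    have := mul_mul_mem_doubleCosetSet (a := a) (g := g) hk K.one_mem
    rw [mul_one] at this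
    simp only [this], fun k hk g => by
    have := mul_mul_mem_doubleCosetSet (a := a) (g := g) K.one_mem hk
    rw [one_mul] at this
    simp only [this], HasCompactSupport.intro (isCompact_doubleCosetSet hK a)
      fun _ hx => if_neg hx⟩

open Classical in
theorem doubleCosetFun_apply {K : Subgroup G} (hK : IsCompact (K : Set G)) (a g : G) :
    (doubleCosetFun hK a : G → ℂ) g = if g ∈ doubleCosetSet K a then 1 else 0 := rfl

end DoubleCoset

/-! ### Existence and uniqueness of the normalized Whittaker function -/

section WhittakerFunction

variable {F : Type*} [NontriviallyNormedField F] [IsUltrametricDist F] {ϖ : Fˣ}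
  [LocallyCompactSpace F] [MeasurableSpace F] [BorelSpace F] {μF : Measure F}
  [μF.IsAddHaarMeasure] {ψ : AddChar F Circle}

theorem borelSpace_units : BorelSpace Fˣ := by
  constructor
  rw [Units.isEmbedding_val₀.isInducing.eq_induced]
  rw [borel_comap]
  rw [← BorelSpace.measurable_eq (α := F)]
  rfl

/-- The Whittaker function with Satake parameter `z`. -/
noncomputable def whittaker (ψ : AddChar F Circle) (ε z : ℂ) : H F → ℂ :=
  whit (fun x => (ψ x : ℂ)) (whitVal F ε z)

theorem IsUniformizer.isQuasi_whittaker (hu : IsUniformizer ϖ)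
    (hψ : ∀ x : F, ‖x‖ ≤ 1 → ψ x = 1) (ε z : ℂ) :
    IsQuasi (fun x => (ψ x : ℂ)) (whittaker ψ ε z) :=
  hu.isQuasi_whit (addChar_add ψ) (addChar_eq_one hψ) (whitVal_neg ε z)

theorem IsUniformizer.whittaker_aH (hu : IsUniformizer ϖ)
    (hψ : ∀ x : F, ‖x‖ ≤ 1 → ψ x = 1) (ε z : ℂ) (a : Fˣ) :
    whittaker ψ ε z (aH a) = whitVal F ε z (-lv (a : F)) :=
  hu.whit_aH (addChar_add ψ) (addChar_eq_one hψ) (whitVal_neg ε z) a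

theorem isLaurent_whittaker (ε : ℂ) (h : H F) : IsLaurent fun z => whittaker ψ ε z h := by
  unfold whittaker whit whitVal
  refine (IsLaurent.const _).mul ?_
  split_ifs
  · exact IsLaurent.const 0
  · exact (IsLaurent.const _).mul (IsLaurent.eval_add_inv _)

/-- The truncated integrals stabilize, because the character integrates to 0 over every shell of
radius greater than q. The threshold depends on h, as the truncation must contain x for equivariance
and reach |a| for the shell formula. -/
theorem IsUniformizer.jacquet_eq_whittaker (hu : IsUniformizer ϖ) (hμF : μF {x | ‖x‖ ≤ 1} = 1)
    (hψ : ∀ x : F, ‖x‖ ≤ 1 → ψ x = 1)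
    (hψ' : ∃ x : F, ‖x‖ ≤ 1 ∧ ψ ((ϖ : F)⁻¹ * x) ≠ 1) {ε z : ℂ} (hε : ε ^ 2 = 1) (hz : z ≠ 0)
    (h : H F) : ∃ k₀ : ℤ, ∀ k, k₀ ≤ k → jacquet μF ψ (ε * sqrtCard F * z) k h =
      (1 - ((resCard F : ℂ) * z ^ 2)⁻¹) * whittaker ψ ε z h := by
  obtain ⟨x, a, l, hl, rfl⟩ := iwasawaH h
  refine ⟨max 1 (max (lv x) (lv (a : F))), fun k hk => ?_⟩
  have h1 : 1 ≤ k := (le_max_left _ _).trans hk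
  have h2 : lv x ≤ k := (le_max_left _ _).trans ((le_max_right _ _).trans hk)
  have h3 : lv (a : F) ≤ k := (le_max_right _ _).trans ((le_max_right _ _).trans hk)
  have hx : ‖x‖ ≤ (resCard F : ℝ) ^ k := by
    by_cases hx0 : x = 0
    · rw [hx0, norm_zero]
      exact (zpow_pos hu.card_pos _).le
    · rw [hu.norm_eq_zpow_lv hx0]
      exact zpow_le_zpow_right₀ hu.one_lt_card.le h2
  have hq : IsQuasi (fun x => (ψ x : ℂ)) (whittaker ψ ε z) := hu.isQuasi_whittaker hψ ε z
  have hja : jacquet μF ψ (ε * sqrtCard F * z) k (aH a) =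
      jacquet μF ψ (ε * sqrtCard F * z) k (aH (ϖ ^ (-lv (a : F)))) := by
    obtain ⟨l', hl', e⟩ := nak_mem (F := F) (x := 0) (y := 0) (a := a) (b := ϖ ^ (-lv (a : F))) (by
      rw [hu.norm_zpow, neg_neg, ← hu.norm_eq_zpow_lv a.ne_zero]) (by
      rw [sub_self, norm_zero]
      exact norm_nonneg _)
    rw [nH_zero, one_mul, one_mul] at e
    rw [e, jacquet_mul_KH _ _ _ hl']
  rw [jacquet_mul_KH _ _ _ hl, jacquet_nH_mul _ hx, hja,
    hq.nak hu (addChar_eq_one hψ) x a hl, hu.whittaker_aH hψ, hu.lv_zpow]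
  rcases lt_or_ge (-lv (a : F)) 0 with h4 | h4
  · rw [hu.jacquet_neg hμF hψ hψ' _ h4 (by omega), whitVal_neg _ _ _ (by omega)]
    ring
  · rw [neg_neg]
    lift -lv (a : F) to ℕ using h4 with m
    rw [hu.jacquet_natCast hμF hψ hψ' hε hz m h1]
    ring

/-- The Jacquet integral runs over left translates of `w ^ hgt`, and right Hecke operators, being
finite sums, commute with it. The eigenvalue of `w ^ hgt` is thus inherited wherever the factor 1 -
(q z²)⁻¹ is nonzero; the remaining parameters follow by Laurent interpolation. -/
theorem IsUniformizer.hecke_whittaker (hu : IsUniformizer ϖ) (hμF : μF {x | ‖x‖ ≤ 1} = 1)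
    (hψ : ∀ x : F, ‖x‖ ≤ 1 → ψ x = 1)
    (hψ' : ∃ x : F, ‖x‖ ≤ 1 ∧ ψ ((ϖ : F)⁻¹ * x) ≠ 1)
    (μH : Measure (H F)) [μH.IsHaarMeasure] (hμH : μH (KH F) = 1) (f : spherical (KH F))
    {ε z : ℂ} (hε : ε ^ 2 = 1) (hz : z ≠ 0) (h : H F) :
    ∫ x, (f : H F → ℂ) x * whittaker ψ ε z (h * x) ∂μH =
      (∫ x, (f : H F → ℂ) x * (ε * sqrtCard F * z) ^ hgt x ∂μH) * whittaker ψ ε z h := by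
  have hs := hu.sqrtCard_ne_zero
  have hε0 : ε ≠ 0 := by rintro rfl; simp at hε
  obtain ⟨s, hsum⟩ := exists_integral_eq_sum_of_invariant μH isOpen_KH hμH f.2.2.1 f.2.2.2
  have e1 : ∀ (w : ℂ) (h : H F), ∫ x, (f : H F → ℂ) x * w ^ hgt (h * x) ∂μH =
      ∑ x ∈ s, (f : H F → ℂ) x * w ^ hgt (h * x) := fun w h =>
    hsum _ fun k hk g => by rw [← mul_assoc, hgt_mul_KH hk]
  have e1' : ∀ w : ℂ, ∫ x, (f : H F → ℂ) x * w ^ hgt x ∂μH =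
      ∑ x ∈ s, (f : H F → ℂ) x * w ^ hgt x := fun w =>
    hsum _ fun k hk g => by rw [hgt_mul_KH hk]
  have e2 : ∀ z : ℂ, ∫ x, (f : H F → ℂ) x * whittaker ψ ε z (h * x) ∂μH =
      ∑ x ∈ s, (f : H F → ℂ) x * whittaker ψ ε z (h * x) := fun z =>
    hsum _ fun k hk g => by
      rw [← mul_assoc, (hu.isQuasi_whittaker hψ ε z).mul_KH (addChar_eq_one hψ) hk]
  rw [e1', e2]
  -- The test points are z = 1, 2, 3, …: there q z² is an integer greater than 1, so the factor 1 -
  -- (q z²)⁻¹ does not vanish.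
  refine IsLaurent.eq_of_infinite
    (f := fun z => ∑ x ∈ s, (f : H F → ℂ) x * whittaker ψ ε z (h * x))
    (g := fun z => (∑ x ∈ s, (f : H F → ℂ) x * (ε * sqrtCard F * z) ^ hgt x) * whittaker ψ ε z h)
    (A := Set.range fun n : ℕ => ((n : ℂ) + 1)) ?_ ?_ ?_ ?_ hz
  · exact IsLaurent.sum _ fun x _ => (IsLaurent.const _).mul (isLaurent_whittaker ε _)
  · refine IsLaurent.mul (IsLaurent.sum _ fun x _ => (IsLaurent.const _).mul ?_)
      (isLaurent_whittaker ε _)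
    simp_rw [_root_.mul_zpow (ε * sqrtCard F)]
    exact (IsLaurent.const _).mul (IsLaurent.zpow _)
  · refine Set.infinite_range_of_injective fun m n h => ?_
    simpa using h
  · rintro _ ⟨n, rfl⟩
    set z : ℂ := (n : ℂ) + 1
    have hz : z ≠ 0 := Nat.cast_add_one_ne_zero n
    refine ⟨hz, ?_⟩
    have hC : 1 - ((resCard F : ℂ) * z ^ 2)⁻¹ ≠ 0 := by
      rw [sub_ne_zero]
      intro h1
      have h2 : (resCard F : ℂ) * z ^ 2 = 1 := by rw [← inv_inv ((resCard F : ℂ) * z ^ 2), ← h1,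
        inv_one]
      have h3 : resCard F * (n + 1) ^ 2 = 1 := by
        have : z = ((n + 1 : ℕ) : ℂ) := by push_cast; rfl
        rw [this] at h2
        exact_mod_cast h2
      have h4 := Nat.eq_one_of_mul_eq_one_right h3
      have := hu.one_lt_card_nat
      omega
    set w := ε * sqrtCard F * z
    have hw : w ≠ 0 := mul_ne_zero (mul_ne_zero hε0 hs) hz
    choose k₀ hk₀ using fun h => hu.jacquet_eq_whittaker (μF := μF) hμF hψ hψ' hε hz h
    classical
    -- A single truncation is needed for all translates h x in the finite sum; inserting 1 includes
    -- h itself.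
    obtain ⟨k, hk⟩ : ∃ k, ∀ x ∈ insert 1 s, k₀ (h * x) ≤ k := by
      exact ⟨(insert 1 s).sup' (Finset.insert_nonempty _ _) fun x => k₀ (h * x),
        fun x hx => Finset.le_sup' (fun x => k₀ (h * x)) hx⟩
    refine mul_left_cancel₀ hC ?_
    have hkh : jacquet μF ψ w k h = (1 - ((resCard F : ℂ) * z ^ 2)⁻¹) * whittaker ψ ε z h := by
      have := hk₀ (h * 1) k (hk 1 (Finset.mem_insert_self _ _))
      rwa [mul_one] at this
    calc (1 - ((resCard F : ℂ) * z ^ 2)⁻¹) * ∑ x ∈ s, (f : H F → ℂ) x * whittaker ψ ε z (h * x)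
        = ∑ x ∈ s, (f : H F → ℂ) x * jacquet μF ψ w k (h * x) := by
          rw [Finset.mul_sum]
          refine Finset.sum_congr rfl fun x hx => ?_
          rw [hk₀ (h * x) k (hk x (Finset.mem_insert_of_mem hx))]
          ring
      _ = ∫ u in {x : F | ‖x‖ ≤ (resCard F : ℝ) ^ k}, ∑ x ∈ s, (f : H F → ℂ) x *
            (starRingEnd ℂ (ψ u : ℂ) * w ^ hgt (wH * (nH u * (h * x)))) ∂μF := by
          rw [integral_finsetSum _ fun x _ =>
            (integrableOn_jacquet (μF := μF) hψ w (h * x) k).const_mul _]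
          refine Finset.sum_congr rfl fun x _ => ?_
          rw [integral_const_mul]
          rfl
      _ = ∫ u in {x : F | ‖x‖ ≤ (resCard F : ℝ) ^ k}, (∑ x ∈ s, (f : H F → ℂ) x * w ^ hgt x) *
            (starRingEnd ℂ (ψ u : ℂ) * w ^ hgt (wH * (nH u * h))) ∂μF := by
          congr 1
          funext u
          have h1 := hu.hecke_height μH f hw (wH * (nH u * h))
          rw [e1, e1'] at h1
          have h2 : ∑ x ∈ s, (f : H F → ℂ) x *
              (starRingEnd ℂ (ψ u : ℂ) * w ^ hgt (wH * (nH u * (h * x)))) =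
              starRingEnd ℂ (ψ u : ℂ) * ∑ x ∈ s, (f : H F → ℂ) x *
                w ^ hgt (wH * (nH u * h) * x) := by
            rw [Finset.mul_sum]
            refine Finset.sum_congr rfl fun x _ => ?_
            rw [mul_assoc wH, mul_assoc (nH u)]
            ring
          rw [h2, h1]
          ring
      _ = (∑ x ∈ s, (f : H F → ℂ) x * w ^ hgt x) * jacquet μF ψ w k h := by
          rw [integral_const_mul]
          rfl
      _ = _ := by
          rw [hkh]
          ring

variable {χ₀ : Fˣ →* ℂˣ}

theorem unit_sq_eq_one {u : ℂˣ} (h : u ^ 2 = 1) : (u : ℂ) ^ 2 = 1 := by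
  rw [← Units.val_pow_eq_pow_val, h, Units.val_one]

theorem IsUniformizer.isW_whittaker (hu : IsUniformizer ϖ) (hμF : μF {x | ‖x‖ ≤ 1} = 1)
    (hψ : ∀ x : F, ‖x‖ ≤ 1 → ψ x = 1)
    (hψ' : ∃ x : F, ‖x‖ ≤ 1 ∧ ψ ((ϖ : F)⁻¹ * x) ≠ 1)
    (hχ : ∀ a : Fˣ, ‖(a : F)‖ = 1 → χ₀ a = 1) (hχ' : χ₀ ϖ ^ 2 = 1)
    (μH : Measure (H F)) [μH.IsHaarMeasure] (hμH : μH (KH F) = 1) (ζ : ℂ) :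
    IsW ψ χ₀ μH ζ (whittaker ψ (χ₀ ϖ : ℂ) (satakeParam F ζ)) := by
  refine ⟨?_, hu.isQuasi_whittaker hψ _ _, fun f h => ?_⟩
  · have h1 : lv (((1 : Fˣ) : Fˣ) : F) = 0 := hu.lv_eq (by simp)
    rw [← aH_one, hu.whittaker_aH hψ, h1, neg_zero]
    have := whitVal_natCast (F := F) (χ₀ ϖ : ℂ) (satakeParam F ζ) 0
    simpa using this
  · rw [hu.satakeH_eq hχ hχ', hu.hecke_whittaker hμF hψ hψ' μH hμH f (unit_sq_eq_one hχ')
      (hu.satakeParam_ne_zero ζ)]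

theorem IsUniformizer.existsUnique_isW (hu : IsUniformizer ϖ) (hμF : μF {x | ‖x‖ ≤ 1} = 1)
    (hψ : ∀ x : F, ‖x‖ ≤ 1 → ψ x = 1)
    (hψ' : ∃ x : F, ‖x‖ ≤ 1 ∧ ψ ((ϖ : F)⁻¹ * x) ≠ 1)
    (hχ : ∀ a : Fˣ, ‖(a : F)‖ = 1 → χ₀ a = 1) (hχ' : χ₀ ϖ ^ 2 = 1)
    (μH : Measure (H F)) [μH.IsHaarMeasure] (hμH : μH (KH F) = 1) (ζ : ℂ) :
    ∃! W : H F → ℂ, IsW ψ χ₀ μH ζ W := by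
  classical
  refine ⟨_, hu.isW_whittaker hμF hψ hψ' hχ hχ' μH hμH ζ, fun W hW => ?_⟩
  obtain ⟨hW1, hW2, hW3⟩ := hW
  obtain ⟨hV1, hV2, hV3⟩ := hu.isW_whittaker hμF hψ hψ' hχ hχ' μH hμH ζ
  set V := whittaker ψ (χ₀ ϖ : ℂ) (satakeParam F ζ)
  have hc1 := addChar_eq_one hψ
  have hc2 := addChar_ne_one hψ'
  have hD : IsQuasi (fun x => (ψ x : ℂ)) (W - V) := IsQuasi.sub hW2 hV2
  refine IsQuasi.ext hW2 hu hc1 hc2 hV2 fun m => sub_eq_zero.1 ?_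
  change (W - V) (aH (ϖ ^ (m : ℤ))) = 0
  set D := W - V with hDdef
  -- The difference D of two solutions is tested against the characteristic function of K' a(ϖ^m) K'
  -- at the identity. Both solutions give the same eigenvalue there, so the sum of D over this
  -- double coset is 0.
  induction m using Nat.strong_induction_on with | _ m ih =>
  set a := ϖ ^ (m : ℤ) with ha
  set f := doubleCosetFun isCompact_KH (aH a) with hf
  have hfval : ∀ g, (f : H F → ℂ) g =
    if g ∈ doubleCosetSet (KH F) (aH a) then 1 else 0 := fun g => rfl
  obtain ⟨s, hsum⟩ := exists_integral_eq_sum_of_invariant μH isOpen_KH hμH f.2.2.1 f.2.2.2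
  have h0 : ∑ x ∈ s, (f : H F → ℂ) x * D x = 0 := by
    have e1 := hW3 f 1
    have e2 := hV3 f 1
    simp only [one_mul] at e1 e2
    rw [hsum _ fun k hk g => IsQuasi.mul_KH hW2 hc1 hk g] at e1
    rw [hsum _ fun k hk g => IsQuasi.mul_KH hV2 hc1 hk g] at e2
    rw [hW1] at e1
    rw [hV1] at e2
    simp only [hDdef, Pi.sub_apply, mul_sub, Finset.sum_sub_distrib, ← e1, ← e2, sub_self]
  -- The gauge of n(y) a(b) is max(|b|, |y|, 1)²/|b|, and it equals q^m on the double coset. Hence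
  -- |b| ≥ q^{-m}. In the case of equality y is integral and the value is D(a(ϖ^m)); otherwise D
  -- vanishes by induction or by the conductor of the character.
  have h1 : ∀ x, (f : H F → ℂ) x * D x =
      D (aH a) * ((f : H F → ℂ) x * if hgt x = -m then 1 else 0) := by
    intro x
    rw [hfval]
    split_ifs with hx hx'
    · obtain ⟨y, b, k, hk, rfl⟩ := iwasawaH x
      rw [hgt_nak y b hk] at hx'
      obtain ⟨k', hk', l', hl', e⟩ := hx
      have hg := congrArg gaugeH e
      rw [gaugeH_mul_KH hl', gaugeH_KH_mul hk', gaugeH_mul_KH hk, gaugeH_na, eq_comm] at hg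
      have hga : gaugeH (aH a : H F) = (resCard F : ℝ) ^ (m : ℤ) := by
        have := gaugeH_na (0 : F) a
        rw [nH_zero, one_mul] at this
        rw [this, ha, hu.norm_zpow, norm_zero, max_eq_left (zpow_pos hu.card_pos _).le,
          max_eq_right (zpow_le_one_of_nonpos₀ hu.one_lt_card.le (by omega)), one_pow,
          _root_.zpow_neg, one_div, inv_inv]
      have hb : ‖(b : F)‖ = (resCard F : ℝ) ^ (-(m : ℤ)) := by
        rw [hu.norm_eq_zpow_lv b.ne_zero, hx']
      rw [hga, hb, _root_.zpow_neg, div_inv_eq_mul,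
        eq_comm, mul_eq_right₀ (zpow_pos hu.card_pos _).ne',
        pow_eq_one_iff_of_nonneg (by positivity) two_ne_zero] at hg
      have hy : ‖y‖ ≤ 1 := ((le_max_right _ _).trans (le_max_left _ _)).trans hg.le
      rw [hD.nak hu hc1 y b hk, hx', neg_neg, hc1 y hy]
      ring
    · obtain ⟨y, b, k, hk, rfl⟩ := iwasawaH x
      rw [hgt_nak y b hk] at hx'
      rw [hD.nak hu hc1 y b hk]
      obtain ⟨k', hk', l', hl', e⟩ := hx
      have hg := congrArg gaugeH e
      rw [gaugeH_mul_KH hl', gaugeH_KH_mul hk', gaugeH_mul_KH hk, gaugeH_na, eq_comm] at hg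
      have hga : gaugeH (aH a : H F) = (resCard F : ℝ) ^ (m : ℤ) := by
        have := gaugeH_na (0 : F) a
        rw [nH_zero, one_mul] at this
        rw [this, ha, hu.norm_zpow, norm_zero, max_eq_left (zpow_pos hu.card_pos _).le,
          max_eq_right (zpow_le_one_of_nonpos₀ hu.one_lt_card.le (by omega)), one_pow,
          _root_.zpow_neg, one_div, inv_inv]
      have hle : (resCard F : ℝ) ^ (-lv (b : F)) ≤ (resCard F : ℝ) ^ (m : ℤ) := by
        rw [← hga, hg, _root_.zpow_neg, ← hu.norm_eq_zpow_lv b.ne_zero, ← one_div]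
        have : (1 : ℝ) ≤ max (max ‖(b : F)‖ ‖y‖) 1 ^ 2 := one_le_pow₀ (le_max_right _ _)
        gcongr
      rw [zpow_le_zpow_iff_right₀ hu.one_lt_card] at hle
      have : D (aH (ϖ ^ (-lv (b : F)))) = 0 := by
        rcases lt_or_ge (-lv (b : F)) 0 with h4 | h4
        · exact hD.eq_zero hu hc1 hc2 h4
        · have hm : -lv (b : F) ≠ m := fun h => hx' (by omega)
          lift -lv (b : F) to ℕ using h4 with n
          exact ih n (by omega)
      rw [this]
      ring
    · ring
    · ring
  rw [Finset.sum_congr rfl fun x _ => h1 x, ← Finset.mul_sum, ← hsum _ fun k hk g => by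
    rw [hgt_mul_KH hk]] at h0
  refine (mul_eq_zero.1 h0).resolve_right ?_
  -- The coefficient of D(a(ϖ^m)) is the volume of E, which is open, contains a(ϖ^m) and lies in a
  -- compact set, hence positive and finite.
  obtain ⟨E, hE⟩ : ∃ E : Set (H F), E = {g | g ∈ doubleCosetSet (KH F) (aH a) ∧
    hgt g = -m} := ⟨_, rfl⟩
  have h2 : (fun x => (f : H F → ℂ) x * if hgt x = -m then 1 else 0) = E.indicator fun _ => 1 := by
    funext x
    rw [hfval, hE]
    by_cases h3 : x ∈ doubleCosetSet (KH F) (aH a) <;> by_cases h4 : hgt x = -m <;>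
      simp [h3, h4]
  have hopen : IsOpen E := by
    have : IsOpen (doubleCosetSet (KH F) (aH a)) := isOpen_doubleCosetSet isOpen_KH _
    rw [hE]
    refine IsOpen.inter (t := {g : H F | hgt g = -m}) this ?_
    have hl : IsLocallyConstant fun g : H F => (hgt g : ℂ) :=
      isLocallyConstant_of_right_invariant isOpen_KH fun k hk g => by rw [hgt_mul_KH hk]
    have := hl.isOpen_fiber (-m : ℂ)
    have he : {g : H F | hgt g = -m} = {g : H F | (hgt g : ℂ) = -m} := by
      ext g
      simp only [Set.mem_ofPred_eq]
      norm_cast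
    rwa [he]
  have hne : E.Nonempty := by
    rw [hE]
    exact ⟨aH a, mem_doubleCosetSet_self _ _, by rw [hgt_aH, ha, hu.lv_zpow]⟩
  have hcpt : μH E ≠ ⊤ := by
    have h3 : μH (doubleCosetSet (KH F) (aH a)) < ⊤ :=
      (isCompact_doubleCosetSet isCompact_KH _).measure_lt_top
    refine ((measure_mono ?_).trans_lt h3).ne
    rw [hE]
    exact fun g hg => hg.1
  rw [h2, integral_indicator hopen.measurableSet, setIntegral_const]
  simp only [Complex.real_smul, mul_one, ne_eq, Complex.ofReal_eq_zero]
  exact (ENNReal.toReal_pos (hopen.measure_pos μH hne).ne' hcpt).ne'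

end WhittakerFunction

end SO5PGL2

namespace SO5PGL2

/-! ### Coset expansion of a function together with its integrals -/

section Cosets

variable {Γ : Type*} [Group Γ] [TopologicalSpace Γ] [IsTopologicalGroup Γ]
  [MeasurableSpace Γ] [BorelSpace Γ] (μ : Measure Γ) [μ.IsHaarMeasure]

open Classical in
-- The summation formula for right-invariant φ, applied to the characteristic function of the coset
-- gU, yields the expansion of f at g. One finite set therefore serves both the expansion and the
-- integrals.
theorem exists_coset_sum_integral {U : Subgroup Γ} (hU : IsOpen (U : Set Γ)) (hμ : μ U = 1)
    {f : Γ → ℂ} (hf : ∀ k ∈ U, ∀ g, f (g * k) = f g) (hc : HasCompactSupport f) :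
    ∃ s : Finset Γ, (∀ g, f g = ∑ x ∈ s, f x * if x⁻¹ * g ∈ U then 1 else 0) ∧
      ∀ φ : Γ → ℂ, (∀ k ∈ U, ∀ g, φ (g * k) = φ g) → ∫ g, f g * φ g ∂μ = ∑ x ∈ s, f x * φ x := by
  obtain ⟨s, hs⟩ := exists_integral_eq_sum_of_invariant μ hU hμ hf hc
  refine ⟨s, fun g => ?_, hs⟩
  rw [← hs (fun x => if x⁻¹ * g ∈ U then 1 else 0) fun k hk x => by
    simp only [_root_.mul_inv_rev, mul_assoc, U.mul_mem_cancel_left (U.inv_mem hk)]]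
  have h1 : (fun x => f x * if x⁻¹ * g ∈ U then (1 : ℂ) else 0) =
      fun x => (U : Set Γ).indicator (fun _ => f g) (g⁻¹ * x) := by
    funext x
    have h2 : x⁻¹ * g ∈ U ↔ g⁻¹ * x ∈ U := by
      rw [← U.inv_mem_iff, _root_.mul_inv_rev, inv_inv]
    by_cases h : g⁻¹ * x ∈ U
    · have := hf _ h g
      rw [mul_inv_cancel_left] at this
      simp [h2, h, this]
    · simp [h2, h]
  rw [h1, integral_mul_left_eq_self (fun x => (U : Set Γ).indicator (fun _ => f g) x) g⁻¹,
    integral_indicator hU.measurableSet]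
  simp [Measure.real, hμ]

end Cosets

/-! ### Polynomial bases with one element in each degree -/

section Polynomials

theorem degree_chebyshevS (n : ℕ) : (Polynomial.Chebyshev.S ℂ n).degree = n := by
  induction n using Nat.strong_induction_on with
  | _ n ih =>
    match n with
    | 0 => simp
    | 1 => simp
    | n + 2 =>
      have h : Polynomial.Chebyshev.S ℂ ((n + 2 : ℕ) : ℤ) =
          Polynomial.X * Polynomial.Chebyshev.S ℂ ((n + 1 : ℕ) : ℤ) -
            Polynomial.Chebyshev.S ℂ (n : ℤ) := by
        push_cast
        exact Polynomial.Chebyshev.S_add_two ℂ (n : ℤ)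
      have h1 := ih (n + 1) (by omega)
      have h2 := ih n (by omega)
      have h3 : (Polynomial.X * Polynomial.Chebyshev.S ℂ ((n + 1 : ℕ) : ℤ)).degree =
          ((n + 2 : ℕ) : WithBot ℕ) := by
        rw [Polynomial.degree_mul, Polynomial.degree_X, h1]
        push_cast
        ring
      rw [h, Polynomial.degree_sub_eq_left_of_degree_lt, h3]
      rw [h3, h2]
      exact_mod_cast (by omega : n < n + 2)

/-- A sequence of polynomials of degrees `0, 1, 2, …` is a basis of the space of polynomials. -/
theorem exists_equiv_polynomial (p : ℕ → Polynomial ℂ) (hp : ∀ n, (p n).degree = n) :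
    ∃ e : (ℕ →₀ ℂ) ≃ₗ[ℂ] Polynomial ℂ, ∀ c, e c = c.sum fun n a => a • p n := by
  let S : Polynomial.Sequence ℂ := ⟨p, hp⟩
  have hS : ∀ i, IsUnit (S i).leadingCoeff := fun i => by
    rw [isUnit_iff_ne_zero, Polynomial.leadingCoeff_ne_zero]
    intro h
    have := hp i
    rw [show p i = S i from rfl, h] at this
    simp at this
  refine ⟨(S.basis hS).repr.symm, fun c => ?_⟩
  rw [Module.Basis.repr_symm_apply, Finsupp.linearCombination_apply]
  simp [S]

end Polynomials

/-! ### Integration over Fˣ by shells of constant norm -/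

section UnitIntegral

variable {F : Type*} [NontriviallyNormedField F] [IsUltrametricDist F] {ϖ : Fˣ}
  [LocallyCompactSpace F] [MeasurableSpace F] [BorelSpace F] {μU : Measure Fˣ} [μU.IsHaarMeasure]

theorem measurableSet_units_norm_eq (r : ℝ) : MeasurableSet {a : Fˣ | ‖(a : F)‖ = r} := by
  have := borelSpace_units (F := F)
  exact (isClosed_eq (continuous_norm.comp Units.continuous_val) continuous_const).measurableSet

theorem IsUniformizer.integrable_units (hu : IsUniformizer ϖ)
    (hμU : μU {a | ‖(a : F)‖ = 1} = 1) (m : ℤ) (c : ℂ) :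
    Integrable ({a : Fˣ | ‖(a : F)‖ = (resCard F : ℝ) ^ m}.indicator fun _ => c) μU := by
  have := borelSpace_units (F := F)
  rw [integrable_indicator_iff (measurableSet_units_norm_eq _)]
  simp [hu.measure_units μU hμU]

theorem IsUniformizer.integral_units (hu : IsUniformizer ϖ)
    (hμU : μU {a | ‖(a : F)‖ = 1} = 1) {ι : Type*} (s : Finset ι) (m : ι → ℤ) (c : ι → ℂ) :
    ∫ a, ∑ i ∈ s, {a : Fˣ | ‖(a : F)‖ = (resCard F : ℝ) ^ m i}.indicator (fun _ => c i) a ∂μU =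
      ∑ i ∈ s, c i := by
  have := borelSpace_units (F := F)
  rw [integral_finsetSum _ fun i _ => hu.integrable_units hμU _ _]
  refine Finset.sum_congr rfl fun i _ => ?_
  rw [integral_indicator (measurableSet_units_norm_eq _)]
  simp [Measure.real, hu.measure_units μU hμU]

end UnitIntegral

/-! ### The space C_c(N'\H/K', ψ), its coordinates and its pairing with Whittaker functions -/

section WhittakerSpace

variable {F : Type*} [NontriviallyNormedField F] [IsUltrametricDist F] {ϖ : Fˣ}
  {ψ : AddChar F Circle}

theorem isQuasi_of_mem_CcH (φ : CcH ψ) :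
    IsQuasi (fun x => starRingEnd ℂ (ψ x : ℂ)) (φ : H F → ℂ) := by
  intro x g k hk
  rw [φ.2.2.1 k hk, φ.2.1]

theorem continuous_hgt : Continuous (hgt : H F → ℤ) := by
  have h : IsLocallyConstant (hgt : H F → ℤ) := by
    rw [IsLocallyConstant.iff_exists_open]
    intro x
    refine ⟨(fun y => x⁻¹ * y) ⁻¹' (KH F : Set (H F)), isOpen_KH.preimage (by fun_prop), by
      simp [(KH F).one_mem], fun y hy => ?_⟩
    have := hgt_mul_KH hy x
    simpa using this
  exact h.continuous

/-- Compactness modulo N' bounds the height from below on the support, since the height is invariant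
under N'. This makes the coordinates on the torus finitely supported. -/
theorem IsUniformizer.exists_bound_CcH (hu : IsUniformizer ϖ) (φ : CcH ψ) :
    ∃ M : ℕ, ∀ m : ℕ, (φ : H F → ℂ) (aH (ϖ ^ (m : ℤ))) ≠ 0 → m ≤ M := by
  obtain ⟨Ω, hΩ, h⟩ := φ.2.2.2
  obtain ⟨B, hB⟩ := (hΩ.image continuous_hgt).bddBelow
  refine ⟨(-B).toNat, fun m hm => ?_⟩
  obtain ⟨x, ω, hω, e⟩ := h _ hm
  have h1 : hgt ω = -(m : ℤ) := by
    have h2 : hgt (nH x * ω) = hgt ω := by rw [hgt, heightH_nH_mul, hgt]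
    rw [← h2, ← e, hgt_aH, hu.lv_zpow]
  have := hB (Set.mem_image_of_mem _ hω)
  omega

theorem IsUniformizer.mem_CcH_whit [LocallyCompactSpace F] (hu : IsUniformizer ϖ)
    (hψ : ∀ x : F, ‖x‖ ≤ 1 → ψ x = 1)
    {w : ℤ → ℂ} (hw : ∀ m < 0, w m = 0) {s : Finset ℤ} (hs : ∀ m, w m ≠ 0 → m ∈ s) :
    whit (fun x => starRingEnd ℂ (ψ x : ℂ)) w ∈ CcH ψ := by
  have hq := hu.isQuasi_whit (conj_addChar_add ψ) (conj_addChar_eq_one hψ) hw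
  refine ⟨hq.nH_mul, fun k hk g => hq.mul_KH (conj_addChar_eq_one hψ) hk g,
    ⋃ m ∈ s, (fun k => aH (ϖ ^ m) * k) '' (KH F : Set (H F)),
    s.isCompact_biUnion fun m _ => isCompact_KH.image (by fun_prop), fun g hg => ?_⟩
  obtain ⟨x, a, k, hk, rfl⟩ := iwasawaH g
  rw [hq.nak hu (conj_addChar_eq_one hψ) x a hk,
    hu.whit_aH (conj_addChar_add ψ) (conj_addChar_eq_one hψ) hw, hu.lv_zpow, neg_neg] at hg
  refine ⟨x, aH a * k, Set.mem_biUnion (hs _ (right_ne_zero_of_mul hg))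
    ⟨aH (ϖ ^ lv (a : F) * a) * k, (KH F).mul_mem (aH_mem_KH ?_) hk, ?_⟩, mul_assoc _ _ _⟩
  · rw [Units.val_mul, norm_mul, hu.norm_zpow, mul_comm, hu.norm_mul_zpow_lv]
  · change aH (ϖ ^ (-lv (a : F))) * (aH (ϖ ^ lv (a : F) * a) * k) = _
    rw [← mul_assoc, ← aH_mul, ← mul_assoc, ← _root_.zpow_add, neg_add_cancel, _root_.zpow_zero,
      one_mul]

/-- The function `φ'_r`. -/
noncomputable def torusFun (ψ : AddChar F Circle) (r : ℤ) : H F → ℂ :=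
  whit (fun x => starRingEnd ℂ (ψ x : ℂ)) (fun m => if 0 ≤ m ∧ m = r then 1 else 0)

theorem IsUniformizer.torusFun_mem [LocallyCompactSpace F] (hu : IsUniformizer ϖ)
    (hψ : ∀ x : F, ‖x‖ ≤ 1 → ψ x = 1) (r : ℤ) : torusFun ψ r ∈ CcH ψ :=
  hu.mem_CcH_whit hψ (fun m hm => if_neg (by omega)) (s := {r}) fun m hm => by
    by_contra h
    exact hm (if_neg fun h' => h (by simp [h'.2]))

theorem IsUniformizer.torusFun_aH (hu : IsUniformizer ϖ)
    (hψ : ∀ x : F, ‖x‖ ≤ 1 → ψ x = 1) (r : ℤ) (a : Fˣ) :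
    torusFun ψ r (aH a) = if 0 ≤ -lv (a : F) ∧ -lv (a : F) = r then 1 else 0 :=
  hu.whit_aH (conj_addChar_add ψ) (conj_addChar_eq_one hψ) (fun m hm => if_neg (by omega)) a

/-- Functions in `C_c(N'\H/K', ψ)` are determined by their values on the torus. -/
theorem IsUniformizer.exists_equiv_CcH [LocallyCompactSpace F] (hu : IsUniformizer ϖ)
    (hψ : ∀ x : F, ‖x‖ ≤ 1 → ψ x = 1)
    (hψ' : ∃ x : F, ‖x‖ ≤ 1 ∧ ψ ((ϖ : F)⁻¹ * x) ≠ 1) :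
    ∃ e : CcH ψ ≃ₗ[ℂ] (ℕ →₀ ℂ), ∀ φ m, e φ m = (φ : H F → ℂ) (aH (ϖ ^ (m : ℤ))) := by
  have hfin : ∀ φ : CcH ψ, (Function.support
      fun m : ℕ => (φ : H F → ℂ) (aH (ϖ ^ (m : ℤ)))).Finite := fun φ => by
    obtain ⟨M, hM⟩ := hu.exists_bound_CcH φ
    exact (Set.finite_Iic M).subset fun m hm => hM m hm
  let e : CcH ψ →ₗ[ℂ] (ℕ →₀ ℂ) :=
    { toFun := fun φ => Finsupp.ofSupportFinite _ (hfin φ)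
      map_add' := fun φ φ' => by ext m; simp [Finsupp.ofSupportFinite]
      map_smul' := fun c φ => by ext m; simp [Finsupp.ofSupportFinite] }
  have he : ∀ φ m, e φ m = (φ : H F → ℂ) (aH (ϖ ^ (m : ℤ))) := fun φ m => rfl
  refine ⟨LinearEquiv.ofBijective e ⟨fun φ φ' h => ?_, fun c => ?_⟩, he⟩
  · refine Subtype.ext ((isQuasi_of_mem_CcH φ).ext hu (conj_addChar_eq_one hψ)
      (conj_addChar_ne_one hψ') (isQuasi_of_mem_CcH φ') fun m => ?_)
    rw [← he, ← he, h]
  · have hw : ∀ m < 0, (fun m : ℤ => if m < 0 then 0 else c m.toNat) m = 0 := fun m hm => if_pos hm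
    refine ⟨⟨_, hu.mem_CcH_whit hψ hw (s := c.support.image fun m : ℕ => (m : ℤ)) fun m hm => ?_⟩, ?_⟩
    · rw [Finset.mem_image]
      by_cases h : m < 0
      · exact absurd (if_pos h) hm
      · refine ⟨m.toNat, Finsupp.mem_support_iff.2 ?_, by omega⟩
        simpa [h] using hm
    · ext m
      refine (hu.whit_aH (conj_addChar_add ψ) (conj_addChar_eq_one hψ) hw _).trans ?_
      rw [hu.lv_zpow]
      simp

variable [LocallyCompactSpace F] [MeasurableSpace F] [BorelSpace F]

/-- Each shell |α| = q^{-m} has volume 1, and the weight |α|⁻¹ = q^m turns the factor (ε q^{-1/2})^m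
of the Whittaker value into (ε q^{1/2})^m. -/
theorem IsUniformizer.integral_torus (hu : IsUniformizer ϖ) {μU : Measure Fˣ} [μU.IsHaarMeasure]
    (hμU : μU {a | ‖(a : F)‖ = 1} = 1)
    (hψ : ∀ x : F, ‖x‖ ≤ 1 → ψ x = 1)
    (hψ' : ∃ x : F, ‖x‖ ≤ 1 ∧ ψ ((ϖ : F)⁻¹ * x) ≠ 1) (ε z : ℂ) (φ : CcH ψ) {s : Finset ℕ}
    (hs : ∀ m : ℕ, (φ : H F → ℂ) (aH (ϖ ^ (m : ℤ))) ≠ 0 → m ∈ s) :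
    ∫ a : Fˣ, (φ : H F → ℂ) (aH a) * whittaker ψ ε z (aH a) * ((‖(a : F)‖⁻¹ : ℝ) : ℂ) ∂μU =
      ∑ m ∈ s, (φ : H F → ℂ) (aH (ϖ ^ (m : ℤ))) * (ε * sqrtCard F) ^ m *
        (Polynomial.Chebyshev.S ℂ m).eval (z + z⁻¹) := by
  rw [← hu.integral_units hμU s (fun m => -(m : ℤ))]
  congr 1
  funext a
  have h1 := (isQuasi_of_mem_CcH φ).nak hu (conj_addChar_eq_one hψ) 0 a (KH F).one_mem
  rw [mul_one, nH_zero, one_mul, conj_addChar_eq_one hψ 0 (by simp), one_mul] at h1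
  have h2 : ∀ m : ℕ, ‖(a : F)‖ = (resCard F : ℝ) ^ (-(m : ℤ)) ↔ -lv (a : F) = m := fun m => by
    rw [hu.norm_eq_zpow_lv a.ne_zero, hu.zpow_inj]
    omega
  by_cases h : ∃ m ∈ s, -lv (a : F) = ((m : ℕ) : ℤ)
  · obtain ⟨m, hm, hm'⟩ := h
    rw [Finset.sum_eq_single_of_mem m hm fun m' _ hne => Set.indicator_of_notMem (by
      rw [Set.mem_ofPred_eq, h2, hm']
      exact_mod_cast hne.symm) _, Set.indicator_of_mem (show a ∈ {a : Fˣ | ‖(a : F)‖ = (resCard F : ℝ) ^ (-(m : ℤ))} from (h2 m).2 hm'), h1,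
      hu.whittaker_aH hψ, hm', whitVal_natCast, (h2 m).2 hm']
    have h3 : (((((resCard F : ℝ) ^ (-(m : ℤ)))⁻¹ : ℝ)) : ℂ) = (sqrtCard F ^ 2) ^ m := by
      rw [hu.sqrtCard_sq, _root_.zpow_neg, inv_inv]
      simp
    have h4 : (ε * (sqrtCard F)⁻¹) ^ m * (sqrtCard F ^ 2) ^ m = (ε * sqrtCard F) ^ m := by
      rw [← mul_pow]
      congr 1
      field_simp [hu.sqrtCard_ne_zero]
    rw [h3, ← h4]
    ring
  · rw [Finset.sum_eq_zero fun m hm => Set.indicator_of_notMem (by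
      rw [Set.mem_ofPred_eq, h2]
      exact fun h' => h ⟨m, hm, h'⟩) _]
    have h3 : (φ : H F → ℂ) (aH (ϖ ^ (-lv (a : F)))) = 0 := by
      by_cases h4 : -lv (a : F) < 0
      · exact (isQuasi_of_mem_CcH φ).eq_zero hu (conj_addChar_eq_one hψ) (conj_addChar_ne_one hψ') h4
      · by_contra h5
        have h6 : -lv (a : F) = ((-lv (a : F)).toNat : ℤ) := by omega
        rw [h6] at h5
        exact h ⟨_, hs _ h5, h6⟩
    rw [h1, h3, zero_mul, zero_mul]

variable (μF : Measure F) [μF.IsAddHaarMeasure]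

theorem phiOf'_mem (f' : spherical (KH F)) : phiOf' ψ μF f' ∈ CcH ψ := by
  refine ⟨fun y g => ?_, fun k hk g => ?_, tsupport (f' : H F → ℂ), f'.2.2.2, fun g hg => ?_⟩
  · unfold phiOf'
    rw [← integral_const_mul]
    conv_rhs => rw [← integral_add_right_eq_self _ (y : F)]
    congr 1
    funext x
    rw [← mul_assoc, ← nH_add]
    have e : starRingEnd ℂ (ψ y : ℂ) * (ψ y : ℂ) = 1 := conj_mul_self_addChar ψ y
    have e' : (ψ (x + y) : ℂ) = (ψ x : ℂ) * (ψ y : ℂ) := addChar_add ψ x y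
    refine Eq.trans ?_ (congrArg (fun c => starRingEnd ℂ (ψ y : ℂ) * (c * _)) e'.symm)
    linear_combination -(ψ x : ℂ) * (f' : H F → ℂ) (nH (x + y) * g) * e
  · simp only [phiOf', ← mul_assoc, f'.2.2.1 k hk]
  · have h : ∃ x : F, (f' : H F → ℂ) (nH x * g) ≠ 0 := by
      by_contra h
      push Not at h
      exact hg (by simp [phiOf', h])
    obtain ⟨x, hx⟩ := h
    refine ⟨-x, nH x * g, subset_tsupport _ hx, ?_⟩
    rw [← mul_assoc, ← nH_add, neg_add_cancel, nH_zero, one_mul]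

theorem inv_mul_mem_KH_iff {u x : F} {a b : Fˣ} {k : H F} (hk : k ∈ KH F) :
    (nH u * aH b * k)⁻¹ * (nH x * aH a) ∈ KH F ↔ ‖(a : F)‖ = ‖(b : F)‖ ∧ ‖x - u‖ ≤ ‖(b : F)‖ := by
  constructor
  · intro h
    have := nak_eq (KH F).one_mem ((KH F).mul_mem hk h) (x := x) (a := a) (y := u) (b := b) (by group)
    exact this
  · rintro ⟨h1, h2⟩
    obtain ⟨l, hl, e⟩ := nak_mem h1 h2
    rw [e, _root_.mul_inv_rev, mul_assoc, inv_mul_cancel_left]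
    exact (KH F).mul_mem ((KH F).inv_mem hk) hl

theorem IsUniformizer.measure_ball_unit (hu : IsUniformizer ϖ) (hμF : μF {x | ‖x‖ ≤ 1} = 1)
    (u : F) (b : Fˣ) : μF {x | ‖x - u‖ ≤ ‖(b : F)‖} = ENNReal.ofReal ‖(b : F)‖ := by
  have h := hu.measure_norm_le μF hμF (lv (b : F))
  rw [← hu.norm_eq_zpow_lv b.ne_zero] at h
  rw [← h, ← measure_preimage_add_right μF (-u) {x | ‖x‖ ≤ ‖(b : F)‖}]
  simp [sub_eq_add_neg]

/-- The Iwasawa integration formula for `f'` times a Whittaker function. -/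
theorem IsUniformizer.integral_phiOf' (hu : IsUniformizer ϖ) (hμF : μF {x | ‖x‖ ≤ 1} = 1)
    {μU : Measure Fˣ} [μU.IsHaarMeasure]
    (hμU : μU {a | ‖(a : F)‖ = 1} = 1)
    (hψ : ∀ x : F, ‖x‖ ≤ 1 → ψ x = 1)
    (hψ' : ∃ x : F, ‖x‖ ≤ 1 ∧ ψ ((ϖ : F)⁻¹ * x) ≠ 1)
    (μH : Measure (H F)) [μH.IsHaarMeasure] (hμH : μH (KH F) = 1) (f' : spherical (KH F))
    {W : H F → ℂ} (hW : IsQuasi (fun x => (ψ x : ℂ)) W) :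
    ∫ a : Fˣ, phiOf' ψ μF f' (aH a) * W (aH a) * ((‖(a : F)‖⁻¹ : ℝ) : ℂ) ∂μU =
      ∫ g, (f' : H F → ℂ) g * W g ∂μH := by
  classical
  obtain ⟨s, hs, hs'⟩ := exists_coset_sum_integral μH isOpen_KH hμH f'.2.2.1 f'.2.2.2
  rw [hs' W fun k hk g => hW.mul_KH (addChar_eq_one hψ) hk g,
    ← hu.integral_units hμU s hgt (fun y => (f' : H F → ℂ) y * W y)]
  congr 1
  funext a
  have hball : ∀ (u : F) (b : Fˣ), IsCompact {x : F | ‖x - u‖ ≤ ‖(b : F)‖} := fun u b => by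
    have : ProperSpace F := ProperSpace.of_locallyCompactSpace F
    simpa [Metric.closedBall, dist_eq_norm] using isCompact_closedBall u ‖(b : F)‖
  have hc : Continuous fun x : F => (ψ x : ℂ) := (continuous_of_trivial ψ hψ).continuous
  have hint : ∀ (u : F) (b : Fˣ), Integrable ({x : F | ‖x - u‖ ≤ ‖(b : F)‖}.indicator
      fun x => (ψ x : ℂ)) μF := fun u b => by
    rw [integrable_indicator_iff (hball u b).isClosed.measurableSet]
    exact hc.continuousOn.integrableOn_compact (hball u b)
  -- the integrals over the cosets
  have key : ∀ y : H F, Integrable (fun x => (ψ x : ℂ) * if y⁻¹ * (nH x * aH a) ∈ KH F then 1 else 0) μF ∧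
      (∫ x, (ψ x : ℂ) * (if y⁻¹ * (nH x * aH a) ∈ KH F then 1 else 0) ∂μF) * W (aH a) *
        ((‖(a : F)‖⁻¹ : ℝ) : ℂ) =
      {a : Fˣ | ‖(a : F)‖ = (resCard F : ℝ) ^ hgt y}.indicator (fun _ => W y) a := by
    intro y
    obtain ⟨u, b, k, hk, rfl⟩ := iwasawaH y
    simp only [inv_mul_mem_KH_iff hk]
    have h1 : {a : Fˣ | ‖(a : F)‖ = (resCard F : ℝ) ^ hgt (nH u * aH b * k)} =
        {a : Fˣ | ‖(a : F)‖ = ‖(b : F)‖} := by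
      rw [hgt_nak _ _ hk, ← hu.norm_eq_zpow_lv b.ne_zero]
    rw [h1]
    by_cases hab : ‖(a : F)‖ = ‖(b : F)‖
    · have h2 : (fun x => (ψ x : ℂ) * if ‖(a : F)‖ = ‖(b : F)‖ ∧ ‖x - u‖ ≤ ‖(b : F)‖ then 1 else 0) =
          {x : F | ‖x - u‖ ≤ ‖(b : F)‖}.indicator fun x => (ψ x : ℂ) := by
        funext x
        simp [hab, Set.indicator_apply]
      rw [h2]
      refine ⟨hint u b, ?_⟩
      rw [Set.indicator_of_mem (by exact hab)]
      have h3 : W (aH a) = W (aH (ϖ ^ (-lv (b : F)))) := by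
        have := hW.nak hu (addChar_eq_one hψ) 0 a (KH F).one_mem
        rw [mul_one, nH_zero, one_mul, addChar_eq_one hψ 0 (by simp), one_mul] at this
        rw [this, lv, hab, lv]
      rw [hW.nak hu (addChar_eq_one hψ) u b hk, h3]
      -- If |b| ≤ 1 the character is constant on the ball around u, whose volume |b| cancels the
      -- weight |a|⁻¹. If |b| > 1 the Whittaker function vanishes at a.
      by_cases hb : ‖(b : F)‖ ≤ 1
      · rw [integral_indicator (hball u b).isClosed.measurableSet,
          setIntegral_congr_fun (g := fun _ => (ψ u : ℂ)) (hball u b).isClosed.measurableSet]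
        · rw [setIntegral_const, Measure.real, hu.measure_ball_unit μF hμF,
            ENNReal.toReal_ofReal (norm_nonneg _), hab, Complex.real_smul]
          have : ((‖(b : F)‖ : ℝ) : ℂ) ≠ 0 := by simp
          push_cast
          field_simp
        · intro x hx
          have : (ψ x : ℂ) = (ψ (x - u) : ℂ) * (ψ u : ℂ) := by rw [← addChar_add, sub_add_cancel]
          simp only [this]
          rw [addChar_eq_one hψ _ (le_trans hx hb), one_mul]
      · have : W (aH (ϖ ^ (-lv (b : F)))) = 0 := by
          refine hW.eq_zero hu (addChar_eq_one hψ) (addChar_ne_one hψ') ?_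
          rw [hu.norm_eq_zpow_lv b.ne_zero, ← zpow_zero (resCard F : ℝ),
            zpow_le_zpow_iff_right₀ hu.one_lt_card] at hb
          omega
        rw [this, mul_zero, mul_zero, zero_mul]
    · simp [hab]
  have h4 : phiOf' ψ μF f' (aH a) =
      ∑ y ∈ s, (f' : H F → ℂ) y *
        ∫ x, (ψ x : ℂ) * (if y⁻¹ * (nH x * aH a) ∈ KH F then 1 else 0) ∂μF := by
    unfold phiOf'
    simp_rw [← integral_const_mul]
    rw [← integral_finsetSum _ fun y _ => (key y).1.const_mul _]
    congr 1
    funext x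
    rw [hs, Finset.mul_sum]
    refine Finset.sum_congr rfl fun y _ => ?_
    ring
  rw [h4, Finset.sum_mul, Finset.sum_mul]
  refine Finset.sum_congr rfl fun y _ => ?_
  rw [mul_assoc, mul_assoc, ← mul_assoc (∫ _, _ ∂_), (key y).2]
  by_cases h : a ∈ {a : Fˣ | ‖(a : F)‖ = (resCard F : ℝ) ^ hgt y}
  · rw [Set.indicator_of_mem h, Set.indicator_of_mem h]
  · rw [Set.indicator_of_notMem h, Set.indicator_of_notMem h, mul_zero]

end WhittakerSpace

end SO5PGL2

namespace SO5PGL2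

/-! ### Elements of `SO(3,2)` -/

section Elements

variable {F : Type*} [NontriviallyNormedField F]

theorem toMat_mul (g h : SO5 F) : toMat (g * h) = toMat g * toMat h := rfl

theorem toMat_one : toMat (1 : SO5 F) = 1 := rfl

theorem toMat_form (g : SO5 F) : (toMat g)ᵀ * J F * toMat g = J F := g.2

theorem toMat_injective : Function.Injective (toMat : SO5 F → Matrix (Fin 5) (Fin 5) F) :=
  fun _ _ h => Subtype.ext (Subtype.ext h)

theorem J_eq : J F =
    !![0, 0, 0, 0, 1; 0, 0, 0, 1, 0; 0, 0, 1, 0, 0; 0, 1, 0, 0, 0; 1, 0, 0, 0, 0] := by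
  ext i j
  rw [J, Matrix.of_apply]
  fin_cases i <;> fin_cases j <;> first | exact if_pos rfl | exact if_neg (by decide)

theorem J_mul_J : J F * J F = 1 := by
  rw [J_eq]
  ext i j
  fin_cases i <;> fin_cases j <;> simp [Matrix.mul_apply, Fin.sum_univ_five]

theorem toMat_form' (g : SO5 F) : toMat g * J F * (toMat g)ᵀ = J F := by
  have h1 : (J F * (toMat g)ᵀ * J F) * toMat g = 1 := by
    rw [Matrix.mul_assoc, Matrix.mul_assoc, ← Matrix.mul_assoc (toMat g)ᵀ, toMat_form, J_mul_J]
  have h2 := mul_eq_one_comm.1 h1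
  calc toMat g * J F * (toMat g)ᵀ = (toMat g * (J F * (toMat g)ᵀ * J F)) * J F := by
        simp only [Matrix.mul_assoc, J_mul_J, Matrix.mul_one]
    _ = J F := by rw [h2, Matrix.one_mul]

theorem rows_form (g : SO5 F) (i j : Fin 5) :
    toMat g i 0 * toMat g j 4 + toMat g i 1 * toMat g j 3 + toMat g i 2 * toMat g j 2 +
      toMat g i 3 * toMat g j 1 + toMat g i 4 * toMat g j 0 = J F i j := by
  have := congrFun (congrFun (toMat_form' g) i) j
  rw [← this, J_eq]
  simp [Matrix.mul_apply, Fin.sum_univ_five]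
  ring

/-- The element of `SO(3,2)` with a given matrix. -/
def mkG (m : Matrix (Fin 5) (Fin 5) F) (h : mᵀ * J F * m = J F) (hd : m.det = 1) : SO5 F :=
  ⟨⟨m, hd⟩, h⟩

/-- The transpose of an element of `SO(3,2)`. -/
def transposeG (g : SO5 F) : SO5 F :=
  mkG (toMat g)ᵀ (by rw [transpose_transpose, toMat_form']) (by rw [det_transpose]; exact g.1.2)

theorem toMat_transposeG (g : SO5 F) : toMat (transposeG g) = (toMat g)ᵀ := rfl

/-- The antidiagonal matrix as an element of `SO(3,2)`. -/
def longG : SO5 F :=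
  mkG !![0, 0, 0, 0, 1; 0, 0, 0, 1, 0; 0, 0, 1, 0, 0; 0, 1, 0, 0, 0; 1, 0, 0, 0, 0] (by
    rw [J_eq]
    ext i j
    fin_cases i <;> fin_cases j <;> simp [Matrix.mul_apply, Fin.sum_univ_five]) (by
    simp [Matrix.det_succ_row_zero, Fin.sum_univ_succ, Fin.succAbove]
    norm_num)

/-- The permutation exchanging the coordinates `1, 2` and the coordinates `4, 5`. -/
def swapG : SO5 F :=
  mkG !![0, 1, 0, 0, 0; 1, 0, 0, 0, 0; 0, 0, 1, 0, 0; 0, 0, 0, 0, 1; 0, 0, 0, 1, 0] (by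
    rw [J_eq]
    ext i j
    fin_cases i <;> fin_cases j <;> simp [Matrix.mul_apply, Fin.sum_univ_five]) (by
    simp [Matrix.det_succ_row_zero, Fin.sum_univ_succ, Fin.succAbove])

/-- The reflection of the short root `β`. -/
def reflG : SO5 F :=
  mkG !![1, 0, 0, 0, 0; 0, 0, 0, 1, 0; 0, 0, -1, 0, 0; 0, 1, 0, 0, 0; 0, 0, 0, 0, 1] (by
    rw [J_eq]
    ext i j
    fin_cases i <;> fin_cases j <;> simp [Matrix.mul_apply, Fin.sum_univ_five]) (by
    simp [Matrix.det_succ_row_zero, Fin.sum_univ_succ, Fin.succAbove])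

/-- The elements of the unipotent radical of the stabilizer of an isotropic line. -/
def unipG (h2 : (2 : F) ≠ 0) (y₁ y₂ y₃ : F) : SO5 F :=
  mkG !![1, -y₃, -y₂, -y₁, -(y₁ * y₃ + y₂ ^ 2 / 2); 0, 1, 0, 0, y₁; 0, 0, 1, 0, y₂;
    0, 0, 0, 1, y₃; 0, 0, 0, 0, 1] (by
    rw [J_eq]
    ext i j
    fin_cases i <;> fin_cases j <;> simp [Matrix.mul_apply, Fin.sum_univ_five]
    field_simp
    ring) (by
    simp [Matrix.det_succ_row_zero, Fin.sum_univ_succ, Fin.succAbove])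

/-- The elements of the root subgroup of the short root `β`. -/
def shortG (h2 : (2 : F) ≠ 0) (x : F) : SO5 F :=
  mkG !![1, 0, 0, 0, 0; 0, 1, x, -(x ^ 2 / 2), 0; 0, 0, 1, -x, 0; 0, 0, 0, 1, 0;
    0, 0, 0, 0, 1] (by
    rw [J_eq]
    ext i j
    fin_cases i <;> fin_cases j <;> simp [Matrix.mul_apply, Fin.sum_univ_five]
    field_simp
    ring) (by
    simp [Matrix.det_succ_row_zero, Fin.sum_univ_succ, Fin.succAbove])

/-- The elements `diag(α, 1, 1, 1, α⁻¹)`. -/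
def torusG (a : Fˣ) : SO5 F :=
  mkG (Matrix.diagonal ![(a : F), 1, 1, 1, ((a⁻¹ : Fˣ) : F)]) (by
    rw [J_eq]
    ext i j
    fin_cases i <;> fin_cases j <;>
      simp [Matrix.mul_apply, Matrix.diagonal]) (by
    simp [Matrix.det_diagonal, Fin.prod_univ_five])

theorem longG_mulVec (v : Fin 5 → F) : toMat longG *ᵥ v = ![v 4, v 3, v 2, v 1, v 0] := by
  ext i
  fin_cases i <;> simp [longG, mkG, toMat, Matrix.mulVec, dotProduct, Fin.sum_univ_five]

theorem swapG_mulVec (v : Fin 5 → F) : toMat swapG *ᵥ v = ![v 1, v 0, v 2, v 4, v 3] := by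
  ext i
  fin_cases i <;> simp [swapG, mkG, toMat, Matrix.mulVec, dotProduct, Fin.sum_univ_five]

theorem reflG_mulVec (v : Fin 5 → F) : toMat reflG *ᵥ v = ![v 0, v 3, -v 2, v 1, v 4] := by
  ext i
  fin_cases i <;> simp [reflG, mkG, toMat, Matrix.mulVec, dotProduct, Fin.sum_univ_five]

theorem unipG_mulVec (h2 : (2 : F) ≠ 0) (y₁ y₂ y₃ : F) (v : Fin 5 → F) :
    toMat (unipG h2 y₁ y₂ y₃) *ᵥ v =
      ![v 0 - v 1 * y₃ - v 2 * y₂ - v 3 * y₁ - v 4 * (y₁ * y₃ + y₂ ^ 2 / 2), v 1 + v 4 * y₁,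
        v 2 + v 4 * y₂, v 3 + v 4 * y₃, v 4] := by
  ext i
  fin_cases i <;> simp [unipG, mkG, toMat, Matrix.mulVec, dotProduct, Fin.sum_univ_five] <;> ring

theorem shortG_vecMul (h2 : (2 : F) ≠ 0) (x : F) (v : Fin 5 → F) :
    v ᵥ* toMat (shortG h2 x) =
      ![v 0, v 1, v 1 * x + v 2, -(v 1 * x ^ 2 / 2) - v 2 * x + v 3, v 4] := by
  ext i
  fin_cases i <;> simp [shortG, mkG, toMat, Matrix.vecMul, dotProduct, Fin.sum_univ_five]
  ring

theorem torusG_mulVec (a : Fˣ) (v : Fin 5 → F) :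
    toMat (torusG a) *ᵥ v = ![a * v 0, v 1, v 2, v 3, (a : F)⁻¹ * v 4] := by
  ext i
  fin_cases i <;> simp [torusG, mkG, toMat, Matrix.mulVec_diagonal]

theorem vecMul_eq_transposeG_mulVec (g : SO5 F) (v : Fin 5 → F) :
    v ᵥ* toMat g = toMat (transposeG g) *ᵥ v := by
  rw [toMat_transposeG, mulVec_transpose]

theorem form_mulVec (g : SO5 F) (v : Fin 5 → F) :
    (toMat g *ᵥ v) ⬝ᵥ (J F *ᵥ (toMat g *ᵥ v)) = v ⬝ᵥ (J F *ᵥ v) := by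
  conv_rhs => rw [← toMat_form g]
  rw [← mulVec_mulVec, ← mulVec_mulVec, dotProduct_mulVec v (toMat g)ᵀ, vecMul_transpose]

end Elements

/-! ### The maximal compact subgroup and its orbits -/

section Compact

variable {F : Type*} [NontriviallyNormedField F] [IsUltrametricDist F]

theorem norm_sum_le_ultrametric {ι : Type*} (s : Finset ι) (f : ι → F) {r : ℝ} (hr : 0 ≤ r)
    (h : ∀ i ∈ s, ‖f i‖ ≤ r) : ‖∑ i ∈ s, f i‖ ≤ r :=
  IsUltrametricDist.norm_sum_le_of_forall_le_of_nonneg hr h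

theorem transposeG_mem_KG {k : SO5 F} (hk : k ∈ KG F) : transposeG k ∈ KG F :=
  mem_KG.2 fun i j => mem_KG.1 hk j i

theorem norm_mulVec_KG_le {k : SO5 F} (hk : k ∈ KG F) (v : Fin 5 → F) : ‖toMat k *ᵥ v‖ ≤ ‖v‖ := by
  rw [pi_norm_le_iff_of_nonneg (norm_nonneg _)]
  intro i
  change ‖∑ j, toMat k i j * v j‖ ≤ ‖v‖
  refine norm_sum_le_ultrametric _ _ (norm_nonneg v) fun j _ => ?_
  rw [norm_mul]
  exact (mul_le_of_le_one_left (norm_nonneg (v j)) (mem_KG.1 hk i j)).trans (norm_le_pi_norm v j)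

theorem norm_mulVec_KG {k : SO5 F} (hk : k ∈ KG F) (v : Fin 5 → F) : ‖toMat k *ᵥ v‖ = ‖v‖ := by
  refine le_antisymm (norm_mulVec_KG_le hk v) ?_
  have := norm_mulVec_KG_le ((KG F).inv_mem hk) (toMat k *ᵥ v)
  rwa [mulVec_mulVec, ← toMat_mul, inv_mul_cancel, toMat_one, one_mulVec] at this

theorem norm_vecMul_KG {k : SO5 F} (hk : k ∈ KG F) (v : Fin 5 → F) : ‖v ᵥ* toMat k‖ = ‖v‖ := by
  rw [vecMul_eq_transposeG_mulVec, norm_mulVec_KG (transposeG_mem_KG hk)]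

theorem isInducing_toMat : Topology.IsInducing (toMat : SO5 F → Matrix (Fin 5) (Fin 5) F) :=
  Topology.IsInducing.subtypeVal.comp Topology.IsInducing.subtypeVal

theorem isCompact_KG [LocallyCompactSpace F] : IsCompact (KG F : Set (SO5 F)) := by
  rw [isInducing_toMat.isCompact_iff]
  let B : Set (Matrix (Fin 5) (Fin 5) F) := {m | ∀ i j, ‖m i j‖ ≤ 1}
  have hB : IsCompact B := by
    have : B = Set.pi Set.univ fun i : Fin 5 => Set.pi Set.univ fun j : Fin 5 =>
        {x : F | ‖x‖ ≤ 1} := by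
      ext m
      exact ⟨fun h i _ j _ => h i j, fun h i j => h i trivial j trivial⟩
    rw [this]
    exact isCompact_univ_pi fun i => isCompact_univ_pi fun j => isCompact_norm_le 1
  have h : toMat '' (KG F : Set (SO5 F)) = B ∩ {m | mᵀ * J F * m = J F ∧ m.det = 1} := by
    ext m
    constructor
    · rintro ⟨k, hk, rfl⟩
      exact ⟨mem_KG.1 hk, toMat_form k, k.1.2⟩
    · rintro ⟨h1, h2, h3⟩
      exact ⟨mkG m h2 h3, mem_KG.2 h1, rfl⟩
  rw [h]
  refine hB.inter_right ?_
  refine (isClosed_eq ?_ continuous_const).inter (isClosed_eq ?_ continuous_const)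
  · fun_prop
  · exact Continuous.matrix_det continuous_id

theorem longG_mem_KG : (longG : SO5 F) ∈ KG F := mem_KG.2 fun i j => by
  fin_cases i <;> fin_cases j <;> simp [longG, mkG, toMat]

theorem swapG_mem_KG : (swapG : SO5 F) ∈ KG F := mem_KG.2 fun i j => by
  fin_cases i <;> fin_cases j <;> simp [swapG, mkG, toMat]

theorem reflG_mem_KG : (reflG : SO5 F) ∈ KG F := mem_KG.2 fun i j => by
  fin_cases i <;> fin_cases j <;> simp [reflG, mkG, toMat]

theorem ne_zero_of_norm_two (h2 : ‖(2 : F)‖ = 1) : (2 : F) ≠ 0 := by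
  rintro h
  rw [h, norm_zero] at h2
  exact zero_ne_one h2

theorem unipG_mem_KG (h2 : ‖(2 : F)‖ = 1) {y₁ y₂ y₃ : F} (h₁ : ‖y₁‖ ≤ 1) (h₂ : ‖y₂‖ ≤ 1)
    (h₃ : ‖y₃‖ ≤ 1) : unipG (ne_zero_of_norm_two h2) y₁ y₂ y₃ ∈ KG F := by
  have h : ‖y₁ * y₃ + y₂ ^ 2 / 2‖ ≤ 1 := by
    refine norm_add_le_of_le (norm_mul_le_one h₁ h₃) ?_
    rw [norm_div, h2, div_one, norm_pow]
    exact pow_le_one₀ (norm_nonneg _) h₂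
  refine mem_KG.2 fun i j => ?_
  fin_cases i <;> fin_cases j <;> simp [unipG, mkG, toMat, h₁, h₂, h₃]
  rw [← norm_neg]
  simpa using h

theorem shortG_mem_KG (h2 : ‖(2 : F)‖ = 1) {x : F} (hx : ‖x‖ ≤ 1) :
    shortG (ne_zero_of_norm_two h2) x ∈ KG F := by
  refine mem_KG.2 fun i j => ?_
  have : ‖x‖ ^ 2 ≤ 1 := pow_le_one₀ (norm_nonneg _) hx
  fin_cases i <;> fin_cases j <;> simp [shortG, mkG, toMat, hx, h2, this]

theorem torusG_mem_KG {a : Fˣ} (ha : ‖(a : F)‖ = 1) : torusG a ∈ KG F := by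
  refine mem_KG.2 fun i j => ?_
  fin_cases i <;> fin_cases j <;> simp [torusG, mkG, toMat, Matrix.diagonal, ha]

theorem exists_norm_apply_eq (v : Fin 5 → F) : ∃ i, ‖v i‖ = ‖v‖ := by
  by_contra h
  push Not at h
  have h1 : ∀ i, ‖v i‖ < ‖v‖ := fun i => lt_of_le_of_ne (norm_le_pi_norm v i) (h i)
  have h0 : 0 < ‖v‖ := (norm_nonneg _).trans_lt (h1 0)
  exact lt_irrefl _ ((pi_norm_lt_iff h0).2 h1)

/-- Permutations in K bring a maximal coordinate to the last place. A maximal middle coordinate is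
first subtracted from the first one by a unipotent element; as both end coordinates are then
strictly smaller, no cancellation occurs. -/
theorem exists_mulVec_last (h2 : ‖(2 : F)‖ = 1) (v : Fin 5 → F) :
    ∃ k ∈ KG F, ‖(toMat k *ᵥ v) 4‖ = ‖v‖ := by
  by_cases h0 : ‖v 0‖ = ‖v‖
  · exact ⟨longG, longG_mem_KG, by rw [longG_mulVec]; simpa using h0⟩
  by_cases h4 : ‖v 4‖ = ‖v‖
  · exact ⟨1, (KG F).one_mem, by rw [toMat_one, one_mulVec]; exact h4⟩
  obtain ⟨i, hi⟩ := exists_norm_apply_eq v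
  fin_cases i
  · exact absurd hi h0
  · refine ⟨longG * swapG, (KG F).mul_mem longG_mem_KG swapG_mem_KG, ?_⟩
    rw [toMat_mul, ← mulVec_mulVec, swapG_mulVec, longG_mulVec]
    simpa using hi
  · refine ⟨longG * unipG (ne_zero_of_norm_two h2) 0 1 0,
      (KG F).mul_mem longG_mem_KG (unipG_mem_KG h2 (by simp) (by simp) (by simp)), ?_⟩
    rw [toMat_mul, ← mulVec_mulVec, unipG_mulVec, longG_mulVec]
    have h0' : ‖v 0‖ < ‖v 2‖ := by
      rw [show ‖v 2‖ = ‖v‖ from hi]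
      exact lt_of_le_of_ne (norm_le_pi_norm v 0) h0
    have h4' : ‖v 4 * (1 ^ 2 / 2)‖ < ‖v 2‖ := by
      rw [show ‖v 2‖ = ‖v‖ from hi, norm_mul, norm_div, h2]
      simpa using lt_of_le_of_ne (norm_le_pi_norm v 4) h4
    have h5 : ‖v 2‖ = ‖(v 0 - v 2 - v 4 * (1 ^ 2 / 2))‖ := by
      have e : v 0 - v 2 - v 4 * (1 ^ 2 / 2) = (v 0 - v 4 * (1 ^ 2 / 2)) + -v 2 := by ring
      rw [e, norm_add_eq_of_lt, norm_neg]
      rw [norm_neg]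
      refine (norm_sub_le_of_le (le_max_left _ _) (le_max_right _ _)).trans_lt (max_lt h0' h4')
    rw [← show ‖v 2‖ = ‖v‖ from hi, h5]
    simp
  · refine ⟨swapG, swapG_mem_KG, ?_⟩
    rw [swapG_mulVec]
    simpa using hi
  · exact absurd hi h4

/-- Every nonzero vector can be moved by `K` into the span of the first and the last basis
vector. -/
theorem exists_mulVec_eq (h2 : ‖(2 : F)‖ = 1) {v : Fin 5 → F} (hv : v ≠ 0) :
    ∃ k ∈ KG F, ∃ l : Fˣ, ‖(l : F)‖ = ‖v‖ ∧
      toMat k *ᵥ v = ![(v ⬝ᵥ (J F *ᵥ v)) / (2 * l), 0, 0, 0, (l : F)] := by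
  obtain ⟨k, hk, h⟩ := exists_mulVec_last h2 v
  have h20 := ne_zero_of_norm_two h2
  set w := toMat k *ᵥ v with hw
  have hwv : ‖w‖ = ‖v‖ := norm_mulVec_KG hk v
  have hl0 : w 4 ≠ 0 := by
    rw [← norm_ne_zero_iff, h]
    exact norm_ne_zero_iff.2 hv
  have hle : ∀ i, ‖-(w i / w 4)‖ ≤ 1 := fun i => by
    rw [norm_neg, norm_div, h, ← hwv]
    exact div_le_one_of_le₀ (norm_le_pi_norm w i) (norm_nonneg _)
  -- The last coordinate dominates, so the unipotent element that clears the three middle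
  -- coordinates is integral. The first coordinate is then forced by the value of the quadratic
  -- form.
  refine ⟨unipG h20 (-(w 1 / w 4)) (-(w 2 / w 4)) (-(w 3 / w 4)) * k,
    (KG F).mul_mem (unipG_mem_KG h2 (hle 1) (hle 2) (hle 3)) hk, Units.mk0 _ hl0, h, ?_⟩
  rw [toMat_mul, ← mulVec_mulVec, ← hw, unipG_mulVec, ← form_mulVec k v, ← hw, form_eq]
  simp only [Units.val_mk0]
  ext i
  fin_cases i
  · simp only [Fin.zero_eta, Matrix.cons_val_zero]
    field_simp
    ring
  all_goals simp
  all_goals field_simp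
  all_goals ring

/-- Vectors of the same norm and the same value of the quadratic form are in the same `K`-orbit. -/
theorem exists_mulVec_eq_of_form_eq (h2 : ‖(2 : F)‖ = 1) {v w : Fin 5 → F} (hv : v ≠ 0)
    (hvw : ‖v‖ = ‖w‖) (h : v ⬝ᵥ (J F *ᵥ v) = w ⬝ᵥ (J F *ᵥ w)) :
    ∃ k ∈ KG F, toMat k *ᵥ v = w := by
  have h20 := ne_zero_of_norm_two h2
  have hw : w ≠ 0 := by
    rw [← norm_ne_zero_iff, ← hvw]
    exact norm_ne_zero_iff.2 hv
  obtain ⟨k, hk, l, hl, e⟩ := exists_mulVec_eq h2 hv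
  obtain ⟨k', hk', l', hl', e'⟩ := exists_mulVec_eq h2 hw
  -- The two normal forms differ only by the scalars l and l' of equal norm, hence by an element of
  -- the torus in K.
  have hu : ‖((l * l'⁻¹ : Fˣ) : F)‖ = 1 := by
    rw [Units.val_mul, norm_mul, hl, hvw, ← hl', Units.val_inv_eq_inv_val, norm_inv,
      mul_inv_cancel₀ (by simp)]
  refine ⟨k'⁻¹ * (torusG (l * l'⁻¹) * k),
    (KG F).mul_mem ((KG F).inv_mem hk') ((KG F).mul_mem (torusG_mem_KG hu) hk), ?_⟩
  have e2 : toMat (torusG (l * l'⁻¹) * k) *ᵥ v = toMat k' *ᵥ w := by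
    rw [toMat_mul, ← mulVec_mulVec, e, e', torusG_mulVec, h]
    ext i
    fin_cases i <;> simp
    field_simp
  rw [toMat_mul, ← mulVec_mulVec, e2, mulVec_mulVec, ← toMat_mul, inv_mul_cancel, toMat_one,
    one_mulVec]

end Compact

/-! ### The Iwasawa decomposition -/

section Iwasawa

variable {F : Type*} [NontriviallyNormedField F] [IsUltrametricDist F]

theorem row_mul (g k : SO5 F) (i : Fin 5) : toMat (g * k) i = toMat g i ᵥ* toMat k := by
  ext j
  rw [toMat_mul, Matrix.mul_apply]
  rfl

theorem row_ne_zero (g : SO5 F) (i : Fin 5) : toMat g i ≠ 0 := by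
  intro h
  have := rows_form g i (Fin.rev i)
  simp [h, J] at this

theorem form_row (g : SO5 F) {i : Fin 5} (hi : i ≠ 2) :
    toMat g i ⬝ᵥ (J F *ᵥ toMat g i) = 0 := by
  rw [form_eq]
  have := rows_form g i i
  have hJ : J F i i = 0 := by
    fin_cases i <;> simp_all [J_eq]
  rw [hJ] at this
  linear_combination this

/-- The relations between rows do the rest: orthogonality to the last row clears the first column,
and orthogonality of the third and fourth rows clears the remaining entry below the diagonal. -/
theorem upper_of_rows {g : SO5 F} (h4 : ∀ j : Fin 5, j < 4 → toMat g 4 j = 0)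
    (h3 : ∀ j : Fin 5, j < 3 → toMat g 3 j = 0) : ∀ i j : Fin 5, j < i → toMat g i j = 0 := by
  have h44 : toMat g 4 4 ≠ 0 := by
    intro h
    refine row_ne_zero g 4 (funext fun j => ?_)
    by_cases hj : j < 4
    · exact h4 j hj
    · rw [show j = 4 by omega, h]; rfl
  have e4 := fun i => rows_form g i 4
  simp only [h4 0 (by decide), h4 1 (by decide), h4 2 (by decide), h4 3 (by decide), mul_zero,
    add_zero] at e4
  have h30 := h3 0 (by decide)
  have h20 : toMat g 2 0 = 0 := by
    have := e4 2
    simp [J_eq, h44] at this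
    exact this
  have h10 : toMat g 1 0 = 0 := by
    have := e4 1
    simp [J_eq, h44] at this
    exact this
  have h33 : toMat g 3 3 ≠ 0 := by
    intro h
    have := rows_form g 3 1
    simp [J_eq, h3 0 (by decide), h3 1 (by decide), h3 2 (by decide), h,
      h10] at this
  have h21 : toMat g 2 1 = 0 := by
    have := rows_form g 2 3
    simp [J_eq, h3 0 (by decide), h3 1 (by decide), h3 2 (by decide), h20,
      h33] at this
    exact this
  intro i j hij
  fin_cases i <;> fin_cases j <;> simp at hij <;>
    first
      | exact h4 _ (by decide)
      | exact h3 _ (by decide)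
      | assumption

/-- The last row is isotropic, so K moves it to a multiple of the last coordinate vector. In the
fourth row a reflection makes the second entry dominate the fourth; isotropy then bounds the middle
entry. A short root element clears the middle entry and, again by isotropy, the fourth one, and a
reflection puts the surviving entry in place. -/
theorem iwasawaG (h2 : ‖(2 : F)‖ = 1) (g : SO5 F) : ∃ b : BorelG F, ∃ k ∈ KG F, g = b.1 * k := by
  have h20 := ne_zero_of_norm_two h2
  suffices ∃ k ∈ KG F, ∀ i j : Fin 5, j < i → toMat (g * k) i j = 0 by
    obtain ⟨k, hk, h⟩ := this
    exact ⟨⟨g * k, h⟩, k⁻¹, (KG F).inv_mem hk, by group⟩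
  obtain ⟨k, hk, l, hl, e⟩ := exists_mulVec_eq h2 (row_ne_zero g 4)
  rw [form_row g (by decide), zero_div] at e
  have e4 : toMat (g * transposeG k) 4 = ![0, 0, 0, 0, (l : F)] := by
    rw [row_mul, toMat_transposeG, vecMul_transpose, e]
  obtain ⟨g', hg'⟩ : ∃ g', g' = g * transposeG k := ⟨_, rfl⟩
  rw [← hg'] at e4
  suffices ∃ k ∈ KG F, ∀ i j : Fin 5, j < i → toMat (g' * k) i j = 0 by
    obtain ⟨k', hk', h⟩ := this
    exact ⟨transposeG k * k', (KG F).mul_mem (transposeG_mem_KG hk) hk', by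
      rwa [← mul_assoc, ← hg']⟩
  have h30 : toMat g' 3 0 = 0 := by
    have := rows_form g' 3 4
    rw [e4] at this
    simpa [J_eq] using this
  -- normalize the fourth row
  obtain ⟨k₁, hk₁, h41, h301, hle⟩ : ∃ k ∈ KG F, toMat (g' * k) 4 = ![0, 0, 0, 0, (l : F)] ∧
      toMat (g' * k) 3 0 = 0 ∧ ‖toMat (g' * k) 3 3‖ ≤ ‖toMat (g' * k) 3 1‖ := by
    by_cases h : ‖toMat g' 3 3‖ ≤ ‖toMat g' 3 1‖
    · exact ⟨1, (KG F).one_mem, by rwa [mul_one], by rwa [mul_one], by rwa [mul_one]⟩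
    · have hr : ∀ i, toMat (g' * transposeG reflG) i = ![toMat g' i 0, toMat g' i 3, -toMat g' i 2,
          toMat g' i 1, toMat g' i 4] := fun i => by
        rw [row_mul, toMat_transposeG, vecMul_transpose, reflG_mulVec]
      refine ⟨transposeG reflG, transposeG_mem_KG reflG_mem_KG, ?_, ?_, ?_⟩
      · rw [hr, e4]; simp
      · rw [hr, h30]; simp
      · rw [hr]
        simpa using (not_le.1 h).le
  obtain ⟨g₁, hg₁⟩ : ∃ g₁, g₁ = g' * k₁ := ⟨_, rfl⟩
  rw [← hg₁] at h41 h301 hle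
  have hform := form_row g₁ (i := 3) (by decide)
  rw [form_eq, h301] at hform
  have h31 : toMat g₁ 3 1 ≠ 0 := by
    intro h
    have h33 : toMat g₁ 3 3 = 0 := by simpa [h] using hle
    have h32 : toMat g₁ 3 2 = 0 := by simpa [h, h33] using hform
    have := rows_form g₁ 3 1
    have h10 : toMat g₁ 1 0 = 0 := by
      have := rows_form g₁ 1 4
      rw [h41] at this
      simpa [J_eq] using this
    simp [J_eq, h, h301, h32, h33, h10] at this
  have h32 : ‖toMat g₁ 3 2‖ ≤ ‖toMat g₁ 3 1‖ := by
    have h3 : ‖toMat g₁ 3 2‖ ^ 2 = ‖toMat g₁ 3 1‖ * ‖toMat g₁ 3 3‖ := by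
      have : toMat g₁ 3 2 ^ 2 = -(2 * toMat g₁ 3 1 * toMat g₁ 3 3) := by linear_combination hform
      rw [← norm_pow, this, norm_neg, norm_mul, norm_mul, h2, one_mul]
    refine abs_le_of_sq_le_sq' ?_ (norm_nonneg _) |>.2
    nlinarith [norm_nonneg (toMat g₁ 3 1)]
  have hx : ‖-(toMat g₁ 3 2 / toMat g₁ 3 1)‖ ≤ 1 := by
    rw [norm_neg, norm_div]
    exact div_le_one_of_le₀ h32 (norm_nonneg _)
  have hr : ∀ i, toMat (g₁ * (shortG h20 (-(toMat g₁ 3 2 / toMat g₁ 3 1)) * transposeG reflG)) i =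
      _ := fun i => by
    rw [← mul_assoc, row_mul, row_mul, shortG_vecMul, toMat_transposeG, vecMul_transpose,
      reflG_mulVec]
  refine ⟨k₁ * (shortG h20 (-(toMat g₁ 3 2 / toMat g₁ 3 1)) * transposeG reflG),
    (KG F).mul_mem hk₁ ((KG F).mul_mem (shortG_mem_KG h2 hx) (transposeG_mem_KG reflG_mem_KG)), ?_⟩
  rw [← mul_assoc k₁, ← mul_assoc, ← mul_assoc, ← hg₁, mul_assoc]
  refine upper_of_rows (fun j hj => ?_) fun j hj => ?_
  · rw [hr, h41]
    fin_cases j <;> simp at hj ⊢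
  · rw [hr]
    fin_cases j <;> simp at hj ⊢
    · exact h301
    · field_simp
      linear_combination hform
    · field_simp
      ring

end Iwasawa

end SO5PGL2

namespace SO5PGL2

/-! ### The Satake transform of `SO(3,2)` -/

section Rows

variable {F : Type*} [NontriviallyNormedField F]

/-- The exterior product of the last two rows. -/
def wedge (g : SO5 F) : Fin 5 → Fin 5 → F := fun i j =>
  toMat g 3 i * toMat g 4 j - toMat g 4 i * toMat g 3 j

theorem borelG_mul_row_four (b : BorelG F) (g : SO5 F) :
    toMat (b.1 * g) 4 = toMat b.1 4 4 • toMat g 4 := by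
  ext j
  rw [toMat_mul, Matrix.mul_apply, Fin.sum_univ_five, b.2 4 0 (by decide), b.2 4 1 (by decide),
    b.2 4 2 (by decide), b.2 4 3 (by decide)]
  simp

theorem borelG_mul_row_three (b : BorelG F) (g : SO5 F) :
    toMat (b.1 * g) 3 = toMat b.1 3 3 • toMat g 3 + toMat b.1 3 4 • toMat g 4 := by
  ext j
  rw [toMat_mul, Matrix.mul_apply, Fin.sum_univ_five, b.2 3 0 (by decide), b.2 3 1 (by decide),
    b.2 3 2 (by decide)]
  simp

theorem borelG_mul_wedge (b : BorelG F) (g : SO5 F) :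
    wedge (b.1 * g) = (toMat b.1 3 3 * toMat b.1 4 4) • wedge g := by
  ext i j
  simp only [wedge, borelG_mul_row_four, borelG_mul_row_three, Pi.smul_apply, Pi.add_apply,
    smul_eq_mul]
  ring

theorem borelG_zero_four (b : BorelG F) : toMat b.1 0 0 * toMat b.1 4 4 = 1 := by
  have := rows_form b.1 0 4
  rw [b.2 4 0 (by decide), b.2 4 1 (by decide),
    b.2 4 2 (by decide), b.2 4 3 (by decide)] at this
  simpa [J_eq] using this

theorem borelG_one_three (b : BorelG F) : toMat b.1 1 1 * toMat b.1 3 3 = 1 := by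
  have := rows_form b.1 1 3
  rw [b.2 3 0 (by decide), b.2 3 1 (by decide),
    b.2 3 2 (by decide), b.2 1 0 (by decide)] at this
  simpa [J_eq] using this

theorem borelG_two_two (b : BorelG F) : toMat b.1 2 2 ^ 2 = 1 := by
  have := rows_form b.1 2 2
  rw [b.2 2 0 (by decide), b.2 2 1 (by decide)] at this
  simpa [J_eq, sq] using this

end Rows

section Satake

variable {F : Type*} [NontriviallyNormedField F] [IsUltrametricDist F] {ϖ : Fˣ}

theorem norm_row_mul_KG {k : SO5 F} (hk : k ∈ KG F) (g : SO5 F) (i : Fin 5) :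
    ‖toMat (g * k) i‖ = ‖toMat g i‖ := by
  rw [row_mul, norm_vecMul_KG hk]

theorem norm_wedge_mul_KG {k : SO5 F} (hk : k ∈ KG F) (g : SO5 F) : ‖wedge (g * k)‖ = ‖wedge g‖ := by
  have key : ∀ (g : SO5 F), ∀ k ∈ KG F, ‖wedge (g * k)‖ ≤ ‖wedge g‖ := by
    intro g k hk
    rw [pi_norm_le_iff_of_nonneg (norm_nonneg _)]
    intro i
    rw [pi_norm_le_iff_of_nonneg (norm_nonneg _)]
    intro j
    have : wedge (g * k) i j = ∑ a, ∑ b, toMat k a i * toMat k b j * wedge g a b := by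
      simp only [wedge, toMat_mul, Matrix.mul_apply, Finset.sum_mul_sum, ← Finset.sum_sub_distrib]
      refine Finset.sum_congr rfl fun a _ => Finset.sum_congr rfl fun b _ => ?_
      ring
    rw [this]
    refine norm_sum_le_ultrametric _ _ (norm_nonneg _) fun a _ =>
      norm_sum_le_ultrametric _ _ (norm_nonneg _) fun b _ => ?_
    rw [norm_mul]
    refine (mul_le_of_le_one_left (norm_nonneg (wedge g a b))
      (norm_mul_le_one (mem_KG.1 hk a i) (mem_KG.1 hk b j))).trans ?_
    exact (norm_le_pi_norm (wedge g a) b).trans (norm_le_pi_norm (wedge g) a)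
  refine le_antisymm (key g k hk) ?_
  have := key (g * k) k⁻¹ ((KG F).inv_mem hk)
  rwa [mul_inv_cancel_right] at this

theorem norm_row_one : ‖toMat (1 : SO5 F) 4‖ = 1 := by
  refine le_antisymm ((pi_norm_le_iff_of_nonneg zero_le_one).2 fun i =>
    mem_KG.1 (KG F).one_mem 4 i) ?_
  have := norm_le_pi_norm (toMat (1 : SO5 F) 4) 4
  simpa [toMat_one] using this

theorem norm_wedge_one : ‖wedge (1 : SO5 F)‖ = 1 := by
  refine le_antisymm ((pi_norm_le_iff_of_nonneg zero_le_one).2 fun i =>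
    (pi_norm_le_iff_of_nonneg zero_le_one).2 fun j => ?_) ?_
  · have h := mem_KG.1 (KG F).one_mem
    exact norm_sub_le_of_le (norm_mul_le_one (h _ _) (h _ _)) (norm_mul_le_one (h _ _) (h _ _))
  · have := (norm_le_pi_norm (wedge (1 : SO5 F) 3) 4).trans (norm_le_pi_norm (wedge (1 : SO5 F)) 3)
    simpa [wedge, toMat_one] using this

/-- The exponent of the norm of the last row. -/
noncomputable def rht (g : SO5 F) : ℤ := Int.log (resCard F) ‖toMat g 4‖

/-- The exponent of the norm of the exterior product of the last two rows. -/
noncomputable def wht (g : SO5 F) : ℤ := Int.log (resCard F) ‖wedge g‖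

theorem norm_row_borelG_mul (b : BorelG F) (g : SO5 F) :
    ‖toMat (b.1 * g) 4‖ = ‖toMat b.1 4 4‖ * ‖toMat g 4‖ := by
  rw [borelG_mul_row_four, norm_smul]

theorem norm_wedge_borelG_mul (b : BorelG F) (g : SO5 F) :
    ‖wedge (b.1 * g)‖ = ‖toMat b.1 3 3‖ * ‖toMat b.1 4 4‖ * ‖wedge g‖ := by
  rw [borelG_mul_wedge, norm_smul, norm_mul]

theorem rht_mul_KG {k : SO5 F} (hk : k ∈ KG F) (g : SO5 F) : rht (g * k) = rht g := by
  rw [rht, norm_row_mul_KG hk, rht]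

theorem wht_mul_KG {k : SO5 F} (hk : k ∈ KG F) (g : SO5 F) : wht (g * k) = wht g := by
  rw [wht, norm_wedge_mul_KG hk, wht]

variable (hu : IsUniformizer ϖ) (h2 : ‖(2 : F)‖ = 1)
include hu h2

theorem IsUniformizer.norm_row (g : SO5 F) : ‖toMat g 4‖ = (resCard F : ℝ) ^ rht g := by
  obtain ⟨b, k, hk, rfl⟩ := iwasawaG h2 g
  rw [rht_mul_KG hk, norm_row_mul_KG hk, rht, ← mul_one b.1, norm_row_borelG_mul, norm_row_one,
    mul_one]
  exact hu.norm_eq_zpow_lv (right_ne_zero_of_mul_eq_one (borelG_zero_four b))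

theorem IsUniformizer.norm_wedge (g : SO5 F) : ‖wedge g‖ = (resCard F : ℝ) ^ wht g := by
  obtain ⟨b, k, hk, rfl⟩ := iwasawaG h2 g
  rw [wht_mul_KG hk, norm_wedge_mul_KG hk, wht, ← mul_one b.1, norm_wedge_borelG_mul,
    norm_wedge_one, mul_one, ← norm_mul]
  exact hu.norm_eq_zpow_lv (mul_ne_zero (right_ne_zero_of_mul_eq_one (borelG_one_three b))
    (right_ne_zero_of_mul_eq_one (borelG_zero_four b)))

theorem IsUniformizer.rht_borelG_mul (b : BorelG F) (g : SO5 F) :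
    rht (b.1 * g) = lv (toMat b.1 4 4) + rht g := by
  have h := norm_row_borelG_mul b g
  rw [hu.norm_row h2, hu.norm_row h2,
    hu.norm_eq_zpow_lv (right_ne_zero_of_mul_eq_one (borelG_zero_four b)),
    ← zpow_add₀ hu.card_pos.ne', hu.zpow_inj] at h
  exact h

theorem IsUniformizer.wht_borelG_mul (b : BorelG F) (g : SO5 F) :
    wht (b.1 * g) = lv (toMat b.1 3 3) + lv (toMat b.1 4 4) + wht g := by
  have h := norm_wedge_borelG_mul b g
  rw [hu.norm_wedge h2, hu.norm_wedge h2,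
    hu.norm_eq_zpow_lv (right_ne_zero_of_mul_eq_one (borelG_zero_four b)),
    hu.norm_eq_zpow_lv (right_ne_zero_of_mul_eq_one (borelG_one_three b)),
    ← zpow_add₀ hu.card_pos.ne', ← zpow_add₀ hu.card_pos.ne', hu.zpow_inj] at h
  exact h

omit h2 in
theorem IsUniformizer.norm_of_mul_eq_one {x y : F} (h : x * y = 1) :
    ‖x‖ = (resCard F : ℝ) ^ (-lv y) := by
  rw [_root_.zpow_neg, ← hu.norm_eq_zpow_lv (right_ne_zero_of_mul_eq_one h), eq_inv_of_mul_eq_one_left h,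
    norm_inv]

omit h2 in
-- With the factor δ_B^{1/2} the character is |α|^{3/2+ζ}|β|, since the powers |β|^{±ζ} cancel; this
-- equals |α|^{1/2+ζ} |αβ|. Consequently ζ enters through the last row only, while the exterior
-- product of the last two rows has a fixed exponent.
theorem IsUniformizer.borelCharG_eq (ζ : ℂ) (b : BorelG F) :
    borelCharG ζ (1 / 2 + ζ) b =
      (sqrtCard F * satakeParam F ζ) ^ (-lv (toMat b.1 4 4)) *
        (resCard F : ℂ) ^ (-(lv (toMat b.1 3 3) + lv (toMat b.1 4 4))) := by
  have hq := hu.card_pos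
  have hs := hu.sqrtCard_ne_zero
  have hz := hu.satakeParam_ne_zero ζ
  have ha := hu.norm_of_mul_eq_one (borelG_zero_four b)
  have hb := hu.norm_of_mul_eq_one (borelG_one_three b)
  rw [neg_add_rev, ← hu.sqrtCard_sq, borelCharG, ha, hb]
  generalize -lv (toMat b.1 4 4) = m
  generalize -lv (toMat b.1 3 3) = n
  have h1 : ((((resCard F : ℝ) ^ m) ^ (3 / 2 : ℝ) * ((resCard F : ℝ) ^ n) ^ (1 / 2 : ℝ) : ℝ) : ℂ) =
      (sqrtCard F ^ m) ^ 3 * sqrtCard F ^ n := by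
    rw [Complex.ofReal_mul, hu.rpow_half, ← hu.rpow_half m, ← Complex.ofReal_pow,
      ← Real.rpow_mul_natCast (zpow_pos hq m).le]
    norm_num
  have h2 : (((resCard F : ℝ) ^ n : ℝ) : ℂ) ^ (1 / 2 + ζ) =
      sqrtCard F ^ n * satakeParam F ζ ^ n := by
    rw [Complex.cpow_add _ _ (by
      rw [Complex.ofReal_ne_zero]; exact (zpow_pos hq n).ne'), hu.zpow_cpow n ζ, ← hu.rpow_half n,
      Complex.ofReal_cpow (zpow_pos hq n).le]
    norm_num
  rw [h1, h2, ← zpow_sub₀ hq.ne', hu.zpow_cpow, zpow_sub₀ hz, sq, _root_.mul_zpow, _root_.mul_zpow,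
    zpow_add₀ hs]
  field_simp

/-- The function on `G` attached to the induced representation `I_G(ζ, 1/2 + ζ)`. -/
theorem IsUniformizer.satakeG_eq_wedge (μG : Measure (SO5 F)) [μG.IsHaarMeasure]
    (f : spherical (KG F)) (ζ : ℂ) :
    satakeG μG f ζ = ∫ g, (f : SO5 F → ℂ) g *
      ((sqrtCard F * satakeParam F ζ) ^ (-rht g) * (resCard F : ℂ) ^ (-wht g)) ∂μG := by
  have hw : sqrtCard F * satakeParam F ζ ≠ 0 :=
    mul_ne_zero hu.sqrtCard_ne_zero (hu.satakeParam_ne_zero ζ)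
  have hq : (resCard F : ℂ) ≠ 0 := by exact_mod_cast hu.card_pos.ne'
  refine finiteRankTrace_heckeOperator μG isOpen_KG f _ _ (iwasawaG h2) ?_ ?_ ?_
  · intro b g
    rw [hu.borelCharG_eq, hu.rht_borelG_mul h2, hu.wht_borelG_mul h2, neg_add, neg_add (_ + _),
      zpow_add₀ hw, zpow_add₀ hq]
    ring
  · intro k hk g
    rw [rht_mul_KG hk, wht_mul_KG hk]
  · have h1 : rht (1 : SO5 F) = 0 := by rw [rht, norm_row_one, Int.log_one_right]
    have h3 : wht (1 : SO5 F) = 0 := by rw [wht, norm_wedge_one, Int.log_one_right]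
    simp [h1, h3]

end Satake

/-! ### The intertwining integral along the short root -/

section Intertwining

variable {F : Type*} [NontriviallyNormedField F] [IsUltrametricDist F] {ϖ : Fˣ}

theorem reflG_row_four : toMat (reflG : SO5 F) 4 = ![0, 0, 0, 0, 1] := by
  ext i
  fin_cases i <;> simp [reflG, mkG, toMat]

theorem reflG_row_three : toMat (reflG : SO5 F) 3 = ![0, 1, 0, 0, 0] := by
  ext i
  fin_cases i <;> simp [reflG, mkG, toMat]

theorem reflG_shortG_mul_row_four (h2 : (2 : F) ≠ 0) (x : F) (g : SO5 F) :
    toMat (reflG * shortG h2 x * g) 4 = toMat g 4 := by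
  rw [row_mul, row_mul, reflG_row_four, shortG_vecMul]
  ext j
  simp [Matrix.vecMul, dotProduct, Fin.sum_univ_five]

theorem reflG_shortG_mul_row_three (h2 : (2 : F) ≠ 0) (x : F) (g : SO5 F) (j : Fin 5) :
    toMat (reflG * shortG h2 x * g) 3 j =
      toMat g 1 j + x * toMat g 2 j - x ^ 2 / 2 * toMat g 3 j := by
  rw [row_mul, row_mul, reflG_row_three, shortG_vecMul]
  simp [Matrix.vecMul, dotProduct, Fin.sum_univ_five]
  ring

/-- The last row keeps only its last entry, so the exterior product is measured by the other entries
of the fourth row. Isotropy gives these the norms β, βs and βs² beside a zero, where β is the norm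
of the second diagonal entry of b; their maximum is β max(1, s)². -/
theorem norm_wedge_reflG_shortG (h2 : ‖(2 : F)‖ = 1) (x : F) (b : BorelG F) :
    ‖wedge (reflG * shortG (ne_zero_of_norm_two h2) x * b.1)‖ =
      ‖toMat b.1 4 4‖ * ‖toMat b.1 1 1‖ *
        max 1 ‖(toMat b.1 1 1)⁻¹ * (x + toMat b.1 2 2 * toMat b.1 1 2)‖ ^ 2 := by
  have h20 := ne_zero_of_norm_two h2
  have h11 := left_ne_zero_of_mul_eq_one (borelG_one_three b)
  have h22 := borelG_two_two b
  have hn22 : ‖toMat b.1 2 2‖ = 1 := by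
    have := congrArg norm h22
    rw [norm_pow, norm_one] at this
    exact (pow_eq_one_iff_of_nonneg (norm_nonneg _) two_ne_zero).1 this
  obtain ⟨g, hg⟩ : ∃ g, g = reflG * shortG h20 x * b.1 := ⟨_, rfl⟩
  rw [← hg]
  have hr := reflG_shortG_mul_row_three h20 x b.1
  rw [← hg] at hr
  have hr4 := reflG_shortG_mul_row_four h20 x b.1
  rw [← hg] at hr4
  have e40 : toMat g 4 0 = 0 := by rw [hr4]; exact b.2 4 0 (by decide)
  have e41 : toMat g 4 1 = 0 := by rw [hr4]; exact b.2 4 1 (by decide)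
  have e42 : toMat g 4 2 = 0 := by rw [hr4]; exact b.2 4 2 (by decide)
  have e43 : toMat g 4 3 = 0 := by rw [hr4]; exact b.2 4 3 (by decide)
  have e44 : toMat g 4 4 = toMat b.1 4 4 := by rw [hr4]
  have e30 : toMat g 3 0 = 0 := by
    rw [hr, b.2 1 0 (by decide), b.2 2 0 (by decide), b.2 3 0 (by decide)]
    ring
  have e31 : toMat g 3 1 = toMat b.1 1 1 := by
    rw [hr, b.2 2 1 (by decide), b.2 3 1 (by decide)]
    ring
  obtain ⟨y, hy⟩ : ∃ y, y = toMat g 3 2 := ⟨_, rfl⟩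
  have hy' : y = toMat b.1 2 2 * (x + toMat b.1 2 2 * toMat b.1 1 2) := by
    rw [hy, hr, b.2 3 2 (by decide)]
    linear_combination -(toMat b.1 1 2) * h22
  have hyn : ‖x + toMat b.1 2 2 * toMat b.1 1 2‖ = ‖y‖ := by
    rw [hy', norm_mul, hn22, one_mul]
  have hu3 : ‖toMat b.1 1 1‖ * ‖toMat g 3 3‖ = ‖y‖ ^ 2 := by
    have := form_row g (i := 3) (by decide)
    rw [form_eq, e30, e31, ← hy] at this
    have e : toMat b.1 1 1 * toMat g 3 3 * 2 = -y ^ 2 := by linear_combination this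
    have := congrArg norm e
    rwa [norm_mul, norm_mul, norm_neg, norm_pow, h2, mul_one] at this
  have h11n : 0 < ‖toMat b.1 1 1‖ := norm_pos_iff.2 h11
  rw [norm_mul, norm_inv, hyn]
  set β := ‖toMat b.1 1 1‖
  set L := ‖toMat b.1 4 4‖ with hL
  have hL0 : 0 ≤ L := norm_nonneg _
  obtain ⟨s, hs⟩ : ∃ s, s = β⁻¹ * ‖y‖ := ⟨_, rfl⟩
  have hs0 : 0 ≤ s := hs ▸ by positivity
  have hys : ‖y‖ = β * s := by rw [hs]; field_simp
  have h33 : ‖toMat g 3 3‖ = β * s ^ 2 := by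
    have : β * ‖toMat g 3 3‖ = β * (β * s ^ 2) := by rw [hu3, hys]; ring
    exact mul_left_cancel₀ h11n.ne' this
  rw [← hs]
  have hm1 : 1 ≤ max 1 s ^ 2 := one_le_pow₀ (le_max_left _ _)
  have hms : s ≤ max 1 s ^ 2 := (le_max_right 1 s).trans (le_self_pow₀ (le_max_left _ _) two_ne_zero)
  have hms2 : s ^ 2 ≤ max 1 s ^ 2 := pow_le_pow_left₀ hs0 (le_max_right _ _) 2
  have hM : 0 ≤ L * β * max 1 s ^ 2 := by positivity
  have hj : ∀ j : Fin 5, j ≠ 4 → ‖toMat g 3 j * toMat g 4 4‖ ≤ L * β * max 1 s ^ 2 := by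
    intro j hj
    rw [norm_mul, e44, ← hL, mul_comm, mul_assoc]
    refine mul_le_mul_of_nonneg_left ?_ hL0
    fin_cases j
    · simp only [Fin.zero_eta, e30, norm_zero]; positivity
    · simp only [Fin.mk_one, e31]
      exact le_mul_of_one_le_right h11n.le hm1
    · simp only [Fin.reduceFinMk, ← hy, hys]
      exact mul_le_mul_of_nonneg_left hms h11n.le
    · simp only [Fin.reduceFinMk, h33]
      exact mul_le_mul_of_nonneg_left hms2 h11n.le
    · exact absurd rfl hj
  have h40 : ∀ j : Fin 5, j ≠ 4 → toMat g 4 j = 0 := by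
    intro j hj
    fin_cases j
    exacts [e40, e41, e42, e43, absurd rfl hj]
  refine le_antisymm ?_ ?_
  · refine (pi_norm_le_iff_of_nonneg hM).2 fun i => (pi_norm_le_iff_of_nonneg hM).2 fun j => ?_
    by_cases hi4 : i = 4 <;> by_cases hj4 : j = 4
    · rw [wedge, hi4, hj4, mul_comm, sub_self, norm_zero]; exact hM
    · rw [wedge, hi4, h40 j hj4, mul_zero, zero_sub, norm_neg, mul_comm]
      exact hj j hj4
    · rw [wedge, hj4, h40 i hi4, zero_mul, sub_zero]
      exact hj i hi4
    · rw [wedge, h40 i hi4, h40 j hj4, mul_zero, zero_mul, sub_zero, norm_zero]; exact hM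
  · have hw : ∀ j : Fin 5, j ≠ 4 → ‖toMat g 3 j‖ * L ≤ ‖wedge g‖ := by
      intro j hj
      have := (norm_le_pi_norm (wedge g j) 4).trans (norm_le_pi_norm (wedge g) j)
      rwa [wedge, h40 j hj, zero_mul, sub_zero, norm_mul, e44] at this
    rcases le_total s 1 with h | h
    · rw [max_eq_left h]
      have := hw 1 (by decide)
      rw [e31] at this
      linarith
    · rw [max_eq_right h]
      have := hw 3 (by decide)
      rw [h33] at this
      linarith

variable [LocallyCompactSpace F] [MeasurableSpace F] [BorelSpace F] {μF : Measure F}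
  [μF.IsAddHaarMeasure]

theorem IsUniformizer.exists_max_one_norm (hu : IsUniformizer ϖ) (x : F) :
    ∃ m : ℕ, max 1 ‖x‖ = (resCard F : ℝ) ^ (m : ℤ) := by
  rcases le_total ‖x‖ 1 with h | h
  · exact ⟨0, by simp [h]⟩
  · have hx : x ≠ 0 := by
      rintro rfl
      rw [norm_zero] at h
      exact absurd h (by norm_num)
    have h1 := hu.norm_eq_zpow_lv hx
    have h3 : 0 ≤ lv x := by
      rw [h1, ← zpow_zero (resCard F : ℝ), zpow_le_zpow_iff_right₀ hu.one_lt_card] at h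
      exact h
    refine ⟨(lv x).toNat, ?_⟩
    rw [max_eq_right h, h1, Int.toNat_of_nonneg h3]

/-- On the shell where max(1, |x|) = q^m the integrand is q^{-2m} and the volume is at most q^m, so
the shells are dominated by a geometric series. -/
theorem IsUniformizer.integrable_max_one (hu : IsUniformizer ϖ) (hμF : μF {x | ‖x‖ ≤ 1} = 1) :
    Integrable (fun x : F => (max 1 ‖x‖ ^ 2)⁻¹) μF := by
  have hq := hu.card_pos
  refine ⟨by fun_prop, ?_⟩
  rw [hasFiniteIntegral_iff_enorm]
  have hun : (Set.univ : Set F) = ⋃ m : ℕ, {x : F | max 1 ‖x‖ = (resCard F : ℝ) ^ (m : ℤ)} := by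
    ext x
    simpa using hu.exists_max_one_norm x
  rw [← setLIntegral_univ, hun]
  refine (lintegral_iUnion_le _ _).trans_lt ?_
  have hs : Summable fun m : ℕ => ((resCard F : ℝ)⁻¹) ^ m :=
    summable_geometric_of_lt_one (inv_pos.2 hq).le (inv_lt_one_of_one_lt₀ hu.one_lt_card)
  refine lt_of_le_of_lt (ENNReal.tsum_le_tsum fun m => ?_) hs.tsum_ofReal_lt_top
  have hmeas : MeasurableSet {x : F | max 1 ‖x‖ = (resCard F : ℝ) ^ (m : ℤ)} :=
    measurableSet_eq_fun (by fun_prop) (by fun_prop)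
  rw [setLIntegral_congr_fun (g := fun _ => ENNReal.ofReal (((resCard F : ℝ) ^ m) ^ 2)⁻¹) hmeas,
    setLIntegral_const]
  · refine (mul_le_mul_right (measure_mono (t := {x : F | ‖x‖ ≤ (resCard F : ℝ) ^ (m : ℤ)})
      fun x hx => (le_max_right _ _).trans (le_of_eq hx)) _).trans ?_
    rw [hu.measure_norm_le μF hμF, ← ENNReal.ofReal_mul (by positivity)]
    refine ENNReal.ofReal_le_ofReal (le_of_eq ?_)
    rw [_root_.zpow_natCast, inv_pow]
    field_simp
  · intro x hx
    have hx' : max 1 ‖x‖ = (resCard F : ℝ) ^ (m : ℤ) := hx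
    simp only [hx', _root_.zpow_natCast]
    rw [Real.enorm_eq_ofReal (by positivity)]

/-- The constant of the intertwining operator. -/
noncomputable def intertwiningConst (μF : Measure F) : ℂ :=
  ∫ x : F, (((max 1 ‖x‖ ^ 2)⁻¹ : ℝ) : ℂ) ∂μF

theorem IsUniformizer.intertwiningConst_ne_zero (hu : IsUniformizer ϖ)
    (hμF : μF {x | ‖x‖ ≤ 1} = 1) : intertwiningConst μF ≠ 0 := by
  have hI : intertwiningConst μF = ((∫ x : F, (max 1 ‖x‖ ^ 2)⁻¹ ∂μF : ℝ) : ℂ) :=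
    integral_ofReal (f := fun x : F => (max 1 ‖x‖ ^ 2)⁻¹)
  rw [hI, Complex.ofReal_ne_zero]
  refine ((integral_pos_iff_support_of_nonneg (fun x => by positivity)
    (hu.integrable_max_one hμF)).2 ?_).ne'
  have : Function.support (fun x : F => (max 1 ‖x‖ ^ 2)⁻¹) = Set.univ := by
    ext x
    have : (0 : ℝ) < max 1 ‖x‖ := zero_lt_one.trans_le (le_max_left _ _)
    simp [this.ne']
  rw [this, pos_iff_ne_zero]
  intro h
  have := measure_mono_null (Set.subset_univ {x : F | ‖x‖ ≤ 1}) h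
  rw [hμF] at this
  exact one_ne_zero this

/-- An affine change of variable normalizes the integrand; its Jacobian cancels the norm of the
second diagonal entry of b. Only the last diagonal entry is left, that is, the norm of the last row.
-/
theorem IsUniformizer.integral_wedge (hu : IsUniformizer ϖ) (h2 : ‖(2 : F)‖ = 1)
    (hμF : μF {x | ‖x‖ ≤ 1} = 1) (g : SO5 F) :
    ∫ x : F, (resCard F : ℂ) ^ (-wht (reflG * shortG (ne_zero_of_norm_two h2) x * g)) ∂μF =
      intertwiningConst μF * (resCard F : ℂ) ^ (-rht g) := by
  obtain ⟨b, k, hk, rfl⟩ := iwasawaG h2 g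
  have h11 := left_ne_zero_of_mul_eq_one (borelG_one_three b)
  have e : ∀ (n : ℤ), (resCard F : ℂ) ^ (-n) = ((((resCard F : ℝ) ^ n)⁻¹ : ℝ) : ℂ) := fun n => by
    rw [_root_.zpow_neg]
    push_cast
    rfl
  have h3 : ∀ x : F, (resCard F : ℂ) ^
      (-wht (reflG * shortG (ne_zero_of_norm_two h2) x * (b.1 * k))) =
      (((‖toMat b.1 4 4‖ * ‖toMat b.1 1 1‖)⁻¹ : ℝ) : ℂ) *
        (((max 1 ‖((Units.mk0 _ h11)⁻¹ : Fˣ) * (x + toMat b.1 2 2 * toMat b.1 1 2)‖ ^ 2)⁻¹ : ℝ) : ℂ) := by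
    intro x
    rw [← mul_assoc, wht_mul_KG hk, e, ← hu.norm_wedge h2, norm_wedge_reflG_shortG h2, mul_inv,
      Complex.ofReal_mul]
    simp
  have h4 : ‖toMat b.1 4‖ = ‖toMat b.1 4 4‖ := by
    have := norm_row_borelG_mul b 1
    rwa [norm_row_one, mul_one, mul_one] at this
  simp_rw [h3]
  rw [integral_const_mul, integral_add_right_eq_self (μ := μF) (fun x : F =>
    (((max 1 ‖((Units.mk0 _ h11)⁻¹ : Fˣ) * x‖ ^ 2)⁻¹ : ℝ) : ℂ)),
    hu.integral_mul μF hμF (Units.mk0 _ h11)⁻¹ (fun x : F => (((max 1 ‖x‖ ^ 2)⁻¹ : ℝ) : ℂ)),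
    rht_mul_KG hk, e, ← hu.norm_row h2, h4, ← mul_assoc, mul_comm, ← Complex.ofReal_mul]
  congr 2
  rw [Units.val_inv_eq_inv_val, Units.val_mk0, norm_inv, inv_inv, mul_inv, mul_assoc,
    inv_mul_cancel₀ (norm_ne_zero_iff.2 h11), mul_one]

/-- The Satake transform at `π_ζ` in terms of the norm of the last row. -/
theorem IsUniformizer.satakeG_eq (hu : IsUniformizer ϖ) (h2 : ‖(2 : F)‖ = 1)
    (hμF : μF {x | ‖x‖ ≤ 1} = 1) (μG : Measure (SO5 F)) [μG.IsHaarMeasure] (hμG : μG (KG F) = 1)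
    (f : spherical (KG F)) (ζ : ℂ) :
    satakeG μG f ζ = ∫ g, (f : SO5 F → ℂ) g *
      (sqrtCard F ^ 3 * satakeParam F ζ) ^ (-rht g) ∂μG := by
  have hw : sqrtCard F * satakeParam F ζ ≠ 0 :=
    mul_ne_zero hu.sqrtCard_ne_zero (hu.satakeParam_ne_zero ζ)
  have hq : (resCard F : ℂ) ≠ 0 := by exact_mod_cast hu.card_pos.ne'
  have h20 := ne_zero_of_norm_two h2
  have hc := hu.intertwiningConst_ne_zero hμF
  obtain ⟨s, hs⟩ := exists_integral_eq_sum_of_invariant μG isOpen_KG hμG f.2.2.1 f.2.2.2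
  rw [hs _ fun k hk g => by rw [rht_mul_KG hk]]
  -- The eigenvector identity for the spherical vector at the point `reflG * shortG h20 x`. Left
  -- translation by this point leaves the last row unchanged and affects only the exterior product.
  have h3 : ∀ x : F, ∫ g, (f : SO5 F → ℂ) g * ((sqrtCard F * satakeParam F ζ) ^ (-rht g) *
      (resCard F : ℂ) ^ (-wht (reflG * shortG h20 x * g))) ∂μG =
      satakeG μG f ζ * (resCard F : ℂ) ^ (-wht (reflG * shortG h20 x * 1)) := by
    intro x
    have h4 : ∀ g, rht (reflG * shortG h20 x * g) = rht g := fun g => by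
      rw [rht, reflG_shortG_mul_row_four, rht]
    have := integral_mul_eq_integral_mul_of_iwasawa μG f (fun b : BorelG F => b.1)
      (borelCharG ζ (1 / 2 + ζ)) (iwasawaG h2)
      (φ₀ := fun g => (sqrtCard F * satakeParam F ζ) ^ (-rht g) * (resCard F : ℂ) ^ (-wht g))
      ?_ ?_ ?_ (reflG * shortG h20 x)
    · simp only [h4] at this
      rw [this, hu.satakeG_eq_wedge h2]
      have h5 : rht (reflG * shortG h20 x) = 0 := by
        rw [← mul_one (reflG * shortG h20 x), h4, rht, norm_row_one, Int.log_one_right]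
      rw [h5, mul_one]
      simp
    · intro b g
      rw [hu.borelCharG_eq, hu.rht_borelG_mul h2, hu.wht_borelG_mul h2, neg_add, neg_add (_ + _),
        zpow_add₀ hw, zpow_add₀ hq]
      ring
    · intro k hk g
      rw [rht_mul_KG hk, wht_mul_KG hk]
    · have h1 : rht (1 : SO5 F) = 0 := by rw [rht, norm_row_one, Int.log_one_right]
      have h3 : wht (1 : SO5 F) = 0 := by rw [wht, norm_wedge_one, Int.log_one_right]
      simp [h1, h3]
  -- Integrating over x replaces q^{-`wht`} by the intertwining constant times q^{-`rht`} on both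
  -- sides. After cancelling the constant, the same eigenvalue is expressed by (q^{1/2} z ·
  -- q)^{-`rht`}.
  have h4 := congrArg (fun φ : F → ℂ => ∫ x, φ x ∂μF) (funext h3)
  have hr1 : rht (1 : SO5 F) = 0 := by rw [rht, norm_row_one, Int.log_one_right]
  simp only [integral_const_mul, hu.integral_wedge h2 hμF, hr1, neg_zero, _root_.zpow_zero]
    at h4
  rw [mul_one (intertwiningConst μF)] at h4
  have h5 : ∀ x : F, ∫ g, (f : SO5 F → ℂ) g * ((sqrtCard F * satakeParam F ζ) ^ (-rht g) *
      (resCard F : ℂ) ^ (-wht (reflG * shortG h20 x * g))) ∂μG =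
      ∑ g ∈ s, (f : SO5 F → ℂ) g * ((sqrtCard F * satakeParam F ζ) ^ (-rht g) *
      (resCard F : ℂ) ^ (-wht (reflG * shortG h20 x * g))) := fun x =>
    hs _ fun k hk g => by rw [rht_mul_KG hk, ← mul_assoc, wht_mul_KG hk]
  simp only [h5] at h4
  rw [integral_finsetSum] at h4
  · simp only [integral_const_mul, hu.integral_wedge h2 hμF] at h4
    refine mul_right_cancel₀ hc (h4.symm.trans ?_)
    rw [Finset.sum_mul]
    refine Finset.sum_congr rfl fun g _ => ?_
    have : sqrtCard F ^ 3 * satakeParam F ζ = sqrtCard F * satakeParam F ζ * (resCard F : ℂ) := by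
      rw [← hu.sqrtCard_sq]
      ring
    rw [this, _root_.mul_zpow (sqrtCard F * satakeParam F ζ)]
    ring
  · intro g _
    refine (Integrable.const_mul ?_ _).const_mul _
    -- A non-integrable function has integral 0 by convention, whereas this integral is known and
    -- nonzero.
    refine not_imp_comm.1 integral_undef ?_
    rw [hu.integral_wedge h2 hμF]
    exact mul_ne_zero hc (zpow_ne_zero _ hq)

end Intertwining

end SO5PGL2

namespace SO5PGL2

/-! ### The `K`-orbits in the symmetric space -/

section Orbits

variable {F : Type*} [NontriviallyNormedField F] [IsUltrametricDist F] {ϖ : Fˣ} {t : Kind F}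

theorem smul_val (g : SO5 F) (s : Sphere t) : (g • s).1 = toMat g *ᵥ s.1 := rfl

theorem norm_smul_KG {k : SO5 F} (hk : k ∈ KG F) (s : Sphere t) : ‖(k • s).1‖ = ‖s.1‖ := by
  rw [smul_val, norm_mulVec_KG hk]

theorem Kind.norm_level (h2 : ‖(2 : F)‖ = 1) (ht : t.Admissible) : ‖t.level‖ = 1 := by
  cases t with
  | split => simp [Kind.level]
  | nonsplit θ =>
    have : (4 : F) = 2 ^ 2 := by norm_num
    rw [Kind.level, this, norm_mul, norm_pow, h2, ht.1]
    norm_num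

theorem one_le_norm_sphere (h2 : ‖(2 : F)‖ = 1) (ht : t.Admissible) (s : Sphere t) :
    1 ≤ ‖s.1‖ := by
  by_contra h
  have h1 := t.norm_level h2 ht
  have h3 := s.2
  rw [form_eq] at h3
  have h4 : ∀ i j : Fin 5, ‖s.1 i * s.1 j‖ ≤ ‖s.1‖ ^ 2 := fun i j => by
    rw [norm_mul, sq]
    exact mul_le_mul (norm_le_pi_norm _ _) (norm_le_pi_norm _ _) (norm_nonneg _) (norm_nonneg _)
  have h5 : ‖2 * s.1 0 * s.1 4 + 2 * s.1 1 * s.1 3 + s.1 2 ^ 2‖ ≤ ‖s.1‖ ^ 2 := by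
    refine norm_add_le_of_le (norm_add_le_of_le ?_ ?_) ?_
    · rw [mul_assoc, norm_mul, h2, one_mul]
      exact h4 0 4
    · rw [mul_assoc, norm_mul, h2, one_mul]
      exact h4 1 3
    · rw [sq]
      exact h4 2 2
  rw [h3, h1] at h5
  have := norm_nonneg s.1
  nlinarith

theorem v1_form (h2 : (2 : F) ≠ 0) (t : Kind F) : t.v1 ⬝ᵥ (J F *ᵥ t.v1) = t.level := by
  rw [form_eq]
  cases t
  · simp [Kind.v1, Kind.level, h2]
  · simp [Kind.v1, Kind.level]
    ring

theorem dv_eq (t : Kind F) (ϖ : Fˣ) (r : ℕ) : dv t ϖ r = toMat (torusG (ϖ ^ r)) *ᵥ t.v1 := by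
  simp [dv, torusG, mkG, toMat]

/-- The point `d_r v₁` of the symmetric space. -/
def dS (h2 : (2 : F) ≠ 0) (t : Kind F) (ϖ : Fˣ) (r : ℕ) : Sphere t :=
  ⟨dv t ϖ r, by rw [dv_eq, form_mulVec, v1_form h2]⟩

theorem norm_dv (hu : IsUniformizer ϖ) (h2 : ‖(2 : F)‖ = 1) (ht : t.Admissible) (r : ℕ) :
    ‖dv t ϖ r‖ = (resCard F : ℝ) ^ (r : ℤ) := by
  have hq := hu.one_lt_card
  have h1 : (1 : ℝ) ≤ (resCard F : ℝ) ^ (r : ℤ) := one_le_zpow₀ hq.le (by omega)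
  have h0 : ‖(ϖ : F) ^ r‖ ≤ 1 := by
    rw [norm_pow]
    exact pow_le_one₀ (norm_nonneg _) hu.norm_lt_one.le
  have h4 : ‖((ϖ : F) ^ r)⁻¹‖ = (resCard F : ℝ) ^ (r : ℤ) := by
    rw [norm_inv, norm_pow, hu.norm_eq, inv_pow, inv_inv, _root_.zpow_natCast]
  have hv : (dv t ϖ r) 4 = ((ϖ : F) ^ r)⁻¹ := by
    cases t <;> simp [dv_eq, torusG_mulVec, Kind.v1]
  refine le_antisymm ((pi_norm_le_iff_of_nonneg (by positivity)).2 fun i => ?_) ?_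
  · cases t with
    | split =>
      fin_cases i <;> simp [dv_eq, torusG_mulVec, Kind.v1, h2, hu.norm_eq]
      · exact (inv_le_one_of_one_le₀ (one_le_pow₀ hq.le)).trans (one_le_pow₀ hq.le)
    | nonsplit θ =>
      fin_cases i <;> simp [dv_eq, torusG_mulVec, Kind.v1, h2, hu.norm_eq, ht.1]
      · exact (inv_le_one_of_one_le₀ (one_le_pow₀ hq.le)).trans (one_le_pow₀ hq.le)
      · exact one_le_pow₀ hq.le
  · rw [← h4, ← hv]
    exact norm_le_pi_norm _ _

/-- The index of the `K`-orbit of a point of the symmetric space. -/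
noncomputable def sht (s : Sphere t) : ℕ := (Int.log (resCard F) ‖s.1‖).toNat

theorem sht_smul {k : SO5 F} (hk : k ∈ KG F) (s : Sphere t) : sht (k • s) = sht s := by
  rw [sht, norm_smul_KG hk, sht]

variable (hu : IsUniformizer ϖ) (h2 : ‖(2 : F)‖ = 1) (ht : t.Admissible)
include hu h2 ht

theorem IsUniformizer.norm_sphere (s : Sphere t) : ‖s.1‖ = (resCard F : ℝ) ^ (sht s : ℤ) := by
  obtain ⟨i, hi⟩ := exists_norm_apply_eq s.1
  have h1 := one_le_norm_sphere h2 ht s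
  have h0 : s.1 i ≠ 0 := by
    rw [← norm_ne_zero_iff, hi]
    exact (zero_lt_one.trans_le h1).ne'
  have h3 := hu.norm_eq_zpow_lv h0
  rw [hi] at h3
  rw [h3, ← zpow_zero (resCard F : ℝ), zpow_le_zpow_iff_right₀ hu.one_lt_card] at h1
  rw [sht, h3, Int.log_zpow hu.one_lt_card_nat, Int.toNat_of_nonneg h1]

theorem IsUniformizer.norm_sphere_le_iff (s : Sphere t) (r : ℕ) :
    ‖s.1‖ ≤ (resCard F : ℝ) ^ (r : ℤ) ↔ sht s ≤ r := by
  rw [hu.norm_sphere h2 ht, zpow_le_zpow_iff_right₀ hu.one_lt_card, Nat.cast_le]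

theorem IsUniformizer.sht_eq_iff (s : Sphere t) (r : ℕ) :
    sht s = r ↔ ‖s.1‖ = (resCard F : ℝ) ^ (r : ℤ) := by
  rw [hu.norm_sphere h2 ht, hu.zpow_inj, Nat.cast_inj]

theorem IsUniformizer.sht_dS (r : ℕ) : sht (dS (ne_zero_of_norm_two h2) t ϖ r) = r := by
  rw [hu.sht_eq_iff h2 ht]
  exact norm_dv hu h2 ht r

/-- The quadratic form takes the same value at all points of S, so the norm is the only invariant of
a K-orbit. -/
theorem IsUniformizer.exists_smul_eq {s s' : Sphere t} (h : sht s = sht s') :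
    ∃ k ∈ KG F, k • s = s' := by
  obtain ⟨k, hk, e⟩ := exists_mulVec_eq_of_form_eq h2 (v := s.1) (w := s'.1) (fun h0 => by
    have := one_le_norm_sphere h2 ht s
    rw [h0, norm_zero] at this
    exact absurd this (by norm_num)) (by rw [hu.norm_sphere h2 ht, hu.norm_sphere h2 ht, h])
    (by rw [s.2, s'.2])
  exact ⟨k, hk, Subtype.ext e⟩

theorem IsUniformizer.eq_dS_of_invariant {α : Type*} {T : Sphere t → α}
    (hT : ∀ k ∈ KG F, ∀ s, T (k • s) = T s) (s : Sphere t) :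
    T s = T (dS (ne_zero_of_norm_two h2) t ϖ (sht s)) := by
  obtain ⟨k, hk, e⟩ := hu.exists_smul_eq h2 ht (s := s)
    (s' := dS (ne_zero_of_norm_two h2) t ϖ (sht s)) (by rw [hu.sht_dS h2 ht])
  rw [← e, hT k hk]

theorem IsUniformizer.mem_orbit_iff (r : ℕ) (s : Sphere t) : s ∈ orbit t ϖ r ↔ sht s = r := by
  constructor
  · rintro ⟨k, hk, e⟩
    rw [hu.sht_eq_iff h2 ht, e, norm_mulVec_KG hk, norm_dv hu h2 ht]
  · intro h
    obtain ⟨k, hk, e⟩ := hu.exists_smul_eq h2 ht (s := dS (ne_zero_of_norm_two h2) t ϖ r) (s' := s)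
      (by rw [hu.sht_dS h2 ht, h])
    exact ⟨k, hk, by rw [← e]; rfl⟩

theorem IsUniformizer.sht_base : sht (base t) = 0 := by
  rw [hu.sht_eq_iff h2 ht, Nat.cast_zero, zpow_zero]
  refine le_antisymm ((pi_norm_le_iff_of_nonneg zero_le_one).2 fun i => ?_)
    (one_le_norm_sphere h2 ht _)
  cases t with
  | split => fin_cases i <;> simp [base, Kind.v0]
  | nonsplit θ => fin_cases i <;> simp [base, Kind.v0, h2, ht.1]

theorem IsUniformizer.exists_smul_base (s : Sphere t) : ∃ g : SO5 F, g • base t = s := by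
  have h20 := ne_zero_of_norm_two h2
  obtain ⟨k, hk, e⟩ := hu.exists_smul_eq h2 ht (s := dS h20 t ϖ (sht s)) (s' := s)
    (by rw [hu.sht_dS h2 ht])
  obtain ⟨k', hk', e'⟩ := hu.exists_smul_eq h2 ht (s := base t) (s' := dS h20 t ϖ 0)
    (by rw [hu.sht_dS h2 ht, hu.sht_base h2 ht])
  refine ⟨k * (torusG (ϖ ^ sht s) * k'), ?_⟩
  rw [mul_smul, mul_smul, e']
  refine Eq.trans (congrArg (fun x => k • x) ?_) e
  apply Subtype.ext
  rw [smul_val]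
  change _ *ᵥ dv t ϖ 0 = dv t ϖ (sht s)
  rw [dv_eq, dv_eq, mulVec_mulVec, ← toMat_mul]
  congr 2
  apply toMat_injective
  rw [toMat_mul]
  ext i j
  fin_cases i <;> fin_cases j <;> simp [torusG, mkG, toMat]

end Orbits

/-! ### Balls and orbits in S, and the space C_c(K\S) -/

section Topology

variable {F : Type*} [NontriviallyNormedField F] [IsUltrametricDist F] {ϖ : Fˣ} {t : Kind F}

theorem continuous_toMat : Continuous (toMat : SO5 F → Matrix (Fin 5) (Fin 5) F) :=
  isInducing_toMat.continuous

theorem continuous_smul_sphere : Continuous fun p : SO5 F × Sphere t => p.1 • p.2 := by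
  refine Continuous.subtype_mk ?_ _
  exact (continuous_toMat.comp continuous_fst).matrix_mulVec
    (continuous_subtype_val.comp continuous_snd)

theorem continuous_smul_left (s : Sphere t) : Continuous fun g : SO5 F => g • s :=
  continuous_smul_sphere.comp (continuous_id.prodMk continuous_const)

theorem continuous_smul_right (g : SO5 F) : Continuous fun s : Sphere t => g • s :=
  continuous_smul_sphere.comp (continuous_const.prodMk continuous_id)

variable (hu : IsUniformizer ϖ) (h2 : ‖(2 : F)‖ = 1) (ht : t.Admissible)
include hu h2 ht

theorem IsUniformizer.isClopen_sht_le (r : ℕ) : IsClopen {s : Sphere t | sht s ≤ r} := by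
  have h : {s : Sphere t | sht s ≤ r} = {s | ‖s.1‖ ≤ (resCard F : ℝ) ^ (r : ℤ)} := by
    ext s
    exact (hu.norm_sphere_le_iff h2 ht s r).symm
  have hpos : (0 : ℝ) < (resCard F : ℝ) ^ (r : ℤ) := zpow_pos hu.card_pos _
  rw [h]
  refine ⟨isClosed_le (by fun_prop) continuous_const, ?_⟩
  have : {s : Sphere t | ‖s.1‖ ≤ (resCard F : ℝ) ^ (r : ℤ)} =
      ⋂ i : Fin 5, {s | ‖s.1 i‖ ≤ (resCard F : ℝ) ^ (r : ℤ)} := by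
    ext s
    rw [Set.mem_ofPred_eq, pi_norm_le_iff_of_nonneg hpos.le, Set.mem_iInter]
    rfl
  rw [this]
  exact isOpen_iInter_of_finite fun i =>
    (isOpen_norm_le hpos.ne').preimage (f := fun s : Sphere t => s.1 i)
      ((continuous_apply i).comp continuous_subtype_val)

theorem IsUniformizer.isLocallyConstant_sht : IsLocallyConstant (sht : Sphere t → ℕ) := by
  rw [IsLocallyConstant.iff_isOpen_fiber]
  intro r
  cases r with
  | zero =>
    have : {s : Sphere t | sht s = 0} = {s | sht s ≤ 0} := by ext s; simp
    change IsOpen {s : Sphere t | sht s = 0}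
    rw [this]
    exact (hu.isClopen_sht_le h2 ht 0).2
  | succ r =>
    have : {s : Sphere t | sht s = r + 1} = {s | sht s ≤ r + 1} \ {s | sht s ≤ r} := by
      ext s
      simp only [Set.mem_ofPred_eq, Set.mem_sdiff]
      omega
    change IsOpen {s : Sphere t | sht s = r + 1}
    rw [this]
    exact ((hu.isClopen_sht_le h2 ht (r + 1)).diff (hu.isClopen_sht_le h2 ht r)).2

theorem IsUniformizer.isClopen_sht_eq (r : ℕ) : IsClopen {s : Sphere t | sht s = r} :=
  (hu.isLocallyConstant_sht h2 ht).isClopen_fiber r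

variable [LocallyCompactSpace F]

omit hu h2 ht in
theorem isCompact_norm_sphere_le (R : ℝ) : IsCompact {s : Sphere t | ‖s.1‖ ≤ R} := by
  have : ProperSpace F := ProperSpace.of_locallyCompactSpace F
  have h : (Subtype.val '' {s : Sphere t | ‖s.1‖ ≤ R}) =
      Metric.closedBall 0 R ∩ {x : Fin 5 → F | x ⬝ᵥ (J F *ᵥ x) = t.level} := by
    ext x
    simp only [Set.mem_image, Set.mem_ofPred_eq, Set.mem_inter_iff, mem_closedBall_zero_iff]
    constructor
    · rintro ⟨s, hs, rfl⟩
      exact ⟨hs, s.2⟩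
    · rintro ⟨h1, h2⟩
      exact ⟨⟨x, h2⟩, h1, rfl⟩
  have hc : IsClosed {x : Fin 5 → F | x ⬝ᵥ (J F *ᵥ x) = t.level} := by
    refine isClosed_eq ?_ continuous_const
    simp only [form_eq]
    fun_prop
  have key : IsCompact (Subtype.val '' {s : Sphere t | ‖s.1‖ ≤ R}) := by
    rw [h]
    exact (isCompact_closedBall _ _).inter_right hc
  exact Topology.IsInducing.subtypeVal.isCompact_iff.2 key

theorem IsUniformizer.isCompact_sht_le (r : ℕ) : IsCompact {s : Sphere t | sht s ≤ r} := by
  have h : {s : Sphere t | sht s ≤ r} = {s | ‖s.1‖ ≤ (resCard F : ℝ) ^ (r : ℤ)} := by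
    ext s
    exact (hu.norm_sphere_le_iff h2 ht s r).symm
  rw [h]
  exact isCompact_norm_sphere_le _

theorem IsUniformizer.isCompact_sht_eq (r : ℕ) : IsCompact {s : Sphere t | sht s = r} :=
  (hu.isCompact_sht_le h2 ht r).of_isClosed_subset (hu.isClopen_sht_eq h2 ht r).1
    fun _ hs => le_of_eq hs

theorem IsUniformizer.comp_sht_mem_CcS {c : ℕ → ℂ} {M : ℕ} (hc : ∀ r, c r ≠ 0 → r ≤ M) :
    (fun s : Sphere t => c (sht s)) ∈ CcS t := by
  refine ⟨(hu.isLocallyConstant_sht h2 ht).comp c, ?_, fun k hk s => congrArg c (sht_smul hk s)⟩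
  exact HasCompactSupport.intro (hu.isCompact_sht_le h2 ht M) fun s hs => by
    by_contra h
    exact hs (hc _ h)

/-- Functions in `C_c(K\S)` are determined by their values at the points `d_r v₁`. -/
theorem IsUniformizer.exists_equiv_CcS :
    ∃ e : CcS t ≃ₗ[ℂ] (ℕ →₀ ℂ), ∀ φ r,
      e φ r = (φ : Sphere t → ℂ) (dS (ne_zero_of_norm_two h2) t ϖ r) := by
  have h20 := ne_zero_of_norm_two h2
  have hfin : ∀ φ : CcS t, (Function.support
      fun r : ℕ => (φ : Sphere t → ℂ) (dS h20 t ϖ r)).Finite := fun φ => by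
    have h := (φ.2.2.1.isCompact.image (hu.isLocallyConstant_sht h2 ht).continuous).finite_of_discrete
    refine h.subset fun r hr => ⟨dS h20 t ϖ r, subset_tsupport _ hr, hu.sht_dS h2 ht r⟩
  let e : CcS t →ₗ[ℂ] (ℕ →₀ ℂ) :=
    { toFun := fun φ => Finsupp.ofSupportFinite _ (hfin φ)
      map_add' := fun φ φ' => by ext m; rfl
      map_smul' := fun c φ => by ext m; rfl }
  have he : ∀ φ r, e φ r = (φ : Sphere t → ℂ) (dS h20 t ϖ r) := fun φ r => rfl
  refine ⟨LinearEquiv.ofBijective e ⟨fun φ φ' h => ?_, fun c => ?_⟩, he⟩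
  · refine Subtype.ext (funext fun s => ?_)
    rw [hu.eq_dS_of_invariant h2 ht φ.2.2.2 s, hu.eq_dS_of_invariant h2 ht φ'.2.2.2 s, ← he, ← he, h]
  · refine ⟨⟨fun s => c (sht s), hu.comp_sht_mem_CcS h2 ht (M := c.support.sup id) fun r hr =>
      Finset.le_sup (f := id) (Finsupp.mem_support_iff.2 hr)⟩, ?_⟩
    ext r
    rw [he]
    exact congrArg c (hu.sht_dS h2 ht r)

omit [LocallyCompactSpace F] in
theorem IsUniformizer.phi_apply (r : ℕ) (s : Sphere t) :
    phi t ϖ r s = if sht s = r then 1 else 0 := by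
  simp only [phi, hu.mem_orbit_iff h2 ht]

omit [LocallyCompactSpace F] in
theorem IsUniformizer.Phi_apply (r : ℕ) (s : Sphere t) :
    Phi t ϖ r s = if sht s ≤ r then 1 else 0 := by
  rw [Phi, Finset.sum_apply]
  simp only [hu.phi_apply h2 ht]
  rw [Finset.sum_ite_eq]
  simp

theorem IsUniformizer.Phi_mem (r : ℕ) : Phi t ϖ r ∈ CcS t := by
  have : Phi t ϖ r = fun s : Sphere t => if sht s ≤ r then (1 : ℂ) else 0 :=
    funext fun s => hu.Phi_apply h2 ht r s
  rw [this]
  exact hu.comp_sht_mem_CcS h2 ht (c := fun n => if n ≤ r then (1 : ℂ) else 0) (M := r)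
    fun n hn => by
      by_contra h
      exact hn (if_neg h)

end Topology

end SO5PGL2

namespace SO5PGL2

/-! ### Volumes of congruence conditions on a ternary quadratic form -/

theorem prod_apply_of_slices {α β : Type*} [MeasurableSpace α] [MeasurableSpace β]
    (μ : Measure α) (ν : Measure β) [SFinite μ] [SFinite ν] {s : Set (α × β)} (hs : MeasurableSet s)
    {A : Set α} (hA : MeasurableSet A) {c : ENNReal} (h : ∀ x ∈ A, ν (Prod.mk x ⁻¹' s) = c)
    (h' : ∀ x ∉ A, ν (Prod.mk x ⁻¹' s) = 0) : μ.prod ν s = c * μ A := by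
  rw [Measure.prod_apply hs, ← lintegral_indicator_const hA]
  refine lintegral_congr fun x => ?_
  by_cases hx : x ∈ A
  · rw [h x hx, Set.indicator_of_mem hx]
  · rw [h' x hx, Set.indicator_of_notMem hx]

theorem prod_apply_of_slices_symm {α β : Type*} [MeasurableSpace α] [MeasurableSpace β]
    (μ : Measure α) (ν : Measure β) [SFinite μ] [SFinite ν] {s : Set (α × β)} (hs : MeasurableSet s)
    {A : Set β} (hA : MeasurableSet A) {c : ENNReal}
    (h : ∀ y ∈ A, μ ((fun x => (x, y)) ⁻¹' s) = c)
    (h' : ∀ y ∉ A, μ ((fun x => (x, y)) ⁻¹' s) = 0) : μ.prod ν s = c * ν A := by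
  rw [Measure.prod_apply_symm hs, ← lintegral_indicator_const hA]
  refine lintegral_congr fun x => ?_
  by_cases hx : x ∈ A
  · rw [h x hx, Set.indicator_of_mem hx]
  · rw [h' x hx, Set.indicator_of_notMem hx]

instance secondCountableTopology_of_locallyCompact {F : Type*} [NontriviallyNormedField F]
    [LocallyCompactSpace F] : SecondCountableTopology F := by
  have : ProperSpace F := ProperSpace.of_locallyCompactSpace F
  infer_instance

section Volumes

variable {F : Type*} [NontriviallyNormedField F] [IsUltrametricDist F] [LocallyCompactSpace F]
  [MeasurableSpace F] [BorelSpace F] {ϖ : Fˣ} (hu : IsUniformizer ϖ) (h2 : ‖(2 : F)‖ = 1)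
  (μF : Measure F) [μF.IsAddHaarMeasure] (hμF : μF {x | ‖x‖ ≤ 1} = 1)

include hu in
theorem IsUniformizer.norm_lt_one_iff (x : F) : ‖x‖ < 1 ↔ ‖x‖ ≤ (resCard F : ℝ) ^ (-1 : ℤ) := by
  have := hu.norm_lt_iff (k := 0) x
  simpa using this

include hu hμF

theorem IsUniformizer.measure_norm_lt_one :
    μF {x | ‖x‖ < 1} = ENNReal.ofReal ((resCard F : ℝ) ^ (-1 : ℤ)) := by
  simp only [hu.norm_lt_one_iff]
  exact hu.measure_norm_le μF hμF (-1)

theorem IsUniformizer.measure_norm_eq_one :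
    μF {x | ‖x‖ = 1} = ENNReal.ofReal (1 - (resCard F : ℝ) ^ (-1 : ℤ)) := by
  have h : {x : F | ‖x‖ = 1} = {x | ‖x‖ ≤ 1} \ {x | ‖x‖ < 1} := by
    ext x
    simp only [Set.mem_ofPred_eq, Set.mem_sdiff, not_lt]
    exact le_antisymm_iff
  rw [h, measure_sdiff (s₁ := {x : F | ‖x‖ ≤ 1}) (s₂ := {x : F | ‖x‖ < 1}) (fun x (hx : ‖x‖ < 1) => hx.le)
    (by measurability : MeasurableSet _).nullMeasurableSet
    (by rw [hu.measure_norm_lt_one μF hμF]; exact ENNReal.ofReal_ne_top),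
    hu.measure_norm_lt_one μF hμF, hμF,
    ENNReal.ofReal_sub _ (zpow_pos hu.card_pos _).le, ENNReal.ofReal_one]

theorem IsUniformizer.measure_affine {c : F} (hc : ‖c‖ = 1) (e : F) (m : ℤ) :
    μF {b | ‖c * b - e‖ ≤ (resCard F : ℝ) ^ m} = ENNReal.ofReal ((resCard F : ℝ) ^ m) := by
  have hc0 : c ≠ 0 := by
    rw [← norm_ne_zero_iff, hc]
    exact one_ne_zero
  have h : {b | ‖c * b - e‖ ≤ (resCard F : ℝ) ^ m} =
      (fun b => -(c⁻¹ * e) + b) ⁻¹' {b | ‖b‖ ≤ (resCard F : ℝ) ^ m} := by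
    ext b
    have : c * b - e = c * (-(c⁻¹ * e) + b) := by field_simp; ring
    rw [Set.mem_preimage, Set.mem_ofPred_eq, Set.mem_ofPred_eq, this, norm_mul, hc, one_mul]
  rw [h, measure_preimage_add, hu.measure_norm_le μF hμF]

include h2

/-- The hyperbola `2ab ≡ e`, with `a` a unit. -/
theorem IsUniformizer.measure_hyperbola {e : F} (he : ‖e‖ ≤ 1) {j : ℤ} (hj : 0 ≤ j) :
    μF.prod μF {p | ‖p.1‖ = 1 ∧ ‖p.2‖ ≤ 1 ∧ ‖2 * p.1 * p.2 - e‖ ≤ (resCard F : ℝ) ^ (-j)} =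
      ENNReal.ofReal ((resCard F : ℝ) ^ (-j) * (1 - (resCard F : ℝ) ^ (-1 : ℤ))) := by
  have hm : MeasurableSet {p : F × F | ‖p.1‖ = 1 ∧ ‖p.2‖ ≤ 1 ∧
      ‖2 * p.1 * p.2 - e‖ ≤ (resCard F : ℝ) ^ (-j)} := by
    measurability
  have hq : (resCard F : ℝ) ^ (-j) ≤ 1 := zpow_le_one_of_nonpos₀ hu.one_lt_card.le (by omega)
  rw [prod_apply_of_slices μF μF hm (A := {x | ‖x‖ = 1})
    (by measurability)
    (c := ENNReal.ofReal ((resCard F : ℝ) ^ (-j))), hu.measure_norm_eq_one μF hμF,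
    ← ENNReal.ofReal_mul (zpow_pos hu.card_pos _).le]
  · intro a (ha : ‖a‖ = 1)
    have h2a : ‖2 * a‖ = 1 := by rw [norm_mul, h2, ha, one_mul]
    rw [← hu.measure_affine μF hμF h2a e (-j)]
    congr 1
    ext b
    simp only [Set.mem_preimage, Set.mem_ofPred_eq]
    refine ⟨fun h => h.2.2, fun h => ⟨ha, ?_, h⟩⟩
    have := norm_add_le_of_le (h.trans hq) he
    rwa [sub_add_cancel, norm_mul, h2a, one_mul] at this
  · intro a ha
    convert measure_empty (μ := μF)
    ext b
    simp only [Set.mem_preimage, Set.mem_ofPred_eq, Set.mem_empty_iff_false, iff_false]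
    exact fun h => ha h.1

/-- The hyperbola `2ab ≡ e` with `a` a unit and `b` not a unit. -/
theorem IsUniformizer.measure_hyperbola_lt {e : F} (he : ‖e‖ < 1) {j : ℤ} (hj : 1 ≤ j) :
    μF.prod μF {p | ‖p.1‖ = 1 ∧ ‖p.2‖ < 1 ∧ ‖2 * p.1 * p.2 - e‖ ≤ (resCard F : ℝ) ^ (-j)} =
      ENNReal.ofReal ((resCard F : ℝ) ^ (-j) * (1 - (resCard F : ℝ) ^ (-1 : ℤ))) := by
  rw [← hu.measure_hyperbola h2 μF hμF he.le (by omega : 0 ≤ j)]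
  congr 1
  ext p
  simp only [Set.mem_ofPred_eq]
  refine ⟨fun h => ⟨h.1, h.2.1.le, h.2.2⟩, fun h => ⟨h.1, ?_, h.2.2⟩⟩
  have hq : (resCard F : ℝ) ^ (-j) < 1 := zpow_lt_one_of_neg₀ hu.one_lt_card (by omega)
  have := (IsUltrametricDist.norm_add_le_max (2 * p.1 * p.2 - e) e).trans_lt
    (max_lt (h.2.2.trans_lt hq) he)
  rwa [sub_add_cancel, norm_mul, norm_mul, h2, h.1, one_mul, one_mul] at this

/-- The number of square roots of `e`. -/
noncomputable def sqrtCount (e : F) : ℝ := by classical exact if IsSquare e then 2 else 0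

/-- If e = w², then z² - e = (z - w)(z + w), and the two factors cannot both be small because 2w is
a unit: the set is a disjoint union of two balls. If e is not a square, Hensel's lemma makes the set
empty. -/
theorem IsUniformizer.measure_sq {e : F} (he : ‖e‖ = 1) {j : ℤ} (hj : 1 ≤ j) :
    μF {z | ‖z‖ ≤ 1 ∧ ‖z ^ 2 - e‖ ≤ (resCard F : ℝ) ^ (-j)} =
      ENNReal.ofReal (sqrtCount e * (resCard F : ℝ) ^ (-j)) := by
  have hq : (resCard F : ℝ) ^ (-j) < 1 := zpow_lt_one_of_neg₀ hu.one_lt_card (by omega)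
  have hq0 : 0 < (resCard F : ℝ) ^ (-j) := zpow_pos hu.card_pos _
  by_cases hsq : IsSquare e
  · obtain ⟨w, rfl⟩ := hsq
    have hw : ‖w‖ = 1 := by
      rw [norm_mul] at he
      nlinarith [norm_nonneg w]
    have hball : ∀ v : F, μF {z | ‖z - v‖ ≤ (resCard F : ℝ) ^ (-j)} =
        ENNReal.ofReal ((resCard F : ℝ) ^ (-j)) := fun v => by
      have := hu.measure_affine μF hμF (norm_one (α := F)) v (-j)
      simpa only [one_mul] using this
    have hn : ∀ v : F, ‖v‖ = 1 → ∀ z, ‖z - v‖ ≤ (resCard F : ℝ) ^ (-j) → ‖z + v‖ = 1 := by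
      intro v hv z hz
      have h1 : ‖2 * v‖ = 1 := by rw [norm_mul, h2, hv, one_mul]
      have : z + v = (z - v) + 2 * v := by ring
      rw [this, norm_add_eq_of_lt (by rw [h1]; exact hz.trans_lt hq), h1]
    have hset : {z | ‖z‖ ≤ 1 ∧ ‖z ^ 2 - w * w‖ ≤ (resCard F : ℝ) ^ (-j)} =
        {z | ‖z - w‖ ≤ (resCard F : ℝ) ^ (-j)} ∪ {z | ‖z - -w‖ ≤ (resCard F : ℝ) ^ (-j)} := by
      ext z
      have hz : z ^ 2 - w * w = (z - w) * (z + w) := by ring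
      simp only [Set.mem_ofPred_eq, Set.mem_union, hz, norm_mul]
      constructor
      · rintro ⟨-, h⟩
        by_contra! hc
        rw [sub_neg_eq_add] at hc
        rcases lt_or_ge ‖z - w‖ 1 with h1 | h1
        · have : z + w = (z - w) + 2 * w := by ring
          have h3 : ‖2 * w‖ = 1 := by rw [norm_mul, h2, hw, one_mul]
          rw [this, norm_add_eq_of_lt (by rw [h3]; exact h1), h3, mul_one] at h
          exact absurd h (not_le.2 hc.1)
        · have := le_mul_of_one_le_left (norm_nonneg (z + w)) h1
          exact absurd (this.trans h) (not_le.2 hc.2)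
      · rintro (h | h)
        · refine ⟨?_, by rwa [hn w hw z h, mul_one]⟩
          have := norm_add_le_of_le (h.trans hq.le) hw.le
          rwa [sub_add_cancel] at this
        · have h' := hn (-w) (by rw [norm_neg, hw]) z h
          rw [← sub_eq_add_neg] at h'
          rw [sub_neg_eq_add] at h
          refine ⟨?_, by rwa [h', one_mul]⟩
          have := norm_sub_le_of_le (h.trans hq.le) hw.le
          rwa [add_sub_cancel_right] at this
    rw [hset, measure_union _ (by measurability), hball, hball,
      ← ENNReal.ofReal_add hq0.le hq0.le, sqrtCount, if_pos ⟨w, rfl⟩, two_mul]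
    rw [Set.disjoint_left]
    intro z h h'
    have h1 := hn w hw z h
    rw [Set.mem_ofPred_eq, sub_neg_eq_add, h1] at h'
    exact absurd h' (not_le.2 hq)
  · rw [sqrtCount, if_neg hsq, zero_mul, ENNReal.ofReal_zero]
    convert measure_empty (μ := μF)
    ext z
    simp only [Set.mem_ofPred_eq, Set.mem_empty_iff_false, iff_false]
    rintro ⟨-, h⟩
    exact hsq (isSquare_of_norm_sub_lt h2 he (h.trans_lt hq))

end Volumes

end SO5PGL2

namespace SO5PGL2

/-! ### Volumes of the solutions of 2ab + z² ≡ e -/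

section TernaryVolumes

variable {F : Type*} [NontriviallyNormedField F] [IsUltrametricDist F] [LocallyCompactSpace F]
  [MeasurableSpace F] [BorelSpace F] {ϖ : Fˣ} (hu : IsUniformizer ϖ) (h2 : ‖(2 : F)‖ = 1)
  (μF : Measure F) [μF.IsAddHaarMeasure] (hμF : μF {x | ‖x‖ ≤ 1} = 1)

/-- The product measure on `F³`. -/
noncomputable abbrev cube : Measure (F × F × F) := μF.prod (μF.prod μF)

/-- The ternary form `2ab + z²` at `(z, a, b)`. -/
def ternary (u : F × F × F) : F := 2 * u.2.1 * u.2.2 + u.1 ^ 2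

theorem measurable_ternary : Measurable (ternary : F × F × F → F) := by
  unfold ternary
  fun_prop

include hu hμF in
theorem IsUniformizer.cube_preimage (a : Fˣ) {A : Set (F × F × F)} (hA : MeasurableSet A) :
    cube μF ((fun u => ((a : F) * u.1, (a : F) * u.2.1, (a : F) * u.2.2)) ⁻¹' A) =
      ENNReal.ofReal (‖(a : F)‖⁻¹ ^ 3) * cube μF A := by
  have hm : Measurable fun x : F => (a : F) * x := by fun_prop
  have h : (cube μF).map (Prod.map (fun x : F => (a : F) * x)
      (Prod.map (fun x : F => (a : F) * x) (fun x : F => (a : F) * x))) =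
      ENNReal.ofReal (‖(a : F)‖⁻¹ ^ 3) • cube μF := by
    rw [cube, ← Measure.map_prod_map _ _ hm (hm.prodMap hm), ← Measure.map_prod_map _ _ hm hm,
      hu.map_mul μF hμF, Measure.prod_smul_left, Measure.prod_smul_right, Measure.prod_smul_left,
      Measure.prod_smul_right, Measure.prod_smul_right, smul_smul, smul_smul,
      ← ENNReal.ofReal_mul (by positivity), ← ENNReal.ofReal_mul (by positivity)]
    congr 2
    ring
  rw [← smul_eq_mul, ← Measure.smul_apply, ← h, Measure.map_apply (hm.prodMap (hm.prodMap hm)) hA]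
  rfl

/-- The set of integral vectors with `2ab + z² ≡ e`. -/
def ternarySet (e : F) (j : ℤ) : Set (F × F × F) :=
  {u | ‖u.1‖ ≤ 1 ∧ ‖u.2.1‖ ≤ 1 ∧ ‖u.2.2‖ ≤ 1 ∧ ‖ternary u - e‖ ≤ (resCard F : ℝ) ^ (-j)}

theorem measurableSet_ternarySet (e : F) (j : ℤ) : MeasurableSet (ternarySet e j) := by
  have := measurable_ternary (F := F)
  unfold ternarySet
  measurability

theorem norm_ternary_le {u : F × F × F} {r : ℝ} (h2 : ‖(2 : F)‖ = 1) (h1 : ‖u.1‖ ≤ r)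
    (h3 : ‖u.2.1‖ ≤ r) (h4 : ‖u.2.2‖ ≤ r) : ‖ternary u‖ ≤ r ^ 2 := by
  have hr := (norm_nonneg _).trans h1
  refine norm_add_le_of_le ?_ ?_
  · rw [norm_mul, norm_mul, h2, one_mul, sq]
    exact mul_le_mul h3 h4 (norm_nonneg _) hr
  · rw [norm_pow]
    exact pow_le_pow_left₀ (norm_nonneg _) h1 2

theorem norm_sq_le_one {z : F} (hz : ‖z‖ ≤ 1) : ‖z ^ 2‖ ≤ 1 := by
  rw [norm_pow]
  exact pow_le_one₀ (norm_nonneg _) hz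

include hu h2 hμF

theorem IsUniformizer.cube_ternarySet_of_nonpos {e : F} (he : ‖e‖ ≤ 1) {j : ℤ} (hj : j ≤ 0) :
    cube μF (ternarySet e j) = 1 := by
  have h : ternarySet e j = {x : F | ‖x‖ ≤ 1} ×ˢ ({x : F | ‖x‖ ≤ 1} ×ˢ {x : F | ‖x‖ ≤ 1}) := by
    ext u
    simp only [ternarySet, Set.mem_ofPred_eq, Set.mem_prod]
    refine ⟨fun h => ⟨h.1, h.2.1, h.2.2.1⟩, fun h => ⟨h.1, h.2.1, h.2.2, ?_⟩⟩
    have h1 := norm_ternary_le h2 h.1 h.2.1 h.2.2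
    rw [one_pow] at h1
    exact (norm_sub_le_of_le h1 he).trans (one_le_zpow₀ hu.one_lt_card.le (by omega))
  rw [h, cube, Measure.prod_prod, Measure.prod_prod, hμF, one_mul, one_mul]

theorem IsUniformizer.cube_ternarySet_left {e : F} (he : ‖e‖ ≤ 1) {j : ℤ} (hj : 1 ≤ j) :
    cube μF (ternarySet e j ∩ {u | ‖u.2.1‖ = 1}) =
      ENNReal.ofReal ((resCard F : ℝ) ^ (-j) * (1 - (resCard F : ℝ) ^ (-1 : ℤ))) := by
  have hm : MeasurableSet (ternarySet e j ∩ {u : F × F × F | ‖u.2.1‖ = 1}) :=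
    (measurableSet_ternarySet e j).inter (by measurability)
  rw [cube, prod_apply_of_slices μF _ hm (A := {x | ‖x‖ ≤ 1}) (by measurability), hμF, mul_one]
  · intro z (hz : ‖z‖ ≤ 1)
    rw [← hu.measure_hyperbola h2 μF hμF
      (norm_sub_le_of_le he (norm_sq_le_one hz)) (by omega : 0 ≤ j)]
    congr 1
    ext p
    have : 2 * p.1 * p.2 + z ^ 2 - e = 2 * p.1 * p.2 - (e - z ^ 2) := by ring
    simp only [ternarySet, ternary, Set.mem_preimage, Set.mem_ofPred_eq, Set.mem_inter_iff, this]
    exact ⟨fun h => ⟨h.2, h.1.2.2.1, h.1.2.2.2⟩, fun h => ⟨⟨hz, h.1.le, h.2.1, h.2.2⟩, h.1⟩⟩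
  · intro z hz
    convert measure_empty (μ := μF.prod μF)
    ext p
    simp only [Set.mem_preimage, Set.mem_inter_iff, Set.mem_empty_iff_false, iff_false]
    exact fun h => hz h.1.1

theorem IsUniformizer.cube_ternarySet_right {e : F} {j : ℤ} (hj : 1 ≤ j) :
    cube μF (ternarySet e j ∩ {u | ‖u.2.1‖ < 1 ∧ ‖u.2.2‖ = 1}) =
      ENNReal.ofReal ((resCard F : ℝ) ^ (-j) * (1 - (resCard F : ℝ) ^ (-1 : ℤ))) *
        μF {z | ‖z‖ ≤ 1 ∧ ‖z ^ 2 - e‖ < 1} := by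
  have hm : MeasurableSet (ternarySet e j ∩ {u : F × F × F | ‖u.2.1‖ < 1 ∧ ‖u.2.2‖ = 1}) :=
    (measurableSet_ternarySet e j).inter (by measurability)
  have hq : (resCard F : ℝ) ^ (-j) < 1 := zpow_lt_one_of_neg₀ hu.one_lt_card (by omega)
  refine prod_apply_of_slices μF _ hm (by measurability) ?_ ?_
  · rintro z ⟨hz, hze⟩
    rw [← norm_neg, neg_sub] at hze
    rw [← hu.measure_hyperbola_lt h2 μF hμF hze hj]
    have hsw := (Measure.measurePreserving_swap (μ := μF) (ν := μF)).measure_preimage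
      (s := {p : F × F | ‖p.1‖ = 1 ∧ ‖p.2‖ < 1 ∧
        ‖2 * p.1 * p.2 - (e - z ^ 2)‖ ≤ (resCard F : ℝ) ^ (-j)})
      (by measurability : MeasurableSet _).nullMeasurableSet
    rw [← hsw]
    congr 1
    ext p
    have : 2 * p.1 * p.2 + z ^ 2 - e = 2 * p.2 * p.1 - (e - z ^ 2) := by ring
    simp only [ternarySet, ternary, Set.mem_preimage, Set.mem_ofPred_eq, Set.mem_inter_iff, this,
      Prod.fst_swap, Prod.snd_swap]
    exact ⟨fun h => ⟨h.2.2, h.2.1, h.1.2.2.2⟩,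
      fun h => ⟨⟨hz, h.2.1.le, h.1.le, h.2.2⟩, h.2.1, h.1⟩⟩
  · intro z hz
    convert measure_empty (μ := μF.prod μF)
    ext p
    simp only [Set.mem_preimage, Set.mem_inter_iff, Set.mem_empty_iff_false, iff_false]
    rintro ⟨⟨h1, h3, h4, h5⟩, h6, h7⟩
    refine hz ⟨h1, ?_⟩
    have h8 : ‖2 * p.1 * p.2‖ < 1 := by
      rw [norm_mul, norm_mul, h2, one_mul, show ‖p.2‖ = 1 from h7, mul_one]
      exact h6
    have h9 : z ^ 2 - e = (ternary (z, p) - e) - 2 * p.1 * p.2 := by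
      rw [ternary]
      ring
    rw [h9, sub_eq_add_neg]
    refine (IsUltrametricDist.norm_add_le_max _ _).trans_lt (max_lt (h5.trans_lt hq) ?_)
    rwa [norm_neg]

/-- If a is a unit, the congruence is solved linearly for b with z free. If a is not a unit but b
is, it is solved for a, which requires z² ≡ e modulo ϖ. The solutions with neither a nor b a unit
remain. -/
theorem IsUniformizer.cube_ternarySet_eq_add {e : F} (he : ‖e‖ ≤ 1) {j : ℤ} (hj : 1 ≤ j) :
    cube μF (ternarySet e j) =
      ENNReal.ofReal ((resCard F : ℝ) ^ (-j) * (1 - (resCard F : ℝ) ^ (-1 : ℤ))) *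
        (1 + μF {z | ‖z‖ ≤ 1 ∧ ‖z ^ 2 - e‖ < 1}) +
      cube μF (ternarySet e j ∩ {u | ‖u.2.1‖ < 1 ∧ ‖u.2.2‖ < 1}) := by
  have hm1 : MeasurableSet (ternarySet e j ∩ {u : F × F × F | ‖u.2.1‖ < 1 ∧ ‖u.2.2‖ = 1}) :=
    (measurableSet_ternarySet e j).inter (by measurability)
  have hm2 : MeasurableSet (ternarySet e j ∩ {u : F × F × F | ‖u.2.1‖ < 1 ∧ ‖u.2.2‖ < 1}) :=
    (measurableSet_ternarySet e j).inter (by measurability)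
  have hs : ternarySet e j = (ternarySet e j ∩ {u | ‖u.2.1‖ = 1}) ∪
      ((ternarySet e j ∩ {u | ‖u.2.1‖ < 1 ∧ ‖u.2.2‖ = 1}) ∪
        (ternarySet e j ∩ {u | ‖u.2.1‖ < 1 ∧ ‖u.2.2‖ < 1})) := by
    ext u
    simp only [Set.mem_union, Set.mem_inter_iff, Set.mem_ofPred_eq]
    constructor
    · intro h
      rcases lt_or_eq_of_le h.2.1 with h1 | h1
      · rcases lt_or_eq_of_le h.2.2.1 with h3 | h3
        · exact Or.inr (Or.inr ⟨h, h1, h3⟩)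
        · exact Or.inr (Or.inl ⟨h, h1, h3⟩)
      · exact Or.inl ⟨h, h1⟩
    · rintro (h | h | h) <;> exact h.1
  conv_lhs => rw [hs]
  rw [measure_union _ (hm1.union hm2), measure_union _ hm2, hu.cube_ternarySet_left h2 μF hμF he hj,
    hu.cube_ternarySet_right h2 μF hμF hj, ← add_assoc, mul_add, mul_one]
  · rw [Set.disjoint_left]
    rintro u ⟨-, -, h⟩ ⟨-, -, h'⟩
    exact absurd h' (by rw [h]; exact lt_irrefl _)
  · rw [Set.disjoint_left]
    rintro u ⟨-, h⟩ (⟨-, h', -⟩ | ⟨-, h', -⟩) <;>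
    exact absurd h' (by rw [show ‖u.2.1‖ = 1 from h]; exact lt_irrefl _)

omit hu hμF [MeasurableSpace F] [BorelSpace F] in
theorem sqrtCount_congr {e e' : F} (he : ‖e‖ = 1) (h : ‖e' - e‖ < 1) :
    sqrtCount e' = sqrtCount e := by
  have he' : ‖e'‖ = 1 := by
    have := norm_add_eq_of_lt (x := e' - e) (y := e) (by rwa [he])
    rwa [sub_add_cancel, he] at this
  have : IsSquare e' ↔ IsSquare e := by
    constructor
    · rintro ⟨w, rfl⟩
      exact isSquare_of_norm_sub_lt h2 he (z := w) (by rwa [sq])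
    · rintro ⟨w, rfl⟩
      exact isSquare_of_norm_sub_lt h2 he' (z := w) (by rwa [sq, ← norm_neg, neg_sub])
  unfold sqrtCount
  by_cases h : IsSquare e
  · rw [if_pos h, if_pos (this.2 h)]
  · rw [if_neg h, if_neg (mt this.1 h)]

/-- When a and b are both non-units, e - 2ab is a unit in the square class of e, so z runs over
approximate square roots and the count depends only on e. -/
theorem IsUniformizer.cube_ternarySet_of_unit {e : F} (he : ‖e‖ = 1) {j : ℤ} (hj : 1 ≤ j) :
    cube μF (ternarySet e j) = ENNReal.ofReal ((resCard F : ℝ) ^ (-j) *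
      (1 + (sqrtCount e - 1) * (resCard F : ℝ) ^ (-1 : ℤ))) := by
  have hm : MeasurableSet (ternarySet e j ∩ {u : F × F × F | ‖u.2.1‖ < 1 ∧ ‖u.2.2‖ < 1}) :=
    (measurableSet_ternarySet e j).inter (by measurability)
  have hq0 : 0 < (resCard F : ℝ) ^ (-1 : ℤ) := zpow_pos hu.card_pos _
  have hqj : 0 < (resCard F : ℝ) ^ (-j) := zpow_pos hu.card_pos _
  have hq1 : (resCard F : ℝ) ^ (-1 : ℤ) < 1 := zpow_lt_one_of_neg₀ hu.one_lt_card (by omega)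
  have hs0 : 0 ≤ sqrtCount e := by
    unfold sqrtCount
    split_ifs <;> norm_num
  have h3 : cube μF (ternarySet e j ∩ {u | ‖u.2.1‖ < 1 ∧ ‖u.2.2‖ < 1}) =
      ENNReal.ofReal (sqrtCount e * (resCard F : ℝ) ^ (-j)) *
        (ENNReal.ofReal ((resCard F : ℝ) ^ (-1 : ℤ)) *
          ENNReal.ofReal ((resCard F : ℝ) ^ (-1 : ℤ))) := by
    rw [cube, prod_apply_of_slices_symm μF _ hm (A := {x : F | ‖x‖ < 1} ×ˢ {x : F | ‖x‖ < 1})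
      ((by measurability : MeasurableSet _).prod (by measurability))
      (c := ENNReal.ofReal (sqrtCount e * (resCard F : ℝ) ^ (-j))), Measure.prod_prod,
      hu.measure_norm_lt_one μF hμF]
    · rintro p ⟨hp1 : ‖p.1‖ < 1, hp2 : ‖p.2‖ < 1⟩
      have h4 : ‖e - 2 * p.1 * p.2 - e‖ < 1 := by
        rw [sub_sub_cancel_left, norm_neg, norm_mul, norm_mul, h2, one_mul]
        nlinarith [norm_nonneg p.1, norm_nonneg p.2]
      have h5 := norm_add_eq_of_lt (x := e - 2 * p.1 * p.2 - e) (y := e) (by rwa [he])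
      rw [sub_add_cancel, he] at h5
      rw [← sqrtCount_congr h2 he h4, ← hu.measure_sq h2 μF hμF h5 hj]
      congr 1
      ext z
      have : 2 * p.1 * p.2 + z ^ 2 - e = z ^ 2 - (e - 2 * p.1 * p.2) := by ring
      simp only [ternarySet, ternary, Set.mem_preimage, Set.mem_ofPred_eq, Set.mem_inter_iff, this]
      exact ⟨fun h => ⟨h.1.1, h.1.2.2.2⟩, fun h => ⟨⟨h.1, hp1.le, hp2.le, h.2⟩, hp1, hp2⟩⟩
    · intro p hp
      convert measure_empty (μ := μF)
      ext z
      simp only [Set.mem_preimage, Set.mem_inter_iff, Set.mem_empty_iff_false, iff_false]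
      exact fun h => hp ⟨h.2.1, h.2.2⟩
  have h4 : μF {z | ‖z‖ ≤ 1 ∧ ‖z ^ 2 - e‖ < 1} =
      ENNReal.ofReal (sqrtCount e * (resCard F : ℝ) ^ (-1 : ℤ)) := by
    simp only [hu.norm_lt_one_iff (_ - e)]
    exact hu.measure_sq h2 μF hμF he le_rfl
  rw [hu.cube_ternarySet_eq_add h2 μF hμF he.le hj, h3, h4, ← ENNReal.ofReal_one,
    ← ENNReal.ofReal_add zero_le_one (by positivity),
    ← ENNReal.ofReal_mul (mul_nonneg hqj.le (by linarith)), ← ENNReal.ofReal_mul hq0.le,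
    ← ENNReal.ofReal_mul (by positivity), ← ENNReal.ofReal_add (by
      refine mul_nonneg (mul_nonneg hqj.le (by linarith)) ?_
      positivity) (by positivity)]
  congr 1
  ring

/-- For a right-hand side divisible by ϖ², non-units a and b force z to be a non-unit. The vector is
then divisible by ϖ, and dividing by ϖ leads back to e modulo ϖ^{j-2} with Jacobian q^{-3}. -/
theorem IsUniformizer.cube_ternarySet_mul {e : F} (he : ‖e‖ ≤ 1) {j : ℤ} (hj : 1 ≤ j) :
    cube μF (ternarySet ((ϖ : F) ^ 2 * e) j) =
      ENNReal.ofReal ((resCard F : ℝ) ^ (-j) * (1 - (resCard F : ℝ) ^ (-2 : ℤ))) +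
      ENNReal.ofReal ((resCard F : ℝ) ^ (-3 : ℤ)) * cube μF (ternarySet e (j - 2)) := by
  have hq0 : 0 < (resCard F : ℝ) ^ (-1 : ℤ) := zpow_pos hu.card_pos _
  have hqj : 0 < (resCard F : ℝ) ^ (-j) := zpow_pos hu.card_pos _
  have hqj1 : (resCard F : ℝ) ^ (-j) < 1 := zpow_lt_one_of_neg₀ hu.one_lt_card (by omega)
  have hq1 : (resCard F : ℝ) ^ (-1 : ℤ) < 1 := zpow_lt_one_of_neg₀ hu.one_lt_card (by omega)
  have hϖ := hu.norm_lt_one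
  have hϖ0 : 0 < ‖(ϖ : F)‖ := norm_pos_iff.2 ϖ.ne_zero
  have he' : ‖(ϖ : F) ^ 2 * e‖ < 1 := by
    rw [norm_mul, norm_pow]
    nlinarith [norm_nonneg e]
  have h4 : {z : F | ‖z‖ ≤ 1 ∧ ‖z ^ 2 - (ϖ : F) ^ 2 * e‖ < 1} = {z | ‖z‖ < 1} := by
    ext z
    simp only [Set.mem_ofPred_eq]
    constructor
    · rintro ⟨-, h⟩
      have := (IsUltrametricDist.norm_add_le_max _ _).trans_lt (max_lt h he')
      rw [sub_add_cancel, norm_pow] at this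
      exact (pow_lt_one_iff_of_nonneg (norm_nonneg _) two_ne_zero).1 this
    · intro h
      refine ⟨h.le, ?_⟩
      rw [sub_eq_add_neg]
      refine (IsUltrametricDist.norm_add_le_max _ _).trans_lt (max_lt ?_ (by rwa [norm_neg]))
      rw [norm_pow]
      exact pow_lt_one₀ (norm_nonneg _) h two_ne_zero
  have hsc : ∀ x : F, ‖x‖ < 1 ↔ ‖((ϖ⁻¹ : Fˣ) : F) * x‖ ≤ 1 := fun x => by
    rw [hu.lt_one_iff, norm_mul, Units.val_inv_eq_inv_val, norm_inv, inv_mul_le_iff₀ hϖ0, mul_one]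
  have h3 : ternarySet ((ϖ : F) ^ 2 * e) j ∩ {u | ‖u.2.1‖ < 1 ∧ ‖u.2.2‖ < 1} =
      (fun u : F × F × F => (((ϖ⁻¹ : Fˣ) : F) * u.1, ((ϖ⁻¹ : Fˣ) : F) * u.2.1,
        ((ϖ⁻¹ : Fˣ) : F) * u.2.2)) ⁻¹' ternarySet e (j - 2) := by
    ext u
    have hform : ternary (((ϖ⁻¹ : Fˣ) : F) * u.1, ((ϖ⁻¹ : Fˣ) : F) * u.2.1,
        ((ϖ⁻¹ : Fˣ) : F) * u.2.2) - e = ((ϖ⁻¹ : Fˣ) : F) ^ 2 * (ternary u - (ϖ : F) ^ 2 * e) := by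
      have : ((ϖ⁻¹ : Fˣ) : F) * (ϖ : F) = 1 := by simp
      simp only [ternary]
      linear_combination (e * (((ϖ⁻¹ : Fˣ) : F) * (ϖ : F)) + e) * this
    have hnorm : ‖((ϖ⁻¹ : Fˣ) : F) ^ 2 * (ternary u - (ϖ : F) ^ 2 * e)‖ ≤
        (resCard F : ℝ) ^ (-(j - 2)) ↔
        ‖ternary u - (ϖ : F) ^ 2 * e‖ ≤ (resCard F : ℝ) ^ (-j) := by
      rw [norm_mul, norm_pow, Units.val_inv_eq_inv_val, norm_inv, hu.norm_eq, inv_inv,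
        show -(j - 2) = 2 + -j by ring, zpow_add₀ hu.card_pos.ne']
      exact mul_le_mul_iff_right₀ (pow_pos hu.card_pos 2)
    simp only [ternarySet, Set.mem_inter_iff, Set.mem_ofPred_eq, Set.mem_preimage, ← hsc, hform,
      hnorm]
    constructor
    · rintro ⟨⟨h1, -, -, h5⟩, h6, h7⟩
      refine ⟨?_, h6, h7, h5⟩
      by_contra hz
      have hz1 : ‖u.1‖ = 1 := le_antisymm h1 (not_lt.1 hz)
      have h8 : ‖2 * u.2.1 * u.2.2‖ < 1 := by
        rw [norm_mul, norm_mul, h2, one_mul]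
        nlinarith [norm_nonneg u.2.1, norm_nonneg u.2.2]
      have h9 : ‖u.1 ^ 2‖ < 1 := by
        have : u.1 ^ 2 = (ternary u - (ϖ : F) ^ 2 * e) +
          ((ϖ : F) ^ 2 * e + -(2 * u.2.1 * u.2.2)) := by
          simp only [ternary]
          ring
        rw [this]
        refine (IsUltrametricDist.norm_add_le_max _ _).trans_lt (max_lt (h5.trans_lt hqj1) ?_)
        exact (IsUltrametricDist.norm_add_le_max _ _).trans_lt (max_lt he' (by rwa [norm_neg]))
      rw [norm_pow, hz1, one_pow] at h9
      exact lt_irrefl _ h9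
    · rintro ⟨h1, h6, h7, h5⟩
      exact ⟨⟨h1.le, h6.le, h7.le, h5⟩, h6, h7⟩
  rw [hu.cube_ternarySet_eq_add h2 μF hμF he'.le hj, h4, hu.measure_norm_lt_one μF hμF, h3,
    hu.cube_preimage μF hμF _ (measurableSet_ternarySet _ _), ← ENNReal.ofReal_one,
    ← ENNReal.ofReal_add zero_le_one hq0.le, ← ENNReal.ofReal_mul (mul_nonneg hqj.le (by linarith))]
  congr 1
  · congr 1
    rw [show (-2 : ℤ) = -1 + -1 by norm_num, zpow_add₀ hu.card_pos.ne']
    ring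
  · congr 2
    rw [Units.val_inv_eq_inv_val, norm_inv, inv_inv, hu.norm_eq, _root_.zpow_neg, inv_pow]
    rfl

end TernaryVolumes

end SO5PGL2

namespace SO5PGL2

/-! ### The invariant measure in the coordinates of the open Borel orbits -/

section InvariantMeasure

variable {F : Type*} [NontriviallyNormedField F] [IsUltrametricDist F] [LocallyCompactSpace F]
  [MeasurableSpace F] [BorelSpace F] {ϖ : Fˣ} {t : Kind F}

/-- The coordinates `(s₃, s₂, s₄) / s₅`. -/
noncomputable def ucoord (s : Sphere t) : F × F × F := (s.1 2 / s.1 4, s.1 1 / s.1 4, s.1 3 / s.1 4)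

theorem measurable_apply (i : Fin 5) : Measurable fun s : Sphere t => s.1 i :=
  (measurable_pi_apply i).comp measurable_subtype_coe

theorem measurable_ucoord : Measurable (ucoord : Sphere t → F × F × F) :=
  ((measurable_apply 2).div (measurable_apply 4)).prodMk
    (((measurable_apply 1).div (measurable_apply 4)).prodMk
      ((measurable_apply 3).div (measurable_apply 4)))

theorem measurable_smul_sphere (g : SO5 F) : Measurable fun s : Sphere t => g • s :=
  (continuous_smul_right g).measurable

theorem IsInvariantMeasure.measure_preimage {μS : Measure (Sphere t)}
    (hμS : IsInvariantMeasure t ϖ μS) (g : SO5 F) {A : Set (Sphere t)} (hA : MeasurableSet A) :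
    μS ((fun s => g • s) ⁻¹' A) = μS A := by
  conv_rhs => rw [← hμS.invariant g]
  rw [Measure.map_apply (measurable_smul_sphere g) hA]

theorem sphere_eq (s : Sphere t) (h4 : s.1 4 ≠ 0) :
    2 * s.1 0 * s.1 4 = t.level - s.1 4 ^ 2 * ternary (ucoord s) := by
  have h := s.2
  rw [form_eq] at h
  have key : s.1 4 ^ 2 * ternary (ucoord s) = 2 * s.1 1 * s.1 3 + s.1 2 ^ 2 := by
    rw [ternary, ucoord]
    field_simp
  linear_combination h + key

/-- The unipotent radical fixes s₅ and acts on u by translations; this is what makes the invariant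
measure a Haar measure in u. -/
theorem ucoord_unipG (h20 : (2 : F) ≠ 0) (y : F × F × F) {s : Sphere t} (h4 : s.1 4 ≠ 0) :
    ucoord (unipG h20 y.2.1 y.1 y.2.2 • s) = y + ucoord s := by
  unfold ucoord
  rw [smul_val, unipG_mulVec]
  refine Prod.ext ?_ (Prod.ext ?_ ?_) <;> simp <;> field_simp <;> ring

theorem unipG_smul_four (h20 : (2 : F) ≠ 0) (y₁ y₂ y₃ : F) (s : Sphere t) :
    (unipG h20 y₁ y₂ y₃ • s).1 4 = s.1 4 := by
  rw [smul_val, unipG_mulVec]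
  rfl

theorem torusG_smul_four (a : Fˣ) (s : Sphere t) :
    (torusG a • s).1 4 = ((a⁻¹ : Fˣ) : F) * s.1 4 := by
  rw [smul_val, torusG_mulVec]
  simp

theorem ucoord_torusG (a : Fˣ) (s : Sphere t) :
    ucoord (torusG a • s) =
      ((a : F) * (ucoord s).1, (a : F) * (ucoord s).2.1, (a : F) * (ucoord s).2.2) := by
  unfold ucoord
  rw [smul_val, torusG_mulVec]
  refine Prod.ext ?_ (Prod.ext ?_ ?_) <;> simp [div_eq_mul_inv] <;> ring

theorem isCompact_sphere_subset {m R : ℝ} (hm : 0 < m) (h2 : ‖(2 : F)‖ = 1) :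
    ∃ B : Set (Sphere t), IsCompact B ∧ {s : Sphere t | ‖s.1 4‖ = m ∧ ‖ucoord s‖ ≤ R} ⊆ B := by
  refine ⟨{s | ‖s.1‖ ≤ max (m * R) (max m (m⁻¹ * max ‖t.level‖ (m ^ 2 * R ^ 2)))},
    isCompact_norm_sphere_le _, ?_⟩
  rintro s ⟨h4, hR'⟩
  have h40 : s.1 4 ≠ 0 := by
    rw [← norm_ne_zero_iff, h4]
    exact hm.ne'
  have hu1 : ‖(ucoord s).1‖ ≤ R := (norm_fst_le _).trans hR'
  have hu2 : ‖(ucoord s).2.1‖ ≤ R := (norm_fst_le _).trans ((norm_snd_le _).trans hR')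
  have hu3 : ‖(ucoord s).2.2‖ ≤ R := (norm_snd_le _).trans ((norm_snd_le _).trans hR')
  have key : ∀ x : F, ‖x / s.1 4‖ ≤ R → ‖x‖ ≤ m * R := fun x hx => by
    rwa [norm_div, h4, div_le_iff₀' hm] at hx
  have h0 : ‖s.1 0‖ ≤ m⁻¹ * max ‖t.level‖ (m ^ 2 * R ^ 2) := by
    have h := congrArg norm (sphere_eq s h40)
    rw [norm_mul, norm_mul, h2, one_mul, h4] at h
    rw [inv_mul_eq_div, le_div_iff₀ hm, h]
    refine norm_sub_le_of_le (le_max_left _ _) (le_max_of_le_right ?_)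
    rw [norm_mul, norm_pow, h4]
    exact mul_le_mul_of_nonneg_left (norm_ternary_le h2 hu1 hu2 hu3) (by positivity)
  refine (pi_norm_le_iff_of_nonneg ?_).2 fun i => ?_
  · exact le_max_of_le_right (le_max_of_le_left hm.le)
  · fin_cases i
    · exact le_max_of_le_right (le_max_of_le_right h0)
    · exact le_max_of_le_left (key _ hu2)
    · exact le_max_of_le_left (key _ hu1)
    · exact le_max_of_le_left (key _ hu3)
    · exact le_max_of_le_right (le_max_of_le_left h4.le)

variable (hu : IsUniformizer ϖ) (h2 : ‖(2 : F)‖ = 1) (μF : Measure F) [μF.IsAddHaarMeasure]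
  (hμF : μF {x | ‖x‖ ≤ 1} = 1) {μS : Measure (Sphere t)} (hμS : IsInvariantMeasure t ϖ μS)

/-- The integral vectors of `F³`. -/
def cubeUnit (F : Type*) [NontriviallyNormedField F] : Set (F × F × F) := {u | ‖u‖ ≤ 1}

theorem measurableSet_cubeUnit : MeasurableSet (cubeUnit F) := by
  unfold cubeUnit
  measurability

include hμF in
theorem cube_cubeUnit : cube μF (cubeUnit F) = 1 := by
  have h : cubeUnit F = {x : F | ‖x‖ ≤ 1} ×ˢ ({x : F | ‖x‖ ≤ 1} ×ˢ {x : F | ‖x‖ ≤ 1}) := by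
    ext u
    simp only [cubeUnit, Set.mem_ofPred_eq, Set.mem_prod, norm_prod_le_iff]
  rw [h, cube, Measure.prod_prod, Measure.prod_prod, hμF, one_mul, one_mul]

instance : (cube μF).IsAddHaarMeasure := by
  unfold cube
  have : MeasurableAdd (F × F) := ⟨fun c => by fun_prop, fun c => by fun_prop⟩
  exact Measure.prod.instIsAddHaarMeasure μF (μF.prod μF)

include h2 hμF hμS in
/-- The invariant measure is translation invariant in the coordinates `u`. -/
theorem IsInvariantMeasure.measure_rect {m : ℝ} (hm : 0 < m) {E : Set F} (hE : MeasurableSet E)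
    (hEm : ∀ x ∈ E, ‖x‖ = m) {A : Set (F × F × F)} (hA : MeasurableSet A) :
    μS {s | s.1 4 ∈ E ∧ ucoord s ∈ A} =
      μS {s | s.1 4 ∈ E ∧ ucoord s ∈ cubeUnit F} * cube μF A := by
  have h20 := ne_zero_of_norm_two h2
  have hSE : MeasurableSet {s : Sphere t | s.1 4 ∈ E} := measurable_apply 4 hE
  have hval : ∀ B : Set (F × F × F), MeasurableSet B →
      (μS.restrict {s | s.1 4 ∈ E}).map ucoord B = μS {s | s.1 4 ∈ E ∧ ucoord s ∈ B} := by
    intro B hB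
    rw [Measure.map_apply measurable_ucoord hB, Measure.restrict_apply (measurable_ucoord hB)]
    congr 1
    ext s
    exact and_comm
  -- Fixing |s₅| = m > 0 and bounding u confines s to a compact set, since the first coordinate is
  -- determined by the equation of S.
  have : IsFiniteMeasureOnCompacts ((μS.restrict {s | s.1 4 ∈ E}).map ucoord) := ⟨fun B hB => by
    obtain ⟨R, hR⟩ := hB.isBounded.exists_norm_le
    have hR' : ∀ x ∈ B, ‖x‖ ≤ max R 0 := fun x hx => (hR x hx).trans (le_max_left _ _)
    obtain ⟨C, hC, hsub⟩ := isCompact_sphere_subset (t := t) (R := max R 0) hm h2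
    rw [hval B hB.measurableSet]
    exact (measure_mono fun s hs => hsub ⟨hEm _ hs.1, hR' _ hs.2⟩).trans_lt
      (hμS.finite_on_compacts C hC)⟩
  have : ((μS.restrict {s | s.1 4 ∈ E}).map ucoord).IsAddLeftInvariant := ⟨fun y => by
    refine Measure.ext fun B hB => ?_
    have hmB : MeasurableSet {s : Sphere t | s.1 4 ∈ E ∧ ucoord s ∈ B} :=
      hSE.inter (measurable_ucoord hB)
    have hyB : MeasurableSet ((fun x => y + x) ⁻¹' B) := measurable_const_add y hB
    rw [Measure.map_apply (measurable_const_add y) hB, hval _ hyB, hval B hB,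
      ← hμS.measure_preimage (unipG h20 y.2.1 y.1 y.2.2) hmB]
    congr 1
    ext s
    simp only [Set.mem_ofPred_eq, Set.mem_preimage, unipG_smul_four]
    refine and_congr_right fun h => ?_
    rw [ucoord_unipG h20 y]
    rw [← norm_ne_zero_iff, hEm _ h]
    exact hm.ne'⟩
  have hsm := Measure.isAddLeftInvariant_eq_smul ((μS.restrict {s | s.1 4 ∈ E}).map ucoord)
    (cube μF)
  rw [← hval A hA, ← hval _ measurableSet_cubeUnit, hsm, Measure.smul_apply, Measure.smul_apply,
    cube_cubeUnit μF hμF, smul_mul_assoc, one_mul]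

include h2 hμS in
theorem IsInvariantMeasure.measure_cubeUnit_lt_top {m : ℝ} (hm : 0 < m) :
    μS {s | ‖s.1 4‖ = m ∧ ucoord s ∈ cubeUnit F} < ⊤ := by
  obtain ⟨C, hC, hsub⟩ := isCompact_sphere_subset (t := t) (R := 1) hm h2
  exact (measure_mono hsub).trans_lt (hμS.finite_on_compacts C hC)

include h2 hμF hμS in
-- Translation invariance in u holds over every measurable set of values of s₅, so on a shell of
-- constant |s₅| the measure is a product. Nothing about the factor in s₅ is needed beyond its total
-- mass.
theorem IsInvariantMeasure.map_restrict {m : ℝ} (hm : 0 < m) :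
    (μS.restrict {s | ‖s.1 4‖ = m}).map (fun s => (s.1 4, ucoord s)) =
      ((μS.restrict {s | ‖s.1 4‖ = m ∧ ucoord s ∈ cubeUnit F}).map fun s => s.1 4).prod
        (cube μF) := by
  have hmE : MeasurableSet {x : F | ‖x‖ = m} := by measurability
  have : IsFiniteMeasure (μS.restrict {s | ‖s.1 4‖ = m ∧ ucoord s ∈ cubeUnit F}) :=
    ⟨by rw [Measure.restrict_apply_univ]; exact hμS.measure_cubeUnit_lt_top h2 hm⟩
  symm
  refine Measure.prod_eq fun E A hE hA => ?_
  have hme := measurable_apply (t := t) 4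
  rw [Measure.map_apply (hme.prodMk measurable_ucoord) (hE.prod hA), Measure.map_apply hme hE,
    Measure.restrict_apply (hme.prodMk measurable_ucoord (hE.prod hA)),
    Measure.restrict_apply (hme hE)]
  refine Eq.trans ?_ ((hμS.measure_rect h2 μF hμF hm (hE.inter hmE) (fun x hx => hx.2) hA).trans ?_)
  · congr 1
    ext s
    simp only [Set.mem_inter_iff, Set.mem_preimage, Set.mem_prod, Set.mem_ofPred_eq]
    tauto
  · congr 2
    ext s
    simp only [Set.mem_inter_iff, Set.mem_preimage, Set.mem_ofPred_eq]
    tauto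

/-- The volume of the points with `s₅` a unit and `u` integral. -/
noncomputable def unitVolume (μS : Measure (Sphere t)) : ENNReal :=
  μS {s | ‖s.1 4‖ = 1 ∧ ucoord s ∈ cubeUnit F}

include hu h2 hμF hμS in
-- The torus element for ϖ^m moves the shell |s₅| = 1 to the shell |s₅| = q^m and scales u by ϖ^m;
-- the preimage of the integral cube has volume q^{3m}.
theorem IsUniformizer.measure_cubeUnit (m : ℤ) :
    μS {s | ‖s.1 4‖ = (resCard F : ℝ) ^ m ∧ ucoord s ∈ cubeUnit F} =
      unitVolume μS * ENNReal.ofReal ((resCard F : ℝ) ^ (3 * m)) := by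
  have hm : ∀ m : ℤ, MeasurableSet {x : F | ‖x‖ = (resCard F : ℝ) ^ m} := fun m => by measurability
  have hmU : MeasurableSet
      {s : Sphere t | ‖s.1 4‖ = (resCard F : ℝ) ^ m ∧ ucoord s ∈ cubeUnit F} :=
    (measurable_apply (t := t) 4 (hm m)).inter (measurable_ucoord measurableSet_cubeUnit)
  rw [← hμS.measure_preimage (torusG (ϖ ^ m)) hmU]
  have hA : MeasurableSet ((fun u : F × F × F => (((ϖ ^ m : Fˣ) : F) * u.1,
      ((ϖ ^ m : Fˣ) : F) * u.2.1, ((ϖ ^ m : Fˣ) : F) * u.2.2)) ⁻¹' cubeUnit F) :=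
    measurableSet_cubeUnit.preimage (by fun_prop)
  have h := hμS.measure_rect h2 μF hμF zero_lt_one (by measurability : MeasurableSet {x : F | ‖x‖ = 1})
    (fun x hx => hx) hA
  rw [hu.cube_preimage μF hμF _ measurableSet_cubeUnit, cube_cubeUnit μF hμF, mul_one] at h
  refine Eq.trans ?_ (h.trans ?_)
  · congr 1
    ext s
    simp only [Set.mem_preimage, Set.mem_ofPred_eq, torusG_smul_four, ucoord_torusG]
    refine and_congr_left fun _ => ?_
    rw [norm_mul, ← _root_.zpow_neg, hu.norm_zpow, neg_neg]
    exact mul_eq_left₀ (zpow_pos hu.card_pos _).ne'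
  · rw [unitVolume]
    congr 2
    rw [hu.norm_zpow, _root_.zpow_neg, inv_inv, mul_comm, _root_.zpow_mul]
    rfl

end InvariantMeasure

end SO5PGL2

namespace SO5PGL2

/-! ### The integral of a power of the last coordinate over a ball in the symmetric space -/

/-- The volume of the integral vectors with `2ab + z² ≡ ϖ^{2r} e` modulo `ϖ^j`, where `s` is the
number of square roots of the unit `e`. -/
noncomputable def congrVolume (q s : ℝ) : ℕ → ℤ → ℝ
  | 0, j => if j ≤ 0 then 1 else q ^ (-j) * (1 + (s - 1) * q ^ (-1 : ℤ))
  | r + 1, j => if j ≤ 0 then 1 else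
      q ^ (-j) * (1 - q ^ (-2 : ℤ)) + q ^ (-3 : ℤ) * congrVolume q s r (j - 2)

theorem congrVolume_nonneg {q s : ℝ} (hq : 1 < q) (hs : 0 ≤ s) (r : ℕ) (j : ℤ) :
    0 ≤ congrVolume q s r j := by
  have hq0 : 0 < q := zero_lt_one.trans hq
  have h1 : q ^ (-1 : ℤ) < 1 := zpow_lt_one_of_neg₀ hq (by omega)
  have h2 : q ^ (-2 : ℤ) < 1 := zpow_lt_one_of_neg₀ hq (by omega)
  have h3 : 0 < q ^ (-1 : ℤ) := zpow_pos hq0 _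
  induction r generalizing j with
  | zero =>
    rw [congrVolume]
    split_ifs
    · exact zero_le_one
    · refine mul_nonneg (zpow_pos hq0 _).le ?_
      nlinarith
  | succ r ih =>
    rw [congrVolume]
    split_ifs
    · exact zero_le_one
    · exact add_nonneg (mul_nonneg (zpow_pos hq0 _).le (by linarith))
        (mul_nonneg (zpow_pos hq0 _).le (ih _))

theorem congrVolume_of_nonpos (q s : ℝ) (r : ℕ) {j : ℤ} (hj : j ≤ 0) : congrVolume q s r j = 1 := by
  cases r <;> rw [congrVolume, if_pos hj]

/-- The generating series of the volumes. -/
noncomputable def congrSeries (q s y : ℝ) : ℕ → ℝ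
  | 0 => (1 + (s - 1) * (y / q ^ 2)) / (1 - y / q)
  | r + 1 => (1 - y ^ 2 / q ^ 4) / (1 - y / q) + y ^ 2 / q ^ 3 * congrSeries q s y r

theorem HasSum.of_eq {f g : ℕ → ℝ} {a b : ℝ} (h : HasSum f a) (hf : ∀ i, g i = f i) (ha : b = a) :
    HasSum g b := by
  rw [show g = f from funext hf, ha]
  exact h

theorem hasSum_congrVolume {q s y : ℝ} (hq : 1 < q) (hy0 : 0 ≤ y) (hy : y ≤ 1) (r : ℕ) :
    HasSum (fun j : ℕ => congrVolume q s r j * y ^ j) (congrSeries q s y r) := by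
  have hq0 : 0 < q := zero_lt_one.trans hq
  have hyq : y / q < 1 := (div_lt_one hq0).2 (hy.trans_lt hq)
  have hyq' : 1 - y / q ≠ 0 := by linarith
  have hyq2 : q - y ≠ 0 := by linarith
  have hg := hasSum_geometric_of_lt_one (div_nonneg hy0 hq0.le) hyq
  have hpow : ∀ j : ℕ, ∀ a : ℤ, q ^ (-((j : ℤ) + a)) * y ^ j = q ^ (-a) * (y / q) ^ j := fun j a => by
    rw [neg_add, zpow_add₀ hq0.ne', _root_.zpow_neg, _root_.zpow_natCast, div_pow]
    ring
  induction r with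
  | zero =>
    refine (hasSum_nat_add_iff' 1).1 ?_
    refine HasSum.of_eq (hg.mul_left (y / q * (1 + (s - 1) * q ^ (-1 : ℤ)))) (fun j => ?_) ?_
    · rw [congrVolume, if_neg (by push_cast; omega), pow_succ, Nat.cast_succ]
      have := hpow j 1
      rw [_root_.zpow_neg_one] at this ⊢
      linear_combination (1 + (s - 1) * q⁻¹) * y * this
    · rw [Finset.sum_range_one, congrVolume_of_nonpos _ _ _ (by simp), congrSeries, _root_.zpow_neg_one]
      field_simp
      ring
  | succ r ih =>
    -- The recursion lowers j by 2, so the terms j = 0 and j = 1 are split off. For j = 1 the inner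
    -- index is -1, where the volume is 1.
    refine (hasSum_nat_add_iff' 2).1 ?_
    refine HasSum.of_eq ((hg.mul_left ((y / q) ^ 2 * (1 - q ^ (-2 : ℤ)))).add
      (ih.mul_left (q ^ (-3 : ℤ) * y ^ 2))) (fun j => ?_) ?_
    · rw [congrVolume, if_neg (by push_cast; omega), pow_add, Nat.cast_add, Nat.cast_ofNat,
        add_sub_cancel_right]
      have := hpow j 2
      rw [show q ^ (-2 : ℤ) = (q ^ 2)⁻¹ from rfl] at this ⊢
      linear_combination (1 - (q ^ 2)⁻¹) * y ^ 2 * this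
    · rw [Finset.sum_range_succ, Finset.sum_range_one, congrVolume_of_nonpos _ _ _ (by simp),
        congrVolume, if_neg (by norm_num), congrVolume_of_nonpos _ _ _ (by simp), congrSeries,
        show q ^ (-2 : ℤ) = (q ^ 2)⁻¹ from rfl, show q ^ (-3 : ℤ) = (q ^ 3)⁻¹ from rfl,
        show q ^ (-((1 : ℕ) : ℤ)) = q⁻¹ by simp]
      field_simp
      ring

section BallIntegral

variable {F : Type*} [NontriviallyNormedField F] [IsUltrametricDist F] [LocallyCompactSpace F]
  [MeasurableSpace F] [BorelSpace F] {ϖ : Fˣ} {t : Kind F}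
  (hu : IsUniformizer ϖ) (h2 : ‖(2 : F)‖ = 1) (ht : t.Admissible)
  (μF : Measure F) [μF.IsAddHaarMeasure]
  (hμF : μF {x | ‖x‖ ≤ 1} = 1) {μS : Measure (Sphere t)} (hμS : IsInvariantMeasure t ϖ μS)

omit [LocallyCompactSpace F] [MeasurableSpace F] [BorelSpace F] in
theorem sqrtCount_nonneg (e : F) : 0 ≤ sqrtCount e := by
  unfold sqrtCount
  split_ifs <;> norm_num

include hu h2 hμF in
theorem IsUniformizer.cube_ternarySet {e : F} (he : ‖e‖ = 1) (r : ℕ) (j : ℤ) :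
    cube μF (ternarySet ((ϖ : F) ^ (2 * r) * e) j) =
      ENNReal.ofReal (congrVolume (resCard F) (sqrtCount e) r j) := by
  have hq := hu.one_lt_card
  have he' : ∀ r : ℕ, ‖(ϖ : F) ^ (2 * r) * e‖ ≤ 1 := fun r => by
    rw [norm_mul, he, mul_one, norm_pow]
    exact pow_le_one₀ (norm_nonneg _) hu.norm_lt_one.le
  induction r generalizing j with
  | zero =>
    rcases le_or_gt j 0 with hj | hj
    · rw [hu.cube_ternarySet_of_nonpos h2 μF hμF (he' 0) hj, congrVolume_of_nonpos _ _ _ hj,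
        ENNReal.ofReal_one]
    · rw [mul_zero, pow_zero, one_mul, hu.cube_ternarySet_of_unit h2 μF hμF he hj, congrVolume,
        if_neg (by omega)]
  | succ r ih =>
    rcases le_or_gt j 0 with hj | hj
    · rw [hu.cube_ternarySet_of_nonpos h2 μF hμF (he' _) hj, congrVolume_of_nonpos _ _ _ hj,
        ENNReal.ofReal_one]
    · have h2q : (resCard F : ℝ) ^ (-2 : ℤ) < 1 := zpow_lt_one_of_neg₀ hq (by omega)
      rw [show (ϖ : F) ^ (2 * (r + 1)) * e = (ϖ : F) ^ 2 * ((ϖ : F) ^ (2 * r) * e) by ring,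
        hu.cube_ternarySet_mul h2 μF hμF (he' r) hj, ih, congrVolume, if_neg (by omega),
        ← ENNReal.ofReal_mul (zpow_pos hu.card_pos _).le, ← ENNReal.ofReal_add]
      · exact mul_nonneg (zpow_pos hu.card_pos _).le (by linarith)
      · exact mul_nonneg (zpow_pos hu.card_pos _).le (congrVolume_nonneg hq (sqrtCount_nonneg e) _ _)

omit [LocallyCompactSpace F] [MeasurableSpace F] [BorelSpace F] in
theorem sqrtCount_mul_sq (e : F) {w : F} (hw : w ≠ 0) : sqrtCount (e * w ^ 2) = sqrtCount e := by
  have : IsSquare (e * w ^ 2) ↔ IsSquare e := by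
    constructor
    · rintro ⟨v, hv⟩
      refine ⟨v / w, ?_⟩
      field_simp
      rw [hv]
      ring
    · rintro ⟨v, rfl⟩
      exact ⟨v * w, by ring⟩
  unfold sqrtCount
  by_cases h : IsSquare e
  · rw [if_pos h, if_pos (this.2 h)]
  · rw [if_neg h, if_neg (mt this.1 h)]

include hu h2 ht hμF in
-- Scaling u by ϖ^j makes it integral and turns the condition into a congruence modulo ϖ^j. Its
-- right-hand side is ϖ^{2r} times the level times a unit square, so the volume depends only on the
-- square class of the level.
theorem IsUniformizer.cube_slice (r j : ℕ) {x : F} (hx : ‖x‖ = (resCard F : ℝ) ^ ((r : ℤ) - j)) :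
    cube μF {u | ‖u‖ ≤ (resCard F : ℝ) ^ (j : ℤ) ∧
      ‖t.level - x ^ 2 * ternary u‖ ≤ (resCard F : ℝ) ^ (2 * (r : ℤ) - j)} =
    ENNReal.ofReal ((resCard F : ℝ) ^ (3 * (j : ℤ)) *
      congrVolume (resCard F) (sqrtCount t.level) r j) := by
  have hq0 := hu.card_pos
  have hx0 : x ≠ 0 := by
    rw [← norm_ne_zero_iff, hx]
    exact (zpow_pos hq0 _).ne'
  have hϖ0 := ϖ.ne_zero
  -- The choice makes ϖ^{2j} x⁻² = ϖ^{2r} w², and the assumption on |x| says precisely that w is a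
  -- unit.
  set w : F := x⁻¹ * ((ϖ : F) ^ j * ((ϖ : F) ^ r)⁻¹) with hw
  have hw0 : w ≠ 0 := mul_ne_zero (inv_ne_zero hx0)
    (mul_ne_zero (pow_ne_zero _ hϖ0) (inv_ne_zero (pow_ne_zero _ hϖ0)))
  have hnϖ : ∀ k : ℕ, ‖(ϖ : F) ^ k‖ = (resCard F : ℝ) ^ (-(k : ℤ)) := fun k => by
    rw [norm_pow, hu.norm_eq, _root_.zpow_neg, _root_.zpow_natCast, inv_pow]
  have hwn : ‖w‖ = 1 := by
    rw [hw, norm_mul, norm_mul, norm_inv, norm_inv, hx, hnϖ, hnϖ, ← _root_.zpow_neg,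
      ← _root_.zpow_neg, ← zpow_add₀ hq0.ne', ← zpow_add₀ hq0.ne']
    convert zpow_zero _ using 2
    ring
  have hen : ‖t.level * w ^ 2‖ = 1 := by
    rw [norm_mul, t.norm_level h2 ht, norm_pow, hwn]
    norm_num
  have hset : {u : F × F × F | ‖u‖ ≤ (resCard F : ℝ) ^ (j : ℤ) ∧
      ‖t.level - x ^ 2 * ternary u‖ ≤ (resCard F : ℝ) ^ (2 * (r : ℤ) - j)} =
      (fun u : F × F × F => (((ϖ ^ j : Fˣ) : F) * u.1, ((ϖ ^ j : Fˣ) : F) * u.2.1,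
        ((ϖ ^ j : Fˣ) : F) * u.2.2)) ⁻¹' ternarySet ((ϖ : F) ^ (2 * r) * (t.level * w ^ 2)) j := by
    ext u
    have h1 : ∀ y : F, ‖((ϖ ^ j : Fˣ) : F) * y‖ ≤ 1 ↔ ‖y‖ ≤ (resCard F : ℝ) ^ (j : ℤ) := fun y => by
      rw [norm_mul, Units.val_pow_eq_pow_val, hnϖ, _root_.zpow_neg,
        inv_mul_le_iff₀ (zpow_pos hq0 _), mul_one]
    have h3 : ternary (((ϖ ^ j : Fˣ) : F) * u.1, ((ϖ ^ j : Fˣ) : F) * u.2.1,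
        ((ϖ ^ j : Fˣ) : F) * u.2.2) - (ϖ : F) ^ (2 * r) * (t.level * w ^ 2) =
        -(((ϖ : F) ^ j) ^ 2 * (x⁻¹) ^ 2 * (t.level - x ^ 2 * ternary u)) := by
      rw [hw]
      simp only [ternary, Units.val_pow_eq_pow_val]
      field_simp
      ring
    have h4 : ‖-(((ϖ : F) ^ j) ^ 2 * (x⁻¹) ^ 2 * (t.level - x ^ 2 * ternary u))‖ ≤
        (resCard F : ℝ) ^ (-(j : ℤ)) ↔
        ‖t.level - x ^ 2 * ternary u‖ ≤ (resCard F : ℝ) ^ (2 * (r : ℤ) - j) := by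
      have h5 : ‖((ϖ : F) ^ j)‖ ^ 2 * ‖x⁻¹‖ ^ 2 = (resCard F : ℝ) ^ (-(2 * (r : ℤ))) := by
        rw [hnϖ, norm_inv, hx, ← mul_pow, ← _root_.zpow_neg, ← zpow_add₀ hq0.ne',
          ← _root_.zpow_natCast, ← _root_.zpow_mul]
        congr 1
        push_cast
        ring
      rw [norm_neg, norm_mul, norm_mul, norm_pow, norm_pow _ 2, h5, _root_.zpow_neg,
        inv_mul_le_iff₀ (zpow_pos hq0 _), ← zpow_add₀ hq0.ne', ← sub_eq_add_neg]
    simp only [ternarySet, Set.mem_preimage, Set.mem_ofPred_eq, h1, h3, h4, norm_prod_le_iff,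
      and_assoc]
  rw [hset, hu.cube_preimage μF hμF _ (measurableSet_ternarySet _ _),
    hu.cube_ternarySet h2 μF hμF hen, sqrtCount_mul_sq _ hw0, ENNReal.ofReal_mul (zpow_pos hq0 _).le]
  congr 2
  rw [Units.val_pow_eq_pow_val, hnϖ, _root_.zpow_neg, inv_inv, mul_comm, _root_.zpow_mul]
  rfl

theorem norm_le_iff_ucoord (h2 : ‖(2 : F)‖ = 1) {a b : ℝ} (ha : 0 < a) (hab : a ≤ b) {s : Sphere t}
    (hs : ‖s.1 4‖ = a) :
    ‖s.1‖ ≤ b ↔ ‖ucoord s‖ ≤ b / a ∧ ‖t.level - s.1 4 ^ 2 * ternary (ucoord s)‖ ≤ b * a := by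
  have hs0 : s.1 4 ≠ 0 := by
    rw [← norm_ne_zero_iff, hs]
    exact ha.ne'
  have h0 := congrArg norm (sphere_eq s hs0)
  rw [norm_mul, norm_mul, h2, one_mul, hs] at h0
  rw [← h0, mul_le_mul_iff_left₀ ha, norm_prod_le_iff, norm_prod_le_iff,
    pi_norm_le_iff_of_nonneg (ha.le.trans hab)]
  simp only [ucoord, norm_div, hs, div_le_div_iff_of_pos_right ha]
  constructor
  · intro h
    exact ⟨⟨h 2, h 1, h 3⟩, h 0⟩
  · rintro ⟨⟨h2', h1', h3'⟩, h0'⟩ i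
    fin_cases i
    exacts [h0', h1', h2', h3', hs.le.trans hab]

include hu h2 ht hμF hμS in
-- The shell contributes q^{3(r-j)} and the slice q^{3j} times a congruence volume. The product
-- q^{3r} is independent of j, so summing over shells gives a generating series of congruence
-- volumes.
theorem IsUniformizer.measure_ball_inter (r j : ℕ) :
    μS {s | sht s ≤ r ∧ ‖s.1 4‖ = (resCard F : ℝ) ^ ((r : ℤ) - j)} =
      unitVolume μS * ENNReal.ofReal ((resCard F : ℝ) ^ (3 * r) *
        congrVolume (resCard F) (sqrtCount t.level) r j) := by
  have hq0 := hu.card_pos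
  have hm : (0 : ℝ) < (resCard F : ℝ) ^ ((r : ℤ) - j) := zpow_pos hq0 _
  have hme := measurable_apply (t := t) 4
  have hE : MeasurableSet {x : F | ‖x‖ = (resCard F : ℝ) ^ ((r : ℤ) - j)} := by measurability
  let D : Set (F × F × F × F) := {p | ‖p.1‖ = (resCard F : ℝ) ^ ((r : ℤ) - j) ∧
    (‖p.2‖ ≤ (resCard F : ℝ) ^ (j : ℤ) ∧
      ‖t.level - p.1 ^ 2 * ternary p.2‖ ≤ (resCard F : ℝ) ^ (2 * (r : ℤ) - j))}
  have hD : MeasurableSet D := by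
    have := measurable_ternary (F := F)
    have h : Measurable fun p : F × F × F × F => t.level - p.1 ^ 2 * ternary p.2 := by fun_prop
    have h1 : MeasurableSet {p : F × F × F × F | ‖p.1‖ = (resCard F : ℝ) ^ ((r : ℤ) - j)} := by
      measurability
    have h2 : MeasurableSet {p : F × F × F × F | ‖p.2‖ ≤ (resCard F : ℝ) ^ (j : ℤ)} := by
      measurability
    have h3 : MeasurableSet {p : F × F × F × F |
        ‖t.level - p.1 ^ 2 * ternary p.2‖ ≤ (resCard F : ℝ) ^ (2 * (r : ℤ) - j)} :=
      measurableSet_le h.norm measurable_const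
    exact h1.inter (h2.inter h3)
  have h1 : {s : Sphere t | sht s ≤ r ∧ ‖s.1 4‖ = (resCard F : ℝ) ^ ((r : ℤ) - j)} =
      (fun s : Sphere t => (s.1 4, ucoord s)) ⁻¹' D ∩
        {s | ‖s.1 4‖ = (resCard F : ℝ) ^ ((r : ℤ) - j)} := by
    ext s
    simp only [D, Set.mem_ofPred_eq, Set.mem_inter_iff, Set.mem_preimage]
    rw [← hu.norm_sphere_le_iff h2 ht]
    have key : ‖s.1 4‖ = (resCard F : ℝ) ^ ((r : ℤ) - j) →
        (‖s.1‖ ≤ (resCard F : ℝ) ^ (r : ℤ) ↔ ‖ucoord s‖ ≤ (resCard F : ℝ) ^ (j : ℤ) ∧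
          ‖t.level - s.1 4 ^ 2 * ternary (ucoord s)‖ ≤ (resCard F : ℝ) ^ (2 * (r : ℤ) - j)) := by
      intro hs
      rw [norm_le_iff_ucoord h2 hm (zpow_le_zpow_right₀ hu.one_lt_card.le (by omega)) hs,
        ← zpow_sub₀ hq0.ne', ← zpow_add₀ hq0.ne', sub_sub_cancel, ← add_sub_assoc, two_mul]
    tauto
  have h := congrArg (fun ν => ν D) (hμS.map_restrict h2 μF hμF hm)
  rw [Measure.map_apply (hme.prodMk measurable_ucoord) hD,
    Measure.restrict_apply (hme.prodMk measurable_ucoord hD), ← h1] at h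
  have : IsFiniteMeasure (μS.restrict {s | ‖s.1 4‖ = (resCard F : ℝ) ^ ((r : ℤ) - j) ∧
      ucoord s ∈ cubeUnit F}) :=
    ⟨by rw [Measure.restrict_apply_univ]; exact hμS.measure_cubeUnit_lt_top h2 hm⟩
  have h3 := prod_apply_of_slices ((μS.restrict {s | ‖s.1 4‖ = (resCard F : ℝ) ^ ((r : ℤ) - j) ∧
      ucoord s ∈ cubeUnit F}).map fun s => s.1 4) (cube μF) hD hE
      (c := ENNReal.ofReal ((resCard F : ℝ) ^ (3 * (j : ℤ)) *
      congrVolume (resCard F) (sqrtCount t.level) r j)) (fun x hx => by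
        rw [← hu.cube_slice h2 ht μF hμF r j hx]
        congr 1
        ext u
        exact ⟨fun h => h.2, fun h => ⟨hx, h⟩⟩) (fun x hx => by
        convert measure_empty (μ := cube μF)
        ext u
        simp only [Set.mem_empty_iff_false, iff_false]
        exact fun h => hx h.1)
  have h4 : ((μS.restrict {s | ‖s.1 4‖ = (resCard F : ℝ) ^ ((r : ℤ) - j) ∧
      ucoord s ∈ cubeUnit F}).map fun s => s.1 4) {x : F | ‖x‖ = (resCard F : ℝ) ^ ((r : ℤ) - j)} =
      unitVolume μS * ENNReal.ofReal ((resCard F : ℝ) ^ (3 * ((r : ℤ) - j))) := by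
    rw [← hu.measure_cubeUnit h2 μF hμF hμS, Measure.map_apply hme hE,
      Measure.restrict_apply (hme hE)]
    congr 1
    ext s
    exact ⟨fun h => h.2, fun h => ⟨h.1, h⟩⟩
  rw [h, h3, h4, mul_comm, mul_assoc, ← ENNReal.ofReal_mul (zpow_pos hq0 _).le, ← mul_assoc,
    ← zpow_add₀ hq0.ne']
  congr 3
  rw [← _root_.zpow_natCast]
  congr 1
  push_cast
  ring

include hu h2 ht hμF hμS in
/-- The integral of `|s₅|^n` over a ball in the symmetric space. -/
theorem IsUniformizer.integral_ball (r : ℕ) {n : ℕ} (hn : n ≠ 0) :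
    ∫ s in {s | sht s ≤ r}, ‖s.1 4‖ ^ n ∂μS =
      (unitVolume μS).toReal * ((resCard F : ℝ) ^ (3 * r) * ((resCard F : ℝ) ^ n) ^ r *
        congrSeries (resCard F) (sqrtCount t.level) ((resCard F : ℝ) ^ n)⁻¹ r) := by
  have hq := hu.one_lt_card
  have hq0 := hu.card_pos
  have hme := measurable_apply (t := t) 4
  let U : ℕ → Set (Sphere t) := fun j => {s | sht s ≤ r ∧ ‖s.1 4‖ = (resCard F : ℝ) ^ ((r : ℤ) - j)}
  have hball : MeasurableSet {s : Sphere t | sht s ≤ r} := (hu.isClopen_sht_le h2 ht r).2.measurableSet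
  have hU : ∀ j, MeasurableSet (U j) := fun j => by
    have hE : MeasurableSet {x : F | ‖x‖ = (resCard F : ℝ) ^ ((r : ℤ) - j)} := by measurability
    exact hball.inter (hme hE)
  have hd : Pairwise (Function.onFun Disjoint U) := by
    intro i j hij
    rw [Function.onFun, Set.disjoint_left]
    rintro s ⟨-, h⟩ ⟨-, h'⟩
    rw [h, hu.zpow_inj] at h'
    omega
  have hsub : (⋃ j, U j) ⊆ {s : Sphere t | sht s ≤ r} := Set.iUnion_subset fun j s hs => hs.1
  have hint : IntegrableOn (fun s : Sphere t => ‖s.1 4‖ ^ n) {s | sht s ≤ r} μS := by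
    have : IsFiniteMeasureOnCompacts μS := ⟨fun _ hK => hμS.finite_on_compacts _ hK⟩
    refine ContinuousOn.integrableOn_compact (hu.isCompact_sht_le h2 ht r) (Continuous.continuousOn ?_)
    exact (((continuous_apply 4).comp continuous_subtype_val).norm).pow n
  have hsum := hasSum_integral_iUnion hU hd (hint.mono_set hsub)
  rw [← setIntegral_eq_of_subset_of_forall_sdiff_eq_zero hball hsub] at hsum
  · refine hsum.unique ?_
    have hy1 : ((resCard F : ℝ) ^ n)⁻¹ ≤ 1 := inv_le_one_of_one_le₀ (one_le_pow₀ hq.le)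
    have hy0 : 0 ≤ ((resCard F : ℝ) ^ n)⁻¹ := by positivity
    have := (hasSum_congrVolume (s := sqrtCount t.level) hq hy0 hy1 r).mul_left
      ((unitVolume μS).toReal * ((resCard F : ℝ) ^ (3 * r) * ((resCard F : ℝ) ^ n) ^ r))
    refine HasSum.of_eq this (fun j => ?_) ?_
    · have hc : Set.EqOn (fun s : Sphere t => ‖s.1 4‖ ^ n)
          (fun _ => ((resCard F : ℝ) ^ ((r : ℤ) - j)) ^ n) (U j) := fun s hs => by
        simp only [hs.2]
      rw [setIntegral_congr_fun (hU j) hc, setIntegral_const, measureReal_def,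
        hu.measure_ball_inter h2 ht μF hμF hμS, ENNReal.toReal_mul, ENNReal.toReal_ofReal
          (mul_nonneg (by positivity) (congrVolume_nonneg hq (sqrtCount_nonneg _) _ _)),
        zpow_sub₀ hq0.ne', _root_.zpow_natCast, _root_.zpow_natCast, smul_eq_mul, div_pow,
        inv_pow, ← pow_mul, ← pow_mul, ← pow_mul, ← pow_mul, mul_comm r n, mul_comm j n]
      ring
    · ring
  -- A point of the ball outside all shells has s₅ = 0, and there the integrand vanishes because n ≠
  -- 0. The measure of this set is not needed.
  · intro s hs
    have h4 : s.1 4 = 0 := by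
      by_contra h
      refine hs.2 (Set.mem_iUnion.2 ?_)
      have h1 := hu.norm_eq_zpow_lv h
      have h3 : ‖s.1 4‖ ≤ (resCard F : ℝ) ^ (r : ℤ) :=
        (norm_le_pi_norm _ _).trans ((hu.norm_sphere_le_iff h2 ht s r).2 hs.1)
      rw [h1, zpow_le_zpow_iff_right₀ hq] at h3
      refine ⟨((r : ℤ) - lv (s.1 4)).toNat, hs.1, ?_⟩
      rw [h1, Int.toNat_of_nonneg (by omega)]
      congr 1
      ring
    simp only [h4, norm_zero]
    exact zero_pow hn

end BallIntegral

end SO5PGL2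

namespace SO5PGL2

/-! ### Ball integrals as polynomials in z + z⁻¹ -/

section BallPolynomials

variable {F : Type*} [NontriviallyNormedField F] [IsUltrametricDist F] {ϖ : Fˣ} {t : Kind F}

/-- The polynomial in `q^ζ + q^{-ζ}` that is the integral of `T_ζ` over the ball `sht ≤ r`. -/
noncomputable def ballPoly (t : Kind F) (r : ℕ) : Polynomial ℂ :=
  Polynomial.C (sqrtCard F ^ (3 * r)) * (Polynomial.Chebyshev.S ℂ r -
    Polynomial.C (t.sign * (sqrtCard F)⁻¹) * Polynomial.Chebyshev.S ℂ ((r : ℤ) - 1))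

theorem ballPoly_zero (t : Kind F) : ballPoly t 0 = 1 := by simp [ballPoly]

theorem ballPoly_succ (hs : sqrtCard F ≠ 0) {z : ℂ} (hz : z ≠ 0) (r : ℕ) :
    (ballPoly t (r + 1)).eval (z + z⁻¹) =
      sqrtCard F ^ 3 * z * (ballPoly t r).eval (z + z⁻¹) +
        (sqrtCard F ^ 3 * z⁻¹) ^ (r + 1) * (1 - t.sign * (sqrtCard F)⁻¹ * z) := by
  cases r with
  | zero =>
    simp [ballPoly]
    field_simp
    ring
  | succ r =>
    have h1 := chebyshevS_succ hz (r + 1)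
    have h2 := chebyshevS_succ hz r
    simp only [ballPoly, Polynomial.eval_mul, Polynomial.eval_sub, Polynomial.eval_C]
    rw [show ((r + 1 + 1 : ℕ) : ℤ) - 1 = (r + 1 : ℕ) by push_cast; ring,
      show ((r + 1 : ℕ) : ℤ) - 1 = (r : ℕ) by push_cast; ring, h1, mul_pow, ← pow_mul]
    have hzz : z * z⁻¹ = 1 := mul_inv_cancel₀ hz
    linear_combination (-(sqrtCard F ^ (3 * (r + 1 + 1))) * t.sign * (sqrtCard F)⁻¹) * h2 +
      (sqrtCard F ^ (3 * (r + 1 + 1))) * t.sign * (sqrtCard F)⁻¹ * (z⁻¹) ^ (r + 1) * hzz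

variable (hu : IsUniformizer ϖ) (h2 : ‖(2 : F)‖ = 1) (ht : t.Admissible)

theorem sign_sq (t : Kind F) : t.sign ^ 2 = 1 := by
  cases t <;> simp [Kind.sign]

include h2 ht in
theorem sqrtCount_level : (sqrtCount t.level : ℂ) - 1 = t.sign := by
  cases t with
  | split =>
    have : IsSquare (Kind.level (Kind.split : Kind F)) := ⟨1, by simp [Kind.level]⟩
    rw [sqrtCount, if_pos this, Kind.sign]
    norm_num
  | nonsplit θ =>
    have h20 := ne_zero_of_norm_two h2
    have : ¬ IsSquare (Kind.level (Kind.nonsplit θ)) := by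
      rintro ⟨w, hw⟩
      refine ht.2 ⟨w / 2, ?_⟩
      simp only [Kind.level] at hw
      field_simp
      linear_combination hw
    rw [sqrtCount, if_neg this, Kind.sign]
    norm_num

include hu h2 ht in
-- Both sides satisfy the same first-order recursion in r. The inhomogeneous terms match because the
-- number of square roots of the level minus one is the sign σ, with σ² = 1, so that 1 - y²/q⁴ = (1
-- + σ y/q²)(1 - σ y/q²).
theorem IsUniformizer.congrSeries_eq {y : ℝ} (hy0 : 0 < y) (hy : y ≤ 1) (r : ℕ) {z : ℂ}
    (hz : sqrtCard F ^ 3 * z = y) :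
    (((resCard F : ℝ) ^ (3 * r) * (y⁻¹) ^ r *
      congrSeries (resCard F) (sqrtCount t.level) y r : ℝ) : ℂ) =
    ((congrSeries (resCard F) (sqrtCount t.level) y 0 : ℝ) : ℂ) *
      (ballPoly t r).eval (z + z⁻¹) := by
  have hq := hu.one_lt_card
  have hs0 := hu.sqrtCard_ne_zero
  have hq0 : (resCard F : ℂ) ≠ 0 := by exact_mod_cast hu.card_pos.ne'
  have hyc : (y : ℂ) ≠ 0 := by exact_mod_cast hy0.ne'
  have hz0 : z ≠ 0 := by
    rintro rfl
    rw [mul_zero] at hz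
    exact hyc hz.symm
  have hyq : (1 : ℂ) - y / resCard F ≠ 0 := by
    have : (1 : ℝ) - y / resCard F ≠ 0 := by
      have := (div_lt_one hu.card_pos).2 (hy.trans_lt hq)
      linarith
    exact_mod_cast this
  induction r with
  | zero => simp [ballPoly_zero]
  | succ r ih =>
    have hcomm : ∀ a b c d : ℂ, a * (b * c + d) = b * (a * c) + a * d := fun a b c d => by ring
    rw [ballPoly_succ hs0 hz0, hz, hcomm, ← ih]
    have hq2 := hu.sqrtCard_sq
    have h1 : sqrtCard F ^ 3 * z⁻¹ = (resCard F : ℂ) ^ 3 * (y : ℂ)⁻¹ := by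
      rw [← hq2, ← hz]
      field_simp
    have h3 : t.sign * (sqrtCard F)⁻¹ * z = t.sign * (y : ℂ) / (resCard F : ℂ) ^ 2 := by
      rw [← hq2, ← hz]
      field_simp
    rw [h1, h3]
    have hsq := sign_sq t
    have hsgn := sqrtCount_level h2 ht
    have key : (1 - (y : ℂ) ^ 2 / (resCard F : ℂ) ^ 4) / (1 - y / resCard F) =
        (1 + ((sqrtCount t.level : ℂ) - 1) * (y / (resCard F : ℂ) ^ 2)) / (1 - y / resCard F) *
          (1 - t.sign * (y : ℂ) / (resCard F : ℂ) ^ 2) := by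
      rw [hsgn, div_mul_eq_mul_div]
      congr 1
      linear_combination ((y : ℂ) ^ 2 / (resCard F : ℂ) ^ 4) * hsq
    simp only [congrSeries]
    push_cast
    rw [key]
    have hyy : (y : ℂ)⁻¹ * y = 1 := inv_mul_cancel₀ hyc
    have e1 : ((y : ℂ)⁻¹) ^ (r + 1) * y ^ 2 = ((y : ℂ)⁻¹) ^ r * y := by
      linear_combination ((y : ℂ)⁻¹) ^ r * y * hyy
    have e2 : (resCard F : ℂ) ^ (3 * (r + 1)) / (resCard F : ℂ) ^ 3 = (resCard F : ℂ) ^ (3 * r) := by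
      field_simp
      ring
    generalize (1 + ((sqrtCount t.level : ℂ) - 1) * (y / (resCard F : ℂ) ^ 2)) /
      (1 - y / resCard F) = Z
    generalize ((congrSeries (resCard F) (sqrtCount t.level) y r : ℝ) : ℂ) = A
    rw [mul_pow, ← pow_mul, mul_add]
    have e3 : (resCard F : ℂ) ^ (3 * (r + 1)) * ((y : ℂ)⁻¹) ^ (r + 1) *
        ((y : ℂ) ^ 2 / (resCard F : ℂ) ^ 3 * A) =
        y * ((resCard F : ℂ) ^ (3 * r) * ((y : ℂ)⁻¹) ^ r * A) := by
      rw [← e2]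
      linear_combination ((resCard F : ℂ) ^ (3 * (r + 1)) / (resCard F : ℂ) ^ 3 * A) * e1
    rw [e3]
    ring

variable [LocallyCompactSpace F] [MeasurableSpace F] [BorelSpace F] (μF : Measure F)
  [μF.IsAddHaarMeasure] (hμF : μF {x | ‖x‖ ≤ 1} = 1) {μS : Measure (Sphere t)}
  (hμS : IsInvariantMeasure t ϖ μS)

include hu h2 ht hμF hμS in
-- Comparison with the ball r = 0 removes the unknown volume `unitVolume` and the factor common to
-- all r.
theorem IsUniformizer.integral_ball_eq (r : ℕ) {n : ℕ} (hn : n ≠ 0) {z : ℂ}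
    (hz : sqrtCard F ^ 3 * z = ((resCard F : ℂ) ^ n)⁻¹) :
    ((∫ s in {s | sht s ≤ r}, ‖s.1 4‖ ^ n ∂μS : ℝ) : ℂ) =
      ((∫ s in {s | sht s ≤ 0}, ‖s.1 4‖ ^ n ∂μS : ℝ) : ℂ) * (ballPoly t r).eval (z + z⁻¹) := by
  have hq := hu.one_lt_card
  have hy1 : ((resCard F : ℝ) ^ n)⁻¹ ≤ 1 := inv_le_one_of_one_le₀ (one_le_pow₀ hq.le)
  have hy0 : 0 < ((resCard F : ℝ) ^ n)⁻¹ := inv_pos.2 (pow_pos hu.card_pos n)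
  have h := hu.congrSeries_eq h2 ht hy0 hy1 r (z := z) (by rw [hz]; push_cast; rfl)
  rw [inv_inv] at h
  rw [hu.integral_ball h2 ht μF hμF hμS r hn, hu.integral_ball h2 ht μF hμF hμS 0 hn,
    Complex.ofReal_mul, h]
  simp only [mul_zero, pow_zero, one_mul]
  rw [Complex.ofReal_mul]
  ring

end BallPolynomials

end SO5PGL2

namespace SO5PGL2

/-! ### Averages over the maximal compact subgroup -/

section Averages

variable {F : Type*} [NontriviallyNormedField F] [IsUltrametricDist F] [LocallyCompactSpace F]
  {ϖ : Fˣ} {t : Kind F}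

instance : SecondCountableTopology (SO5 F) := by
  have : SecondCountableTopology (Matrix (Fin 5) (Fin 5) F) :=
    inferInstanceAs (SecondCountableTopology (Fin 5 → Fin 5 → F))
  exact isInducing_toMat.secondCountableTopology

instance : LocallyCompactSpace (SO5 F) :=
  isCompact_KG.locallyCompactSpace_of_mem_nhds_of_group (isOpen_KG.mem_nhds (KG F).one_mem)

variable (μG : Measure (SO5 F)) [μG.IsHaarMeasure] (hμG : μG (KG F) = 1)

include hμG in
-- The translated measure is again a left Haar measure, hence a multiple of μG. Both give K measure
-- 1, so unimodularity of G is not required.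
theorem map_mul_right_KG {k : SO5 F} (hk : k ∈ KG F) : μG.map (· * k) = μG := by
  have hm : Measurable fun g : SO5 F => g * k := (continuous_mul_const k).measurable
  have : IsFiniteMeasureOnCompacts (μG.map (· * k)) := ⟨fun A hA => by
    have := (Homeomorph.mulRight k).isClosedEmbedding.isCompact_preimage hA
    exact ((Homeomorph.mulRight k).toMeasurableEquiv.measurableEmbedding.map_apply μG A).trans_lt
      this.measure_lt_top⟩
  have h := Measure.isMulLeftInvariant_eq_smul (μG.map (· * k)) μG
  have h1 := congrArg (fun ν => ν (KG F : Set (SO5 F))) h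
  have h2 : (fun g : SO5 F => g * k) ⁻¹' (KG F) = (KG F : Set (SO5 F)) := by
    ext g
    exact (KG F).mul_mem_cancel_right hk
  rw [Measure.map_apply hm isOpen_KG.measurableSet, h2, Measure.smul_apply, hμG] at h1
  rw [h]
  have h3 : Measure.haarScalarFactor (μG.map (· * k)) μG = 1 := by
    rw [ENNReal.smul_def, smul_eq_mul, mul_one] at h1
    exact_mod_cast h1.symm
  rw [h3, one_smul]

/-- The average of a function over `K`. -/
noncomputable def avgK (φ : SO5 F → ℂ) : ℂ := ∫ k in (KG F : Set (SO5 F)), φ k ∂μG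

include hμG in
theorem avgK_const (c : ℂ) : avgK μG (fun _ => c) = c := by
  rw [avgK, setIntegral_const, measureReal_def, hμG, ENNReal.toReal_one, one_smul]

theorem avgK_congr {φ φ' : SO5 F → ℂ} (h : ∀ k ∈ KG F, φ k = φ' k) : avgK μG φ = avgK μG φ' :=
  setIntegral_congr_fun isOpen_KG.measurableSet h

theorem avgK_mul_left {k : SO5 F} (hk : k ∈ KG F) (φ : SO5 F → ℂ) :
    avgK μG (fun g => φ (k * g)) = avgK μG φ := by
  rw [avgK, avgK, ← integral_indicator isOpen_KG.measurableSet,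
    ← integral_indicator isOpen_KG.measurableSet,
    ← integral_mul_left_eq_self ((KG F : Set (SO5 F)).indicator φ) k]
  congr 1
  funext g
  classical
  simp only [Set.indicator_apply, SetLike.mem_coe, (KG F).mul_mem_cancel_left hk]

include hμG in
theorem avgK_mul_right {k : SO5 F} (hk : k ∈ KG F) (φ : SO5 F → ℂ) :
    avgK μG (fun g => φ (g * k)) = avgK μG φ := by
  have hemb := (Homeomorph.mulRight k).isClosedEmbedding.measurableEmbedding
  have h := hemb.integral_map (μ := μG) ((KG F : Set (SO5 F)).indicator φ)
  have he : (Homeomorph.mulRight k : SO5 F → SO5 F) = (· * k) := rfl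
  rw [he, map_mul_right_KG μG hμG hk] at h
  rw [avgK, avgK, ← integral_indicator isOpen_KG.measurableSet,
    ← integral_indicator isOpen_KG.measurableSet, h]
  congr 1
  funext g
  classical
  simp only [Set.indicator_apply, SetLike.mem_coe, (KG F).mul_mem_cancel_right hk]

theorem avgK_const_mul (c : ℂ) (φ : SO5 F → ℂ) : avgK μG (fun k => c * φ k) = c * avgK μG φ :=
  integral_const_mul _ _

theorem integrableOn_KG {φ : SO5 F → ℂ} (hφ : Continuous φ) : IntegrableOn φ (KG F) μG :=
  hφ.continuousOn.integrableOn_compact isCompact_KG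

theorem avgK_swap {X : Type*} [TopologicalSpace X] [SecondCountableTopology X] [MeasurableSpace X]
    [BorelSpace X] (μX : Measure X) [SFinite μX] {A : Set X} (hA : IsCompact A)
    (hAm : MeasurableSet A) (hfin : μX A < ⊤) {φ : SO5 F → X → ℂ}
    (hφ : Continuous fun p : SO5 F × X => φ p.1 p.2) :
    ∫ a in A, avgK μG (fun k => φ k a) ∂μX = avgK μG fun k => ∫ a in A, φ k a ∂μX := by
  symm
  refine integral_integral_swap ?_
  obtain ⟨B, hB⟩ := (isCompact_KG.prod hA).exists_bound_of_continuousOn hφ.continuousOn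
  rw [Measure.prod_restrict]
  have : IsFiniteMeasure ((μG.prod μX).restrict ((KG F : Set (SO5 F)) ×ˢ A)) := ⟨by
    rw [Measure.restrict_apply_univ, Measure.prod_prod]
    exact ENNReal.mul_lt_top isCompact_KG.measure_lt_top hfin⟩
  exact Integrable.of_bound hφ.aestronglyMeasurable B
    (ae_restrict_of_forall_mem (isOpen_KG.measurableSet.prod hAm) hB)

/-- The `K`-average of `|s₅|^n`. -/
noncomputable def avgPow (n : ℕ) (s : Sphere t) : ℂ :=
  avgK μG fun k => ((‖(k • s).1 4‖ ^ n : ℝ) : ℂ)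

omit [LocallyCompactSpace F] in
theorem continuous_pow_norm (n : ℕ) : Continuous fun s : Sphere t => ((‖s.1 4‖ ^ n : ℝ) : ℂ) :=
  Complex.continuous_ofReal.comp ((((continuous_apply 4).comp continuous_subtype_val).norm).pow n)

include hμG in
theorem avgPow_smul (n : ℕ) {k : SO5 F} (hk : k ∈ KG F) (s : Sphere t) :
    avgPow μG n (k • s) = avgPow μG n s := by
  have := avgK_mul_right μG hμG hk fun g => ((‖(g • s).1 4‖ ^ n : ℝ) : ℂ)
  rw [avgPow, avgPow, ← this]
  simp only [mul_smul]

omit [LocallyCompactSpace F] in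
-- The last row of g is isotropic, hence a scalar of norm ‖row‖ times the last row of an element of
-- K. That element depends on g alone and not on s.
theorem norm_smul_four (h2 : ‖(2 : F)‖ = 1) (g : SO5 F) :
    ∃ k ∈ KG F, ∀ s : Sphere t, ‖(g • s).1 4‖ = ‖toMat g 4‖ * ‖(k • s).1 4‖ := by
  obtain ⟨k, hk, l, hl, e⟩ := exists_mulVec_eq h2 (row_ne_zero g 4)
  rw [form_row g (by decide), zero_div] at e
  refine ⟨transposeG k⁻¹, transposeG_mem_KG ((KG F).inv_mem hk), fun s => ?_⟩
  have hv : toMat g 4 = toMat k⁻¹ *ᵥ ![0, 0, 0, 0, (l : F)] := by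
    rw [← e, mulVec_mulVec, ← toMat_mul, inv_mul_cancel, toMat_one, one_mulVec]
  have h4 : (g • s).1 4 = (l : F) * (transposeG k⁻¹ • s).1 4 := by
    have h1 : (g • s).1 4 = toMat g 4 ⬝ᵥ s.1 := rfl
    rw [h1, hv, ← vecMul_transpose, ← dotProduct_mulVec, smul_val, toMat_transposeG]
    simp [dotProduct, Fin.sum_univ_five]
  rw [h4, norm_mul, hl]

theorem isLocallyConstant_of_invariant (hu : IsUniformizer ϖ) (h2 : ‖(2 : F)‖ = 1)
    (ht : t.Admissible) {α : Type*} {T : Sphere t → α} (hT : ∀ k ∈ KG F, ∀ s, T (k • s) = T s) :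
    IsLocallyConstant T := by
  have : T = (fun r => T (dS (ne_zero_of_norm_two h2) t ϖ r)) ∘ sht :=
    funext fun s => hu.eq_dS_of_invariant h2 ht hT s
  rw [this]
  exact (hu.isLocallyConstant_sht h2 ht).comp _

include hμG in
/-- The `K`-average of `|s₅|^n` is an eigenfunction of the Hecke algebra. -/
theorem integral_mul_avgPow (hu : IsUniformizer ϖ) (h2 : ‖(2 : F)‖ = 1) (ht : t.Admissible)
    (n : ℕ) (f : spherical (KG F)) (s : Sphere t) :
    ∫ g, (f : SO5 F → ℂ) g * avgPow μG n (g • s) ∂μG =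
      (∫ g, (f : SO5 F → ℂ) g * ((‖toMat g 4‖ ^ n : ℝ) : ℂ) ∂μG) * avgPow μG n s := by
  have hT : ∀ k ∈ KG F, ∀ s : Sphere t, avgPow μG n (k • s) = avgPow μG n s :=
    fun k hk s => avgPow_smul μG hμG n hk s
  have hTc := (isLocallyConstant_of_invariant hu h2 ht hT).continuous
  obtain ⟨S, hS⟩ := exists_integral_eq_sum μG isOpen_KG f.2.2.1 f.2.2.2
  have hrow : Continuous fun g : SO5 F => ((‖toMat g 4‖ ^ n : ℝ) : ℂ) :=
    Complex.continuous_ofReal.comp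
      ((((continuous_apply 4).comp continuous_toMat).norm).pow n)
  -- The two averages are exchanged. For fixed k', |(k' x k s)₅| splits as ‖last row of k' x‖ times
  -- |(k₀ k s)₅| with k₀ independent of k, and averaging over k restores the original average at s.
  have h1 : ∀ x : SO5 F, avgK μG (fun k => avgPow μG n ((x * k) • s)) =
      avgK μG (fun k => ((‖toMat (k * x) 4‖ ^ n : ℝ) : ℂ)) * avgPow μG n s := by
    intro x
    have hsw := avgK_swap μG μG isCompact_KG isOpen_KG.measurableSet isCompact_KG.measure_lt_top
      (φ := fun k' k => ((‖(k' • ((x * k) • s)).1 4‖ ^ n : ℝ) : ℂ)) (by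
        refine (continuous_pow_norm n).comp (continuous_smul_sphere.comp
          (continuous_fst.prodMk ((continuous_smul_left s).comp ?_)))
        fun_prop)
    refine Eq.trans hsw ?_
    rw [mul_comm, ← avgK_const_mul]
    refine avgK_congr μG fun k' hk' => ?_
    obtain ⟨k₀, hk₀, e⟩ := norm_smul_four (t := t) h2 (k' * x)
    rw [mul_comm]
    have h3 : ∀ k : SO5 F, ((‖(k' • ((x * k) • s)).1 4‖ ^ n : ℝ) : ℂ) =
        ((‖toMat (k' * x) 4‖ ^ n : ℝ) : ℂ) * ((‖((k₀ * k) • s).1 4‖ ^ n : ℝ) : ℂ) := fun k => by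
      rw [← mul_smul, ← mul_assoc, mul_smul _ k, e, mul_smul, mul_pow, Complex.ofReal_mul]
    simp only [h3]
    rw [integral_const_mul]
    congr 1
    exact avgK_mul_left μG hk₀ fun k => ((‖(k • s).1 4‖ ^ n : ℝ) : ℂ)
  -- Left invariance of f allows k' to be inserted in front of g. Averaging the resulting finite
  -- sums over k' produces the row averages that appear in `h1`.
  have h3 : ∀ k' ∈ KG F, ∫ g, (f : SO5 F → ℂ) g * ((‖toMat g 4‖ ^ n : ℝ) : ℂ) ∂μG =
      ∑ x ∈ S, (f : SO5 F → ℂ) x * ((‖toMat (k' * x) 4‖ ^ n : ℝ) : ℂ) := by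
    intro k' hk'
    rw [← integral_mul_left_eq_self _ k']
    simp only [f.2.1 k' hk']
    have hc : Continuous fun g : SO5 F => ((‖toMat (k' * g) 4‖ ^ n : ℝ) : ℂ) :=
      hrow.comp (continuous_const_mul k')
    rw [hS (fun g => ((‖toMat (k' * g) 4‖ ^ n : ℝ) : ℂ))
      fun x => integrableOn_KG μG (hc.comp (continuous_const_mul x))]
    refine Finset.sum_congr rfl fun x _ => ?_
    congr 1
    refine Eq.trans (avgK_congr μG fun k hk => ?_) (avgK_const μG hμG _)
    rw [← mul_assoc, norm_row_mul_KG hk]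
  have h4 : ∫ g, (f : SO5 F → ℂ) g * ((‖toMat g 4‖ ^ n : ℝ) : ℂ) ∂μG =
      ∑ x ∈ S, (f : SO5 F → ℂ) x * avgK μG fun k' => ((‖toMat (k' * x) 4‖ ^ n : ℝ) : ℂ) := by
    rw [← avgK_const μG hμG (∫ g, (f : SO5 F → ℂ) g * ((‖toMat g 4‖ ^ n : ℝ) : ℂ) ∂μG),
      avgK_congr μG h3, avgK, integral_finsetSum]
    · refine Finset.sum_congr rfl fun x _ => ?_
      rw [integral_const_mul, avgK]
    · intro x _
      exact (integrableOn_KG μG (hrow.comp (continuous_mul_const x))).const_mul _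
  rw [hS (fun g => avgPow μG n (g • s)) fun x => integrableOn_KG μG
    (hTc.comp ((continuous_smul_left s).comp (continuous_const_mul x))), h4, Finset.sum_mul]
  refine Finset.sum_congr rfl fun x _ => ?_
  rw [mul_assoc, ← h1 x, avgK]

variable [MeasurableSpace F] [BorelSpace F] {μS : Measure (Sphere t)}
  (hμS : IsInvariantMeasure t ϖ μS)

include hμS in
theorem IsInvariantMeasure.isFiniteMeasureOnCompacts : IsFiniteMeasureOnCompacts μS :=
  ⟨fun _ hK => hμS.finite_on_compacts _ hK⟩

include hμS in
theorem IsInvariantMeasure.sigmaFinite : SigmaFinite μS := by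
  refine ⟨⟨⟨fun n : ℕ => {s | ‖s.1‖ ≤ n}, fun _ => trivial,
    fun n => hμS.finite_on_compacts _ (isCompact_norm_sphere_le _), ?_⟩⟩⟩
  refine Set.eq_univ_of_forall fun s => Set.mem_iUnion.2 ?_
  exact exists_nat_ge ‖s.1‖

include hμS in
theorem IsInvariantMeasure.integral_smul (g : SO5 F) (φ : Sphere t → ℂ) :
    ∫ s, φ (g • s) ∂μS = ∫ s, φ s ∂μS := by
  let e : Sphere t ≃ₜ Sphere t :=
    ⟨⟨fun s => g • s, fun s => g⁻¹ • s, fun s => inv_smul_smul g s, fun s => smul_inv_smul g s⟩,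
      continuous_smul_right g, continuous_smul_right g⁻¹⟩
  have h := e.isClosedEmbedding.measurableEmbedding.integral_map (μ := μS) φ
  have he : (e : Sphere t → Sphere t) = fun s => g • s := rfl
  rw [he, hμS.invariant g] at h
  exact h.symm

include hμG hμS in
/-- The integral of a function over a `K`-orbit is the integral of its `K`-average. -/
theorem IsInvariantMeasure.setIntegral_eq_avgK (hu : IsUniformizer ϖ) (h2 : ‖(2 : F)‖ = 1)
    (ht : t.Admissible) {φ : Sphere t → ℂ} (hφ : Continuous φ) (r : ℕ) :
    ∫ s in {s | sht s = r}, φ s ∂μS = ∫ s in {s | sht s = r}, avgK μG (fun k => φ (k • s)) ∂μS := by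
  have := hμS.sigmaFinite
  have hO := (hu.isClopen_sht_eq h2 ht r (t := t)).2.measurableSet
  rw [avgK_swap μG μS (hu.isCompact_sht_eq h2 ht r) hO
    (hμS.finite_on_compacts _ (hu.isCompact_sht_eq h2 ht r)) (hφ.comp continuous_smul_sphere),
    avgK_congr μG (φ' := fun _ => ∫ s in {s | sht s = r}, φ s ∂μS) fun k hk => ?_, avgK_const μG hμG]
  rw [← integral_indicator hO, ← integral_indicator hO,
    ← hμS.integral_smul k (Set.indicator _ φ)]
  congr 1
  funext s
  classical
  simp only [Set.indicator_apply, Set.mem_ofPred_eq, sht_smul hk]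

end Averages

end SO5PGL2

namespace SO5PGL2

/-! ### The spherical functions on the symmetric space -/

section SphericalFunction

variable {F : Type*} [NontriviallyNormedField F] [IsUltrametricDist F]
  {ϖ : Fˣ} {t : Kind F}

/-- The polynomial in `q^ζ + q^{-ζ}` that is the integral of `T_ζ` over the orbit `sht = r`. -/
noncomputable def orbitPoly (t : Kind F) : ℕ → Polynomial ℂ
  | 0 => ballPoly t 0
  | r + 1 => ballPoly t (r + 1) - ballPoly t r

theorem sum_orbitPoly (t : Kind F) (r : ℕ) :
    ∑ i ∈ Finset.range (r + 1), orbitPoly t i = ballPoly t r := by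
  induction r with
  | zero => simp [orbitPoly]
  | succ r ih =>
    rw [Finset.sum_range_succ, ih, orbitPoly]
    ring

theorem degree_ballPoly (hs : sqrtCard F ≠ 0) (t : Kind F) (r : ℕ) : (ballPoly t r).degree = r := by
  rw [ballPoly, Polynomial.degree_C_mul (pow_ne_zero _ hs)]
  cases r with
  | zero => simp
  | succ r =>
    rw [show ((r + 1 : ℕ) : ℤ) - 1 = (r : ℕ) by push_cast; ring,
      Polynomial.degree_sub_eq_left_of_degree_lt, degree_chebyshevS]
    have hsg : t.sign ≠ 0 := by
      have := sign_sq t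
      rintro h
      simp [h] at this
    rw [Polynomial.degree_C_mul (mul_ne_zero hsg (inv_ne_zero hs)), degree_chebyshevS,
      degree_chebyshevS]
    exact_mod_cast Nat.lt_succ_self r

theorem degree_orbitPoly (hs : sqrtCard F ≠ 0) (t : Kind F) (r : ℕ) :
    (orbitPoly t r).degree = r := by
  cases r with
  | zero => exact degree_ballPoly hs t 0
  | succ r =>
    rw [orbitPoly, Polynomial.degree_sub_eq_left_of_degree_lt, degree_ballPoly hs]
    rw [degree_ballPoly hs, degree_ballPoly hs]
    exact_mod_cast Nat.lt_succ_self r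

theorem exists_add_inv_eq (x : ℂ) : ∃ z : ℂ, z ≠ 0 ∧ z + z⁻¹ = x := by
  obtain ⟨w, hw⟩ := IsAlgClosed.exists_eq_mul_self (x ^ 2 - 4)
  have h1 : (x + w) / 2 * ((x - w) / 2) = 1 := by linear_combination hw / 4
  have h0 : (x + w) / 2 ≠ 0 := left_ne_zero_of_mul_eq_one h1
  refine ⟨(x + w) / 2, h0, ?_⟩
  rw [inv_eq_of_mul_eq_one_right h1]
  ring

/-- The volume of the orbit `sht = r`. -/
noncomputable def orbitVol [MeasurableSpace F] (μS : Measure (Sphere t)) (r : ℕ) : ℂ :=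
  ((μS {s | sht s = r}).toReal : ℂ)

/-- The spherical function `T_ζ` as a function of `z = q^ζ`. -/
noncomputable def sphericalT [MeasurableSpace F] (μS : Measure (Sphere t)) (z : ℂ)
    (s : Sphere t) : ℂ :=
  (orbitPoly t (sht s)).eval (z + z⁻¹) / orbitVol μS (sht s)

/-- The parameters `z` at which the spherical function is an average of a power of `|s₅|`. -/
noncomputable def powParam (F : Type*) [NontriviallyNormedField F] [IsUltrametricDist F] (n : ℕ) : ℂ :=
  (sqrtCard F ^ 3)⁻¹ * ((resCard F : ℂ) ^ n)⁻¹

variable (hu : IsUniformizer ϖ) (h2 : ‖(2 : F)‖ = 1) (ht : t.Admissible)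

include hu in
theorem IsUniformizer.powParam_ne_zero (n : ℕ) : powParam F n ≠ 0 := by
  have : (resCard F : ℂ) ≠ 0 := by exact_mod_cast hu.card_pos.ne'
  exact mul_ne_zero (inv_ne_zero (pow_ne_zero _ hu.sqrtCard_ne_zero)) (inv_ne_zero (pow_ne_zero _ this))

include hu in
theorem IsUniformizer.sqrtCard_mul_powParam (n : ℕ) :
    sqrtCard F ^ 3 * powParam F n = ((resCard F : ℂ) ^ n)⁻¹ := by
  rw [powParam, mul_inv_cancel_left₀ (pow_ne_zero _ hu.sqrtCard_ne_zero)]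

include hu in
theorem IsUniformizer.infinite_powParam : ((fun n => powParam F n) '' {n | n ≠ 0}).Infinite := by
  have hinj : Function.Injective fun n => powParam F n := by
    intro m n h
    have h1 : sqrtCard F ^ 3 * powParam F m = sqrtCard F ^ 3 * powParam F n := congrArg _ h
    rw [hu.sqrtCard_mul_powParam, hu.sqrtCard_mul_powParam, _root_.inv_inj] at h1
    exact Nat.pow_right_injective hu.one_lt_card_nat (by exact_mod_cast h1)
  refine Set.Infinite.image hinj.injOn ?_
  exact (Set.finite_singleton 0).infinite_compl

variable [LocallyCompactSpace F] [MeasurableSpace F] [BorelSpace F]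
  (μF : Measure F) [μF.IsAddHaarMeasure] (hμF : μF {x | ‖x‖ ≤ 1} = 1)
  (μG : Measure (SO5 F)) [μG.IsHaarMeasure] (hμG : μG (KG F) = 1)
  {μS : Measure (Sphere t)} (hμS : IsInvariantMeasure t ϖ μS)

include hu h2 ht hμS in
theorem IsUniformizer.orbitVol_zero : orbitVol μS 0 = 1 := by
  have : {s : Sphere t | sht s = 0} = orbit t ϖ 0 := by
    ext s
    exact (hu.mem_orbit_iff h2 ht 0 s).symm
  rw [orbitVol, this, hμS.normalized]
  simp

include hu h2 ht hμF hμS in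
theorem IsUniformizer.integral_orbit (r : ℕ) {n : ℕ} (hn : n ≠ 0) :
    ∫ s in {s : Sphere t | sht s = r}, ((‖s.1 4‖ ^ n : ℝ) : ℂ) ∂μS =
      (∫ s in {s : Sphere t | sht s = 0}, ((‖s.1 4‖ ^ n : ℝ) : ℂ) ∂μS) *
        (orbitPoly t r).eval (powParam F n + (powParam F n)⁻¹) := by
  have := hμS.isFiniteMeasureOnCompacts
  have h0 : {s : Sphere t | sht s = 0} = {s | sht s ≤ 0} := by ext s; simp
  have hball : ∀ r, ∫ s in {s : Sphere t | sht s ≤ r}, ((‖s.1 4‖ ^ n : ℝ) : ℂ) ∂μS =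
      (∫ s in {s : Sphere t | sht s = 0}, ((‖s.1 4‖ ^ n : ℝ) : ℂ) ∂μS) *
        (ballPoly t r).eval (powParam F n + (powParam F n)⁻¹) := fun r => by
    rw [h0, integral_complex_ofReal, integral_complex_ofReal]
    exact hu.integral_ball_eq h2 ht μF hμF hμS r hn (hu.sqrtCard_mul_powParam n)
  have hint : ∀ r, IntegrableOn (fun s : Sphere t => ((‖s.1 4‖ ^ n : ℝ) : ℂ)) {s | sht s ≤ r} μS :=
    fun r => (continuous_pow_norm n).continuousOn.integrableOn_compact (hu.isCompact_sht_le h2 ht r)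
  cases r with
  | zero => simp [orbitPoly, ballPoly_zero]
  | succ r =>
    have hs : {s : Sphere t | sht s = r + 1} = {s | sht s ≤ r + 1} \ {s | sht s ≤ r} := by
      ext s
      simp only [Set.mem_ofPred_eq, Set.mem_sdiff]
      omega
    rw [hs, setIntegral_sdiff (hu.isClopen_sht_le h2 ht r).2.measurableSet (hint _)
      (fun s (h : sht s ≤ r) => h.trans (Nat.le_succ r)), hball, hball, orbitPoly,
      Polynomial.eval_sub, mul_sub]

/-- The integrand is continuous and nonnegative on K and equals 1 at the identity, because the last
coordinate of v₁ is 1. -/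
theorem avgPow_dS_ne_zero (n : ℕ) : avgPow μG n (dS (ne_zero_of_norm_two h2) t ϖ 0) ≠ 0 := by
  set s := dS (ne_zero_of_norm_two h2) t ϖ 0 with hs
  have hc : Continuous fun k : SO5 F => ‖(k • s).1 4‖ ^ n :=
    ((((continuous_apply 4).comp continuous_subtype_val).comp (continuous_smul_left s)).norm).pow n
  rw [avgPow, avgK, integral_complex_ofReal, Complex.ofReal_ne_zero]
  refine ne_of_gt ((setIntegral_pos_iff_support_of_nonneg_ae
    (Filter.Eventually.of_forall fun k => by positivity)
    (hc.continuousOn.integrableOn_compact isCompact_KG)).2 ?_)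
  refine (hc.isOpen_support.inter isOpen_KG).measure_pos μG ⟨1, ?_, (KG F).one_mem⟩
  have h4 : s.1 4 = 1 := by
    rw [hs]
    change dv t ϖ 0 4 = 1
    cases t <;> simp [dv_eq, torusG_mulVec, Kind.v1]
  rw [Function.mem_support, one_smul, h4, norm_one, one_pow]
  exact one_ne_zero

include hu h2 ht hμG hμS in
theorem IsUniformizer.integral_orbit_avgPow (r n : ℕ) :
    ∫ s in {s : Sphere t | sht s = r}, ((‖s.1 4‖ ^ n : ℝ) : ℂ) ∂μS =
      orbitVol μS r * avgPow μG n (dS (ne_zero_of_norm_two h2) t ϖ r) := by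
  rw [hμS.setIntegral_eq_avgK μG hμG hu h2 ht (continuous_pow_norm n) r]
  have : Set.EqOn (fun s : Sphere t => avgK μG fun k => ((‖(k • s).1 4‖ ^ n : ℝ) : ℂ))
      (fun _ => avgPow μG n (dS (ne_zero_of_norm_two h2) t ϖ r)) {s | sht s = r} := by
    intro s (hs : sht s = r)
    have h := hu.eq_dS_of_invariant h2 ht (T := avgPow μG n)
      (fun k hk s => avgPow_smul μG hμG n hk s) s
    rw [hs] at h
    exact h
  rw [setIntegral_congr_fun (hu.isClopen_sht_eq h2 ht r).2.measurableSet this, setIntegral_const,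
    orbitVol, measureReal_def]
  simp

include hu h2 ht hμF hμG hμS in
theorem IsUniformizer.avgPow_eq (r : ℕ) {n : ℕ} (hn : n ≠ 0) :
    orbitVol μS r * avgPow μG n (dS (ne_zero_of_norm_two h2) t ϖ r) =
      avgPow μG n (dS (ne_zero_of_norm_two h2) t ϖ 0) *
        (orbitPoly t r).eval (powParam F n + (powParam F n)⁻¹) := by
  rw [← hu.integral_orbit_avgPow h2 ht μG hμG hμS, hu.integral_orbit h2 ht μF hμF hμS r hn,
    hu.integral_orbit_avgPow h2 ht μG hμG hμS, hu.orbitVol_zero h2 ht hμS, one_mul]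

include hu h2 ht hμF hμG hμS in
-- If the orbit had volume 0, its polynomial would vanish at all the special parameters, hence
-- identically, contradicting its degree r.
theorem IsUniformizer.orbitVol_ne_zero (r : ℕ) : orbitVol μS r ≠ 0 := by
  intro h
  have h1 : ∀ n : ℕ, n ≠ 0 → (orbitPoly t r).eval (powParam F n + (powParam F n)⁻¹) = 0 := by
    intro n hn
    have := hu.avgPow_eq h2 ht μF hμF μG hμG hμS r hn
    rw [h, zero_mul, zero_eq_mul] at this
    exact this.resolve_left (avgPow_dS_ne_zero h2 μG n)
  have h3 : ∀ z : ℂ, z ≠ 0 → (orbitPoly t r).eval (z + z⁻¹) = 0 := fun z hz =>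
    (IsLaurent.eval_add_inv (orbitPoly t r)).eq_of_infinite (IsLaurent.const 0)
      hu.infinite_powParam (by
        rintro _ ⟨n, hn, rfl⟩
        exact ⟨hu.powParam_ne_zero n, h1 n hn⟩) hz
  have h4 : orbitPoly t r = 0 := Polynomial.funext fun x => by
    obtain ⟨z, hz, rfl⟩ := exists_add_inv_eq x
    rw [h3 z hz, Polynomial.eval_zero]
  have := degree_orbitPoly hu.sqrtCard_ne_zero t r
  rw [h4, Polynomial.degree_zero] at this
  exact absurd this (by simp)

end SphericalFunction

end SO5PGL2

namespace SO5PGL2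

/-! ### Existence and uniqueness of T_ζ, and its integrals -/

section Eigenfunctions

variable {F : Type*} [NontriviallyNormedField F] [IsUltrametricDist F]
  {ϖ : Fˣ} {t : Kind F} (hu : IsUniformizer ϖ) (h2 : ‖(2 : F)‖ = 1) (ht : t.Admissible)
  [LocallyCompactSpace F] [MeasurableSpace F] [BorelSpace F]
  (μF : Measure F) [μF.IsAddHaarMeasure] (hμF : μF {x | ‖x‖ ≤ 1} = 1)
  (μG : Measure (SO5 F)) [μG.IsHaarMeasure] (hμG : μG (KG F) = 1)
  {μS : Measure (Sphere t)} (hμS : IsInvariantMeasure t ϖ μS)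

omit [LocallyCompactSpace F] [BorelSpace F] in
theorem sphericalT_smul (z : ℂ) {k : SO5 F} (hk : k ∈ KG F) (s : Sphere t) :
    sphericalT μS z (k • s) = sphericalT μS z s := by
  rw [sphericalT, sphericalT, sht_smul hk]

omit [BorelSpace F] in
theorem integrable_spherical_mul (f : spherical (KG F)) {φ : SO5 F → ℂ} (hφ : Continuous φ) :
    Integrable (fun g => (f : SO5 F → ℂ) g * φ g) μG :=
  ((isLocallyConstant_of_right_invariant isOpen_KG f.2.2.1).continuous.mul
    hφ).integrable_of_hasCompactSupport f.2.2.2.mul_right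

include hu h2 ht in
-- On the compact support of f the point g s meets only finitely many K-orbits, so the integral is a
-- finite combination of orbit polynomials in z + z⁻¹.
theorem IsUniformizer.isLaurent_integral_sphericalT (f : spherical (KG F)) (s : Sphere t) :
    IsLaurent fun z => ∫ g, (f : SO5 F → ℂ) g * sphericalT μS z (g • s) ∂μG := by
  have hloc : IsLocallyConstant fun g : SO5 F => sht (g • s) :=
    (hu.isLocallyConstant_sht h2 ht).comp_continuous (continuous_smul_left s)
  have hfin := (f.2.2.2.isCompact.image hloc.continuous).finite_of_discrete
  have h : ∀ z : ℂ, ∫ g, (f : SO5 F → ℂ) g * sphericalT μS z (g • s) ∂μG =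
      ∑ r ∈ hfin.toFinset, ((orbitPoly t r).eval (z + z⁻¹) / orbitVol μS r) *
        ∫ g, (f : SO5 F → ℂ) g * (if sht (g • s) = r then 1 else 0) ∂μG := by
    intro z
    have hint : ∀ r, Integrable (fun g => (f : SO5 F → ℂ) g *
        (if sht (g • s) = r then (1 : ℂ) else 0)) μG := fun r =>
      integrable_spherical_mul μG f (hloc.comp fun m => if m = r then (1 : ℂ) else 0).continuous
    simp_rw [← integral_const_mul]
    rw [← integral_finsetSum _ fun r _ => (hint r).const_mul _]
    congr 1
    funext g
    by_cases hg : (f : SO5 F → ℂ) g = 0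
    · simp [hg]
    · have hmem : sht (g • s) ∈ hfin.toFinset :=
        hfin.mem_toFinset.2 ⟨g, subset_tsupport _ hg, rfl⟩
      rw [Finset.sum_eq_single_of_mem _ hmem fun r _ hr => by rw [if_neg hr.symm, mul_zero, mul_zero],
        if_pos rfl, sphericalT]
      ring
  refine IsLaurent.congr (IsLaurent.sum hfin.toFinset fun r _ => ?_) fun z _ => (h z).symm
  simp only [div_eq_mul_inv]
  exact ((IsLaurent.eval_add_inv _).mul (IsLaurent.const _)).mul (IsLaurent.const _)

include hμG in
theorem isLaurent_integral_rht (f : spherical (KG F)) (c : ℂ) :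
    IsLaurent fun z => ∫ g, (f : SO5 F → ℂ) g * (c * z) ^ (-rht g) ∂μG := by
  obtain ⟨S, -, hS⟩ := exists_coset_sum_integral μG isOpen_KG hμG f.2.2.1 f.2.2.2
  have h : ∀ z : ℂ, ∫ g, (f : SO5 F → ℂ) g * (c * z) ^ (-rht g) ∂μG =
      ∑ x ∈ S, (f : SO5 F → ℂ) x * c ^ (-rht x) * z ^ (-rht x) := fun z => by
    rw [hS _ fun k hk g => by rw [rht_mul_KG hk]]
    refine Finset.sum_congr rfl fun x _ => ?_
    rw [_root_.mul_zpow, mul_assoc]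
  exact IsLaurent.congr (IsLaurent.sum S fun x _ => (IsLaurent.const _).mul (IsLaurent.zpow _))
    fun z _ => (h z).symm

include hu h2 ht hμF hμG hμS

theorem IsUniformizer.sphericalT_powParam {n : ℕ} (hn : n ≠ 0) (s : Sphere t) :
    sphericalT μS (powParam F n) s =
      (avgPow μG n (dS (ne_zero_of_norm_two h2) t ϖ 0))⁻¹ * avgPow μG n s := by
  have h1 := hu.avgPow_eq h2 ht μF hμF μG hμG hμS (sht s) hn
  have h3 := avgPow_dS_ne_zero (ϖ := ϖ) (t := t) h2 μG n
  rw [hu.eq_dS_of_invariant h2 ht (T := avgPow μG n) (fun k hk s => avgPow_smul μG hμG n hk s) s,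
    sphericalT, div_eq_iff (hu.orbitVol_ne_zero h2 ht μF hμF μG hμG hμS _), mul_assoc,
    mul_comm _ (orbitVol μS _), h1, inv_mul_cancel_left₀ h3]

/-- At the parameters `powParam F n` the function is a normalized K-average of |s₅|^n, and (q^{3/2}
z)^{-`rht`} becomes ‖last row‖^n. There the identity is `integral_mul_avgPow`; both sides are
Laurent polynomials in z, so it holds for all z ≠ 0. -/
theorem IsUniformizer.integral_mul_sphericalT (f : spherical (KG F)) (s : Sphere t) {z : ℂ}
    (hz : z ≠ 0) :
    ∫ g, (f : SO5 F → ℂ) g * sphericalT μS z (g • s) ∂μG =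
      (∫ g, (f : SO5 F → ℂ) g * (sqrtCard F ^ 3 * z) ^ (-rht g) ∂μG) * sphericalT μS z s := by
  have hl : IsLaurent fun z => sphericalT μS z s := by
    simp only [sphericalT, div_eq_mul_inv]
    exact (IsLaurent.eval_add_inv _).mul (IsLaurent.const _)
  refine (hu.isLaurent_integral_sphericalT h2 ht μG f s).eq_of_infinite
    ((isLaurent_integral_rht μG hμG f (sqrtCard F ^ 3)).mul hl) hu.infinite_powParam ?_ hz
  · rintro _ ⟨n, hn, rfl⟩
    refine ⟨hu.powParam_ne_zero n, ?_⟩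
    simp only [hu.sphericalT_powParam h2 ht μF hμF μG hμG hμS hn, hu.sqrtCard_mul_powParam]
    have h1 : ∀ g : SO5 F, (((resCard F : ℂ) ^ n)⁻¹) ^ (-rht g) = ((‖toMat g 4‖ ^ n : ℝ) : ℂ) := by
      intro g
      rw [hu.norm_row h2, _root_.inv_zpow', neg_neg]
      push_cast
      rw [← _root_.zpow_natCast, ← _root_.zpow_natCast, ← _root_.zpow_mul, ← _root_.zpow_mul, mul_comm]
    simp only [h1, mul_left_comm _ (avgPow μG n (dS _ t ϖ 0))⁻¹]
    rw [integral_const_mul, integral_mul_avgPow μG hμG hu h2 ht]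

theorem IsUniformizer.isT_sphericalT (ζ : ℂ) :
    IsT t ϖ μG ζ (sphericalT μS (satakeParam F ζ)) := by
  refine ⟨fun k hk s => sphericalT_smul _ hk s, ⟨dS (ne_zero_of_norm_two h2) t ϖ 0, rfl, ?_⟩,
    fun f s => ?_⟩
  · rw [sphericalT, hu.sht_dS h2 ht, hu.orbitVol_zero h2 ht hμS, orbitPoly, ballPoly_zero]
    simp
  · rw [hu.integral_mul_sphericalT h2 ht μF hμF μG hμG hμS f s (hu.satakeParam_ne_zero ζ),
      hu.satakeG_eq h2 hμF μG hμG]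

omit hμF hμG hμS in
theorem IsUniformizer.norm_torusG_mulVec_le (r : ℕ) (v : Fin 5 → F) :
    ‖toMat (torusG (ϖ ^ r)) *ᵥ v‖ ≤ (resCard F : ℝ) ^ (r : ℤ) * ‖v‖ := by
  have hq := hu.one_lt_card
  have h1 : (1 : ℝ) ≤ (resCard F : ℝ) ^ (r : ℤ) := one_le_zpow₀ hq.le (by omega)
  have hϖ : ‖(ϖ : F) ^ r‖ ≤ 1 := by
    rw [norm_pow]
    exact pow_le_one₀ (norm_nonneg _) hu.norm_lt_one.le
  have hle : ∀ i, ‖v i‖ ≤ ‖v‖ := norm_le_pi_norm v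
  have hbig : ‖v‖ ≤ (resCard F : ℝ) ^ (r : ℤ) * ‖v‖ := le_mul_of_one_le_left (norm_nonneg _) h1
  rw [torusG_mulVec]
  refine (pi_norm_le_iff_of_nonneg (by positivity)).2 fun i => ?_
  fin_cases i
  · refine le_trans ?_ hbig
    change ‖((ϖ ^ r : Fˣ) : F) * v 0‖ ≤ _
    rw [norm_mul, Units.val_pow_eq_pow_val]
    exact (mul_le_of_le_one_left (norm_nonneg _) hϖ).trans (hle 0)
  · exact (hle 1).trans hbig
  · exact (hle 2).trans hbig
  · exact (hle 3).trans hbig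
  · change ‖((ϖ ^ r : Fˣ) : F)⁻¹ * v 4‖ ≤ _
    rw [norm_mul, norm_inv, Units.val_pow_eq_pow_val, norm_pow, hu.norm_eq, inv_pow, inv_inv,
      _root_.zpow_natCast]
    exact mul_le_mul_of_nonneg_left (hle 4) (by positivity)

/-- Uniqueness of the normalized spherical function. -/
theorem IsUniformizer.isT_unique {ζ : ℂ} {T T' : Sphere t → ℂ} (hT : IsT t ϖ μG ζ T)
    (hT' : IsT t ϖ μG ζ T') : T = T' := by
  have h20 := ne_zero_of_norm_two h2
  have hone : ∀ {T : Sphere t → ℂ}, IsT t ϖ μG ζ T → T (dS h20 t ϖ 0) = 1 := by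
    rintro T ⟨-, ⟨s, hs, h⟩, -⟩
    rwa [show s = dS h20 t ϖ 0 from Subtype.ext hs] at h
  have hinv : ∀ k ∈ KG F, ∀ s, (T - T') (k • s) = (T - T') s := fun k hk s => by
    rw [Pi.sub_apply, Pi.sub_apply, hT.1 k hk, hT'.1 k hk]
  have hcont : ∀ {T : Sphere t → ℂ}, IsT t ϖ μG ζ T → ∀ s, Continuous fun g : SO5 F => T (g • s) :=
    fun hT s => (isLocallyConstant_of_invariant hu h2 ht hT.1).continuous.comp
      (continuous_smul_left s)
  have key : ∀ r, (T - T') (dS h20 t ϖ r) = 0 := by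
    intro r
    induction r using Nat.strong_induction_on with
    | _ r ih =>
      set s₀ := dS h20 t ϖ 0 with hs₀
      -- The test function is the characteristic function of K d_r K, evaluated at v₁. The points g
      -- v₁ lie in orbits of index at most r, and those of smaller index drop out by induction. The
      -- points of index r form an open set containing d_r, so the value at d_r v₁ is multiplied by
      -- a positive volume.
      set f := doubleCosetFun (isCompact_KG (F := F)) (torusG (ϖ ^ r)) with hf
      have h1 : ∫ g, (f : SO5 F → ℂ) g * (T - T') (g • s₀) ∂μG = 0 := by
        simp only [Pi.sub_apply, mul_sub]
        rw [integral_sub (integrable_spherical_mul μG f (hcont hT s₀))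
          (integrable_spherical_mul μG f (hcont hT' s₀)), hT.2.2, hT'.2.2, hone hT, hone hT', sub_self]
      let B : Set (SO5 F) := doubleCosetSet (KG F) (torusG (ϖ ^ r)) ∩ {g | sht (g • s₀) = r}
      have hBo : IsOpen B := (isOpen_doubleCosetSet isOpen_KG _).inter
        ((hu.isClopen_sht_eq h2 ht r (t := t)).2.preimage (continuous_smul_left s₀))
      have hle : ∀ g ∈ doubleCosetSet (KG F) (torusG (ϖ ^ r)), sht (g • s₀) ≤ r := by
        rintro _ ⟨k, hk, l, hl, rfl⟩
        rw [← hu.norm_sphere_le_iff h2 ht, mul_smul, mul_smul, norm_smul_KG hk, smul_val]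
        refine (hu.norm_torusG_mulVec_le h2 ht r _).trans ?_
        rw [norm_smul_KG hl, (hu.sht_eq_iff h2 ht s₀ 0).1 (hu.sht_dS h2 ht 0)]
        simp
      have h3 : (fun g => (f : SO5 F → ℂ) g * (T - T') (g • s₀)) =
          B.indicator fun _ => (T - T') (dS h20 t ϖ r) := by
        classical
        funext g
        rw [hf, doubleCosetFun_apply, Set.indicator_apply,
          hu.eq_dS_of_invariant h2 ht hinv (g • s₀)]
        by_cases hg : g ∈ doubleCosetSet (KG F) (torusG (ϖ ^ r))
        · rw [if_pos hg, one_mul]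
          rcases (hle g hg).lt_or_eq with h | h
          · rw [ih _ h, if_neg fun hB => h.ne hB.2]
          · rw [if_pos ⟨hg, h⟩, h]
        · rw [if_neg hg, zero_mul, if_neg fun hB => hg hB.1]
      rw [h3, integral_indicator hBo.measurableSet, setIntegral_const, smul_eq_zero] at h1
      refine h1.resolve_left fun h => ?_
      have hmem : torusG (ϖ ^ r) ∈ B := by
        refine ⟨mem_doubleCosetSet_self _ _, ?_⟩
        have : torusG (ϖ ^ r) • s₀ = dS h20 t ϖ r := by
          apply Subtype.ext
          rw [smul_val]
          change _ *ᵥ dv t ϖ 0 = dv t ϖ r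
          rw [dv_eq, dv_eq, mulVec_mulVec, ← toMat_mul]
          congr 2
          apply toMat_injective
          rw [toMat_mul]
          ext i j
          fin_cases i <;> fin_cases j <;> simp [torusG, mkG, toMat]
        rw [Set.mem_ofPred_eq, this, hu.sht_dS h2 ht]
      have hpos := hBo.measure_pos μG ⟨_, hmem⟩
      have hlt : μG B < ⊤ := (measure_mono Set.inter_subset_left).trans_lt
        (isCompact_doubleCosetSet isCompact_KG _).measure_lt_top
      rw [measureReal_def, ENNReal.toReal_eq_zero_iff] at h
      exact h.elim hpos.ne' hlt.ne
  funext s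
  rw [← sub_eq_zero, ← Pi.sub_apply, hu.eq_dS_of_invariant h2 ht hinv s, key]

/-- The integral of a `K`-invariant function against the spherical function. -/
theorem IsUniformizer.integral_mul_T (z : ℂ) (φ : CcS t) {S : Finset ℕ}
    (hS : ∀ r, (φ : Sphere t → ℂ) (dS (ne_zero_of_norm_two h2) t ϖ r) ≠ 0 → r ∈ S) :
    ∫ s, (φ : Sphere t → ℂ) s * sphericalT μS z s ∂μS =
      ∑ r ∈ S, (φ : Sphere t → ℂ) (dS (ne_zero_of_norm_two h2) t ϖ r) *
        (orbitPoly t r).eval (z + z⁻¹) := by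
  have h20 := ne_zero_of_norm_two h2
  have h1 : (fun s => (φ : Sphere t → ℂ) s * sphericalT μS z s) = fun s => ∑ r ∈ S,
      ({s : Sphere t | sht s = r}.indicator fun _ => (φ : Sphere t → ℂ) (dS h20 t ϖ r) *
        ((orbitPoly t r).eval (z + z⁻¹) / orbitVol μS r)) s := by
    classical
    funext s
    simp only [Set.indicator_apply, Set.mem_ofPred_eq]
    rw [Finset.sum_ite_eq, hu.eq_dS_of_invariant h2 ht φ.2.2.2 s, sphericalT]
    split_ifs with h
    · rfl
    · rw [not_imp_comm.1 (hS _) h, zero_mul]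
  have hm : ∀ r, MeasurableSet {s : Sphere t | sht s = r} := fun r =>
    (hu.isClopen_sht_eq h2 ht r).2.measurableSet
  rw [h1, integral_finsetSum]
  · refine Finset.sum_congr rfl fun r _ => ?_
    have hv := hu.orbitVol_ne_zero h2 ht μF hμF μG hμG hμS r
    rw [integral_indicator (hm r), setIntegral_const, measureReal_def, Complex.real_smul]
    change orbitVol μS r * _ = _
    field_simp
  · intro r _
    refine (integrable_indicator_iff (hm r)).2 ?_
    exact integrableOn_const (hμS.finite_on_compacts _ (hu.isCompact_sht_eq h2 ht r)).ne

end Eigenfunctions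

end SO5PGL2

namespace SO5PGL2

/-! ### The function `φ_f` -/

section PhiOf

variable {F : Type*} [NontriviallyNormedField F] [IsUltrametricDist F]
  {ϖ : Fˣ} {t : Kind F} (hu : IsUniformizer ϖ) (h2 : ‖(2 : F)‖ = 1) (ht : t.Admissible)
  (μC : Measure (C t)) [μC.IsHaarMeasure] (hμC : μC {h | (h : SO5 F) ∈ KG F} = 1)

/-- Two elements with the same image of the base point differ by an element of the stabilizer, which
is absorbed by the left invariance of μC. -/
theorem phiOf_smul_base (f : SO5 F → ℂ) (g : SO5 F) :
    phiOf t μC f (g • base t) = ∫ h : C t, f (g * h) ∂μC := by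
  refine Function.FactorsThrough.extend_apply (f := fun g : SO5 F => g • base t)
    (g := fun g => ∫ h : C t, f (g * h) ∂μC) (fun g g' h => ?_) 0 g
  have hc : g'⁻¹ * g ∈ C t := by
    rw [MulAction.mem_stabilizer_iff, mul_smul]
    change g'⁻¹ • g • base t = base t
    rw [inv_smul_eq_iff]
    exact h
  change ∫ h : C t, f (g * h) ∂μC = ∫ h : C t, f (g' * h) ∂μC
  rw [← integral_mul_left_eq_self (fun h : C t => f (g' * h)) ⟨g'⁻¹ * g, hc⟩]
  simp [← mul_assoc]

theorem isOpen_stabilizer_KG : IsOpen {h : C t | (h : SO5 F) ∈ KG F} :=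
  isOpen_KG.preimage continuous_subtype_val

open Classical in
include hu h2 ht hμC in
-- The elements h of the stabilizer with x h in K exist only if x maps the base point into its own
-- K-orbit. In that case they form a left translate of C ∩ K, which has volume 1.
theorem IsUniformizer.integral_coset_stabilizer (x : SO5 F) :
    Integrable (fun h : C t => if x * (h : SO5 F) ∈ KG F then (1 : ℂ) else 0) μC ∧
    ∫ h : C t, (if x * (h : SO5 F) ∈ KG F then (1 : ℂ) else 0) ∂μC =
      if sht (x • base t) = 0 then 1 else 0 := by
  by_cases hx : sht (x • base t) = 0
  · obtain ⟨k, hk, e⟩ := hu.exists_smul_eq h2 ht (s := base t) (s' := x • base t)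
      (by rw [hx, hu.sht_base h2 ht])
    have hc : k⁻¹ * x ∈ C t := by
      rw [MulAction.mem_stabilizer_iff, mul_smul, ← e, inv_smul_smul]
    have h1 : (fun h : C t => if x * (h : SO5 F) ∈ KG F then (1 : ℂ) else 0) =
        fun h => {h : C t | (h : SO5 F) ∈ KG F}.indicator (fun _ => (1 : ℂ))
          (⟨k⁻¹ * x, hc⟩ * h) := by
      funext h
      have h3 : k⁻¹ * x * (h : SO5 F) ∈ KG F ↔ x * (h : SO5 F) ∈ KG F := by
        rw [mul_assoc, (KG F).mul_mem_cancel_left ((KG F).inv_mem hk)]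
      set y : C t := ⟨k⁻¹ * x, hc⟩ * h with hy
      have h4 : x * (h : SO5 F) ∈ KG F ↔ y ∈ {h : C t | (h : SO5 F) ∈ KG F} := h3.symm
      rw [Set.indicator_apply]
      simp only [h4]
    have hint : Integrable ({h : C t | (h : SO5 F) ∈ KG F}.indicator (fun _ => (1 : ℂ))) μC :=
      (integrable_indicator_iff isOpen_stabilizer_KG.measurableSet).2
        (integrableOn_const (by rw [hμC]; exact ENNReal.one_ne_top))
    rw [h1, if_pos hx]
    refine ⟨hint.comp_mul_left _, ?_⟩
    rw [integral_mul_left_eq_self (fun h => {h : C t | (h : SO5 F) ∈ KG F}.indicator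
      (fun _ => (1 : ℂ)) h), integral_indicator isOpen_stabilizer_KG.measurableSet,
      setIntegral_const, measureReal_def, hμC]
    simp
  · have h1 : (fun h : C t => if x * (h : SO5 F) ∈ KG F then (1 : ℂ) else 0) = fun _ => 0 := by
      funext h
      refine if_neg fun hk => hx ?_
      have : x • base t = (x * (h : SO5 F)) • base t := by
        rw [mul_smul]
        exact congrArg _ (MulAction.mem_stabilizer_iff.1 h.2).symm
      rw [this, sht_smul hk, hu.sht_base h2 ht]
    rw [h1, if_neg hx]
    exact ⟨integrable_zero _ _ _, integral_zero _ _⟩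

open Classical in
include hu h2 ht hμC in
theorem IsUniformizer.phiOf_eq_sum {f : SO5 F → ℂ} {S : Finset (SO5 F)}
    (hS : ∀ g, f g = ∑ x ∈ S, f x * if x⁻¹ * g ∈ KG F then 1 else 0) (s : Sphere t) :
    phiOf t μC f s = ∑ x ∈ S, f x * if sht (x⁻¹ • s) = 0 then 1 else 0 := by
  obtain ⟨g, rfl⟩ := hu.exists_smul_base h2 ht s
  rw [phiOf_smul_base]
  have h1 : ∀ h : C t, f (g * h) =
      ∑ x ∈ S, f x * if x⁻¹ * g * (h : SO5 F) ∈ KG F then 1 else 0 := fun h => by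
    rw [hS]
    simp only [mul_assoc]
  simp only [h1]
  rw [integral_finsetSum _ fun x _ =>
    (hu.integral_coset_stabilizer h2 ht μC hμC (x⁻¹ * g)).1.const_mul _]
  refine Finset.sum_congr rfl fun x _ => ?_
  rw [integral_const_mul, (hu.integral_coset_stabilizer h2 ht μC hμC (x⁻¹ * g)).2, mul_smul]

variable [LocallyCompactSpace F] (μG : Measure (SO5 F)) [μG.IsHaarMeasure] (hμG : μG (KG F) = 1)

include hu h2 ht hμC hμG in
theorem IsUniformizer.phiOf_mem (f : spherical (KG F)) : phiOf t μC (f : SO5 F → ℂ) ∈ CcS t := by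
  obtain ⟨S, hS, -⟩ := exists_coset_sum_integral μG isOpen_KG hμG f.2.2.1 f.2.2.2
  have hinv : ∀ k ∈ KG F, ∀ s, phiOf t μC (f : SO5 F → ℂ) (k • s) = phiOf t μC (f : SO5 F → ℂ) s := by
    intro k hk s
    obtain ⟨g, rfl⟩ := hu.exists_smul_base h2 ht s
    rw [← mul_smul, phiOf_smul_base, phiOf_smul_base]
    simp only [mul_assoc, f.2.1 k hk]
  refine ⟨isLocallyConstant_of_invariant hu h2 ht hinv, ?_, hinv⟩
  refine HasCompactSupport.intro (S.isCompact_biUnion fun x _ =>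
    (hu.isCompact_sht_eq h2 ht 0 (t := t)).image (continuous_smul_right x)) fun s hs => ?_
  rw [hu.phiOf_eq_sum h2 ht μC hμC hS]
  refine Finset.sum_eq_zero fun x hx => ?_
  rw [if_neg, mul_zero]
  intro h
  exact hs (Set.mem_biUnion hx ⟨x⁻¹ • s, h, smul_inv_smul x s⟩)

variable [MeasurableSpace F] [BorelSpace F] {μS : Measure (Sphere t)}
  (hμS : IsInvariantMeasure t ϖ μS)

include hu h2 ht hμC hμG hμS in
/-- The integral of `φ_f` against a `K`-invariant function. -/
theorem IsUniformizer.integral_phiOf_mul (f : spherical (KG F)) {T : Sphere t → ℂ}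
    (hT : ∀ k ∈ KG F, ∀ s, T (k • s) = T s) :
    ∫ s, phiOf t μC (f : SO5 F → ℂ) s * T s ∂μS =
      ∫ g, (f : SO5 F → ℂ) g * T (g • base t) ∂μG := by
  obtain ⟨S, hS, hS'⟩ := exists_coset_sum_integral μG isOpen_KG hμG f.2.2.1 f.2.2.2
  obtain ⟨S₁, hS₁⟩ := exists_integral_eq_sum μG isOpen_KG f.2.2.1 f.2.2.2
  have hTc := (isLocallyConstant_of_invariant hu h2 ht hT).continuous
  have hO := (hu.isClopen_sht_eq h2 ht 0 (t := t)).2.measurableSet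
  have hvol : μS {s | sht s = 0} = 1 := by
    rw [← hμS.normalized]
    congr 1
    ext s
    exact (hu.mem_orbit_iff h2 ht 0 s).symm
  -- the average of `T` over the translate of the base orbit
  set A : SO5 F → ℂ := fun x => avgK μG fun k => T ((x * k) • base t) with hA
  have hAinv : ∀ k ∈ KG F, ∀ x, A (x * k) = A x := fun k hk x => by
    simp only [hA, mul_assoc x k]
    exact avgK_mul_left μG hk fun k => T ((x * k) • base t)
  have hcont : Continuous fun g : SO5 F => T (g • base t) := hTc.comp (continuous_smul_left _)
  -- The function g ↦ T(g v₀) need not be right K-invariant, as K may move v₀. Averaging over K on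
  -- the right does not change its integral against f and makes it right invariant, so the expansion
  -- of f applies.
  have h1 : ∫ g, (f : SO5 F → ℂ) g * T (g • base t) ∂μG = ∑ x ∈ S, (f : SO5 F → ℂ) x * A x := by
    rw [← hS' A hAinv, hS₁ _ fun x => integrableOn_KG μG (hcont.comp (continuous_const_mul x)),
      hS₁ A fun x => ?_]
    · refine Finset.sum_congr rfl fun x _ => ?_
      congr 1
      exact (Eq.trans (avgK_congr μG fun k hk => hAinv k hk x) (avgK_const μG hμG (A x))).symm
    · exact integrableOn_KG μG ((isLocallyConstant_of_right_invariant isOpen_KG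
        hAinv).continuous.comp (continuous_const_mul x))
  have h3 : ∀ x : SO5 F, Integrable (fun s => (if sht (x⁻¹ • s) = 0 then (1 : ℂ) else 0) * T s) μS ∧
      ∫ s, (if sht (x⁻¹ • s) = 0 then (1 : ℂ) else 0) * T s ∂μS = A x := by
    intro x
    classical
    have hcx : Continuous fun s : Sphere t => T (x • s) := hTc.comp (continuous_smul_right x)
    have := hμS.isFiniteMeasureOnCompacts
    refine ⟨?_, ?_⟩
    · refine Continuous.integrable_of_hasCompactSupport ?_ (HasCompactSupport.intro
        ((hu.isCompact_sht_eq h2 ht 0 (t := t)).image (continuous_smul_right x)) fun s hs => ?_)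
      · refine Continuous.mul ?_ hTc
        exact (((hu.isLocallyConstant_sht h2 ht).comp_continuous (continuous_smul_right x⁻¹)).comp
          fun m => if m = 0 then (1 : ℂ) else 0).continuous
      · rw [if_neg, zero_mul]
        exact fun h => hs ⟨x⁻¹ • s, h, smul_inv_smul x s⟩
    · rw [← hμS.integral_smul x]
      have h4 : (fun s : Sphere t => (if sht (x⁻¹ • x • s) = 0 then (1 : ℂ) else 0) * T (x • s)) =
          {s : Sphere t | sht s = 0}.indicator fun s => T (x • s) := by
        funext s
        rw [inv_smul_smul]
        by_cases h : sht s = 0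
        · rw [if_pos h, one_mul, Set.indicator_of_mem (by exact h)]
        · rw [if_neg h, zero_mul, Set.indicator_of_notMem (by exact h)]
      -- K acts transitively on the orbit of v₀, so the K-average of T(x ·) takes the same value
      -- A(x) at every point of it.
      have h5 : Set.EqOn (fun s : Sphere t => avgK μG fun k => T (x • k • s)) (fun _ => A x)
          {s | sht s = 0} := by
        intro s (hs : sht s = 0)
        obtain ⟨k, hk, e⟩ := hu.exists_smul_eq h2 ht (s := base t) (s' := s)
          (by rw [hs, hu.sht_base h2 ht])
        have := avgK_mul_right μG hμG hk fun k => T ((x * k) • base t)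
        rw [hA]
        simp only
        rw [← this]
        refine avgK_congr μG fun l _ => ?_
        rw [← e, mul_smul, mul_smul]
      rw [h4, integral_indicator hO, hμS.setIntegral_eq_avgK μG hμG hu h2 ht hcx 0,
        setIntegral_congr_fun hO h5, setIntegral_const, measureReal_def, hvol]
      simp
  rw [h1]
  simp only [hu.phiOf_eq_sum h2 ht μC hμC hS, Finset.sum_mul, mul_assoc]
  rw [integral_finsetSum _ fun x _ => (h3 x).1.const_mul _]
  refine Finset.sum_congr rfl fun x _ => ?_
  rw [integral_const_mul, (h3 x).2]

end PhiOf

end SO5PGL2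

namespace SO5PGL2

/-! ### The Hecke side and the spherical side as bases of the space of polynomials -/

section Assembly

variable {F : Type*} [NontriviallyNormedField F] [IsUltrametricDist F] {ϖ : Fˣ}

theorem IsUniformizer.exists_satakeParam_eq (hu : IsUniformizer ϖ) {z : ℂ} (hz : z ≠ 0) :
    ∃ ζ : ℂ, satakeParam F ζ = z := by
  have hq0 : (resCard F : ℂ) ≠ 0 := by exact_mod_cast hu.card_pos.ne'
  have hlog : Complex.log (resCard F) ≠ 0 := by
    rw [← Complex.ofReal_natCast, ← Complex.ofReal_log hu.card_pos.le, Complex.ofReal_ne_zero]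
    exact (Real.log_pos hu.one_lt_card).ne'
  refine ⟨Complex.log z / Complex.log (resCard F), ?_⟩
  rw [satakeParam, Complex.cpow_def_of_ne_zero hq0, mul_div_cancel₀ _ hlog, Complex.exp_log hz]

/-- A polynomial in `q^ζ + q^{-ζ}` is determined by its values. -/
theorem IsUniformizer.polynomial_eq (hu : IsUniformizer ϖ) {P Q : Polynomial ℂ}
    (h : ∀ ζ, P.eval (satakeParam F ζ + (satakeParam F ζ)⁻¹) =
      Q.eval (satakeParam F ζ + (satakeParam F ζ)⁻¹)) : P = Q :=
  Polynomial.funext fun x => by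
    obtain ⟨z, hz, rfl⟩ := exists_add_inv_eq x
    obtain ⟨ζ, rfl⟩ := hu.exists_satakeParam_eq hz
    exact h ζ

/-- The polynomial attached to the basis function of index `r` on the side of `H`. -/
noncomputable def torusPoly (F : Type*) [NontriviallyNormedField F] [IsUltrametricDist F] (ε : ℂ)
    (r : ℕ) : Polynomial ℂ :=
  Polynomial.C ((ε * sqrtCard F) ^ r) * Polynomial.Chebyshev.S ℂ r

theorem degree_torusPoly {ε : ℂ} (hε : ε * sqrtCard F ≠ 0) (r : ℕ) :
    (torusPoly F ε r).degree = r := by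
  rw [torusPoly, Polynomial.degree_C_mul (pow_ne_zero _ hε), degree_chebyshevS]

/-- The power q^{3r/2} splits as q^r · q^{r/2}, and powers of ε are inserted in pairs using ε² = 1.
The value 0 at r = 0 reflects both S_{-1} = 0 and φ'_{-1} = 0. -/
theorem ballPoly_eq_torusPoly (hu : IsUniformizer ϖ) (t : Kind F) {ε : ℂ} (hε : ε ^ 2 = 1) (r : ℕ) :
    ballPoly t r = (ε ^ r * (resCard F : ℂ) ^ r) •
      (torusPoly F ε r - (t.sign * ε) • if r = 0 then 0 else torusPoly F ε (r - 1)) := by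
  have hs := hu.sqrtCard_ne_zero
  rw [← hu.sqrtCard_sq]
  have h1 : ∀ n : ℕ, ε ^ n * ε ^ n = 1 := fun n => by rw [← mul_pow, ← sq, hε, one_pow]
  cases r with
  | zero => simp [ballPoly, torusPoly]
  | succ r =>
    rw [if_neg (by omega), Nat.add_sub_cancel, ballPoly, torusPoly, torusPoly,
      show ((r + 1 : ℕ) : ℤ) - 1 = (r : ℕ) by push_cast; ring]
    refine Polynomial.funext fun x => ?_
    simp only [Polynomial.eval_mul, Polynomial.eval_sub, Polynomial.eval_C, Polynomial.eval_smul,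
      smul_eq_mul, mul_pow]
    have e1 : sqrtCard F ^ (3 * (r + 1)) = (ε ^ (r + 1) * ε ^ (r + 1)) *
        ((sqrtCard F ^ 2) ^ (r + 1) * sqrtCard F ^ (r + 1)) := by
      rw [h1]
      ring
    have e2 : sqrtCard F ^ (3 * (r + 1)) * (sqrtCard F)⁻¹ = (ε ^ (r + 1) * ε ^ (r + 1)) *
        ((sqrtCard F ^ 2) ^ (r + 1) * sqrtCard F ^ r) := by
      rw [h1]
      field_simp
      ring
    linear_combination (Polynomial.Chebyshev.S ℂ (r + 1 : ℕ)).eval x * e1 -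
      t.sign * (Polynomial.Chebyshev.S ℂ r).eval x * e2

end Assembly

end SO5PGL2

theorem proposition2p5 {F : Type*} [NontriviallyNormedField F] [IsUltrametricDist F]
    [LocallyCompactSpace F] [MeasurableSpace F] [BorelSpace F]
    -- residual characteristic different from `2`
    (hres : ringChar (Residue F) ≠ 2)
    -- a generator `ϖ` of the maximal ideal, and the normalization of the absolute value
    (ϖ : Fˣ) (hϖ : ∀ x : F, ‖x‖ < 1 ↔ ‖x‖ ≤ ‖(ϖ : F)‖)
    (hnorm : ‖(ϖ : F)‖ = (resCard F : ℝ)⁻¹)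
    -- an additive character with conductor `R`
    (ψ : AddChar F Circle) (hψ : ∀ x : F, ‖x‖ ≤ 1 → ψ x = 1)
    (hψ' : ∃ x : F, ‖x‖ ≤ 1 ∧ ψ ((ϖ : F)⁻¹ * x) ≠ 1)
    -- the trivial or the unramified quadratic character
    (χ₀ : Fˣ →* ℂˣ) (hχ : ∀ a : Fˣ, ‖(a : F)‖ = 1 → χ₀ a = 1) (hχ' : χ₀ ϖ ^ 2 = 1)
    -- the split or the non-split case
    (t : Kind F) (ht : t.Admissible)
    -- the normalized measures on `F`, `Fˣ`, `G`, `C_θ`, `S` and `H`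
    (μF : Measure F) [μF.IsAddHaarMeasure] (hμF : μF {x | ‖x‖ ≤ 1} = 1)
    (μU : Measure Fˣ) [μU.IsHaarMeasure] (hμU : μU {a | ‖(a : F)‖ = 1} = 1)
    (μG : Measure (SO5 F)) [μG.IsHaarMeasure] (hμG : μG (KG F) = 1)
    (μC : Measure (C t)) [μC.IsHaarMeasure] (hμC : μC {h | (h : SO5 F) ∈ KG F} = 1)
    (μS : Measure (Sphere t)) (hμS : IsInvariantMeasure t ϖ μS)
    (μH : Measure (H F)) [μH.IsHaarMeasure] (hμH : μH (KH F) = 1) :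
    -- the functions `T_ζ` and `W_ζ` exist and are unique
    (∀ ζ : ℂ, ∃! T : Sphere t → ℂ, IsT t ϖ μG ζ T) ∧
    (∀ ζ : ℂ, ∃! W : H F → ℂ, IsW ψ χ₀ μH ζ W) ∧
    ∀ (T : ℂ → Sphere t → ℂ) (W : ℂ → H F → ℂ),
      (∀ ζ, IsT t ϖ μG ζ (T ζ)) → (∀ ζ, IsW ψ χ₀ μH ζ (W ζ)) →
      -- the map defined by the identity of integrals is a well-defined linear bijection
      ∃ 𝓕 : CcS t ≃ₗ[ℂ] CcH ψ,
        (∀ (φ : CcS t) (φ' : CcH ψ), 𝓕 φ = φ' ↔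
          ∀ ζ : ℂ, ∫ s, (φ : Sphere t → ℂ) s * T ζ s ∂μS =
            ∫ a : Fˣ, (φ' : H F → ℂ) (aH a) * W ζ (aH a) * ((‖(a : F)‖⁻¹ : ℝ) : ℂ) ∂μU) ∧
        -- its values on the basis `Φ_r`, in terms of the functions `φ'_r` (zero for `r < 0`)
        (∃ φ' : ℤ → CcH ψ,
          (∀ (r : ℤ) (a : Fˣ), (0 ≤ r ∧ ‖(a : F)‖ = (resCard F : ℝ) ^ (-r) →
              (φ' r : H F → ℂ) (aH a) = 1) ∧
            (¬ (0 ≤ r ∧ ‖(a : F)‖ = (resCard F : ℝ) ^ (-r)) →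
              (φ' r : H F → ℂ) (aH a) = 0)) ∧
          ∀ r : ℕ, ∃ hΦ : Phi t ϖ r ∈ CcS t,
            𝓕 ⟨Phi t ϖ r, hΦ⟩ = ((χ₀ ϖ : ℂ) ^ r * (resCard F : ℂ) ^ r) •
              (φ' r - (t.sign * (χ₀ ϖ : ℂ)) • φ' ((r : ℤ) - 1))) ∧
        -- corresponding spherical functions
        ∀ (f : spherical (KG F)) (f' : spherical (KH F)), Corresponding χ₀ μG μH f f' →
          ∃ (hf : phiOf t μC f ∈ CcS t) (hf' : phiOf' ψ μF f' ∈ CcH ψ),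
            𝓕 ⟨phiOf t μC f, hf⟩ = ⟨phiOf' ψ μF f', hf'⟩ := by
  classical
  have hu : IsUniformizer ϖ := ⟨hϖ, hnorm⟩
  have h2 := norm_two_eq_one hres
  have h20 := ne_zero_of_norm_two h2
  set ε : ℂ := (χ₀ ϖ : ℂ) with hε
  have hε2 : ε ^ 2 = 1 := by
    rw [hε, ← Units.val_pow_eq_pow_val, hχ', Units.val_one]
  have hε0 : ε * sqrtCard F ≠ 0 := mul_ne_zero (Units.ne_zero _) hu.sqrtCard_ne_zero
  refine ⟨fun ζ => ⟨_, hu.isT_sphericalT h2 ht μF hμF μG hμG hμS ζ, fun T hT =>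
    hu.isT_unique h2 ht μF hμF μG hμG hμS hT (hu.isT_sphericalT h2 ht μF hμF μG hμG hμS ζ)⟩,
    fun ζ => hu.existsUnique_isW hμF hψ hψ' hχ hχ' μH hμH ζ, fun T W hT hW => ?_⟩
  have hTeq : ∀ ζ, T ζ = sphericalT μS (satakeParam F ζ) := fun ζ =>
    hu.isT_unique h2 ht μF hμF μG hμG hμS (hT ζ) (hu.isT_sphericalT h2 ht μF hμF μG hμG hμS ζ)
  have hWeq : ∀ ζ, W ζ = whittaker ψ ε (satakeParam F ζ) := fun ζ =>
    (hu.existsUnique_isW hμF hψ hψ' hχ hχ' μH hμH ζ).unique (hW ζ)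
      (hu.isW_whittaker hμF hψ hψ' hχ hχ' μH hμH ζ)
  obtain ⟨eS, heS⟩ := hu.exists_equiv_CcS h2 ht (t := t)
  obtain ⟨eH, heH⟩ := hu.exists_equiv_CcH hψ hψ'
  obtain ⟨pS, hpS⟩ := exists_equiv_polynomial (orbitPoly t) (degree_orbitPoly hu.sqrtCard_ne_zero t)
  obtain ⟨pH, hpH⟩ := exists_equiv_polynomial (torusPoly F ε) (degree_torusPoly hε0)
  have hS : ∀ (φ : CcS t) (ζ : ℂ), ∫ s, (φ : Sphere t → ℂ) s * T ζ s ∂μS =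
      (pS (eS φ)).eval (satakeParam F ζ + (satakeParam F ζ)⁻¹) := fun φ ζ => by
    rw [hTeq, hu.integral_mul_T h2 ht μF hμF μG hμG hμS _ φ (S := (eS φ).support) fun r hr => by
      rwa [Finsupp.mem_support_iff, heS], hpS, Finsupp.sum, Polynomial.eval_finsetSum]
    refine Finset.sum_congr rfl fun r _ => ?_
    rw [heS, Polynomial.eval_smul, smul_eq_mul]
  have hH : ∀ (φ' : CcH ψ) (ζ : ℂ),
      ∫ a : Fˣ, (φ' : H F → ℂ) (aH a) * W ζ (aH a) * ((‖(a : F)‖⁻¹ : ℝ) : ℂ) ∂μU =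
      (pH (eH φ')).eval (satakeParam F ζ + (satakeParam F ζ)⁻¹) := fun φ' ζ => by
    rw [hWeq, hu.integral_torus hμU hψ hψ' ε _ φ' (s := (eH φ').support) fun r hr => by
      rwa [Finsupp.mem_support_iff, heH], hpH, Finsupp.sum, Polynomial.eval_finsetSum]
    refine Finset.sum_congr rfl fun r _ => ?_
    rw [heH, Polynomial.eval_smul, smul_eq_mul, torusPoly, Polynomial.eval_mul, Polynomial.eval_C,
      mul_assoc]
  -- Coordinates at d_r v₁ followed by the basis of orbit polynomials on one side, coordinates at
  -- a(ϖ^m) followed by the basis of torus polynomials on the other. By `hS` and `hH` these are the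
  -- two pairings, so equal images mean equal integrals for all ζ.
  let 𝓕 : CcS t ≃ₗ[ℂ] CcH ψ := (eS.trans pS).trans (eH.trans pH).symm
  have h𝓕' : ∀ (φ : CcS t) (φ' : CcH ψ), 𝓕 φ = φ' ↔ pS (eS φ) = pH (eH φ') := fun φ φ' =>
    (eH.trans pH).symm_apply_eq
  have h𝓕 : ∀ (φ : CcS t) (φ' : CcH ψ), 𝓕 φ = φ' ↔
      ∀ ζ : ℂ, ∫ s, (φ : Sphere t → ℂ) s * T ζ s ∂μS =
        ∫ a : Fˣ, (φ' : H F → ℂ) (aH a) * W ζ (aH a) * ((‖(a : F)‖⁻¹ : ℝ) : ℂ) ∂μU := by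
    intro φ φ'
    simp only [hS, hH, h𝓕']
    exact ⟨fun h ζ => by rw [h], fun h => hu.polynomial_eq h⟩
  refine ⟨𝓕, h𝓕, ⟨fun r => ⟨torusFun ψ r, hu.torusFun_mem hψ r⟩, fun r a => ?_, fun r => ?_⟩,
    fun f f' hff' => ?_⟩
  · have hiff : (0 ≤ -lv (a : F) ∧ -lv (a : F) = r) ↔
        (0 ≤ r ∧ ‖(a : F)‖ = (resCard F : ℝ) ^ (-r)) := by
      rw [hu.norm_eq_zpow_lv a.ne_zero, hu.zpow_inj]
      constructor <;> rintro ⟨h, h'⟩ <;> constructor <;> omega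
    simp only [hu.torusFun_aH hψ, hiff]
    exact ⟨fun h => if_pos h, fun h => if_neg h⟩
  · refine ⟨hu.Phi_mem h2 ht r, ?_⟩
    have hsingle : ∀ m : ℕ, eH ⟨torusFun ψ m, hu.torusFun_mem hψ m⟩ = Finsupp.single m 1 := by
      intro m
      ext n
      rw [heH, Finsupp.single_apply]
      change torusFun ψ m (aH (ϖ ^ (n : ℤ))) = _
      have hlv : lv ((ϖ ^ (n : ℤ) : Fˣ) : F) = -(n : ℤ) := hu.lv_eq (hu.norm_zpow n)
      rw [hu.torusFun_aH hψ, hlv, neg_neg]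
      congr 1
      exact propext ⟨fun h => by omega, fun h => by omega⟩
    -- Needed for r = 0, where the formula involves φ'_{-1}.
    have hneg : eH ⟨torusFun ψ (-1), hu.torusFun_mem hψ (-1)⟩ = 0 := by
      ext n
      rw [heH]
      change torusFun ψ (-1) (aH (ϖ ^ (n : ℤ))) = _
      rw [hu.torusFun_aH hψ, if_neg (by omega)]
      rfl
    have hpsingle : ∀ m : ℕ, pH (Finsupp.single m 1) = torusPoly F ε m := fun m => by
      rw [hpH, Finsupp.sum_single_index (by rw [zero_smul]), one_smul]
    have hPhi : eS ⟨Phi t ϖ r, hu.Phi_mem h2 ht r⟩ =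
        ∑ i ∈ Finset.range (r + 1), Finsupp.single i (1 : ℂ) := by
      ext n
      rw [heS, Finsupp.finsetSum_apply]
      change Phi t ϖ r (dS h20 t ϖ n) = _
      rw [hu.Phi_apply h2 ht, hu.sht_dS h2 ht]
      simp [Finsupp.single_apply]
    rw [h𝓕', hPhi, map_sum, map_smul, map_sub, map_smul, map_smul, map_sub, map_smul, hsingle,
      hpsingle]
    have hlast : pH (eH ⟨torusFun ψ ((r : ℤ) - 1), hu.torusFun_mem hψ _⟩) =
        if r = 0 then 0 else torusPoly F ε (r - 1) := by
      cases r with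
      | zero =>
        rw [if_pos rfl]
        simp only [Nat.cast_zero, zero_sub]
        rw [hneg, map_zero]
      | succ r =>
        rw [if_neg (by omega)]
        simp only [Nat.cast_succ, add_sub_cancel_right, Nat.add_sub_cancel]
        rw [hsingle, hpsingle]
    rw [hlast, ← ballPoly_eq_torusPoly hu t hε2, ← sum_orbitPoly]
    refine Finset.sum_congr rfl fun i _ => ?_
    rw [hpS, Finsupp.sum_single_index (by rw [zero_smul]), one_smul]
  · refine ⟨hu.phiOf_mem h2 ht μC hμC μG hμG f, phiOf'_mem μF f', (h𝓕 _ _).2 fun ζ => ?_⟩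
    -- The base point v₀ and v₁ both have norm 1, hence lie in the same K-orbit, and the
    -- normalization at v₁ carries over to v₀.
    have hTb : T ζ (base t) = 1 := by
      obtain ⟨s, hs, h⟩ := (hT ζ).2.1
      rw [show s = dS h20 t ϖ 0 from Subtype.ext hs] at h
      rw [hu.eq_dS_of_invariant h2 ht (hT ζ).1, hu.sht_base h2 ht, h]
    -- The Hecke equation at the identity, where W is 1, expresses the Satake transform of f' as its
    -- integral against W.
    have h1 := (hW ζ).2.2 f' 1
    simp only [one_mul, (hW ζ).1, mul_one] at h1
    refine (hu.integral_phiOf_mul h2 ht μC hμC μG hμG hμS f (hT ζ).1).trans ?_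
    rw [(hT ζ).2.2 f, hTb, mul_one, hff' ζ, h1]
    exact (hu.integral_phiOf' μF hμF hμU hψ hψ' μH hμH f' (hW ζ).2.1).symm
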